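/- Theorem. There are a deterministic word RAM program and constants $c\ge 1$ and $C$ such that the following holds. Let $u\ge 1$ be an integer and let $S$ be a finite multiset of integers from $[u]=\{1,\dots,u\}$ with $n'$ distinct elements, cardinality $n$ (counted with multiplicity) and total sum $\sigma$ (counted with multiplicity). Given $u$, $n'$ and the distinct elements of $S$, in any order, each with its multiplicity, the program computes the set of all subset sums of $S$ up to $u$, $$\Bigl\{\textstyle\sum_{x\in T}x \;:\; T\subseteq S \text{ a sub-multiset}\Bigr\}\cap\{0,1,\dots,u\},$$ that is, it lists the elements of this set without repetition, in at most $$C\left(1+\min\left\{\sqrt{n'}\,u\,\log^{5/2}u,\;\; u^{4/3}\log^{2}u,\;\; \sigma\log\sigma\,\log(n'\log u)\right\}\right)$$ steps, on every word length $w\ge c\,(\lfloor\log (u+n)\rfloor+1)$. Here $\log$ is the logarithm to base $2$, with $\log 0$ read as $0$. On a word RAM with word length $w$, memory cells and registers hold integers in $\{0,\dots,2^w-1\}$, memory is addressed by words and is zero outside the input at the start, and each of the following costs one step: loading a constant, an indirect load or store, addition, subtraction or multiplication modulo $2^w$, integer division and remainder, bitwise and/or/xor, shifts, unconditional jumps,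 and jumps conditional on comparing two words. -/

import Mathlib

/-! ### Subset sums -/

/-- The set of all subset sums of the multiset `S`: the sums of its sub-multisets. -/
def subsetSums (S : Multiset ℕ) : Set ℕ := {x | ∃ T : Multiset ℕ, T ≤ S ∧ T.sum = x}

/-- The set of all subset sums of `S` up to `u`. -/
def subsetSumsUpTo (S : Multiset ℕ) (u : ℕ) : Set ℕ := subsetSums S ∩ Set.Icc 0 u

/-! ### The word RAM

A deterministic random access machine with `w`-bit words: finitely many registers (those that the
program mentions) and a memory of words addressed by words.  Every instruction costs one step. -/

namespace WordRAM

/-- The arithmetic and bitwise operations of the machine. -/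
inductive Op where
  | add | sub | mul | div | mod | and | or | xor | shl | shr

/-- The result of an operation on `w`-bit words.  Arithmetic is modulo `2 ^ w` (so `sub` wraps
around); `div` is the floor of the quotient, with `a / 0 = 0` and `a % 0 = a`. -/
def Op.eval (w : ℕ) : Op → ℕ → ℕ → ℕ
  | .add, a, b => (a + b) % 2 ^ w
  | .sub, a, b => (a + (2 ^ w - b)) % 2 ^ w
  | .mul, a, b => (a * b) % 2 ^ w
  | .div, a, b => a / b
  | .mod, a, b => a % b
  | .and, a, b => Nat.land a b
  | .or,  a, b => Nat.lor a b
  | .xor, a, b => Nat.xor a b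
  | .shl, a, b => (a * 2 ^ b) % 2 ^ w
  | .shr, a, b => a / 2 ^ b

/-- Instructions; all arguments other than the constant `k` and the jump target `t` are register
names. -/
inductive Instr where
  /-- `dst := k` -/
  | const (dst k : ℕ)
  /-- `dst := a o b` -/
  | op (o : Op) (dst a b : ℕ)
  /-- `dst := memory[a]` -/
  | load (dst a : ℕ)
  /-- `memory[a] := src` -/
  | store (a src : ℕ)
  /-- continue at instruction `t` -/
  | jump (t : ℕ)
  /-- continue at instruction `t` if `a = b` -/
  | jumpEq (a b t : ℕ)
  /-- continue at instruction `t` if `a < b` -/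
  | jumpLt (a b t : ℕ)

/-- A program is a finite list of instructions; it does not depend on the word length. -/
abbrev Program := List Instr

/-- A configuration: program counter, registers and memory. -/
structure Config where
  pc : ℕ
  reg : ℕ → ℕ
  mem : ℕ → ℕ

/-- The effect of a single instruction. -/
def Instr.exec (w : ℕ) (s : Config) : Instr → Config
  | .const dst k => ⟨s.pc + 1, Function.update s.reg dst (k % 2 ^ w), s.mem⟩
  | .op o dst a b => ⟨s.pc + 1, Function.update s.reg dst (o.eval w (s.reg a) (s.reg b)), s.mem⟩
  | .load dst a => ⟨s.pc + 1, Function.update s.reg dst (s.mem (s.reg a)), s.mem⟩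
  | .store a src => ⟨s.pc + 1, s.reg, Function.update s.mem (s.reg a) (s.reg src)⟩
  | .jump t => ⟨t, s.reg, s.mem⟩
  | .jumpEq a b t => ⟨if s.reg a = s.reg b then t else s.pc + 1, s.reg, s.mem⟩
  | .jumpLt a b t => ⟨if s.reg a < s.reg b then t else s.pc + 1, s.reg, s.mem⟩

/-- The machine halts when the program counter leaves the program. -/
def Halted (P : Program) (s : Config) : Prop := P.length ≤ s.pc

/-- One step of the program `P` with `w`-bit words; a halted configuration does not change. -/
def step (w : ℕ) (P : Program) (s : Config) : Config :=
  match P[s.pc]? with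
  | some i => i.exec w s
  | none => s

/-- The initial configuration: the input occupies the first memory cells; all other memory cells
and all registers are zero. -/
def init (input : List ℕ) : Config := ⟨0, fun _ => 0, fun i => input.getD i 0⟩

/-- The memory holds the list `out` as output: its length in cell `0`, then its entries. -/
def Holds (mem : ℕ → ℕ) (out : List ℕ) : Prop :=
  mem 0 = out.length ∧ ∀ i (hi : i < out.length), mem (i + 1) = out[i]

/-- With `w`-bit words, the program `P` on the given input halts after at most `T` steps, with an
output list that enumerates the set `A` without repetition. -/
def ListsWithin (w : ℕ) (P : Program) (input : List ℕ) (A : Set ℕ) (T : ℝ) : Prop :=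
  ∃ t : ℕ, (t : ℝ) ≤ T ∧ Halted P ((step w P)^[t] (init input)) ∧
    ∃ out : List ℕ, out.Nodup ∧ (∀ x, x ∈ out ↔ x ∈ A) ∧
      Holds ((step w P)^[t] (init input)).mem out

end WordRAM

/-! ### The input and the time bound -/

/-- The input for the bound `u` and the multiset `S`, whose distinct elements are listed by `L`:
`u`, the number of distinct elements, and each distinct element followed by its multiplicity. -/
def encodeInput (u : ℕ) (S : Multiset ℕ) (L : List ℕ) : List ℕ :=
  u :: L.length :: L.flatMap (fun x => [x, S.count x])

/-- The bound `min {√n' u log^(5/2) u, u^(4/3) log² u, σ log σ log (n' log u)}`, with logarithms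
to base two (and value `0` at `0`). -/
noncomputable def subsetSumTime (n' u σ : ℕ) : ℝ :=
  min (Real.sqrt n' * u * Real.logb 2 u ^ (5 / 2 : ℝ))
    (min ((u : ℝ) ^ (4 / 3 : ℝ) * Real.logb 2 u ^ 2)
      (σ * Real.logb 2 σ * Real.logb 2 (n' * Real.logb 2 u)))

/-! Let `t` be the minimum of the bound and the total sum; only sums up to `t` matter. As long as a
value `x` occurs at least three times, pairs of copies of `x` can be traded for copies of `2 * x`.
Done in increasing order of `x`, this leaves every multiplicity at most two, keeps the sums up to
`t` (`hasSubsetSum_reduced`), does not increase the total (`mass_reduced_le`), and multiplies the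
number of distinct values by at most `log t + 1` (`card_support_le`).

The remaining values are split at a threshold `a` and merged along two balanced binary trees whose
nodes are blocks of consecutive values. A block of small values stores its sums in one row of bits,
no longer than the sum of the block plus one. A block of large values, from `a'` to `b'`, stores a
sum `v` of `j` summands at row `j` and column `v - j * a'`. There are at most `t / a'` summands and
the excess is at most `j * (b' - a')`, so the table has size `O(t² (1/a' - 1/b') + J + 1)`, with `J`
the largest number of summands (`node_cells_le`). Over the disjoint blocks of one level this
telescopes to `O(t² / a + t)` (`levelBound_one`), while the small blocks of a level add up to their
total mass (`levelBound_zero`). Two siblings are merged by one convolution, in time proportional to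
`log t` times the size of the result (`wp_combine`). With `m` values left the trees have `O(log m)`
levels, so everything costs `O(log t · log m · (mass (a - 1) + t² / a + t))`.

The program takes the first `a` for which `a` times the mass up to `a` exceeds `t²`. Up to a factor
of two this is as good as any other threshold (`Threshold.le_of_nat`), so the analysis may
substitute `t / √m`, `t^(2/3)` or `t` and obtains the three terms of the minimum without the program
having to know which one is smallest.

A convolution is computed by fast Fourier transforms in complex fixed-point arithmetic. It only has
to decide whether a count is positive, and `O(log t)` fractional bits, hence one machine word per
number, keep the error below a quarter of the unit (`secondZ_err`, `secondZ_correct`).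
Two-dimensional convolutions become one-dimensional by padding the rows (`conv_packed`).

The program is written in a structured language whose clock overcharges the compiled code
(`Runs.code_correct`) and is verified by weakest preconditions. Working memory is allocated upwards
from the variable `top` and never released, so a command preserves what lies below the `top` it
started with. -/

set_option linter.constructorNameAsVariable false

/-! ### A structured language and its compilation to word RAM code -/

namespace WordRAM

/-- The program variables. -/
inductive Var where
  | i | j | n | t | u | top | sx | sr | sb | k | kk | one | big | bk | cs | sn | len | nn | hh
  | w | src | xa | ya | p1 | p2 | p3 | a1 | j1 | z1 | a2 | b2 | j2 | z2 | jj | zz | dd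
  | de | bb | m | d | d' | q | x | c | s | g | pt | ms | root | lo | r | cap | x0
  deriving DecidableEq

/-- Expressions; `ite a b c e` is `c` if `a < b`, else `e`. -/
inductive Expr where
  | var (v : Var)
  | lit (k : ℕ)
  | op (o : Op) (a b : Expr)
  | load (a : Expr)
  | ite (a b c e : Expr)

/-- Structured commands; the guards of `ite` and `while` are `a < b`. -/
inductive Cmd where
  | skip
  | set (v : Var) (e : Expr)
  | store (a e : Expr)
  | seq (c₁ c₂ : Cmd)
  | ite (a b : Expr) (c₁ c₂ : Cmd)
  | while (a b : Expr) (c : Cmd)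

/-- A state of the structured language, with a clock. -/
@[ext] structure St where
  var : Var → ℕ
  mem : ℕ → ℕ
  time : ℕ

namespace Expr

/-- The value of an expression on `w`-bit words. -/
def eval (w : ℕ) (s : St) : Expr → ℕ
  | var v => s.var v
  | lit k => k % 2 ^ w
  | op o a b => o.eval w (a.eval w s) (b.eval w s)
  | load a => s.mem (a.eval w s)
  | ite a b c e => if a.eval w s < b.eval w s then c.eval w s else e.eval w s

/-- An upper bound for the number of steps that evaluate an expression. -/
def cost : Expr → ℕ
  | var _ => 1
  | lit _ => 1
  | op _ a b => a.cost + b.cost + 1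
  | load a => a.cost + 1
  | ite a b c e => a.cost + b.cost + c.cost + e.cost + 2

/-- The register that holds a variable. -/
def _root_.WordRAM.Var.reg (v : Var) : ℕ := 2 * v.ctorIdx

/-- The code that computes an expression into the temporary register `2 * d + 1`, placed at
address `pc`. -/
def code : Expr → (pc d : ℕ) → List Instr
  | var v, _, d => [.op .or (2 * d + 1) v.reg v.reg]
  | lit k, _, d => [.const (2 * d + 1) k]
  | op o a b, pc, d =>
    let ca := a.code pc d
    let cb := b.code (pc + ca.length) (d + 1)
    ca ++ cb ++ [.op o (2 * d + 1) (2 * d + 1) (2 * (d + 1) + 1)]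
  | load a, pc, d => a.code pc d ++ [.load (2 * d + 1) (2 * d + 1)]
  | ite a b c e, pc, d =>
    let ca := a.code pc d
    let p₁ := pc + ca.length
    let cb := b.code p₁ (d + 1)
    let p₂ := p₁ + cb.length
    let ce := e.code (p₂ + 1) d
    let p₃ := p₂ + 1 + ce.length
    let cc := c.code (p₃ + 1) d
    ca ++ cb ++ [.jumpLt (2 * d + 1) (2 * (d + 1) + 1) (p₃ + 1)] ++ ce ++
      [.jump (p₃ + 1 + cc.length)] ++ cc

end Expr

namespace Cmd

/-- The code of a command, placed at address `pc`. -/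
def code : Cmd → (pc : ℕ) → List Instr
  | skip, _ => []
  | set v e, pc => e.code pc 0 ++ [.op .or v.reg 1 1]
  | store a e, pc =>
    let ca := a.code pc 0
    ca ++ e.code (pc + ca.length) 1 ++ [.store 1 3]
  | seq c₁ c₂, pc =>
    let k₁ := c₁.code pc
    k₁ ++ c₂.code (pc + k₁.length)
  | ite a b c₁ c₂, pc =>
    let ca := a.code pc 0
    let p₁ := pc + ca.length
    let cb := b.code p₁ 1
    let p₂ := p₁ + cb.length
    let k₂ := c₂.code (p₂ + 1)
    let p₃ := p₂ + 1 + k₂.length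
    let k₁ := c₁.code (p₃ + 1)
    ca ++ cb ++ [.jumpLt 1 3 (p₃ + 1)] ++ k₂ ++ [.jump (p₃ + 1 + k₁.length)] ++ k₁
  | .while a b c, pc =>
    let ca := a.code pc 0
    let p₁ := pc + ca.length
    let cb := b.code p₁ 1
    let p₂ := p₁ + cb.length
    let k := c.code (p₂ + 2)
    ca ++ cb ++ [.jumpLt 1 3 (p₂ + 2), .jump (p₂ + 2 + k.length + 1)] ++ k ++ [.jump pc]

/-- The variables that a command may change. -/
def writes : Cmd → List Var
  | skip => []
  | set v _ => [v]
  | store _ _ => []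
  | seq c₁ c₂ => c₁.writes ++ c₂.writes
  | ite _ _ c₁ c₂ => c₁.writes ++ c₂.writes
  | .while _ _ c => c.writes

end Cmd

/-- The time that the semantics charges for each simple command and each guard. -/
abbrev unitTime : ℕ := 300

/-- The state after an assignment. -/
def St.set (s : St) (v : Var) (x : ℕ) : St := ⟨Function.update s.var v x, s.mem, s.time + unitTime⟩

/-- The state after a store. -/
def St.put (s : St) (a x : ℕ) : St := ⟨s.var, Function.update s.mem a x, s.time + unitTime⟩

/-- The state after a guard. -/
def St.tick (s : St) : St := ⟨s.var, s.mem, s.time + unitTime⟩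

/-- Big-step semantics. -/
inductive Runs (w : ℕ) : Cmd → St → St → Prop
  | skip (s) : Runs w .skip s s
  | set (s v e) : e.cost < unitTime → Runs w (.set v e) s (s.set v (e.eval w s))
  | store (s a e) : a.cost + e.cost < unitTime →
      Runs w (.store a e) s (s.put (a.eval w s) (e.eval w s))
  | seq {s s₁ s₂ c₁ c₂} : Runs w c₁ s s₁ → Runs w c₂ s₁ s₂ → Runs w (.seq c₁ c₂) s s₂
  | iteT {s s' a b c₁ c₂} : a.cost + b.cost + 2 ≤ unitTime → a.eval w s < b.eval w s →
      Runs w c₁ s.tick s' → Runs w (.ite a b c₁ c₂) s s'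
  | iteF {s s' a b c₁ c₂} : a.cost + b.cost + 2 ≤ unitTime → ¬ a.eval w s < b.eval w s →
      Runs w c₂ s.tick s' → Runs w (.ite a b c₁ c₂) s s'
  | whileT {s s₁ s' a b c} : a.cost + b.cost + 2 ≤ unitTime → a.eval w s < b.eval w s →
      Runs w c s.tick s₁ → Runs w (.while a b c) s₁ s' → Runs w (.while a b c) s s'
  | whileF {s a b c} : a.cost + b.cost + 2 ≤ unitTime → ¬ a.eval w s < b.eval w s →
      Runs w (.while a b c) s s.tick

/-- The program contains the given code at address `pc`. -/
def CodeAt (P : Program) (pc : ℕ) (l : List Instr) : Prop :=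
  ∃ l₁ l₂, P = l₁ ++ l ++ l₂ ∧ l₁.length = pc

theorem CodeAt.left {P pc l₁ l₂} (h : CodeAt P pc (l₁ ++ l₂)) : CodeAt P pc l₁ := by
  obtain ⟨a, b, rfl, hb⟩ := h
  exact ⟨a, l₂ ++ b, by simp, hb⟩

theorem CodeAt.right {P pc l₁ l₂} (h : CodeAt P pc (l₁ ++ l₂)) :
    CodeAt P (pc + l₁.length) l₂ := by
  obtain ⟨a, b, rfl, hb⟩ := h
  exact ⟨a ++ l₁, b, by simp, by simp [hb]⟩

theorem CodeAt.get {P pc i l} (h : CodeAt P pc (i :: l)) : P[pc]? = some i := by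
  obtain ⟨a, b, rfl, rfl⟩ := h
  simp

/-- One step of a configuration that is at the given instruction. -/
theorem step_eq {w P s i l} (h : CodeAt P s.pc (i :: l)) : step w P s = i.exec w s := by
  rw [step, h.get]

theorem Var.reg_inj {v v' : Var} (h : v.reg = v'.reg) : v = v' := by
  have h2 : v.ctorIdx = v'.ctorIdx := by unfold Var.reg at h; omega
  have h3 := congrArg Var.ofNat h2
  rwa [Var.ofNat_ctorIdx, Var.ofNat_ctorIdx] at h3

theorem lor_self' (a : ℕ) : Nat.lor a a = a := Nat.or_self a

/-- `Reach w P s s' r`: the program gets from `s` to `s'` in at most `r` steps. -/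
def Reach (w : ℕ) (P : Program) (s s' : Config) (r : ℕ) : Prop :=
  ∃ n ≤ r, (step w P)^[n] s = s'

theorem Reach.trans {w P s₁ s₂ s₃ r₁ r₂} (h₁ : Reach w P s₁ s₂ r₁) (h₂ : Reach w P s₂ s₃ r₂) :
    Reach w P s₁ s₃ (r₁ + r₂) := by
  obtain ⟨n, hn, rfl⟩ := h₁
  obtain ⟨m, hm, rfl⟩ := h₂
  exact ⟨m + n, by omega, Function.iterate_add_apply _ _ _ _⟩

theorem Reach.step {w P s i l} (h : CodeAt P s.pc (i :: l)) : Reach w P s (i.exec w s) 1 :=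
  ⟨1, le_rfl, by rw [Function.iterate_one, step_eq h]⟩

theorem Reach.mono {w P s s' r r'} (h : Reach w P s s' r) (hr : r ≤ r') : Reach w P s s' r' := by
  obtain ⟨n, hn, e⟩ := h
  exact ⟨n, hn.trans hr, e⟩

/-- The registers of a configuration hold the variables. -/
def Rel (s : St) (c : Config) : Prop := (∀ v : Var, c.reg v.reg = s.var v) ∧ c.mem = s.mem

theorem Var.reg_ne (v : Var) (d : ℕ) : v.reg ≠ 2 * d + 1 := by unfold Var.reg; omega

/-- Variables live in even registers and temporaries in odd ones, and evaluation at depth `d` writes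
only temporaries of depth at least `d`. Hence the variables, and the operands that wait at smaller
depths, survive the evaluation of a subexpression. -/
theorem Expr.code_correct (w : ℕ) (P : Program) (s : St) (e : Expr) :
    ∀ (c : Config) (d : ℕ), Rel s c → CodeAt P c.pc (e.code c.pc d) →
      ∃ c', Reach w P c c' e.cost ∧ c'.pc = c.pc + (e.code c.pc d).length ∧ c'.mem = c.mem ∧
        c'.reg (2 * d + 1) = e.eval w s ∧
        ∀ r, (∀ d', d ≤ d' → r ≠ 2 * d' + 1) → c'.reg r = c.reg r := by
  have keep : ∀ {c c' : Config} {d : ℕ}, Rel s c → c'.mem = c.mem →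
      (∀ r, (∀ d', d ≤ d' → r ≠ 2 * d' + 1) → c'.reg r = c.reg r) → Rel s c' := by
    intro c c' d h hm hr
    exact ⟨fun v => by rw [hr _ (fun d' _ => v.reg_ne d'), h.1], hm.trans h.2⟩
  induction e with
  | var v =>
    intro c d h hc
    refine ⟨_, Reach.step hc, rfl, rfl, ?_, ?_⟩
    · simp [Instr.exec, Op.eval, eval, h.1]
    · intro r hr
      simp [Instr.exec, Function.update_of_ne (hr d le_rfl)]
  | lit k =>
    intro c d h hc
    refine ⟨_, Reach.step hc, rfl, rfl, ?_, ?_⟩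
    · simp [Instr.exec, eval]
    · intro r hr
      simp [Instr.exec, Function.update_of_ne (hr d le_rfl)]
  | op o a b iha ihb =>
    intro c d h hc
    simp only [code] at hc ⊢
    obtain ⟨c₁, r₁, p₁, m₁, v₁, k₁⟩ := iha c d h hc.left.left
    have h₁ := keep h m₁ k₁
    have hc2 := hc.left.right
    rw [← p₁] at hc2
    obtain ⟨c₂, r₂, p₂, m₂, v₂, k₂⟩ := ihb c₁ (d + 1) h₁ hc2
    have hc3 := hc.right
    rw [List.length_append, ← p₁, ← add_assoc, ← p₁, ← p₂] at hc3
    refine ⟨_, (r₁.trans r₂).trans (Reach.step hc3), ?_, ?_, ?_, ?_⟩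
    · simp [Instr.exec, p₂, p₁]; omega
    · simp [Instr.exec, m₂, m₁]
    · simp only [Instr.exec, Function.update_self, v₂, eval]
      rw [k₂ _ (fun d' _ => by omega), v₁]
    · intro r hr
      simp only [Instr.exec]
      rw [Function.update_of_ne (hr d le_rfl), k₂ _ (fun d' _ => hr d' (by omega)), k₁ _ hr]
  | load a iha =>
    intro c d h hc
    simp only [code] at hc ⊢
    obtain ⟨c₁, r₁, p₁, m₁, v₁, k₁⟩ := iha c d h hc.left
    have h₁ := keep h m₁ k₁
    have hc2 := hc.right
    rw [← p₁] at hc2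
    refine ⟨_, r₁.trans (Reach.step hc2), ?_, ?_, ?_, ?_⟩
    · simp [Instr.exec, p₁]; omega
    · simp [Instr.exec, m₁]
    · simp only [Instr.exec, Function.update_self, v₁, eval, h₁.2]
    · intro r hr
      simp only [Instr.exec]
      rw [Function.update_of_ne (hr d le_rfl), k₁ _ hr]
  | ite a b x y iha ihb ihx ihy =>
    intro c d h hc
    simp only [code] at hc ⊢
    obtain ⟨c₁, r₁, p₁, m₁, v₁, k₁⟩ := iha c d h hc.left.left.left.left.left
    have h₁ := keep h m₁ k₁
    have hc2 := hc.left.left.left.left.right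
    rw [← p₁] at hc2 hc ⊢
    obtain ⟨c₂, r₂, p₂, m₂, v₂, k₂⟩ := ihb c₁ (d + 1) h₁ hc2
    have h₂ := keep h₁ m₂ k₂
    have hc3 := hc.left.left.left.right
    rw [List.length_append, ← add_assoc, ← p₁, ← p₂] at hc3
    rw [← p₂] at hc ⊢
    have v₁' : c₂.reg (2 * d + 1) = a.eval w s := by
      rw [k₂ _ (fun d' _ => by omega), v₁]
    have hst := Reach.step (w := w) hc3
    -- The code for the false case comes first; a successful comparison jumps over it and over its
    -- closing jump.
    by_cases hlt : a.eval w s < b.eval w s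
    · set c₃ := Instr.exec w c₂ (.jumpLt (2 * d + 1) (2 * (d + 1) + 1)
        (c₂.pc + 1 + (y.code (c₂.pc + 1) d).length + 1)) with e₃
      have p₃ : c₃.pc = c₂.pc + 1 + (y.code (c₂.pc + 1) d).length + 1 := by
        simp [e₃, Instr.exec, v₁', v₂, hlt]
      have h₃ : Rel s c₃ := h₂
      have hc4 := hc.right
      have hl : c.pc + (a.code c.pc d ++ b.code c₁.pc (d + 1) ++
          [Instr.jumpLt (2 * d + 1) (2 * (d + 1) + 1)
            (c₂.pc + 1 + (y.code (c₂.pc + 1) d).length + 1)] ++ y.code (c₂.pc + 1) d ++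
          [Instr.jump (c₂.pc + 1 + (y.code (c₂.pc + 1) d).length + 1 +
            (x.code (c₂.pc + 1 + (y.code (c₂.pc + 1) d).length + 1) d).length)]).length = c₃.pc := by
        simp only [List.length_append, List.length_singleton]; omega
      rw [hl, ← p₃] at hc4
      obtain ⟨c₄, r₄, p₄, m₄, v₄, k₄⟩ := ihx c₃ d h₃ hc4
      refine ⟨c₄, (((r₁.trans r₂).trans hst).trans r₄).mono (by simp [cost]; omega), ?_, ?_, ?_, ?_⟩
      · rw [p₄, p₃]
        simp only [List.length_append, List.length_singleton]
        omega
      · rw [m₄]; exact m₂.trans m₁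
      · rw [v₄]; simp [eval, hlt]
      · intro r hr
        rw [k₄ _ hr]
        exact (k₂ _ (fun d' _ => hr d' (by omega))).trans (k₁ _ hr)
    · set c₃ := Instr.exec w c₂ (.jumpLt (2 * d + 1) (2 * (d + 1) + 1)
        (c₂.pc + 1 + (y.code (c₂.pc + 1) d).length + 1)) with e₃
      have p₃ : c₃.pc = c₂.pc + 1 := by
        simp [e₃, Instr.exec, v₁', v₂, hlt]
      have h₃ : Rel s c₃ := h₂
      have hc4 := hc.left.left.right
      have hl : c.pc + (a.code c.pc d ++ b.code c₁.pc (d + 1) ++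
          [Instr.jumpLt (2 * d + 1) (2 * (d + 1) + 1)
            (c₂.pc + 1 + (y.code (c₂.pc + 1) d).length + 1)]).length = c₃.pc := by
        simp only [List.length_append, List.length_singleton]; omega
      rw [hl] at hc4
      rw [← p₃] at hc4 hc ⊢
      obtain ⟨c₄, r₄, p₄, m₄, v₄, k₄⟩ := ihy c₃ d h₃ hc4
      have hc5 : CodeAt P c₄.pc [Instr.jump (c₃.pc + (y.code c₃.pc d).length + 1 +
          (x.code (c₃.pc + (y.code c₃.pc d).length + 1) d).length)] := by
        have := hc.left.right
        rwa [show c.pc + _ = c₄.pc by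
          simp only [List.length_append, List.length_singleton]; omega] at this
      refine ⟨_, ((((r₁.trans r₂).trans hst).trans r₄).trans (Reach.step hc5)).mono
        (by simp [cost]; omega), ?_, ?_, ?_, ?_⟩
      · simp only [Instr.exec, List.length_append, List.length_singleton]; omega
      · simp only [Instr.exec]; rw [m₄]; exact m₂.trans m₁
      · simp only [Instr.exec]; rw [v₄]; simp [eval, hlt]
      · intro r hr
        simp only [Instr.exec]
        rw [k₄ _ hr]
        exact (k₂ _ (fun d' _ => hr d' (by omega))).trans (k₁ _ hr)

theorem Reach.zero {w P s} : Reach w P s s 0 := ⟨0, le_rfl, rfl⟩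

/-- Evaluation of an expression, keeping the variables. -/
theorem Expr.code_rel {w P s} {e : Expr} {c : Config} {d : ℕ} (h : Rel s c)
    (hc : CodeAt P c.pc (e.code c.pc d)) :
    ∃ c', Reach w P c c' e.cost ∧ c'.pc = c.pc + (e.code c.pc d).length ∧ Rel s c' ∧
      c'.reg (2 * d + 1) = e.eval w s ∧ ∀ d' < d, c'.reg (2 * d' + 1) = c.reg (2 * d' + 1) := by
  obtain ⟨c', h₁, h₂, h₃, h₄, h₅⟩ := e.code_correct w P s c d h hc
  exact ⟨c', h₁, h₂, ⟨fun v => by rw [h₅ _ (fun d' _ => v.reg_ne d'), h.1], h₃.trans h.2⟩, h₄,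
    fun d' hd => h₅ _ fun d'' hd' => by omega⟩

/-- Evaluation of the two sides of a guard. -/
theorem Expr.code_pair {w P s} {a b : Expr} {c : Config} (h : Rel s c)
    (ha : CodeAt P c.pc (a.code c.pc 0))
    (hb : CodeAt P (c.pc + (a.code c.pc 0).length) (b.code (c.pc + (a.code c.pc 0).length) 1)) :
    ∃ c', Reach w P c c' (a.cost + b.cost) ∧
      c'.pc = c.pc + (a.code c.pc 0).length +
        (b.code (c.pc + (a.code c.pc 0).length) 1).length ∧ Rel s c' ∧
      c'.reg 1 = a.eval w s ∧ c'.reg 3 = b.eval w s := by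
  obtain ⟨c₁, r₁, p₁, h₁, v₁, -⟩ := Expr.code_rel (w := w) h ha
  rw [← p₁] at hb ⊢
  obtain ⟨c₂, r₂, p₂, h₂, v₂, k₂⟩ := Expr.code_rel (w := w) h₁ hb
  exact ⟨c₂, r₁.trans r₂, p₂, h₂, (k₂ 0 zero_lt_one).trans v₁, v₂⟩

theorem Rel.tick {s c} (h : Rel s c) : Rel s.tick c := h

/-- Correctness of the compilation. -/
theorem Runs.code_correct {w : ℕ} {P : Program} {cm : Cmd} {s s' : St} (hr : Runs w cm s s') :
    ∀ c : Config, Rel s c → CodeAt P c.pc (cm.code c.pc) →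
      ∃ c' n, s.time + n ≤ s'.time ∧ Reach w P c c' n ∧ c'.pc = c.pc + (cm.code c.pc).length ∧
        Rel s' c' := by
  -- The clock charges `unitTime` for every simple command and guard. The cost conditions in `Runs`
  -- make this at least the number of machine steps, including the jumps that close a branch or a
  -- loop.
  induction hr with
  | skip s => exact fun c h hc => ⟨c, 0, by simp, .zero, by simp [Cmd.code], h⟩
  | set s v e he =>
    intro c h hc
    simp only [Cmd.code] at hc ⊢
    obtain ⟨c₁, r₁, p₁, h₁, v₁, -⟩ := Expr.code_rel (w := w) h hc.left
    have hc2 := hc.right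
    rw [← p₁] at hc2
    refine ⟨_, _, le_rfl, (r₁.trans (Reach.step hc2)).mono he, by simp [Instr.exec, p₁]; omega, ?_, h₁.2⟩
    intro v'
    simp only [Instr.exec, St.set, Function.update_apply, Op.eval, lor_self', v₁]
    by_cases hv : v' = v
    · simp [hv]
    · rw [if_neg hv, if_neg (fun hh => hv (Var.reg_inj hh)), h₁.1]
  | store s a e he =>
    intro c h hc
    simp only [Cmd.code] at hc ⊢
    obtain ⟨c₁, r₁, p₁, h₁, v₁, w₁⟩ := Expr.code_pair (w := w) h hc.left.left hc.left.right
    have hc2 := hc.right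
    rw [List.length_append, ← add_assoc, ← p₁] at hc2
    refine ⟨_, _, le_rfl, (r₁.trans (Reach.step hc2)).mono he, by simp [Instr.exec, p₁]; omega, h₁.1, ?_⟩
    simp [Instr.exec, St.put, v₁, w₁, h₁.2]
  | seq _ _ ih₁ ih₂ =>
    intro c h hc
    simp only [Cmd.code] at hc ⊢
    obtain ⟨c₁, n₁, t₁, r₁, p₁, h₁⟩ := ih₁ c h hc.left
    have hc2 := hc.right
    rw [← p₁] at hc2 ⊢
    obtain ⟨c₂, n₂, t₂, r₂, p₂, h₂⟩ := ih₂ c₁ h₁ hc2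
    exact ⟨c₂, n₁ + n₂, by omega, r₁.trans r₂, by simp [p₂]; omega, h₂⟩
  | @iteT s s' a b k₁ k₂ hcost hlt _ ih =>
    intro c h hc
    simp only [Cmd.code] at hc ⊢
    obtain ⟨c₁, r₁, p₁, h₁, v₁, w₁⟩ := Expr.code_pair (w := w) h hc.left.left.left.left.left
      hc.left.left.left.left.right
    have hc2 := hc.left.left.left.right
    rw [List.length_append, ← add_assoc, ← p₁] at hc2
    have hst := Reach.step (w := w) hc2
    rw [← p₁] at hc ⊢
    have p₂ : (Instr.exec w c₁ (.jumpLt 1 3 (c₁.pc + 1 + (k₂.code (c₁.pc + 1)).length + 1))).pc =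
      c₁.pc + 1 + (k₂.code (c₁.pc + 1)).length + 1 := by simp [Instr.exec, v₁, w₁, hlt]
    have hc3 := hc.right
    obtain ⟨c₃, n₃, t₃, r₃, p₃, h₃⟩ := ih (Instr.exec w c₁ (.jumpLt 1 3 _)) h₁.tick (by
      rw [p₂]
      convert hc3 using 1
      simp only [List.length_append, List.length_singleton]; omega)
    refine ⟨c₃, _, ?_, (r₁.trans hst).trans r₃, ?_, h₃⟩
    · simp only [St.tick, unitTime] at t₃ hcost; omega
    · rw [p₃, p₂]
      simp only [List.length_append, List.length_singleton]; omega
  | @iteF s s' a b k₁ k₂ hcost hlt _ ih =>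
    intro c h hc
    simp only [Cmd.code] at hc ⊢
    obtain ⟨c₁, r₁, p₁, h₁, v₁, w₁⟩ := Expr.code_pair (w := w) h hc.left.left.left.left.left
      hc.left.left.left.left.right
    have hc2 := hc.left.left.left.right
    rw [List.length_append, ← add_assoc, ← p₁] at hc2
    have hst := Reach.step (w := w) hc2
    rw [← p₁] at hc ⊢
    have p₂ : (Instr.exec w c₁ (.jumpLt 1 3 (c₁.pc + 1 + (k₂.code (c₁.pc + 1)).length + 1))).pc =
      c₁.pc + 1 := by simp [Instr.exec, v₁, w₁, hlt]
    have hc3 := hc.left.left.right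
    obtain ⟨c₃, n₃, t₃, r₃, p₃, h₃⟩ := ih (Instr.exec w c₁ (.jumpLt 1 3 _)) h₁.tick (by
      rw [p₂]
      convert hc3 using 1
      simp only [List.length_append, List.length_singleton]; omega)
    rw [p₂] at p₃
    have hc4 : CodeAt P c₃.pc [.jump (c₁.pc + 1 + (k₂.code (c₁.pc + 1)).length + 1 +
        (k₁.code (c₁.pc + 1 + (k₂.code (c₁.pc + 1)).length + 1)).length)] := by
      convert hc.left.right using 1
      simp only [List.length_append, List.length_singleton]; omega
    refine ⟨_, _, ?_, ((r₁.trans hst).trans r₃).trans (Reach.step hc4), ?_, h₃⟩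
    · simp only [St.tick, unitTime] at t₃ hcost; omega
    · simp only [Instr.exec, List.length_append, List.length_singleton]; omega
  | @whileT s s₁ s' a b k hcost hlt _ _ ih₁ ih₂ =>
    intro c h hc
    have hc' := hc
    simp only [Cmd.code] at hc
    obtain ⟨c₁, r₁, p₁, h₁, v₁, w₁⟩ := Expr.code_pair (w := w) h hc.left.left.left.left
      hc.left.left.left.right
    have hc2 := hc.left.left.right
    rw [List.length_append, ← add_assoc, ← p₁] at hc2
    have hst := Reach.step (w := w) hc2
    rw [← p₁] at hc
    have p₂ : (Instr.exec w c₁ (.jumpLt 1 3 (c₁.pc + 2))).pc = c₁.pc + 2 := by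
      simp [Instr.exec, v₁, w₁, hlt]
    obtain ⟨c₃, n₃, t₃, r₃, p₃, h₃⟩ := ih₁ (Instr.exec w c₁ (.jumpLt 1 3 _)) h₁.tick (by
      rw [p₂]
      convert hc.left.right using 1
      simp only [List.length_append, List.length_cons, List.length_nil]; omega)
    rw [p₂] at p₃
    have hc4 : CodeAt P c₃.pc [.jump c.pc] := by
      convert hc.right using 1
      simp only [List.length_append, List.length_cons, List.length_nil]; omega
    obtain ⟨c₄, n₄, t₄, r₄, p₄, h₄⟩ := ih₂ (Instr.exec w c₃ (.jump c.pc)) h₃ hc'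
    refine ⟨c₄, _, ?_, (((r₁.trans hst).trans r₃).trans (Reach.step hc4)).trans r₄, p₄, h₄⟩
    simp only [St.tick, unitTime] at t₃ hcost; omega
  | @whileF s a b k hcost hlt =>
    intro c h hc
    simp only [Cmd.code] at hc ⊢
    obtain ⟨c₁, r₁, p₁, h₁, v₁, w₁⟩ := Expr.code_pair (w := w) h hc.left.left.left.left
      hc.left.left.left.right
    have hc2 := hc.left.left.right
    rw [List.length_append, ← add_assoc, ← p₁] at hc2
    have hst := Reach.step (w := w) hc2
    have p₂ : (Instr.exec w c₁ (.jumpLt 1 3 (c₁.pc + 2))).pc = c₁.pc + 1 := by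
      simp [Instr.exec, v₁, w₁, hlt]
    rw [← p₁] at hc ⊢
    have hc3 : CodeAt P (c₁.pc + 1) [.jump (c₁.pc + 2 + (k.code (c₁.pc + 2)).length + 1)] := by
      have h3 : CodeAt P c₁.pc ([.jumpLt 1 3 (c₁.pc + 2)] ++
          [.jump (c₁.pc + 2 + (k.code (c₁.pc + 2)).length + 1)]) := hc2
      exact h3.right
    rw [← p₂] at hc3
    refine ⟨_, _, ?_, (r₁.trans hst).trans (Reach.step hc3), ?_, h₁.tick⟩
    · simp only [St.tick, unitTime] at hcost ⊢; omega
    · simp only [Instr.exec, List.length_append, List.length_cons, List.length_nil]; omega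

/-- A run of a command gives an execution of the compiled program up to its end. -/
theorem Runs.halts {w : ℕ} {cm : Cmd} {s' : St} {input : List ℕ}
    (hr : Runs w cm ⟨fun _ => 0, fun i => input.getD i 0, 0⟩ s') :
    ∃ n ≤ s'.time, Halted (cm.code 0) ((step w (cm.code 0))^[n] (init input)) ∧
      ((step w (cm.code 0))^[n] (init input)).mem = s'.mem := by
  obtain ⟨c', n, t, ⟨m, hm, rfl⟩, p, h⟩ := hr.code_correct (P := cm.code 0) (init input)
    ⟨fun _ => rfl, rfl⟩ ⟨[], [], by simp [init], rfl⟩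
  refine ⟨m, by simp only [] at t; omega, ?_, h.2⟩
  rw [Halted, p]
  simp [init]

end WordRAM

/-! ### Verification conditions -/

namespace WordRAM

/-- The command terminates from the given state, in a state with the given property. -/
def wp (w : ℕ) (c : Cmd) (Q : St → Prop) (s : St) : Prop := ∃ s', Runs w c s s' ∧ Q s'

variable {w : ℕ} {Q R : St → Prop} {s : St}

theorem wp.mono {c : Cmd} (h : wp w c Q s) (hQ : ∀ s', Q s' → R s') : wp w c R s := by
  obtain ⟨s', h₁, h₂⟩ := h
  exact ⟨s', h₁, hQ _ h₂⟩

theorem wp_skip (h : Q s) : wp w .skip Q s := ⟨_, .skip s, h⟩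

/-- The value `x` is separate from `e.eval w s`, so the caller can give the intended integer and
prove that no reduction modulo `2 ^ w` took place. The cost condition is a closed computation. -/
theorem wp_set {v : Var} {e : Expr} {x : ℕ} (he : e.eval w s = x) (h : Q (s.set v x))
    (hc : e.cost < unitTime := by decide) : wp w (.set v e) Q s :=
  ⟨_, .set s v e hc, by rwa [he]⟩

theorem wp_store {a e : Expr} {x y : ℕ} (ha : a.eval w s = x) (he : e.eval w s = y)
    (h : Q (s.put x y)) (hc : a.cost + e.cost < unitTime := by decide) :
    wp w (.store a e) Q s :=
  ⟨_, .store s a e hc, by rwa [ha, he]⟩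

theorem wp_seq {c₁ c₂ : Cmd} (h : wp w c₁ (wp w c₂ Q) s) : wp w (.seq c₁ c₂) Q s := by
  obtain ⟨s₁, h₁, s₂, h₂, h⟩ := h
  exact ⟨s₂, .seq h₁ h₂, h⟩

theorem wp_ite {a b : Expr} {c₁ c₂ : Cmd} (h₁ : a.eval w s < b.eval w s → wp w c₁ Q s.tick)
    (h₂ : ¬ a.eval w s < b.eval w s → wp w c₂ Q s.tick)
    (hc : a.cost + b.cost + 2 ≤ unitTime := by decide) : wp w (.ite a b c₁ c₂) Q s := by
  by_cases h : a.eval w s < b.eval w s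
  · obtain ⟨s', r, q⟩ := h₁ h
    exact ⟨s', .iteT hc h r, q⟩
  · obtain ⟨s', r, q⟩ := h₂ h
    exact ⟨s', .iteF hc h r, q⟩

/-- A loop that runs `n` times. -/
theorem wp_while {a b : Expr} {c : Cmd} (I : ℕ → St → Prop) (n : ℕ) (h₀ : I 0 s)
    (hs : ∀ i < n, ∀ s, I i s → a.eval w s < b.eval w s ∧ wp w c (I (i + 1)) s.tick)
    (hn : ∀ s, I n s → ¬ a.eval w s < b.eval w s ∧ Q s.tick)
    (hc : a.cost + b.cost + 2 ≤ unitTime := by decide) : wp w (.while a b c) Q s := by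
  -- Induction on the number `m` of iterations that remain; the invariant is then at index `n - m`.
  have key : ∀ m ≤ n, ∀ s, I (n - m) s → wp w (.while a b c) Q s := by
    intro m
    induction m with
    | zero =>
      intro _ s h
      obtain ⟨h₁, h₂⟩ := hn s h
      exact ⟨_, .whileF hc h₁, h₂⟩
    | succ m ih =>
      intro hm s h
      obtain ⟨h₁, s₁, r₁, h₂⟩ := hs (n - (m + 1)) (by omega) s h
      obtain ⟨s₂, r₂, q⟩ := ih (by omega) s₁ (by rwa [show n - m = n - (m + 1) + 1 by omega])
      exact ⟨s₂, .whileT hc h₁ r₁ r₂, q⟩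
  exact key n le_rfl s (by simpa using h₀)

/-- Variables that a command does not write keep their values. -/
theorem Runs.var_eq {c : Cmd} {s s' : St} (h : Runs w c s s') :
    ∀ v ∉ c.writes, s'.var v = s.var v := by
  induction h with
  | skip s => exact fun _ _ => rfl
  | set s v e =>
    intro v' hv
    exact Function.update_of_ne (by simpa [Cmd.writes] using hv) _ _
  | store => exact fun _ _ => rfl
  | seq _ _ ih₁ ih₂ =>
    intro v hv
    simp only [Cmd.writes, List.mem_append, not_or] at hv
    rw [ih₂ v hv.2, ih₁ v hv.1]
  | iteT _ _ _ ih =>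
    intro v hv
    simp only [Cmd.writes, List.mem_append, not_or] at hv
    exact ih v hv.1
  | iteF _ _ _ ih =>
    intro v hv
    simp only [Cmd.writes, List.mem_append, not_or] at hv
    exact ih v hv.2
  | whileT _ _ _ _ ih₁ ih₂ => exact fun v hv => (ih₂ v hv).trans (ih₁ v hv)
  | whileF => exact fun _ _ => rfl

/-- A specification may use that unwritten variables keep their values. -/
theorem wp.frame {c : Cmd} (h : wp w c Q s) :
    wp w c (fun s' => Q s' ∧ ∀ v ∉ c.writes, s'.var v = s.var v) s := by
  obtain ⟨s', r, q⟩ := h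
  exact ⟨s', r, q, r.var_eq⟩

namespace Expr

instance : Coe Var Expr := ⟨.var⟩
instance (n : ℕ) : OfNat Expr n := ⟨.lit n⟩
instance : Add Expr := ⟨.op .add⟩
instance : Sub Expr := ⟨.op .sub⟩
instance : Mul Expr := ⟨.op .mul⟩
instance : Div Expr := ⟨.op .div⟩
instance : Mod Expr := ⟨.op .mod⟩
/-- The left shift. -/
abbrev shl (a b : Expr) : Expr := .op .shl a b
/-- The right shift. -/
abbrev shr (a b : Expr) : Expr := .op .shr a b

variable (a b c e : Expr) (v : Var) (s)

@[simp] theorem eval_var : eval w s (.var v) = s.var v := rfl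
@[simp] theorem eval_num (n : ℕ) : eval w s (no_index (OfNat.ofNat n) : Expr) = n % 2 ^ w := rfl
@[simp] theorem eval_zero : eval w s (0 : Expr) = 0 := Nat.zero_mod _
@[simp] theorem eval_add : eval w s (a + b) = (eval w s a + eval w s b) % 2 ^ w := rfl
@[simp] theorem eval_sub : eval w s (a - b) = (eval w s a + (2 ^ w - eval w s b)) % 2 ^ w := rfl
@[simp] theorem eval_mul : eval w s (a * b) = (eval w s a * eval w s b) % 2 ^ w := rfl
@[simp] theorem eval_div : eval w s (a / b) = eval w s a / eval w s b := rfl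
@[simp] theorem eval_mod : eval w s (a % b) = eval w s a % eval w s b := rfl
@[simp] theorem eval_shl : eval w s (shl a b) = (eval w s a * 2 ^ eval w s b) % 2 ^ w := rfl
@[simp] theorem eval_shr : eval w s (shr a b) = eval w s a / 2 ^ eval w s b := rfl
@[simp] theorem eval_load : eval w s (.load a) = s.mem (eval w s a) := rfl
@[simp] theorem eval_ite : eval w s (.ite a b c e) =
    if eval w s a < eval w s b then eval w s c else eval w s e := rfl

end Expr

@[simp] theorem St.set_var (s : St) (v v' : Var) (x : ℕ) :
    (s.set v x).var v' = if v' = v then x else s.var v' := Function.update_apply _ _ _ _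
@[simp] theorem St.set_mem (s : St) (v : Var) (x : ℕ) : (s.set v x).mem = s.mem := rfl
@[simp] theorem St.set_time (s : St) (v : Var) (x : ℕ) : (s.set v x).time = s.time + 300 := rfl
@[simp] theorem St.put_var (s : St) (a x : ℕ) : (s.put a x).var = s.var := rfl
@[simp] theorem St.put_mem (s : St) (a x : ℕ) : (s.put a x).mem = Function.update s.mem a x := rfl
@[simp] theorem St.put_time (s : St) (a x : ℕ) : (s.put a x).time = s.time + 300 := rfl
@[simp] theorem St.tick_var (s : St) : s.tick.var = s.var := rfl
@[simp] theorem St.tick_mem (s : St) : s.tick.mem = s.mem := rfl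
@[simp] theorem St.tick_time (s : St) : s.tick.time = s.time + 300 := rfl

/-- Subtraction of a smaller word. -/
theorem sub_mod {a b m : ℕ} (h : b ≤ a) (ha : a < m) : (a + (m - b)) % m = a - b := by
  rw [show a + (m - b) = a - b + m by omega, Nat.add_mod_right, Nat.mod_eq_of_lt (by omega)]

/-- The memory `f` with the `n` cells from `b` on replaced by the values of `g`. -/
def blk (f : ℕ → ℕ) (b n : ℕ) (g : ℕ → ℕ) : ℕ → ℕ :=
  fun a => if b ≤ a ∧ a < b + n then g (a - b) else f a

theorem blk_zero (f b g) : blk f b 0 g = f := by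
  funext a; simp only [blk]; rw [if_neg (by omega)]

theorem blk_succ (f b n g) : Function.update (blk f b n g) (b + n) (g n) = blk f b (n + 1) g := by
  funext a
  by_cases h : a = b + n
  · subst h; simp [blk]
  · rw [Function.update_of_ne h]
    simp only [blk]
    exact if_congr (by omega) rfl rfl

theorem blk_of_lt {f b n g a} (h : a < b) : blk f b n g a = f a := if_neg (by omega)

theorem blk_add {f b n g k} (h : k < n) : blk f b n g (b + k) = g k := by
  simp only [blk]; rw [if_pos (by omega), Nat.add_sub_cancel_left]

open Var in
/-- The loop that stores the values of `e` for `i < n` in the cells from the address `b` on. -/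
def fill (n b : Var) (e : Expr) : Cmd :=
  .seq (.set i 0) (.while i n (.seq (.store (b + i) e) (.set i (i + 1))))

/-- The state after a `fill` loop. -/
def St.fill (s : St) (b n : ℕ) (g : ℕ → ℕ) : St :=
  ⟨Function.update s.var .i n, blk s.mem b n g, s.time + 600 + n * 900⟩

@[simp] theorem St.fill_var (s : St) (b n g v) :
    (s.fill b n g).var v = if v = .i then n else s.var v := Function.update_apply _ _ _ _
@[simp] theorem St.fill_mem (s : St) (b n g) : (s.fill b n g).mem = blk s.mem b n g := rfl
@[simp] theorem St.fill_time (s : St) (b n g) : (s.fill b n g).time = s.time + 600 + n * 900 := rfl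

/-- The expression is evaluated in a state where the cells before `k` already hold their values, so
it may read entries that the same loop has written; the table of roots of unity relies on this. -/
theorem wp_fill {n b : Var} {e : Expr} {nv bv : ℕ} (g : ℕ → ℕ) (hn : s.var n = nv)
    (hb : s.var b = bv) (hni : n ≠ .i) (hbi : b ≠ .i) (hw : bv + nv < 2 ^ w)
    (he : ∀ k < nv, ∀ s' : St, s'.var = Function.update s.var .i k → s'.mem = blk s.mem bv k g →
      e.eval w s' = g k)
    (h : Q (s.fill bv nv g)) (hc : e.cost < 290 := by decide) : wp w (fill n b e) Q s := by
  subst hn hb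
  refine wp_seq (wp_set (x := 0) rfl ?_)
  refine wp_while (fun k s' => s'.var = Function.update s.var .i k ∧
    s'.mem = blk s.mem (s.var b) k g ∧ s'.time = s.time + 300 + k * 900) (s.var n) ?_ ?_ ?_
    (by simp [Expr.cost, unitTime])
  · simp [St.set, blk_zero]
  · rintro k hk s' ⟨h₁, h₂, h₃⟩
    have hbk : (s.var b + k) % 2 ^ w = s.var b + k := Nat.mod_eq_of_lt (by omega)
    have hk1 : (k + 1 % 2 ^ w) % 2 ^ w = k + 1 := by
      rw [Nat.add_mod_mod, Nat.mod_eq_of_lt (by omega)]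
    refine ⟨by simp [h₁, Function.update_of_ne hni, hk], wp_seq (wp_store (x := s.var b + k) ?_
      (he k hk _ h₁ h₂) (wp_set (x := k + 1) ?_ ⟨?_, ?_, ?_⟩)
      (by simp only [unitTime, HAdd.hAdd, Add.add, Expr.cost] at *; simp at *; omega))⟩
    · simp [h₁, Function.update_of_ne hbi, hbk]
    · simp [h₁, hk1]
    · funext v
      simp only [St.set_var, St.put_var, St.tick_var, h₁, Function.update_apply]
      split_ifs <;> rfl
    · simp [h₂, blk_succ]
    · simp [h₃]; ring
  · rintro s' ⟨h₁, h₂, h₃⟩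
    refine ⟨by simp [h₁, Function.update_of_ne hni], ?_⟩
    have : s'.tick = s.fill (s.var b) (s.var n) g := by
      ext1
      · exact h₁
      · exact h₂
      · simp [h₃]; ring
    rwa [this]

end WordRAM

/-! ### Signed integers in two's complement -/

namespace WordRAM

/-- The word that represents the integer `v`. -/
def rep (w : ℕ) (v : ℤ) : ℕ := (v % 2 ^ w).toNat

theorem rep_cast (w : ℕ) (v : ℤ) : (rep w v : ℤ) = v % 2 ^ w :=
  Int.toNat_of_nonneg (Int.emod_nonneg _ (by positivity))

theorem rep_lt (w : ℕ) (v : ℤ) : rep w v < 2 ^ w := by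
  have h := Int.emod_lt_of_pos v (show (0 : ℤ) < 2 ^ w by positivity)
  rw [← rep_cast] at h
  exact_mod_cast h

theorem rep_natCast {w n : ℕ} (h : n < 2 ^ w) : rep w n = n := by
  have h1 := rep_cast w n
  rw [Int.emod_eq_of_lt (by positivity) (by exact_mod_cast h)] at h1
  exact_mod_cast h1

/-- A word is determined by its residue modulo `2 ^ w`, so the rules for signed arithmetic reduce to
congruences. -/
theorem eq_rep {w n : ℕ} {v : ℤ} (h : n < 2 ^ w) (hv : (n : ℤ) ≡ v [ZMOD 2 ^ w]) : n = rep w v := by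
  rw [← rep_natCast h]
  unfold rep
  rw [hv]

theorem rep_modEq (w : ℕ) (v : ℤ) : (rep w v : ℤ) ≡ v [ZMOD 2 ^ w] := by
  rw [rep_cast]; exact Int.mod_modEq _ _

theorem mod_modEq' (w n : ℕ) : ((n % 2 ^ w : ℕ) : ℤ) ≡ n [ZMOD 2 ^ w] := by
  push_cast; exact Int.mod_modEq _ _

theorem rep_add (w : ℕ) (a b : ℤ) : (rep w a + rep w b) % 2 ^ w = rep w (a + b) :=
  eq_rep (Nat.mod_lt _ (by positivity)) ((mod_modEq' _ _).trans
    (by push_cast; exact (rep_modEq w a).add (rep_modEq w b)))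

theorem rep_mul (w : ℕ) (a b : ℤ) : (rep w a * rep w b) % 2 ^ w = rep w (a * b) :=
  eq_rep (Nat.mod_lt _ (by positivity)) ((mod_modEq' _ _).trans
    (by push_cast; exact (rep_modEq w a).mul (rep_modEq w b)))

theorem rep_sub (w : ℕ) (a b : ℤ) : (rep w a + (2 ^ w - rep w b)) % 2 ^ w = rep w (a - b) := by
  refine eq_rep (Nat.mod_lt _ (by positivity)) ((mod_modEq' _ _).trans ?_)
  rw [Nat.cast_add, Nat.cast_sub (rep_lt w b).le]
  have h := (rep_modEq w a).sub (rep_modEq w b)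
  have h0 : ((2 ^ w : ℕ) : ℤ) ≡ 0 [ZMOD 2 ^ w] := by
    push_cast; exact (Int.emod_self).trans (Int.zero_emod _).symm
  have := h.add h0
  rw [add_zero] at this
  convert this using 1
  ring

/-- The signed right shift by `K`, through the offset `2 ^ (K + r)`. -/
theorem rep_shift {w K r : ℕ} {v : ℤ} (h₁ : -2 ^ (K + r) ≤ v) (h₂ : v < 2 ^ (K + r))
    (hw : K + r + 1 ≤ w) :
    ((rep w v + 2 ^ (K + r)) % 2 ^ w / 2 ^ K + (2 ^ w - 2 ^ r)) % 2 ^ w = rep w (v / 2 ^ K) := by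
  have hp : (2 : ℤ) ^ (K + r + 1) ≤ 2 ^ w := pow_le_pow_right₀ (by norm_num) hw
  rw [pow_succ] at hp
  have hKr : 2 ^ (K + r) < 2 ^ w := Nat.pow_lt_pow_right (by norm_num) (by omega)
  have hr : 2 ^ r < 2 ^ w := Nat.pow_lt_pow_right (by norm_num) (by omega)
  have e1 : (rep w v + 2 ^ (K + r)) % 2 ^ w = (v + 2 ^ (K + r)).toNat := by
    have h3 : ((v + 2 ^ (K + r)).toNat : ℤ) = v + 2 ^ (K + r) := Int.toNat_of_nonneg (by linarith)
    have h4 : rep w (2 ^ (K + r)) = 2 ^ (K + r) := by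
      have := rep_natCast hKr; push_cast at this; exact this
    have h5 : (v + 2 ^ (K + r)).toNat < 2 ^ w := by
      have : ((v + 2 ^ (K + r)).toNat : ℤ) < 2 ^ w := by rw [h3]; linarith
      exact_mod_cast this
    calc _ = (rep w v + rep w (2 ^ (K + r))) % 2 ^ w := by rw [h4]
      _ = rep w (v + 2 ^ (K + r)) := rep_add _ _ _
      _ = _ := by rw [← h3, rep_natCast h5, h3]
  have e2 : (v + 2 ^ (K + r)).toNat / 2 ^ K = rep w (v / 2 ^ K + 2 ^ r) := by
    have h3 : ((v + 2 ^ (K + r)).toNat : ℤ) = v + 2 ^ (K + r) := Int.toNat_of_nonneg (by linarith)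
    refine eq_rep ?_ ?_
    · refine (Nat.div_le_self _ _).trans_lt ?_
      have : ((v + 2 ^ (K + r)).toNat : ℤ) < 2 ^ w := by rw [h3]; linarith
      exact_mod_cast this
    · push_cast
      rw [h3, pow_add, Int.add_mul_ediv_left _ _ (by positivity)]
  have h6 : rep w (2 ^ r) = 2 ^ r := by
    have := rep_natCast hr; push_cast at this; exact this
  rw [e1, e2]
  rw [← h6, rep_sub, add_sub_cancel_right]

/-- Comparison of a signed integer with a natural number, through the offset `b`. -/
theorem rep_offset {w b : ℕ} {v : ℤ} (h₁ : -b ≤ v) (h₂ : v < b) (hw : 2 * b ≤ 2 ^ w) :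
    (((rep w v + b) % 2 ^ w : ℕ) : ℤ) = v + b := by
  have hp : (2 * b : ℤ) ≤ 2 ^ w := by exact_mod_cast hw
  push_cast
  rw [rep_cast, Int.emod_add_emod, Int.emod_eq_of_lt (by linarith) (by linarith)]

end WordRAM

/-! ### The discrete Fourier transform -/

namespace WordRAM

open Finset

/-- The partial transform of length `N` before the stages with stride less than `H`. -/
noncomputable def partialDFT (N H : ℕ) (ω : ℂ) (v : ℕ → ℂ) (q : ℕ) : ℂ :=
  ∑ r ∈ range (N / H), v (q % H + r * H) * ω ^ ((q - q % H) * r)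

theorem partialDFT_self {N : ℕ} {ω : ℂ} {v : ℕ → ℂ} {q : ℕ} (hq : q < N) :
    partialDFT N N ω v q = v q := by
  rw [partialDFT, Nat.div_self (by omega), Nat.mod_eq_of_lt hq]
  simp

theorem partialDFT_one {N : ℕ} {ω : ℂ} {v : ℕ → ℂ} {q : ℕ} :
    partialDFT N 1 ω v q = ∑ r ∈ range N, v r * ω ^ (q * r) := by
  simp [partialDFT, Nat.mod_one]

/-- Write `q = a + H * b` with `a < H`. The operands of the butterfly for `q` are `p = a + 2 * H *
b`, reduced modulo the length, and `p + H`; both are in range because `p` lies in the lower half of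
its block of length `2 * H`. -/
theorem stage_index {H m q : ℕ} (hH : 0 < H) (hq : q < 2 * H * m) :
    (q + (q - q % H)) % (2 * H * m) % (2 * H) = q % H ∧
    (q + (q - q % H)) % (2 * H * m) + H < 2 * H * m ∧
    ((q + (q - q % H)) % (2 * H * m) + H) % (2 * H) = q % H + H ∧
    ∃ c, q + (q - q % H) = (q + (q - q % H)) % (2 * H * m) + c * (2 * H * m) := by
  have ha : q % H < H := Nat.mod_lt _ hH
  have hd := Nat.div_add_mod q H
  set a := q % H with ea
  set b := q / H
  have e1 : q + (q - a) = a + 2 * H * b := by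
    have : q - a = H * b := by omega
    rw [this, ← hd]; ring
  have h1 : (q + (q - a)) % (2 * H * m) % (2 * H) = a := by
    rw [Nat.mod_mul_right_mod, e1, Nat.add_mul_mod_self_left, Nat.mod_eq_of_lt (by omega)]
  set p := (q + (q - a)) % (2 * H * m) with hp
  have hpl : p < 2 * H * m := Nat.mod_lt _ (by omega)
  have hpd := Nat.div_add_mod p (2 * H)
  rw [h1] at hpd
  have hb : p / (2 * H) < m := by
    rw [Nat.div_lt_iff_lt_mul (by omega)]; linarith [Nat.mul_comm m (2 * H)]
  refine ⟨h1, ?_, ?_, ?_⟩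
  · have : 2 * H * (p / (2 * H) + 1) ≤ 2 * H * m := Nat.mul_le_mul_left _ hb
    rw [Nat.mul_add] at this
    omega
  · rw [← hpd, Nat.add_assoc, Nat.mul_add_mod, Nat.mod_eq_of_lt (by omega)]
  · exact ⟨(q + (q - a)) / (2 * H * m), by
      have := Nat.div_add_mod (q + (q - a)) (2 * H * m)
      rw [← hp] at this; linarith [Nat.mul_comm (2 * H * m) ((q + (q - a)) / (2 * H * m))]⟩

/-- The sum over `r` is split by parity. The exponent of an even term is `(q - a) * 2 * r`, which
agrees with `(p - a) * r` modulo `N` because `2 * (q - a)` and `p - a` do; an odd term carries the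
additional factor `ω ^ (q - a)`. With this indexing the output comes in natural order and no bit
reversal is needed. -/
theorem partialDFT_stage {N H m : ℕ} {ω : ℂ} (v : ℕ → ℂ) {q : ℕ} (hH : 0 < H)
    (hN : N = 2 * H * m) (hω : ω ^ N = 1) (hq : q < N) :
    partialDFT N H ω v q = partialDFT N (2 * H) ω v ((q + (q - q % H)) % N) +
      ω ^ (q - q % H) * partialDFT N (2 * H) ω v ((q + (q - q % H)) % N + H) := by
  obtain ⟨h1, h2, h3, c, h4⟩ := stage_index hH (hN ▸ hq)
  rw [← hN] at h1 h2 h3 h4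
  have hm : N / (2 * H) = m := by rw [hN]; exact Nat.mul_div_cancel_left _ (by omega)
  have hm2 : N / H = 2 * m := by
    rw [hN, show 2 * H * m = H * (2 * m) by ring]; exact Nat.mul_div_cancel_left _ hH
  have ha : q % H < H := Nat.mod_lt _ hH
  have haq : q % H ≤ q := Nat.mod_le _ _
  unfold partialDFT
  rw [h1, h3, hm, hm2]
  set p := (q + (q - q % H)) % N with hp
  set a := q % H with hea
  have hpow : ∀ r, ω ^ ((p - a) * r) = ω ^ ((q - a) * (2 * r)) := by
    intro r
    have hap : a ≤ p := by rw [← h1]; exact Nat.mod_le _ _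
    have : (q - a) * (2 * r) = (p - a) * r + N * (c * r) := by
      have h5 : 2 * (q - a) = (p - a) + c * N := by omega
      calc (q - a) * (2 * r) = 2 * (q - a) * r := by ring
        _ = _ := by rw [h5]; ring
    rw [this, pow_add, pow_mul ω N, hω, one_pow, mul_one]
  rw [show p + H - (a + H) = p - a by omega, mul_sum]
  have split : ∀ f : ℕ → ℂ, ∑ r ∈ range (2 * m), f r =
      ∑ r ∈ range m, f (2 * r) + ∑ r ∈ range m, f (2 * r + 1) := by
    intro f
    induction m with
    | zero => simp
    | succ m ih =>
      clear hN hm hm2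
      induction m + 1 with
      | zero => simp
      | succ n ihn => rw [show 2 * (n + 1) = 2 * n + 1 + 1 by ring, sum_range_succ, sum_range_succ,
          ihn, sum_range_succ, sum_range_succ]; ring
  rw [split]
  refine congrArg₂ _ (sum_congr rfl fun r _ => ?_) (sum_congr rfl fun r _ => ?_)
  · rw [hpow]; congr 2; ring
  · rw [hpow, show a + (2 * r + 1) * H = a + H + r * (2 * H) by ring,
      show (q - a) * (2 * r + 1) = (q - a) * (2 * r) + (q - a) by ring, pow_add]
    ring

/-- The bound is the same at every stage. It controls the error recursion and also shows that
intermediate values fit in a word. -/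
theorem partialDFT_norm_le {N H : ℕ} {ω : ℂ} {v : ℕ → ℂ} {M : ℝ} (hω : ‖ω‖ = 1) (hH : 0 < H)
    (hN : H ∣ N) (hM : ∀ i < N, ‖v i‖ ≤ M) (hM0 : 0 ≤ M) (q : ℕ) :
    ‖partialDFT N H ω v q‖ ≤ N * M := by
  refine (norm_sum_le _ _).trans ((sum_le_card_nsmul _ _ M fun r hr => ?_).trans ?_)
  · rw [norm_mul, norm_pow, hω, one_pow, mul_one]
    refine hM _ ?_
    have h1 : q % H < H := Nat.mod_lt _ hH
    have h2 : (r + 1) * H ≤ N / H * H := Nat.mul_le_mul_right _ (mem_range.mp hr)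
    rw [Nat.div_mul_cancel hN] at h2
    linarith [add_mul r 1 H]
  · rw [card_range, nsmul_eq_mul]
    gcongr
    exact Nat.div_le_self _ _

/-- The transform of a pointwise product of transforms counts the solutions of
`a + b + l ≡ 0 (mod N)`. -/
theorem dft_mul_dft {N : ℕ} {ω : ℂ} (hω : IsPrimitiveRoot ω N) (x y : ℕ → ℂ) (l : ℕ) :
    ∑ r ∈ range N, ((∑ a ∈ range N, x a * ω ^ (r * a)) * ∑ b ∈ range N, y b * ω ^ (r * b)) *
      ω ^ (l * r) = N * ∑ a ∈ range N, ∑ b ∈ range N,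
        if N ∣ a + b + l then x a * y b else 0 := by
  -- Orthogonality of characters. A second forward transform takes the place of the inverse, which
  -- is why the condition is `a + b + l ≡ 0` and a factor `N` remains.
  have geom : ∀ m : ℕ, ∑ r ∈ range N, (ω ^ m) ^ r = if N ∣ m then (N : ℂ) else 0 := by
    intro m
    split_ifs with h
    · rw [(hω.pow_eq_one_iff_dvd m).mpr h]; simp
    · have h1 : ω ^ m ≠ 1 := fun e => h ((hω.pow_eq_one_iff_dvd m).mp e)
      have h2 := mul_neg_geom_sum (ω ^ m) N
      rw [← pow_mul, mul_comm m N, pow_mul, hω.pow_eq_one, one_pow, sub_self] at h2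
      exact (mul_eq_zero.mp h2).resolve_left (sub_ne_zero.mpr h1.symm)
  calc _ = ∑ r ∈ range N, ∑ a ∈ range N, ∑ b ∈ range N,
        x a * y b * (ω ^ (a + b + l)) ^ r := by
        refine sum_congr rfl fun r _ => ?_
        rw [sum_mul_sum, sum_mul]
        refine sum_congr rfl fun a _ => ?_
        rw [sum_mul]
        refine sum_congr rfl fun b _ => ?_
        rw [← pow_mul, show (a + b + l) * r = r * a + r * b + l * r by ring, pow_add, pow_add]
        ring
    _ = ∑ a ∈ range N, ∑ b ∈ range N, ∑ r ∈ range N, x a * y b * (ω ^ (a + b + l)) ^ r := by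
        rw [sum_comm]
        exact sum_congr rfl fun a _ => sum_comm
    _ = _ := by
        rw [mul_sum]
        refine sum_congr rfl fun a _ => ?_
        rw [mul_sum]
        refine sum_congr rfl fun b _ => ?_
        rw [← mul_sum, geom]
        split_ifs <;> ring

end WordRAM

/-! ### Fixed-point arithmetic for the transform -/

namespace WordRAM

open Finset

/-- The complex number with the given integer parts. -/
def mkC (a b : ℤ) : ℂ := ⟨a, b⟩

/-- The `q`-th complex entry of an array that stores real and imaginary parts alternately. -/
def toC (x : ℕ → ℤ) (q : ℕ) : ℂ := mkC (x (2 * q)) (x (2 * q + 1))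

/-- The real part of a fixed-point product. -/
def mulRe (K : ℕ) (a b c d : ℤ) : ℤ := (a * c - b * d) / 2 ^ K

/-- The imaginary part of a fixed-point product. -/
def mulIm (K : ℕ) (a b c d : ℤ) : ℤ := (a * d + b * c) / 2 ^ K

theorem floor_err (K : ℕ) (v : ℤ) : |((v / 2 ^ K : ℤ) : ℝ) - v / 2 ^ K| ≤ 1 := by
  have hp : (0 : ℝ) < 2 ^ K := by positivity
  have h1 := Int.emod_add_mul_ediv v (2 ^ K)
  have h2 := Int.emod_nonneg v (show (2 : ℤ) ^ K ≠ 0 by positivity)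
  have h3 := Int.emod_lt_of_pos v (show (0 : ℤ) < 2 ^ K by positivity)
  have h1' : ((v % 2 ^ K : ℤ) : ℝ) + 2 ^ K * ((v / 2 ^ K : ℤ) : ℝ) = v := by exact_mod_cast h1
  have h2' : (0 : ℝ) ≤ ((v % 2 ^ K : ℤ) : ℝ) := by exact_mod_cast h2
  have h3' : ((v % 2 ^ K : ℤ) : ℝ) < 2 ^ K := by exact_mod_cast h3
  have h4 : ((v / 2 ^ K : ℤ) : ℝ) - v / 2 ^ K = - (((v % 2 ^ K : ℤ) : ℝ) / 2 ^ K) := by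
    rw [← h1']; field_simp; ring
  rw [h4, abs_neg, abs_of_nonneg (by positivity)]
  exact (div_le_one hp).mpr h3'.le

theorem mul_floor_err (K : ℕ) (a b c d : ℤ) :
    ‖mkC (mulRe K a b c d) (mulIm K a b c d) - mkC a b * mkC c d / 2 ^ K‖ ≤ 2 := by
  have e : (mkC a b * mkC c d / 2 ^ K : ℂ) =
      ⟨((a * c - b * d : ℤ) : ℝ) / 2 ^ K, ((a * d + b * c : ℤ) : ℝ) / 2 ^ K⟩ := by
    rw [show (2 : ℂ) ^ K = ((2 ^ K : ℝ) : ℂ) by push_cast; rfl]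
    apply Complex.ext
    · rw [Complex.div_ofReal_re]; simp [mkC, Complex.mul_re]
    · rw [Complex.div_ofReal_im]; simp [mkC, Complex.mul_im]
  rw [e]
  refine (Complex.norm_le_abs_re_add_abs_im _).trans ?_
  have h1 := floor_err K (a * c - b * d)
  have h2 := floor_err K (a * d + b * c)
  simp only [mkC, Complex.sub_re, Complex.sub_im, mulRe, mulIm]
  linarith

/-- Expand `A * B` around `(S * a) * (S * b)` and divide by the scale `S`: two terms are linear in
the errors, one is quadratic. -/
theorem mul_err {S : ℝ} (hS : 0 < S) {A B a b : ℂ} {Ea Eb : ℝ} (hA : ‖A - S * a‖ ≤ Ea)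
    (hB : ‖B - S * b‖ ≤ Eb) : ‖A * B / S - S * (a * b)‖ ≤ Ea * ‖b‖ + ‖a‖ * Eb + Ea * Eb / S := by
  have hS' : (S : ℂ) ≠ 0 := by exact_mod_cast hS.ne'
  have e : A * B / S - S * (a * b) =
      (A - S * a) * b + a * (B - S * b) + (A - S * a) * (B - S * b) / S := by
    field_simp; ring
  rw [e]
  refine (norm_add_le _ _).trans (add_le_add ((norm_add_le _ _).trans (add_le_add ?_ ?_)) ?_)
  · rw [norm_mul]; gcongr
  · rw [norm_mul]; gcongr
  · rw [norm_div, norm_mul, Complex.norm_real, Real.norm_of_nonneg hS.le]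
    gcongr
    exact (norm_nonneg _).trans hA

/-- The fixed-point product of approximations is an approximation of the product. -/
theorem mulZ_err {K : ℕ} {a b c d : ℤ} {α β : ℂ} {Ea Eb : ℝ}
    (hA : ‖mkC a b - 2 ^ K * α‖ ≤ Ea) (hB : ‖mkC c d - 2 ^ K * β‖ ≤ Eb) :
    ‖mkC (mulRe K a b c d) (mulIm K a b c d) - 2 ^ K * (α * β)‖ ≤
      Ea * ‖β‖ + ‖α‖ * Eb + Ea * Eb / 2 ^ K + 2 := by
  have h := mul_err (S := 2 ^ K) (by positivity) (a := α) (b := β) (A := mkC a b) (B := mkC c d)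
    (Ea := Ea) (Eb := Eb) (by push_cast; exact hA) (by push_cast; exact hB)
  have h2 := mul_floor_err K a b c d
  push_cast at h
  have := norm_add_le (mkC (mulRe K a b c d) (mulIm K a b c d) - mkC a b * mkC c d / 2 ^ K)
    (mkC a b * mkC c d / 2 ^ K - 2 ^ K * (α * β))
  rw [sub_add_sub_cancel] at this
  linarith

/-- Both integers are coordinates of a complex product, hence bounded by its norm. This bounds the
numerator before the shift. -/
theorem mul_range {a b c d : ℤ} {A B : ℝ} (hA : ‖mkC a b‖ ≤ A) (hB : ‖mkC c d‖ ≤ B) :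
    |((a * c - b * d : ℤ) : ℝ)| ≤ A * B ∧ |((a * d + b * c : ℤ) : ℝ)| ≤ A * B := by
  have h : ‖mkC a b * mkC c d‖ ≤ A * B := by
    rw [norm_mul]
    exact mul_le_mul hA hB (norm_nonneg _) ((norm_nonneg _).trans hA)
  constructor
  · refine (le_of_eq ?_).trans ((Complex.abs_re_le_norm _).trans h)
    simp [mkC, Complex.mul_re]
  · refine (le_of_eq ?_).trans ((Complex.abs_im_le_norm _).trans h)
    simp [mkC, Complex.mul_im]

/-- Fixed-point approximations of `cos (π / 2 ^ (j + 1))`. -/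
def cosZ (K : ℕ) : ℕ → ℕ
  | 0 => 0
  | j + 1 => Nat.sqrt ((2 ^ K + cosZ K j) * 2 ^ (K - 1))

/-- The fixed-point approximation of `sin (π / 2 ^ (j + 1))`. -/
def sinZ (K j : ℕ) : ℕ := Nat.sqrt (2 ^ K * 2 ^ K - cosZ K j * cosZ K j)

theorem angle_bounds (j : ℕ) : 0 < Real.pi / 2 ^ (j + 1) ∧ Real.pi / 2 ^ (j + 1) ≤ Real.pi / 2 := by
  refine ⟨by positivity, ?_⟩
  gcongr
  exact le_self_pow₀ (by norm_num) (by omega)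

/-- Errors do not accumulate. The value is always rounded down, and the half-angle map turns an
error of two units into about `1 / (2 * c')` units, less than one since `c' ≥ 7 / 10`; rounding adds
at most one. -/
theorem cosZ_err {K : ℕ} (hK : 2 ≤ K) (j : ℕ) :
    (cosZ K j : ℝ) ≤ 2 ^ K * Real.cos (Real.pi / 2 ^ (j + 1)) ∧
      2 ^ K * Real.cos (Real.pi / 2 ^ (j + 1)) - 2 ≤ cosZ K j := by
  have hK4 : (4 : ℝ) ≤ 2 ^ K := by
    calc (4 : ℝ) = 2 ^ 2 := by norm_num
      _ ≤ _ := pow_le_pow_right₀ (by norm_num) hK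
  induction j with
  | zero => simp [cosZ]
  | succ j ih =>
    obtain ⟨h0, h1⟩ := angle_bounds j
    obtain ⟨h2, h3⟩ := angle_bounds (j + 1)
    have hsq := Real.cos_sq (Real.pi / 2 ^ (j + 1 + 1))
    rw [show 2 * (Real.pi / 2 ^ (j + 1 + 1)) = Real.pi / 2 ^ (j + 1) by
      rw [pow_succ 2 (j + 1)]; field_simp] at hsq
    set c := Real.cos (Real.pi / 2 ^ (j + 1))
    set c' := Real.cos (Real.pi / 2 ^ (j + 1 + 1)) with hc'
    have hc0 : 0 ≤ c := Real.cos_nonneg_of_mem_Icc ⟨by linarith [Real.pi_pos], h1⟩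
    have hc0' : 0 ≤ c' := Real.cos_nonneg_of_mem_Icc ⟨by linarith [Real.pi_pos], h3⟩
    -- The half-angle formula gives `c' ^ 2 ≥ 1 / 2 > 49 / 100`.
    have hc7 : 7 / 10 ≤ c' := by nlinarith
    set m := (2 ^ K + cosZ K j) * 2 ^ (K - 1) with hm
    set n := cosZ K (j + 1) with hn
    have hn1 : n * n ≤ m := Nat.sqrt_le m
    have hn2 : m < (n + 1) * (n + 1) := Nat.lt_succ_sqrt m
    have hpow : (2 : ℝ) ^ (K - 1) * 2 = 2 ^ K := by rw [← pow_succ]; congr 1; omega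
    have hm' : (m : ℝ) * 2 = (2 ^ K + cosZ K j) * 2 ^ K := by
      rw [hm]; push_cast; rw [← hpow]; ring
    have hn1' : (n : ℝ) * n ≤ m := by exact_mod_cast hn1
    have hn2' : (m : ℝ) < (n + 1) * (n + 1) := by exact_mod_cast hn2
    obtain ⟨i1, i2⟩ := ih
    have hn0 : (0 : ℝ) ≤ n := by positivity
    set S : ℝ := 2 ^ K
    have hS0 : 0 ≤ S := by positivity
    have hsq' : 2 * (S * c') ^ 2 = S * S + S * c * S := by
      rw [mul_pow, hsq]; ring
    have i1' := mul_le_mul_of_nonneg_right i1 hS0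
    have i2' := mul_le_mul_of_nonneg_right i2 hS0
    have hc7' := mul_le_mul_of_nonneg_left hc7 hS0
    constructor
    · have : (n : ℝ) ^ 2 ≤ (S * c') ^ 2 := by nlinarith
      exact le_of_sq_le_sq this (by positivity)
    · have h5 : (S * c' - 1) ^ 2 < (n + 1 : ℝ) ^ 2 := by nlinarith
      have := lt_of_pow_lt_pow_left₀ 2 (by positivity) h5
      linarith

/-- The square root of `1 - cos²` loses half of the digits when the sine is small: an error of two
units in the cosine changes the squared sine by about `4 * 2 ^ (2 * h)`, so the root by at most `2 *
2 ^ h`. This is why the number of fractional bits is written as `2 * h`. -/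
theorem sinZ_err {h j : ℕ} (hh : 2 ≤ h) :
    2 ^ (2 * h) * Real.sin (Real.pi / 2 ^ (j + 1)) - 1 ≤ sinZ (2 * h) j ∧
      (sinZ (2 * h) j : ℝ) ≤ 2 ^ (2 * h) * Real.sin (Real.pi / 2 ^ (j + 1)) + 2 ^ (h + 1) := by
  obtain ⟨i1, i2⟩ := cosZ_err (K := 2 * h) (by omega) j
  obtain ⟨h0, h1⟩ := angle_bounds j
  have hsq := Real.sin_sq_add_cos_sq (Real.pi / 2 ^ (j + 1))
  have hs0 : 0 ≤ Real.sin (Real.pi / 2 ^ (j + 1)) :=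
    Real.sin_nonneg_of_nonneg_of_le_pi h0.le (by linarith [Real.pi_pos])
  have hc0 : 0 ≤ Real.cos (Real.pi / 2 ^ (j + 1)) :=
    Real.cos_nonneg_of_mem_Icc ⟨by linarith [Real.pi_pos], h1⟩
  set c := Real.cos (Real.pi / 2 ^ (j + 1))
  set s := Real.sin (Real.pi / 2 ^ (j + 1))
  have hc1 : c ≤ 1 := Real.cos_le_one _
  set C := cosZ (2 * h) j with hC
  have hn1 : sinZ (2 * h) j * sinZ (2 * h) j ≤ _ := Nat.sqrt_le _
  have hn2 : _ < (sinZ (2 * h) j + 1) * (sinZ (2 * h) j + 1) := Nat.lt_succ_sqrt _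
  rw [← hC] at hn1 hn2
  have hS : (2 : ℝ) ^ (2 * h) = 2 ^ h * 2 ^ h := by rw [two_mul, pow_add]
  have hCle : C * C ≤ 2 ^ (2 * h) * 2 ^ (2 * h) := by
    have : (C : ℝ) ≤ 2 ^ (2 * h) := i1.trans (by
      have : (0 : ℝ) < 2 ^ (2 * h) := by positivity
      nlinarith)
    have : C ≤ 2 ^ (2 * h) := by exact_mod_cast this
    exact Nat.mul_le_mul this this
  set n := sinZ (2 * h) j
  have hn1' : (n : ℝ) * n + C * C ≤ 2 ^ (2 * h) * 2 ^ (2 * h) := by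
    have : n * n + C * C ≤ 2 ^ (2 * h) * 2 ^ (2 * h) := by omega
    exact_mod_cast this
  have hn2' : (2 ^ (2 * h) * 2 ^ (2 * h) : ℝ) < (n + 1) * (n + 1) + C * C := by
    have : 2 ^ (2 * h) * 2 ^ (2 * h) < (n + 1) * (n + 1) + C * C := by omega
    exact_mod_cast this
  have hn0 : (0 : ℝ) ≤ n := by positivity
  have hC0 : (0 : ℝ) ≤ C := by positivity
  set S : ℝ := 2 ^ (2 * h)
  have hS0 : 0 < S := by positivity
  constructor
  · have h5 : (S * s) ^ 2 < (n + 1 : ℝ) ^ 2 := by nlinarith [mul_nonneg hS0.le hc0]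
    linarith [lt_of_pow_lt_pow_left₀ 2 (by positivity) h5]
  · have hC2 : (S * c) ^ 2 ≤ (C + 2 : ℝ) ^ 2 := by
      apply pow_le_pow_left₀ (by positivity); linarith
    have hCS : (C : ℝ) ≤ S := by nlinarith
    have hS4 : (16 : ℝ) ≤ S := by
      calc (16 : ℝ) = 2 ^ 4 := by norm_num
        _ ≤ _ := pow_le_pow_right₀ (by norm_num) (by omega)
    have hp : (2 : ℝ) ^ (h + 1) = 2 * 2 ^ h := by rw [pow_succ]; ring
    rw [hp]
    -- The inequality needs `C + 1 ≤ S`. It can only fail for `C = S`, and then the computed sine is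
    -- zero.
    have hC3 : (C + 2 : ℝ) ^ 2 ≤ C * C + 4 * (2 ^ h * 2 ^ h) ∨ (n : ℝ) = 0 := by
      by_cases hn : n = 0
      · right; exact_mod_cast hn
      · left
        have : (1 : ℝ) ≤ n := by exact_mod_cast Nat.one_le_iff_ne_zero.mpr hn
        have hCS1 : (C : ℝ) + 1 ≤ S := by
          have h6 : C < 2 ^ (2 * h) := by
            by_contra hge
            have : 2 ^ (2 * h) * 2 ^ (2 * h) ≤ C * C := by
              exact Nat.mul_le_mul (not_lt.mp hge) (not_lt.mp hge)
            have : 0 < n * n := by positivity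
            have h7 : n * n + C * C ≤ 2 ^ (2 * h) * 2 ^ (2 * h) := by omega
            omega
          have h7 : C + 1 ≤ 2 ^ (2 * h) := h6
          show (C : ℝ) + 1 ≤ 2 ^ (2 * h)
          exact_mod_cast h7
        rw [← hS]; nlinarith
    rcases hC3 with hC3 | hn
    · have h5 : (n : ℝ) ^ 2 ≤ (S * s + 2 * 2 ^ h) ^ 2 := by
        have : 0 ≤ S * s * 2 ^ h := by positivity
        nlinarith
      exact le_of_sq_le_sq h5 (by positivity)
    · rw [hn]; positivity

end WordRAM

/-! ### Error analysis: powers of the root of unity and transform stages. -/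

namespace WordRAM

open Finset

/-- The fixed-point table of the powers of a root of unity. -/
def rootZ (K : ℕ) (C S : ℤ) : ℕ → ℤ × ℤ
  | 0 => (2 ^ K, 0)
  | 1 => (C, S)
  | j + 2 =>
    let a := rootZ K C S ((j + 2) / 2)
    let b := rootZ K C S (j + 2 - (j + 2) / 2)
    (mulRe K a.1 a.2 b.1 b.2, mulIm K a.1 a.2 b.1 b.2)
termination_by j => j
decreasing_by all_goals omega

theorem rootZ_rec (K : ℕ) (C S : ℤ) {j : ℕ} (hj : 2 ≤ j) : rootZ K C S j =
    (mulRe K (rootZ K C S (j / 2)).1 (rootZ K C S (j / 2)).2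
      (rootZ K C S (j - j / 2)).1 (rootZ K C S (j - j / 2)).2,
     mulIm K (rootZ K C S (j / 2)).1 (rootZ K C S (j / 2)).2
      (rootZ K C S (j - j / 2)).1 (rootZ K C S (j - j / 2)).2) := by
  obtain ⟨j, rfl⟩ := Nat.exists_eq_add_of_le' hj
  rw [rootZ]

/-- The interleaved table of the powers of a root of unity. -/
def tableZ (K : ℕ) (C S : ℤ) (i : ℕ) : ℤ :=
  if i % 2 = 0 then (rootZ K C S (i / 2)).1 else (rootZ K C S (i / 2)).2

theorem interleave_even {α : Type*} (f g : ℕ → α) (q : ℕ) :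
    (if 2 * q % 2 = 0 then f (2 * q / 2) else g (2 * q / 2)) = f q := by
  rw [if_pos (by omega), Nat.mul_div_cancel_left _ two_pos]

theorem interleave_odd {α : Type*} (f g : ℕ → α) (q : ℕ) :
    (if (2 * q + 1) % 2 = 0 then f ((2 * q + 1) / 2) else g ((2 * q + 1) / 2)) = g q := by
  rw [if_neg (by omega), show (2 * q + 1) / 2 = q by omega]

theorem toC_interleave (f g : ℕ → ℤ) (q : ℕ) :
    toC (fun i => if i % 2 = 0 then f (i / 2) else g (i / 2)) q = mkC (f q) (g q) := by
  rw [toC, interleave_even f g, interleave_odd f g]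

theorem toC_tableZ (K : ℕ) (C S : ℤ) (q : ℕ) :
    toC (tableZ K C S) q = mkC (rootZ K C S q).1 (rootZ K C S q).2 :=
  toC_interleave (fun q => (rootZ K C S q).1) (fun q => (rootZ K C S q).2) q

/-- The power `j` is the product of the powers `j / 2` and `j - j / 2`. The linear errors add up,
and the surplus `80 * a * b` that `40 * j ^ 2` gains for `j = a + b` pays for the product of the
errors, at most `70 * a * b`, and for the rounding. So the error stays nearly linear in `j`. -/
theorem rootZ_err {h : ℕ} {C S : ℤ} {ω : ℂ} (hω : ‖ω‖ = 1)
    (h1 : ‖mkC C S - 2 ^ (2 * h) * ω‖ ≤ 2 ^ (h + 2)) {j : ℕ} (hj : 40 * (j + 1) * 32 ≤ 2 ^ h) :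
    ‖mkC (rootZ (2 * h) C S j).1 (rootZ (2 * h) C S j).2 - 2 ^ (2 * h) * ω ^ j‖ ≤
      j * (8 * 2 ^ h + 40 * j) := by
  induction j using Nat.strong_induction_on with
  | _ j ih =>
    rcases Nat.lt_or_ge j 2 with hj2 | hj2
    · interval_cases j
      · have : mkC (2 ^ (2 * h)) 0 = 2 ^ (2 * h) := by
          rw [mkC]; push_cast
          apply Complex.ext
          · rw [show (2 : ℂ) ^ (2 * h) = ((2 ^ (2 * h) : ℝ) : ℂ) by push_cast; rfl,
              Complex.ofReal_re]
          · rw [show (2 : ℂ) ^ (2 * h) = ((2 ^ (2 * h) : ℝ) : ℂ) by push_cast; rfl,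
              Complex.ofReal_im]
        simp [rootZ, this]
      · simp only [rootZ, pow_one]
        refine h1.trans ?_
        rw [pow_add]
        have : (0 : ℝ) < 2 ^ h := by positivity
        push_cast; linarith
    · rw [rootZ_rec _ _ _ hj2]
      set a := j / 2 with ha
      set b := j - j / 2 with hb
      have hab : a + b = j := by omega
      have ia := ih a (by omega) (by omega)
      have ib := ih b (by omega) (by omega)
      have := mulZ_err (K := 2 * h) ia ib
      rw [← pow_add, hab] at this
      refine this.trans ?_
      rw [norm_pow, norm_pow, hω, one_pow, one_pow, mul_one, one_mul]
      have hS : (2 : ℝ) ^ (2 * h) = 2 ^ h * 2 ^ h := by rw [two_mul, pow_add]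
      have hj' : (40 * (j + 1) * 32 : ℝ) ≤ 2 ^ h := by exact_mod_cast hj
      have haj : (a : ℝ) ≤ j := by exact_mod_cast (by omega : a ≤ j)
      have hbj : (b : ℝ) ≤ j := by exact_mod_cast (by omega : b ≤ j)
      have hjab : (j : ℝ) = a + b := by exact_mod_cast hab.symm
      have ha1 : (1 : ℝ) ≤ a := by exact_mod_cast (by omega : 1 ≤ a)
      have hb1 : (1 : ℝ) ≤ b := by exact_mod_cast (by omega : 1 ≤ b)
      have hT : (0 : ℝ) < 2 ^ h := by positivity
      rw [hS]
      set T : ℝ := 2 ^ h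
      have e1 : (a : ℝ) * (8 * T + 40 * a) * (b * (8 * T + 40 * b)) / (T * T) ≤ 70 * (a * b) := by
        rw [div_le_iff₀ (by positivity)]
        have u1 : 8 * T + 40 * (a : ℝ) ≤ (8 + 1 / 32) * T := by linarith
        have u2 : 8 * T + 40 * (b : ℝ) ≤ (8 + 1 / 32) * T := by linarith
        have u3 := mul_le_mul u1 u2 (by positivity) (by positivity)
        have u4 := mul_le_mul_of_nonneg_left u3 (show (0 : ℝ) ≤ a * b by positivity)
        have u5 : 0 ≤ (a : ℝ) * b * (T * T) := by positivity
        nlinarith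
      have e2 : (1 : ℝ) ≤ a * b := by nlinarith
      rw [hjab]
      nlinarith

/-- One stage of the fixed-point transform on interleaved arrays. -/
def stageZ (K N H : ℕ) (W x : ℕ → ℤ) (i : ℕ) : ℤ :=
  if i % 2 = 0 then
    (fun _ e p => x (2 * p) +
      mulRe K (W (2 * e)) (W (2 * e + 1)) (x (2 * (p + H))) (x (2 * (p + H) + 1)))
      (i / 2) (i / 2 - i / 2 % H) ((i / 2 + (i / 2 - i / 2 % H)) % N)
  else
    (fun _ e p => x (2 * p + 1) +
      mulIm K (W (2 * e)) (W (2 * e + 1)) (x (2 * (p + H))) (x (2 * (p + H) + 1)))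
      (i / 2) (i / 2 - i / 2 % H) ((i / 2 + (i / 2 - i / 2 % H)) % N)

theorem toC_stageZ (K N H : ℕ) (W x : ℕ → ℤ) (q : ℕ) :
    toC (stageZ K N H W x) q = toC x ((q + (q - q % H)) % N) +
      (fun e p => mkC (mulRe K (W (2 * e)) (W (2 * e + 1)) (x (2 * p)) (x (2 * p + 1)))
        (mulIm K (W (2 * e)) (W (2 * e + 1)) (x (2 * p)) (x (2 * p + 1))))
        (q - q % H) ((q + (q - q % H)) % N + H) := by
  rw [toC, stageZ, stageZ, if_pos (by omega), if_neg (by omega),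
    Nat.mul_div_cancel_left _ two_pos, show (2 * q + 1) / 2 = q by omega]
  apply Complex.ext <;> simp [toC, mkC]

/-- One `E` comes from each operand, a third from the product of the errors since `eW ≤ 2 ^ K`; `eW
* M` comes from the table and `2` from rounding. -/
theorem stageZ_err {K N H m : ℕ} {W x : ℕ → ℤ} {ω : ℂ} {Y : ℕ → ℂ} {E eW M : ℝ} (hω : ‖ω‖ = 1)
    (hH : 0 < H) (hN : N = 2 * H * m) (hW : ∀ e < N, ‖toC W e - 2 ^ K * ω ^ e‖ ≤ eW)
    (heW : eW ≤ 2 ^ K) (hx : ∀ q < N, ‖toC x q - 2 ^ K * Y q‖ ≤ E) (hY : ∀ q, ‖Y q‖ ≤ M)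
    {q : ℕ} (hq : q < N) :
    ‖toC (stageZ K N H W x) q - 2 ^ K * (Y ((q + (q - q % H)) % N) +
      ω ^ (q - q % H) * Y ((q + (q - q % H)) % N + H))‖ ≤ 3 * E + eW * M + 2 := by
  obtain ⟨h1, h2, h3, -⟩ := stage_index hH (hN ▸ hq)
  rw [← hN] at h1 h2 h3
  rw [toC_stageZ]
  set e := q - q % H
  set p := (q + e) % N
  have hE : 0 ≤ E := (norm_nonneg _).trans (hx q hq)
  have heW0 : 0 ≤ eW := (norm_nonneg _).trans (hW q hq)
  have a1 := hx p (by omega)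
  have a2 := mulZ_err (hW e (by omega)) (hx (p + H) h2)
  rw [norm_pow, hω, one_pow, one_mul] at a2
  have a3 : eW * E / 2 ^ K ≤ E := by
    rw [div_le_iff₀ (by positivity), mul_comm]
    exact mul_le_mul_of_nonneg_left heW hE
  have a4 : eW * ‖Y (p + H)‖ ≤ eW * M := mul_le_mul_of_nonneg_left (hY _) heW0
  refine (le_of_eq ?_).trans ((norm_add_le _ _).trans ((add_le_add a1 a2).trans ?_))
  · congr 1; ring
  · linarith

/-- The fixed-point transform of length `2 ^ k` after `s` stages. -/
def fftZ (K k : ℕ) (W x : ℕ → ℤ) : ℕ → ℕ → ℤ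
  | 0 => x
  | s + 1 => stageZ K (2 ^ k) (2 ^ (k - 1 - s)) W (fftZ K k W x s)

/-- The recursion `E ↦ 3 * E + c` is majorised by powers of four, the extra unit absorbing the
constant `c`. After all `k` stages the factor is `4 ^ k`, the square of the length. -/
theorem fftZ_err {K k : ℕ} {W x : ℕ → ℤ} {ω : ℂ} {v : ℕ → ℂ} {E eW M : ℝ} (hω : ‖ω‖ = 1)
    (hω1 : ω ^ 2 ^ k = 1) (hW : ∀ e < 2 ^ k, ‖toC W e - 2 ^ K * ω ^ e‖ ≤ eW) (heW : eW ≤ 2 ^ K)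
    (hx : ∀ q < 2 ^ k, ‖toC x q - 2 ^ K * v q‖ ≤ E) (hv : ∀ q < 2 ^ k, ‖v q‖ ≤ M) {s : ℕ}
    (hs : s ≤ k) : ∀ q < 2 ^ k,
    ‖toC (fftZ K k W x s) q - 2 ^ K * partialDFT (2 ^ k) (2 ^ (k - s)) ω v q‖ ≤
      4 ^ s * (E + eW * (2 ^ k * M) + 2) := by
  have hE : 0 ≤ E := (norm_nonneg _).trans (hx 0 (by positivity))
  have hM : 0 ≤ M := (norm_nonneg _).trans (hv 0 (by positivity))
  have heW0 : 0 ≤ eW := (norm_nonneg _).trans (hW 0 (by positivity))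
  have hc : 0 ≤ eW * (2 ^ k * M) := by positivity
  induction s with
  | zero =>
    intro q hq
    rw [Nat.sub_zero, partialDFT_self hq, pow_zero, one_mul]
    exact (hx q hq).trans (by linarith)
  | succ s ih =>
    intro q hq
    have e1 : 2 ^ (k - s) = 2 * 2 ^ (k - (s + 1)) := by
      rw [← pow_succ']; congr 1; omega
    have e2 : 2 ^ k = 2 * 2 ^ (k - (s + 1)) * 2 ^ s := by
      rw [← e1, ← pow_add]; congr 1; omega
    have ih' := ih (by omega)
    rw [e1] at ih'
    have hb := partialDFT_norm_le (v := v) hω (H := 2 * 2 ^ (k - (s + 1))) (by positivity)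
      ⟨_, e2⟩ hv hM
    push_cast at hb
    have h := stageZ_err hω (by positivity) e2 hW heW ih' hb hq
    rw [partialDFT_stage v (H := 2 ^ (k - (s + 1))) (by positivity) e2 hω1 hq]
    have e3 : k - 1 - s = k - (s + 1) := by omega
    rw [fftZ, e3]
    refine h.trans ?_
    rw [pow_succ]
    have : (1 : ℝ) ≤ 4 ^ s := one_le_pow₀ (by norm_num)
    nlinarith

end WordRAM

/-! ### Choice of the precision and correctness of the fixed-point convolution. -/

namespace WordRAM

open Finset

/-- Half the number of fractional bits for transforms of length `2 ^ k`. -/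
def half (k : ℕ) : ℕ := 10 * k + 20

/-- The table of the powers of the root of unity of order `2 ^ k`. -/
def tableW (k : ℕ) : ℕ → ℤ :=
  tableZ (2 * half k) (cosZ (2 * half k) (k - 2)) (sinZ (2 * half k) (k - 2))

/-- A sequence of natural numbers as an interleaved fixed-point array. -/
def bitsZ (K : ℕ) (x : ℕ → ℕ) (i : ℕ) : ℤ := if i % 2 = 0 then 2 ^ K * x (i / 2) else 0

/-- The pointwise product of interleaved arrays. -/
def prodZ (K : ℕ) (x y : ℕ → ℤ) (i : ℕ) : ℤ :=
  if i % 2 = 0 then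
    mulRe K (x (2 * (i / 2))) (x (2 * (i / 2) + 1)) (y (2 * (i / 2))) (y (2 * (i / 2) + 1))
  else mulIm K (x (2 * (i / 2))) (x (2 * (i / 2) + 1)) (y (2 * (i / 2))) (y (2 * (i / 2) + 1))

/-- The forward transform of a sequence of natural numbers, after `s` stages. -/
def forwardZ (k : ℕ) (x : ℕ → ℕ) (s : ℕ) : ℕ → ℤ :=
  fftZ (2 * half k) k (tableW k) (bitsZ (2 * half k) x) s

/-- The second transform, after `s` stages. -/
def secondZ (k : ℕ) (x y : ℕ → ℕ) (s : ℕ) : ℕ → ℤ :=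
  fftZ (2 * half k) k (tableW k) (prodZ (2 * half k) (forwardZ k x k) (forwardZ k y k)) s

/-- The root of unity `exp (2 π i / 2 ^ k)`. -/
noncomputable def rootC (k : ℕ) : ℂ := Complex.exp (2 * Real.pi * Complex.I / (2 ^ k : ℕ))

theorem rootC_primitive (k : ℕ) : IsPrimitiveRoot (rootC k) (2 ^ k) :=
  Complex.isPrimitiveRoot_exp _ (by positivity)

theorem rootC_norm (k : ℕ) : ‖rootC k‖ = 1 :=
  (rootC_primitive k).norm'_eq_one (by positivity)

/-- The iterates of the half-angle formula start at the angle `π / 2`, so the index `k - 2` belongs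
to `2 * π / 2 ^ k`; this needs `k ≥ 2`. -/
theorem rootC_eq {k : ℕ} (hk : 2 ≤ k) : rootC k =
    ⟨Real.cos (Real.pi / 2 ^ (k - 2 + 1)), Real.sin (Real.pi / 2 ^ (k - 2 + 1))⟩ := by
  have h : (2 * Real.pi * Complex.I / (2 ^ k : ℕ) : ℂ) =
      ((Real.pi / 2 ^ (k - 2 + 1) : ℝ) : ℂ) * Complex.I := by
    have : (2 : ℂ) ^ k = 2 * 2 ^ (k - 2 + 1) := by rw [← pow_succ']; congr 1; omega
    push_cast
    rw [this]
    field_simp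
  rw [rootC, h]
  apply Complex.ext
  · rw [Complex.exp_ofReal_mul_I_re]
  · rw [Complex.exp_ofReal_mul_I_im]

theorem rootC_err {k : ℕ} (hk : 2 ≤ k) :
    ‖mkC (cosZ (2 * half k) (k - 2)) (sinZ (2 * half k) (k - 2)) - 2 ^ (2 * half k) * rootC k‖ ≤
      2 ^ (half k + 2) := by
  obtain ⟨c1, c2⟩ := cosZ_err (K := 2 * half k) (by unfold half; omega) (k - 2)
  obtain ⟨s1, s2⟩ := sinZ_err (h := half k) (j := k - 2) (by unfold half; omega)
  refine (Complex.norm_le_abs_re_add_abs_im _).trans ?_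
  rw [rootC_eq hk, show (2 : ℂ) ^ (2 * half k) = ((2 ^ (2 * half k) : ℝ) : ℂ) by push_cast; rfl,
    Complex.sub_re, Complex.sub_im, Complex.re_ofReal_mul, Complex.im_ofReal_mul]
  simp only [mkC, Int.cast_natCast]
  have hT : (2 : ℝ) ≤ 2 ^ half k := le_self_pow₀ (by norm_num) (by unfold half; omega)
  have e1 : (2 : ℝ) ^ (half k + 1) = 2 * 2 ^ half k := by rw [pow_succ]; ring
  have e2 : (2 : ℝ) ^ (half k + 2) = 4 * 2 ^ half k := by rw [pow_succ, pow_succ]; ring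
  rw [e1] at s2
  rw [e2]
  have a1 : |(cosZ (2 * half k) (k - 2) : ℝ) -
    2 ^ (2 * half k) * Real.cos (Real.pi / 2 ^ (k - 2 + 1))| ≤ 2 := by
    rw [abs_le]; constructor <;> linarith
  have a2 : |(sinZ (2 * half k) (k - 2) : ℝ) -
    2 ^ (2 * half k) * Real.sin (Real.pi / 2 ^ (k - 2 + 1))| ≤ 2 * 2 ^ half k := by
    rw [abs_le]; constructor <;> linarith
  linarith

/-- With `N = 2 ^ k`, the unit is `2 ^ (2 * half k)` while the root of unity is only accurate to
about `2 ^ half k`. The remaining factor `2 ^ half k`, of order `N ^ 10`, has to beat the polynomial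
growth of the errors, which ends at `N ^ 7`. -/
theorem half_pow (k : ℕ) : (2 : ℝ) ^ half k = 1048576 * ((2 : ℝ) ^ k) ^ 10 := by
  rw [half, pow_add, mul_comm 10 k, pow_mul]; norm_num; ring

theorem tableW_err {k : ℕ} (hk : 2 ≤ k) : ∀ e < 2 ^ k,
    ‖toC (tableW k) e - 2 ^ (2 * half k) * rootC k ^ e‖ ≤ 16 * 2 ^ k * 2 ^ half k := by
  intro e he
  have hn : (4 : ℝ) ≤ 2 ^ k := by
    calc (4 : ℝ) = 2 ^ 2 := by norm_num
      _ ≤ _ := pow_le_pow_right₀ (by norm_num) hk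
  have he' : (e + 1 : ℝ) ≤ 2 ^ k := by exact_mod_cast he
  have hT : 1280 * (2 : ℝ) ^ k ≤ 2 ^ half k := by
    rw [half_pow, pow_succ]
    have h9 : (1 : ℝ) ≤ ((2 : ℝ) ^ k) ^ 9 := one_le_pow₀ (by linarith)
    nlinarith
  have hj : (40 * (e + 1) * 32 : ℝ) ≤ 2 ^ half k := by linarith
  rw [tableW, toC_tableZ]
  refine (rootZ_err (rootC_norm k) (rootC_err hk) (by exact_mod_cast hj)).trans ?_
  have he0 : (0 : ℝ) ≤ e := by positivity
  calc (e : ℝ) * (8 * 2 ^ half k + 40 * e) ≤ 2 ^ k * (16 * 2 ^ half k) := by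
        apply mul_le_mul <;> first | positivity | linarith
    _ = _ := by ring

theorem toC_bitsZ (K : ℕ) (x : ℕ → ℕ) (q : ℕ) : toC (bitsZ K x) q = 2 ^ K * (x q : ℂ) := by
  have h := toC_interleave (fun q => 2 ^ K * (x q : ℤ)) (fun _ => 0) q
  change toC (bitsZ K x) q = _ at h
  rw [h, mkC]
  have : (2 ^ K * (x q : ℂ)) = ((2 ^ K * x q : ℝ) : ℂ) := by push_cast; rfl
  rw [this]
  apply Complex.ext
  · rw [Complex.ofReal_re]; push_cast; rfl
  · rw [Complex.ofReal_im]; push_cast; rfl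

theorem toC_prodZ (K : ℕ) (x y : ℕ → ℤ) (q : ℕ) : toC (prodZ K x y) q =
    mkC (mulRe K (x (2 * q)) (x (2 * q + 1)) (y (2 * q)) (y (2 * q + 1)))
      (mulIm K (x (2 * q)) (x (2 * q + 1)) (y (2 * q)) (y (2 * q + 1))) :=
  toC_interleave (fun q => mulRe K (x (2 * q)) (x (2 * q + 1)) (y (2 * q)) (y (2 * q + 1)))
    (fun q => mulIm K (x (2 * q)) (x (2 * q + 1)) (y (2 * q)) (y (2 * q + 1))) q

theorem norm_le_of_err {S E M : ℝ} {A a : ℂ} (hS : 0 ≤ S) (h : ‖A - S * a‖ ≤ E) (ha : ‖a‖ ≤ M) :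
    ‖A‖ ≤ S * M + E := by
  have h1 := norm_add_le (S * a) (A - S * a)
  rw [add_sub_cancel, norm_mul, Complex.norm_real, Real.norm_of_nonneg hS] at h1
  have := mul_le_mul_of_nonneg_left ha hS
  linarith

section errors

variable {k : ℕ} (hk : 2 ≤ k) {x y : ℕ → ℕ} (hx : ∀ q, x q ≤ 1) (hy : ∀ q, y q ≤ 1)

/-- The transform of a sequence of natural numbers. -/
noncomputable def dftC (k : ℕ) (x : ℕ → ℕ) (q : ℕ) : ℂ :=
  ∑ r ∈ range (2 ^ k), (x r : ℂ) * rootC k ^ (q * r)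

include hk in
theorem four_le : (4 : ℝ) ≤ 2 ^ k := by
  calc (4 : ℝ) = 2 ^ 2 := by norm_num
    _ ≤ _ := pow_le_pow_right₀ (by norm_num) hk

include hk in
theorem table_small : 16 * 2 ^ k * 2 ^ half k ≤ (2 : ℝ) ^ (2 * half k) := by
  rw [two_mul, pow_add (2 : ℝ)]
  refine mul_le_mul_of_nonneg_right ?_ (by positivity)
  rw [half_pow, pow_succ]
  have h9 : (1 : ℝ) ≤ ((2 : ℝ) ^ k) ^ 9 := one_le_pow₀ (by linarith [four_le hk])
  nlinarith [four_le hk]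

theorem dftC_norm_le (hx : ∀ q, x q ≤ 1) (q : ℕ) : ‖dftC k x q‖ ≤ 2 ^ k := by
  refine (norm_sum_le _ _).trans ((sum_le_card_nsmul _ _ 1 fun r _ => ?_).trans ?_)
  · rw [norm_mul, norm_pow, rootC_norm, one_pow, mul_one, Complex.norm_natCast]
    exact_mod_cast hx r
  · simp

include hk hx in
-- The input is exact, so `E = 0` in `fftZ_err`; only the table error `16 * N * 2 ^ half k` matters,
-- multiplied by `N` for the size of the partial transforms and by `N ^ 2` for the stages.
theorem forwardZ_err {s : ℕ} (hs : s ≤ k) : ∀ q < 2 ^ k,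
    ‖toC (forwardZ k x s) q - 2 ^ (2 * half k) *
      partialDFT (2 ^ k) (2 ^ (k - s)) (rootC k) (fun q => x q) q‖ ≤
      18 * (2 ^ k) ^ 4 * 2 ^ half k := by
  intro q hq
  have hn := four_le hk
  have h := fftZ_err (rootC_norm k) (rootC_primitive k).pow_eq_one (tableW_err hk) (table_small hk)
    (x := bitsZ (2 * half k) x) (v := fun q => (x q : ℂ)) (E := 0) (M := 1)
    (fun q _ => by rw [toC_bitsZ, sub_self, norm_zero])
    (fun q _ => by rw [Complex.norm_natCast]; exact_mod_cast hx q) hs q hq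
  refine h.trans ?_
  have h4 : (4 : ℝ) ^ s ≤ (2 ^ k) ^ 2 := by
    rw [← pow_mul, mul_comm, pow_mul]; norm_num
    exact pow_le_pow_right₀ (by norm_num) hs
  have hT : (1 : ℝ) ≤ 2 ^ half k := one_le_pow₀ (by norm_num)
  set n : ℝ := 2 ^ k
  set T : ℝ := 2 ^ half k
  calc 4 ^ s * (0 + 16 * n * T * (n * 1) + 2) ≤ n ^ 2 * (16 * n ^ 2 * T + 2 * n ^ 2 * T) := by
        apply mul_le_mul h4 _ (by positivity) (by positivity)
        nlinarith [mul_le_mul (show (1 : ℝ) ≤ n ^ 2 by nlinarith) hT (by norm_num) (by positivity)]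
    _ = _ := by ring

include hk in
-- All errors have the form `c * N ^ p * 2 ^ half k`, and `c * N ^ p` is far below `2 ^ half k = 2 ^
-- 20 * N ^ 10`.
theorem err_small (c : ℝ) (hc : c ≤ 4096) (p : ℕ) (hp : p ≤ 10) :
    c * (2 ^ k) ^ p * 2 ^ half k ≤ (2 : ℝ) ^ (2 * half k) / 4 := by
  have hn := four_le hk
  rw [two_mul, pow_add (2 : ℝ)]
  have h1 : ((2 : ℝ) ^ k) ^ p ≤ (2 ^ k) ^ 10 := pow_le_pow_right₀ (by linarith) hp
  have h2 : c * (2 ^ k) ^ p ≤ (2 : ℝ) ^ half k / 4 := by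
    rw [half_pow]
    have : (0 : ℝ) < (2 ^ k) ^ p := by positivity
    nlinarith
  calc c * (2 ^ k) ^ p * 2 ^ half k ≤ 2 ^ half k / 4 * 2 ^ half k :=
        mul_le_mul_of_nonneg_right h2 (by positivity)
    _ = _ := by ring

include hk hx hy in
-- Each factor has norm at most `N` and error `18 * N ^ 4 * 2 ^ half k`, so the linear terms give
-- `36 * N ^ 5 * 2 ^ half k`; the quadratic term and the rounding fit in the rest.
theorem prodZ_err : ∀ q < 2 ^ k,
    ‖toC (prodZ (2 * half k) (forwardZ k x k) (forwardZ k y k)) q - 2 ^ (2 * half k) *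
      (dftC k x q * dftC k y q)‖ ≤ 38 * (2 ^ k) ^ 5 * 2 ^ half k := by
  intro q hq
  have hn := four_le hk
  have hX := forwardZ_err hk hx le_rfl q hq
  have hY := forwardZ_err hk hy le_rfl q hq
  rw [Nat.sub_self, pow_zero, partialDFT_one] at hX hY
  have h := mulZ_err hX hY
  rw [toC_prodZ]
  refine h.trans ?_
  have b1 : ‖dftC k x q‖ ≤ _ := dftC_norm_le hx q
  have b2 : ‖dftC k y q‖ ≤ _ := dftC_norm_le hy q
  have b3 : 18 * (2 ^ k) ^ 4 * 2 ^ half k * (18 * (2 ^ k) ^ 4 * 2 ^ half k) / 2 ^ (2 * half k) ≤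
      (2 : ℝ) ^ half k := by
    rw [two_mul, pow_add (2 : ℝ), div_le_iff₀ (by positivity)]
    have h3 : 324 * ((2 : ℝ) ^ k) ^ 8 ≤ 2 ^ half k := by
      rw [half_pow]
      have : ((2 : ℝ) ^ k) ^ 8 ≤ (2 ^ k) ^ 10 := pow_le_pow_right₀ (by linarith) (by norm_num)
      have : (0 : ℝ) < (2 ^ k) ^ 8 := by positivity
      linarith
    calc _ = 324 * ((2 : ℝ) ^ k) ^ 8 * (2 ^ half k * 2 ^ half k) := by ring
      _ ≤ _ := mul_le_mul_of_nonneg_right h3 (by positivity)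
  have hT : (2 : ℝ) ≤ 2 ^ half k := le_self_pow₀ (by norm_num) (by unfold half; omega)
  have h5 : (4 : ℝ) ≤ (2 ^ k) ^ 5 := hn.trans (le_self_pow₀ (by linarith) (by norm_num))
  change _ * ‖dftC k y q‖ + ‖dftC k x q‖ * _ + _ + 2 ≤ _
  set n : ℝ := 2 ^ k
  set T : ℝ := 2 ^ half k
  have c1 := mul_le_mul_of_nonneg_left b2 (show 0 ≤ 18 * n ^ 4 * T by positivity)
  have c2 := mul_le_mul_of_nonneg_right b1 (show 0 ≤ 18 * n ^ 4 * T by positivity)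
  have c3 : 4 * T ≤ n ^ 5 * T := mul_le_mul_of_nonneg_right h5 (by positivity)
  nlinarith

include hk hx hy in
-- The factor `N ^ 2` for the stages and the error of order `N ^ 5` of the product give `56 * N ^ 7
-- * 2 ^ half k`, below a quarter of the unit.
theorem secondZ_err {s : ℕ} (hs : s ≤ k) : ∀ q < 2 ^ k,
    ‖toC (secondZ k x y s) q - 2 ^ (2 * half k) *
      partialDFT (2 ^ k) (2 ^ (k - s)) (rootC k) (fun q => dftC k x q * dftC k y q) q‖ ≤
      (2 : ℝ) ^ (2 * half k) / 4 := by
  intro q hq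
  have hn := four_le hk
  have h := fftZ_err (rootC_norm k) (rootC_primitive k).pow_eq_one (tableW_err hk) (table_small hk)
    (v := fun q => dftC k x q * dftC k y q) (M := 2 ^ k * 2 ^ k) (prodZ_err hk hx hy)
    (fun q _ => by
      rw [norm_mul]
      exact mul_le_mul (dftC_norm_le hx q) (dftC_norm_le hy q) (norm_nonneg _) (by positivity))
    hs q hq
  refine (h.trans ?_).trans (err_small hk 56 (by norm_num) 7 (by norm_num))
  have h4 : (4 : ℝ) ^ s ≤ (2 ^ k) ^ 2 := by
    rw [← pow_mul, mul_comm, pow_mul]; norm_num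
    exact pow_le_pow_right₀ (by norm_num) hs
  have hT : (1 : ℝ) ≤ 2 ^ half k := one_le_pow₀ (by norm_num)
  set n : ℝ := 2 ^ k
  set T : ℝ := 2 ^ half k
  calc 4 ^ s * (38 * n ^ 5 * T + 16 * n * T * (n * (n * n)) + 2) ≤ n ^ 2 * (56 * n ^ 5 * T) := by
        apply mul_le_mul h4 _ (by positivity) (by positivity)
        have h5 : (1 : ℝ) ≤ n ^ 4 := one_le_pow₀ (by linarith)
        have h6 : 4 * n ^ 4 ≤ n ^ 5 := by
          rw [pow_succ n 4]; nlinarith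
        have h7 : 4 * n ^ 4 * T ≤ n ^ 5 * T := mul_le_mul_of_nonneg_right h6 (by positivity)
        have h8 : 1 * 1 ≤ n ^ 4 * T := mul_le_mul h5 hT (by norm_num) (by positivity)
        nlinarith
    _ = _ := by ring

/-- The common bound for all entries. -/
theorem bound_eq (k : ℕ) :
    (2 : ℝ) ^ (2 * half k + 3 * k + 2) = 4 * (2 ^ (2 * half k) * (2 ^ k) ^ 3) := by
  rw [pow_add, pow_add, mul_comm 3 k, pow_mul]; ring

include hk in
theorem tableW_norm {e : ℕ} (he : e < 2 ^ k) :
    ‖toC (tableW k) e‖ ≤ 2 ^ (2 * half k + 3 * k + 2) := by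
  have h := tableW_err hk e he
  have h1 := norm_le_of_err (S := 2 ^ (2 * half k)) (by positivity) (by push_cast; exact h)
    (show ‖rootC k ^ e‖ ≤ 1 by rw [norm_pow, rootC_norm, one_pow])
  have := table_small hk
  rw [bound_eq]
  have h3 : (1 : ℝ) ≤ (2 ^ k) ^ 3 := one_le_pow₀ (by linarith [four_le hk])
  have : (0 : ℝ) < 2 ^ (2 * half k) := by positivity
  nlinarith

include hk hx in
theorem forwardZ_norm {s q : ℕ} (hs : s ≤ k) (hq : q < 2 ^ k) :
    ‖toC (forwardZ k x s) q‖ ≤ 2 ^ (2 * half k + 3 * k + 2) := by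
  have h := forwardZ_err hk hx hs q hq
  have h2 := partialDFT_norm_le (v := fun q => (x q : ℂ)) (rootC_norm k) (H := 2 ^ (k - s))
    (by positivity) (pow_dvd_pow 2 (Nat.sub_le _ _))
    (fun q _ => by rw [Complex.norm_natCast]; exact_mod_cast hx q) zero_le_one q
  have h1 := norm_le_of_err (S := 2 ^ (2 * half k)) (by positivity) (by push_cast; exact h) h2
  have h5 := err_small hk 18 (by norm_num) 4 (by norm_num)
  push_cast at h1
  rw [bound_eq]
  have hn := four_le hk
  have h3 : (2 : ℝ) ^ k ≤ (2 ^ k) ^ 3 := le_self_pow₀ (by linarith) (by norm_num)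
  have : (0 : ℝ) < 2 ^ (2 * half k) := by positivity
  nlinarith

include hk hx hy in
-- The input of the second transform has norm at most `N ^ 2`, so its partial sums reach `N ^ 3`;
-- this case dictates the exponent `3 * k + 2`.
theorem secondZ_norm {s q : ℕ} (hs : s ≤ k) (hq : q < 2 ^ k) :
    ‖toC (secondZ k x y s) q‖ ≤ 2 ^ (2 * half k + 3 * k + 2) := by
  have h := secondZ_err hk hx hy hs q hq
  have h2 := partialDFT_norm_le (v := fun q => dftC k x q * dftC k y q) (rootC_norm k)
    (H := 2 ^ (k - s)) (M := 2 ^ k * 2 ^ k) (by positivity) (pow_dvd_pow 2 (Nat.sub_le _ _))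
    (fun q _ => by
      rw [norm_mul]
      exact mul_le_mul (dftC_norm_le hx q) (dftC_norm_le hy q) (norm_nonneg _) (by positivity))
    (by positivity) q
  have h1 := norm_le_of_err (S := 2 ^ (2 * half k)) (by positivity) (by push_cast; exact h) h2
  push_cast at h1
  rw [bound_eq]
  have hn := four_le hk
  have h3 : (4 : ℝ) ≤ (2 ^ k) ^ 3 := hn.trans (le_self_pow₀ (by linarith) (by norm_num))
  have : (0 : ℝ) < 2 ^ (2 * half k) := by positivity
  nlinarith

include hk hx hy in
/-- The second transform detects the sums of the positions of the two sequences. -/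
theorem secondZ_correct {c : ℕ} (hc : c < 2 ^ k) :
    2 ^ (2 * half k - 1) ≤ secondZ k x y k (2 * ((2 ^ k - c) % 2 ^ k)) ↔
      ∃ a < 2 ^ k, ∃ b < 2 ^ k, x a = 1 ∧ y b = 1 ∧ (a + b) % 2 ^ k = c := by
  set l := (2 ^ k - c) % 2 ^ k with hl
  have hll : l < 2 ^ k := Nat.mod_lt _ (by positivity)
  have hn := four_le hk
  have h := secondZ_err hk hx hy le_rfl l hll
  rw [Nat.sub_self, pow_zero, partialDFT_one] at h
  have hd := dft_mul_dft (rootC_primitive k) (fun q => x q) (fun q => y q) l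
  simp only [dftC] at h
  rw [hd] at h
  set m : ℕ := ∑ a ∈ range (2 ^ k), ∑ b ∈ range (2 ^ k), if 2 ^ k ∣ a + b + l then x a * y b else 0
    with hm
  have hmc : (∑ a ∈ range (2 ^ k), ∑ b ∈ range (2 ^ k),
      if 2 ^ k ∣ a + b + l then (x a : ℂ) * y b else 0) = (m : ℂ) := by
    rw [hm]; push_cast; rfl
  rw [hmc] at h
  have hre := (Complex.abs_re_le_norm _).trans h
  have e1 : (2 : ℂ) ^ (2 * half k) * (((2 ^ k : ℕ) : ℂ) * m) =
      ((2 ^ (2 * half k) * (2 ^ k * m) : ℝ) : ℂ) := by push_cast; rfl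
  rw [e1, Complex.sub_re, Complex.ofReal_re] at hre
  have e2 : (toC (secondZ k x y k) l).re = secondZ k x y k (2 * l) := rfl
  rw [e2, abs_le] at hre
  have hpow : (2 : ℝ) ^ (2 * half k) = 2 * 2 ^ (2 * half k - 1) := by
    rw [← pow_succ']; congr 1
  -- The exact value is the unit times `N * m`, where `m` counts the pairs, and the error is at most
  -- a quarter of the unit. So comparison with half of the unit decides whether `m` is zero, and no
  -- division by `N` is needed.
  have key : (2 ^ (2 * half k - 1) ≤ secondZ k x y k (2 * l)) ↔ 0 < m := by
    have hcast : (2 ^ (2 * half k - 1) ≤ secondZ k x y k (2 * l)) ↔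
      ((2 : ℝ) ^ (2 * half k - 1) ≤ secondZ k x y k (2 * l)) := by
      exact_mod_cast Iff.rfl
    rw [hcast]
    have hp : (0 : ℝ) < 2 ^ (2 * half k - 1) := by positivity
    rw [hpow] at hre
    constructor
    · intro h1
      by_contra h0
      have : m = 0 := by omega
      rw [this] at hre
      push_cast at hre
      linarith [hre.2]
    · intro h1
      have : (1 : ℝ) ≤ m := by exact_mod_cast h1
      have h2 : (1 : ℝ) ≤ 2 ^ k * m := by nlinarith
      nlinarith [hre.1]
  rw [key, hm, Finset.sum_pos_iff]
  -- The position read is `l ≡ -c`, so `a + b + l ≡ 0` says `a + b ≡ c`.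
  have hiff : ∀ a b, 2 ^ k ∣ a + b + l ↔ (a + b) % 2 ^ k = c := by
    intro a b
    have hlc : 2 ^ k ∣ l + c := by
      rw [hl]
      rcases Nat.eq_zero_or_pos c with h0 | h0
      · simp [h0]
      · rw [Nat.mod_eq_of_lt (by omega), Nat.sub_add_cancel hc.le]
    have h1 : 2 ^ k ∣ a + b + l ↔ a + b ≡ c [MOD 2 ^ k] := by
      rw [← Nat.modEq_zero_iff_dvd]
      constructor
      · intro h2
        have h3 : a + b + l ≡ c + l [MOD 2 ^ k] :=
          h2.trans ((Nat.modEq_zero_iff_dvd.mpr (by rwa [add_comm])).symm)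
        exact Nat.ModEq.add_right_cancel' l h3
      · intro h2
        exact (h2.add_right l).trans (Nat.modEq_zero_iff_dvd.mpr (by rwa [add_comm]))
    rw [h1, Nat.ModEq, Nat.mod_eq_of_lt hc]
  constructor
  · rintro ⟨a, ha, hpos⟩
    rw [Finset.sum_pos_iff] at hpos
    obtain ⟨b, hb, hpos⟩ := hpos
    split_ifs at hpos with hdvd
    · have h1 := hx a
      have h2 := hy b
      refine ⟨a, mem_range.mp ha, b, mem_range.mp hb, ?_, ?_, (hiff a b).mp hdvd⟩
      · have := Nat.pos_of_mul_pos_right hpos; omega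
      · have := Nat.pos_of_mul_pos_left hpos; omega
    · omega
  · rintro ⟨a, ha, b, hb, h1, h2, h3⟩
    refine ⟨a, mem_range.mpr ha, ?_⟩
    rw [Finset.sum_pos_iff]
    exact ⟨b, mem_range.mpr hb, by rw [if_pos ((hiff a b).mpr h3), h1, h2]; norm_num⟩

end errors

theorem half_eq (k : ℕ) : half k = 10 * k + 20 := rfl

attribute [irreducible] half

end WordRAM

/-! ### The program for convolutions -/

namespace WordRAM

variable {w : ℕ} {Q : St → Prop} {s : St}

open Var in
/-- Sets `sr` to the square root of `sx < 2 ^ (2 * kk + 2)`, rounded down. -/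
def isqrtCmd : Cmd :=
  .seq (.set sr 0) <| .seq (.set sb (.shl 1 (kk + 1))) <| .while 0 sb <|
    .seq (.set sr (.ite sx ((sr + sb) * (sr + sb)) sr (sr + sb))) (.set sb (sb / 2))

theorem lit_mod {n : ℕ} (h : n < 2 ^ w) : n % 2 ^ w = n := Nat.mod_eq_of_lt h

/-- Binary search for the root: it lies in an interval of length `2 * b` that starts at `r`, and the
comparison selects a half. -/
theorem isqrt_step {x r b : ℕ} (h₁ : r * r ≤ x) (h₂ : x < (r + 2 * b) * (r + 2 * b)) :
    (if x < (r + b) * (r + b) then r else r + b) * (if x < (r + b) * (r + b) then r else r + b) ≤ x ∧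
    x < ((if x < (r + b) * (r + b) then r else r + b) + b) *
      ((if x < (r + b) * (r + b) then r else r + b) + b) := by
  split_ifs with h
  · exact ⟨h₁, h⟩
  · refine ⟨not_lt.mp h, ?_⟩
    rwa [show r + b + b = r + 2 * b by ring]

/-- The trial squares stay at most `2 ^ (2 * K + 4)`, hence the condition on `w`. The step width is
halved from `2 ^ (K + 1)` down to zero, which takes `K + 2` rounds. -/
theorem wp_isqrt {K : ℕ} (hK : s.var .kk = K) (hx : s.var .sx < 2 ^ (2 * K + 2))
    (hw : 2 * K + 4 < w)
    (h : ∀ s' : St, s'.var .sr = Nat.sqrt (s.var .sx) → s'.mem = s.mem →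
      s'.time = s.time + 900 + (K + 2) * 900 → (∀ v ∉ isqrtCmd.writes, s'.var v = s.var v) → Q s') :
    wp w isqrtCmd Q s := by
  set x := s.var .sx
  have h1w : 1 < 2 ^ w := Nat.one_lt_two_pow (by omega)
  have hKw : 2 ^ (K + 1) < 2 ^ w := Nat.pow_lt_pow_right (by norm_num) (by omega)
  have hKK : K + 1 < 2 ^ w := (Nat.lt_two_pow_self).trans hKw
  have hsq : 2 ^ (2 * K + 4) < 2 ^ w := Nat.pow_lt_pow_right (by norm_num) hw
  have h2w : 2 < 2 ^ w := lt_of_lt_of_le (by norm_num : 2 < 2 ^ 2) (Nat.pow_le_pow_right (by norm_num) (by omega))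
  suffices wp w isqrtCmd (fun s' => s'.var .sr = Nat.sqrt x ∧ s'.mem = s.mem ∧
      s'.time = s.time + 900 + (K + 2) * 900) s from
    this.frame.mono fun s' ⟨⟨a, b, c⟩, d⟩ => h s' a b c d
  refine wp_seq (wp_set (x := 0) (by simp) (wp_seq (wp_set (x := 2 ^ (K + 1)) ?_ ?_)))
  · simp [hK, lit_mod h1w, lit_mod hKK, lit_mod hKw]
  refine wp_while (fun i s' => s'.var .sb = 2 ^ (K + 1) / 2 ^ i ∧ s'.var .sx = x ∧
    s'.var .sr * s'.var .sr ≤ x ∧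
    x < (s'.var .sr + 2 ^ (K + 2) / 2 ^ i) * (s'.var .sr + 2 ^ (K + 2) / 2 ^ i) ∧
    s'.mem = s.mem ∧ s'.time = s.time + 600 + i * 900) (K + 2) ?_ ?_ ?_
  · refine ⟨by simp, by simp [x], by simp, ?_, by simp, by simp⟩
    simp only [St.set_var, pow_zero, Nat.div_one]
    simp only [reduceCtorEq, if_false, if_true, zero_add]
    rw [← pow_add, show K + 2 + (K + 2) = 2 * K + 2 + 2 by ring, pow_add]
    omega
  · rintro i hi s' ⟨h1, h2, h3, h4, h5, h6⟩
    have hb : 0 < 2 ^ (K + 1) / 2 ^ i :=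
      Nat.div_pos (Nat.pow_le_pow_right (by norm_num) (by omega)) (by positivity)
    have e1 : 2 ^ (K + 2) / 2 ^ i = 2 * (2 ^ (K + 1) / 2 ^ i) := by
      rw [Nat.pow_div (by omega) (by norm_num), Nat.pow_div (by omega) (by norm_num), ← pow_succ']
      congr 1; omega
    have e2 : 2 ^ (K + 2) / 2 ^ (i + 1) = 2 ^ (K + 1) / 2 ^ i := by
      rw [Nat.pow_div (by omega) (by norm_num), Nat.pow_div (by omega) (by norm_num)]
      congr 1; omega
    have e3 : 2 ^ (K + 1) / 2 ^ (i + 1) = 2 ^ (K + 1) / 2 ^ i / 2 := by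
      rw [pow_succ 2 i, Nat.div_div_eq_div_mul]
    have hble : 2 ^ (K + 1) / 2 ^ i ≤ 2 ^ (K + 1) := Nat.div_le_self _ _
    rw [e1] at h4
    set b := 2 ^ (K + 1) / 2 ^ i
    set r := s'.var .sr
    have hr : r < 2 ^ (K + 1) := by
      have : r * r < 2 ^ (K + 1) * 2 ^ (K + 1) := by
        rw [← pow_add, show K + 1 + (K + 1) = 2 * K + 2 by ring]; omega
      exact Nat.mul_self_lt_mul_self_iff.mp this
    have hrb : (r + b) * (r + b) < 2 ^ w := by
      refine lt_of_le_of_lt ?_ hsq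
      have : r + b ≤ 2 ^ (K + 2) := by rw [pow_succ 2 (K + 1)]; omega
      calc _ ≤ 2 ^ (K + 2) * 2 ^ (K + 2) := Nat.mul_le_mul this this
        _ = _ := by rw [← pow_add]; congr 1; ring
    have hrb' : r + b < 2 ^ w := by
      have : 2 ^ (K + 2) < 2 ^ w := Nat.pow_lt_pow_right (by norm_num) (by omega)
      rw [pow_succ 2 (K + 1)] at this; omega
    obtain ⟨g1, g2⟩ := isqrt_step h3 h4
    refine ⟨by simp [h1, hb], wp_seq (wp_set (x := if x < (r + b) * (r + b) then r else r + b) ?_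
      (wp_set (x := b / 2) ?_ ⟨?_, ?_, ?_, ?_, ?_, ?_⟩))⟩
    · simp [h1, h2, r, lit_mod hrb', lit_mod hrb]
    · simp [h1, lit_mod h2w]
    · simp [e3]
    · simp [h2]
    · simpa using g1
    · rw [e2]; simpa using g2
    · simp [h5]
    · simp [h6]; ring
  · rintro s' ⟨h1, h2, h3, h4, h5, h6⟩
    have e1 : 2 ^ (K + 2) / 2 ^ (K + 2) = 1 := Nat.div_self (by positivity)
    have e2 : 2 ^ (K + 1) / 2 ^ (K + 2) = 0 :=
      Nat.div_eq_of_lt (Nat.pow_lt_pow_right (by norm_num) (by omega))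
    rw [e1] at h4
    refine ⟨by simp [h1, e2], ?_, by simp [h5], by simp [h6]; ring⟩
    exact Nat.eq_sqrt.mpr ⟨h3, h4⟩

end WordRAM

/-! ### Complex products in words and the entries of the table of roots. -/

namespace WordRAM

variable {w : ℕ} {Q : St → Prop} {s : St}

section expressions

open Var

/-- The fixed-point real part of a product. -/
def mulReE (a b c d : Expr) : Expr := .shr (a * c - b * d + big) kk - bk

/-- The fixed-point imaginary part of a product. -/
def mulImE (a b c d : Expr) : Expr := .shr (a * d + b * c + big) kk - bk

/-- The entry of an interleaved array at position `2 * q + r`. -/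
def entryE (v : Var) (q : Expr) (r : ℕ) : Expr := .load (v + 2 * q + .lit r)

/-- The entries of the table of roots. -/
def tableE : Expr :=
  .ite i 4 (.ite i 2 (.ite i 1 one 0) (.ite i 3 cs sn))
    (.ite (i % 2) 1
      (mulReE (entryE .w (i / 2 / 2) 0) (entryE .w (i / 2 / 2) 1)
        (entryE .w (i / 2 - i / 2 / 2) 0) (entryE .w (i / 2 - i / 2 / 2) 1))
      (mulImE (entryE .w (i / 2 / 2) 0) (entryE .w (i / 2 / 2) 1)
        (entryE .w (i / 2 - i / 2 / 2) 0) (entryE .w (i / 2 - i / 2 / 2) 1)))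

/-- Prepares the constants and the table of roots for transforms of length `nn = 2 ^ k`. -/
def setupCmd : Cmd :=
  .seq (.set kk (20 * k + 40)) <| .seq (.set one (.shl 1 kk)) <|
  .seq (.set bk (.shl 1 (kk + 6 * k + 6))) <| .seq (.set big (.shl 1 (kk + (kk + 6 * k + 6)))) <|
  .seq (.set len (2 * nn)) <| .seq (.set cs 0) <| .seq (.set j 2) <|
  .seq (.while j k <| .seq (.set sx ((one + cs) * .shl 1 (kk - 1))) <| .seq isqrtCmd <|
    .seq (.set cs sr) <| .set j (j + 1)) <|
  .seq (.set sx (one * one - cs * cs)) <| .seq isqrtCmd <| .seq (.set sn sr) <|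
  .seq (.set .w top) <| .seq (fill len .w tableE) <| .set top (top + len)

end expressions

/-- The constants for transforms of length `2 ^ k` are in place. -/
structure Consts (k : ℕ) (s : St) : Prop where
  hkk : s.var .kk = 2 * half k
  hbk : s.var .bk = 2 ^ (2 * half k + 6 * k + 6)
  hbig : s.var .big = 2 ^ (2 * half k + (2 * half k + 6 * k + 6))
  hnn : s.var .nn = 2 ^ k
  hlen : s.var .len = 2 * 2 ^ k

/-- The memory holds the signed integers `x` from the address `p` on. -/
def HoldsZ (w n p : ℕ) (x : ℕ → ℤ) (s : St) : Prop := ∀ i < n, s.mem (p + i) = rep w (x i)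

theorem Consts.congr {k : ℕ} {s s' : St} (h : Consts k s)
    (hv : ∀ v ∈ [Var.kk, .bk, .big, .nn, .len], s'.var v = s.var v) : Consts k s' := by
  obtain ⟨h1, h2, h3, h4, h5⟩ := h
  constructor <;> rw [hv _ (by decide)] <;> assumption

/-- Intermediate products may wrap around, since residues are all that counts before the shift. The
shift itself needs the true integer to lie within the offset `big`, which follows from the norms of
the factors. -/
theorem eval_mulReE {k : ℕ} {a b c d : Expr} {x y z u : ℤ} (hs : Consts k s)
    (ha : a.eval w s = rep w x) (hb : b.eval w s = rep w y) (hc : c.eval w s = rep w z)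
    (hd : d.eval w s = rep w u)
    (h1 : ‖mkC x y‖ ≤ 2 ^ (2 * half k + 3 * k + 2)) (h2 : ‖mkC z u‖ ≤ 2 ^ (2 * half k + 3 * k + 2))
    (hw : 2 * half k + (2 * half k + 6 * k + 6) + 1 ≤ w) :
    (mulReE a b c d).eval w s = rep w (mulRe (2 * half k) x y z u) := by
  obtain ⟨h, -⟩ := mul_range h1 h2
  rw [← pow_add] at h
  have h' : |x * z - y * u| ≤ 2 ^ (2 * half k + 3 * k + 2 + (2 * half k + 3 * k + 2)) := by
    exact_mod_cast h
  have hlt : (2 : ℤ) ^ (2 * half k + 3 * k + 2 + (2 * half k + 3 * k + 2)) <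
    2 ^ (2 * half k + (2 * half k + 6 * k + 6)) := pow_lt_pow_right₀ (by norm_num) (by omega)
  rw [abs_le] at h'
  have := rep_shift (w := w) (K := 2 * half k) (r := 2 * half k + 6 * k + 6) (v := x * z - y * u)
    (by linarith) (by linarith) (by omega)
  simp only [mulReE, Expr.eval_sub, Expr.eval_shr, Expr.eval_add, Expr.eval_mul, Expr.eval_var,
    ha, hb, hc, hd, hs.hkk, hs.hbk, hs.hbig, rep_mul, rep_sub]
  exact this

theorem eval_mulImE {k : ℕ} {a b c d : Expr} {x y z u : ℤ} (hs : Consts k s)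
    (ha : a.eval w s = rep w x) (hb : b.eval w s = rep w y) (hc : c.eval w s = rep w z)
    (hd : d.eval w s = rep w u)
    (h1 : ‖mkC x y‖ ≤ 2 ^ (2 * half k + 3 * k + 2)) (h2 : ‖mkC z u‖ ≤ 2 ^ (2 * half k + 3 * k + 2))
    (hw : 2 * half k + (2 * half k + 6 * k + 6) + 1 ≤ w) :
    (mulImE a b c d).eval w s = rep w (mulIm (2 * half k) x y z u) := by
  obtain ⟨-, h⟩ := mul_range h1 h2
  rw [← pow_add] at h
  have h' : |x * u + y * z| ≤ 2 ^ (2 * half k + 3 * k + 2 + (2 * half k + 3 * k + 2)) := by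
    exact_mod_cast h
  have hlt : (2 : ℤ) ^ (2 * half k + 3 * k + 2 + (2 * half k + 3 * k + 2)) <
    2 ^ (2 * half k + (2 * half k + 6 * k + 6)) := pow_lt_pow_right₀ (by norm_num) (by omega)
  rw [abs_le] at h'
  have := rep_shift (w := w) (K := 2 * half k) (r := 2 * half k + 6 * k + 6) (v := x * u + y * z)
    (by linarith) (by linarith) (by omega)
  simp only [mulImE, Expr.eval_sub, Expr.eval_shr, Expr.eval_add, Expr.eval_mul, Expr.eval_var,
    ha, hb, hc, hd, hs.hkk, hs.hbk, hs.hbig, rep_mul, rep_add]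
  exact this

theorem eval_entryE {v : Var} {e : Expr} {p q r n : ℕ} {x : ℕ → ℤ} (hv : s.var v = p)
    (he : e.eval w s = q) (hx : ∀ i < n, s.mem (p + i) = rep w (x i)) (hq : 2 * q + r < n)
    (hp : p + n ≤ 2 ^ w) (h2 : 2 < 2 ^ w) :
    (entryE v e r).eval w s = rep w (x (2 * q + r)) := by
  have e1 : (Expr.lit r).eval w s = r := Nat.mod_eq_of_lt (by omega)
  simp only [entryE, Expr.eval_load, Expr.eval_add, Expr.eval_mul, Expr.eval_var, Expr.eval_num,
    hv, he, e1]
  rw [Nat.mod_eq_of_lt h2, Nat.mod_eq_of_lt (show 2 * q < 2 ^ w by omega),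
    Nat.mod_eq_of_lt (show p + 2 * q < 2 ^ w by omega), Nat.mod_eq_of_lt (by omega),
    Nat.add_assoc, hx _ hq]

/-- The word length suffices for transforms of length `2 ^ k`. -/
theorem consts_lt {k : ℕ} (hw : 46 * k + 100 ≤ w) :
    46 * k + 100 < 2 ^ w ∧ 2 ^ (2 * half k) < 2 ^ w ∧ 2 ^ (2 * half k + 6 * k + 6) < 2 ^ w ∧
    2 ^ (2 * half k + (2 * half k + 6 * k + 6)) < 2 ^ w ∧ 2 ^ (k + 1) < 2 ^ w := by
  -- The largest constant has the exponent `4 * half k + 6 * k + 6 = 46 * k + 86`.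
  have hh := half_eq k
  refine ⟨hw.trans_lt Nat.lt_two_pow_self, ?_, ?_, ?_, ?_⟩ <;>
  exact Nat.pow_lt_pow_right (by norm_num) (by omega)

/-- The first four cells hold the powers zero and one. Every later entry is a product of two powers
with smaller exponents, whose cells come before position `j`. -/
theorem eval_tableE {k j tp : ℕ} (hk : 2 ≤ k) (hw : 46 * k + 100 ≤ w) (hs : Consts k s)
    (hone : s.var .one = 2 ^ (2 * half k)) (hcs : s.var .cs = cosZ (2 * half k) (k - 2))
    (hsn : s.var .sn = sinZ (2 * half k) (k - 2)) (hwt : s.var .w = tp) (hi : s.var .i = j)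
    (hj : j < 2 * 2 ^ k) (htp : tp + 2 * 2 ^ k ≤ 2 ^ w)
    (hm : ∀ i < j, s.mem (tp + i) = rep w (tableW k i)) :
    tableE.eval w s = rep w (tableW k j) := by
  obtain ⟨w1, w2, w3, w4, w5⟩ := consts_lt hw
  have hcw : cosZ (2 * half k) (k - 2) < 2 ^ w := by
    obtain ⟨c1, -⟩ := cosZ_err (K := 2 * half k) (by unfold half; omega) (k - 2)
    have c2 : (cosZ (2 * half k) (k - 2) : ℝ) ≤ 2 ^ (2 * half k) := c1.trans
      (mul_le_of_le_one_right (by positivity) (Real.cos_le_one _))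
    have c3 : cosZ (2 * half k) (k - 2) ≤ 2 ^ (2 * half k) := by exact_mod_cast c2
    omega
  have hsw : sinZ (2 * half k) (k - 2) < 2 ^ w := by
    refine lt_of_le_of_lt ?_ w2
    rw [sinZ]
    refine (Nat.sqrt_le_sqrt (Nat.sub_le _ _)).trans ?_
    rw [Nat.sqrt_eq]
  have n4 : 4 % 2 ^ w = 4 := lit_mod (by omega)
  have n2 : 2 % 2 ^ w = 2 := lit_mod (by omega)
  have n1 : 1 % 2 ^ w = 1 := lit_mod (by omega)
  have n3 : 3 % 2 ^ w = 3 := lit_mod (by omega)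
  simp only [tableE, Expr.eval_ite, Expr.eval_var, Expr.eval_num, Expr.eval_mod, hi, n4, n2, n1, n3,
    hone, hcs, hsn, Expr.eval_zero]
  by_cases h4 : j < 4
  · rw [if_pos h4]
    have r0 : tableW k 0 = 2 ^ (2 * half k) := by simp [tableW, tableZ, rootZ]
    have r1 : tableW k 1 = 0 := by simp [tableW, tableZ, rootZ]
    have r2 : tableW k 2 = cosZ (2 * half k) (k - 2) := by simp [tableW, tableZ, rootZ]
    have r3 : tableW k 3 = sinZ (2 * half k) (k - 2) := by simp [tableW, tableZ, rootZ]
    have c0 := rep_natCast w2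
    push_cast at c0
    interval_cases j
    · rw [r0, c0]; rfl
    · rw [r1]; simp [rep]
    · rw [r2, rep_natCast hcw]; rfl
    · rw [r3, rep_natCast hsw]; rfl
  · rw [if_neg h4]
    have hrec := rootZ_rec (2 * half k) (cosZ (2 * half k) (k - 2)) (sinZ (2 * half k) (k - 2))
      (j := j / 2) (by omega)
    have ea : ((Expr.var .i) / 2 / 2).eval w s = j / 2 / 2 := by
      simp only [Expr.eval_div, Expr.eval_var, Expr.eval_num, hi, n2]
    have eb : ((Expr.var .i) / 2 - (Expr.var .i) / 2 / 2).eval w s = j / 2 - j / 2 / 2 := by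
      simp only [Expr.eval_div, Expr.eval_var, Expr.eval_num, Expr.eval_sub, hi, n2]
      exact sub_mod (Nat.div_le_self _ _) (by omega)
    have p1 := eval_entryE (r := 0) hwt ea hm (by omega) (by omega) (by omega)
    have p2 := eval_entryE (r := 1) hwt ea hm (by omega) (by omega) (by omega)
    have p3 := eval_entryE (r := 0) hwt eb hm (by omega) (by omega) (by omega)
    have p4 := eval_entryE (r := 1) hwt eb hm (by omega) (by omega) (by omega)
    have hh := half_eq k
    have na := tableW_norm hk (e := j / 2 / 2) (by omega)
    have nb := tableW_norm hk (e := j / 2 - j / 2 / 2) (by omega)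
    have tr : ∀ q, tableW k (2 * q) = (rootZ (2 * half k) (cosZ (2 * half k) (k - 2))
        (sinZ (2 * half k) (k - 2)) q).1 := fun q => by
      rw [tableW, tableZ, if_pos (by omega), Nat.mul_div_cancel_left _ two_pos]
    have ti : ∀ q, tableW k (2 * q + 1) = (rootZ (2 * half k) (cosZ (2 * half k) (k - 2))
        (sinZ (2 * half k) (k - 2)) q).2 := fun q => by
      rw [tableW, tableZ, if_neg (by omega), show (2 * q + 1) / 2 = q by omega]
    by_cases hpar : j % 2 < 1
    · rw [if_pos hpar]
      have := eval_mulReE hs p1 p2 p3 p4 na nb (by omega)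
      refine this.trans ?_
      congr 1
      have hjj : j = 2 * (j / 2) := by omega
      conv_rhs => rw [hjj, tr, hrec]
      simp only [add_zero, tr, ti]
    · rw [if_neg hpar]
      have := eval_mulImE hs p1 p2 p3 p4 na nb (by omega)
      refine this.trans ?_
      congr 1
      have hjj : j = 2 * (j / 2) + 1 := by omega
      conv_rhs => rw [hjj, ti, hrec]
      simp only [add_zero, tr, ti]

end WordRAM

/-! ### Preparing the constants and the table of roots. -/

namespace WordRAM

variable {w : ℕ} {Q : St → Prop} {s : St}

/-- The table of roots is in place. -/
structure Table (w k : ℕ) (s : St) : Prop extends Consts k s where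
  tab : HoldsZ w (2 * 2 ^ k) (s.var .w) (tableW k) s
  le : s.var .w + 2 * 2 ^ k ≤ s.var .top

theorem cosZ_le (k j : ℕ) (hk : 2 ≤ k) : cosZ (2 * half k) j ≤ 2 ^ (2 * half k) := by
  obtain ⟨c1, -⟩ := cosZ_err (K := 2 * half k) (by unfold half; omega) j
  have c2 : (cosZ (2 * half k) j : ℝ) ≤ 2 ^ (2 * half k) := c1.trans
    (mul_le_of_le_one_right (by positivity) (Real.cos_le_one _))
  exact_mod_cast c2

/-- There are fewer than `k` square roots by the half-angle formula and one for the sine, each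
taking `O(k)` steps, so the quadratic term in `k` is dominated by the cost of the transforms. -/
theorem wp_setup {k : ℕ} (hk : 2 ≤ k) (hw : 46 * k + 100 ≤ w) (hkv : s.var .k = k)
    (hnn : s.var .nn = 2 ^ k) (htop : s.var .top + 2 * 2 ^ k < 2 ^ w)
    (h : ∀ s' : St, Table w k s' → s'.var .one = 2 ^ (2 * half k) →
      s'.var .top = s.var .top + 2 * 2 ^ k → (∀ a < s.var .top, s'.mem a = s.mem a) →
      s'.time ≤ s.time + (k * (1800 * half k + 3900) + 1800 * half k + 1800 * 2 ^ k + 10000) →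
      (∀ v ∉ setupCmd.writes, s'.var v = s.var v) → Q s') :
    wp w setupCmd Q s := by
  suffices wp w setupCmd (fun s' => Table w k s' ∧ s'.var .one = 2 ^ (2 * half k) ∧
      s'.var .top = s.var .top + 2 * 2 ^ k ∧ (∀ a < s.var .top, s'.mem a = s.mem a) ∧
      s'.time ≤ s.time + (k * (1800 * half k + 3900) + 1800 * half k + 1800 * 2 ^ k + 10000)) s from
    this.frame.mono fun s' ⟨⟨a, b, c, d, e⟩, f⟩ => h s' a b c d e f
  obtain ⟨w1, w2, w3, w4, w5⟩ := consts_lt hw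
  have hh := half_eq k
  obtain ⟨K, hK⟩ : ∃ K, K = 2 * half k := ⟨_, rfl⟩
  rw [← hK] at w2 w3 w4
  simp only [← hK]
  have n1 : 1 % 2 ^ w = 1 := lit_mod (by omega)
  have n2 : 2 % 2 ^ w = 2 := lit_mod (by omega)
  have n6 : 6 % 2 ^ w = 6 := lit_mod (by omega)
  have n20 : 20 % 2 ^ w = 20 := lit_mod (by omega)
  have n40 : 40 % 2 ^ w = 40 := lit_mod (by omega)
  have m1 : 20 * k % 2 ^ w = 20 * k := lit_mod (by omega)
  -- The program spells out `2 * half k` as `20 * k + 40`.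
  have m2 : (20 * k + 40) % 2 ^ w = K := by rw [lit_mod (by omega)]; omega
  have m3 : 6 * k % 2 ^ w = 6 * k := lit_mod (by omega)
  have m4 : (K + 6 * k) % 2 ^ w = K + 6 * k := lit_mod (by omega)
  have m5 : (K + 6 * k + 6) % 2 ^ w = K + 6 * k + 6 := lit_mod (by omega)
  have m6 : (K + (K + 6 * k + 6)) % 2 ^ w = K + (K + 6 * k + 6) := lit_mod (by omega)
  have m7 : 2 * 2 ^ k % 2 ^ w = 2 * 2 ^ k := lit_mod (by omega)
  refine wp_seq (wp_set (x := K) (by simp [hkv, n20, n40, m1, m2]) ?_)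
  refine wp_seq (wp_set (x := 2 ^ K) (by simp [n1, lit_mod w2]) ?_)
  refine wp_seq (wp_set (x := 2 ^ (K + 6 * k + 6)) (by
    simp [n1, hkv, n6, m3, m4, m5, lit_mod w3]) ?_)
  refine wp_seq (wp_set (x := 2 ^ (K + (K + 6 * k + 6))) (by
    simp [n1, hkv, n6, m3, m4, m5, m6, lit_mod w4]) ?_)
  refine wp_seq (wp_set (x := 2 * 2 ^ k) (by simp [hnn, n2, m7]) ?_)
  refine wp_seq (wp_set (x := 0) (by simp) (wp_seq (wp_set (x := 2) (by simp [n2]) ?_)))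
  set s0 := ((((((s.set Var.kk K).set Var.one (2 ^ K)).set Var.bk (2 ^ (K + 6 * k + 6))).set Var.big
    (2 ^ (K + (K + 6 * k + 6)))).set Var.len (2 * 2 ^ k)).set Var.cs 0).set Var.j 2 with hs0
  have z1 : s0.var .kk = K := by simp [hs0]
  have z2 : s0.var .one = 2 ^ K := by simp [hs0]
  have z3 : s0.var .k = k := by simp [hs0, hkv]
  have z4 : s0.var .bk = 2 ^ (K + 6 * k + 6) := by simp [hs0]
  have z5 : s0.var .big = 2 ^ (K + (K + 6 * k + 6)) := by simp [hs0]
  have z6 : s0.var .len = 2 * 2 ^ k := by simp [hs0]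
  have z7 : s0.var .nn = 2 ^ k := by simp [hs0, hnn]
  have z8 : s0.var .top = s.var .top := by simp [hs0]
  have zm : s0.mem = s.mem := by simp [hs0]
  have zt : s0.time = s.time + 2100 := by simp [hs0]
  have zj : s0.var .j = 2 := by simp [hs0]
  have zc : s0.var .cs = 0 := by simp [hs0]
  clear_value s0
  have hone : 2 ^ K * 2 ^ K < 2 ^ w := by
    rw [← pow_add]; exact Nat.pow_lt_pow_right (by norm_num) (by omega)
  have hK2 : 2 ^ (2 * K + 2) = 2 ^ K * 2 ^ K * 4 := by rw [pow_add, two_mul, pow_add]; norm_num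
  refine wp_seq (wp_while (fun i s' => s'.var .j = 2 + i ∧ s'.var .cs = cosZ K i ∧ s'.mem = s.mem ∧
    s'.time = s.time + 2100 + i * (2100 + (K + 2) * 900) ∧
    ∀ v ∉ [Var.sx, .sr, .sb, .cs, .j], s'.var v = s0.var v) (k - 2) ?_ ?_ ?_)
  · exact ⟨zj, by rw [zc]; rfl, zm, by omega, fun _ _ => rfl⟩
  · rintro i hi s1 ⟨a1, a2, a3, a4, a5⟩
    have b1 := a5 .kk (by decide)
    have b2 := a5 .one (by decide)
    have b3 := a5 .k (by decide)
    rw [z1] at b1; rw [z2] at b2; rw [z3] at b3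
    have hc := cosZ_le k i hk
    rw [← hK] at hc
    have c1 : (2 ^ K + cosZ K i) % 2 ^ w = 2 ^ K + cosZ K i := lit_mod (by
      have : 2 ^ (K + 1) < 2 ^ w := Nat.pow_lt_pow_right (by norm_num) (by omega)
      rw [pow_succ] at this; omega)
    have c2 : (K + (2 ^ w - 1)) % 2 ^ w = K - 1 := sub_mod (by omega) (by omega)
    have hle : 2 ^ (K - 1) * 2 = 2 ^ K := by rw [← pow_succ, Nat.sub_add_cancel (by omega)]
    have c4 : (2 ^ K + cosZ K i) * 2 ^ (K - 1) ≤ 2 ^ K * 2 ^ K := 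
      calc _ ≤ (2 ^ K + 2 ^ K) * 2 ^ (K - 1) := Nat.mul_le_mul_right _ (by omega)
        _ = 2 ^ K * (2 ^ (K - 1) * 2) := by ring
        _ = _ := by rw [hle]
    have c5 : 2 ^ (K - 1) % 2 ^ w = 2 ^ (K - 1) := lit_mod (by omega)
    refine ⟨by simp [a1, b3]; omega, ?_⟩
    refine wp_seq (wp_set (x := (2 ^ K + cosZ K i) * 2 ^ (K - 1)) (by
      simp [a2, b1, b2, n1, c1, c2, c5, lit_mod (c4.trans_lt hone)]) ?_)
    refine wp_seq (wp_isqrt (K := K) (by simp [b1]) ?_ (by omega) ?_)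
    · simp only [St.set_var, if_true]
      rw [hK2]; have : 0 < 2 ^ K * 2 ^ K := by positivity
      omega
    intro s2 d1 d2 d3 d4
    refine wp_seq (wp_set (x := cosZ K (i + 1)) (by rw [Expr.eval_var, d1]; simp [cosZ]) ?_)
    refine wp_set (x := 2 + (i + 1)) ?_ ⟨by simp, by simp, by simp [d2, a3],
      by simp [d3, a4]; ring, ?_⟩
    · have e1 := d4 .j (by decide)
      simp only [Expr.eval_add, Expr.eval_var, Expr.eval_num, St.set_var, e1, reduceCtorEq, if_false,
        St.tick_var, a1, n1]
      exact lit_mod (by omega)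
    · intro v hv
      have e1 : v ∉ isqrtCmd.writes := fun hh => hv (by
        revert hh; simp [isqrtCmd, Cmd.writes]; tauto)
      rw [← a5 v hv]
      simp only [List.mem_cons, not_or] at hv
      simp [hv, d4 v e1]
  · rintro s1 ⟨a1, a2, a3, a4, a5⟩
    have b1 := a5 .kk (by decide)
    have b2 := a5 .one (by decide)
    have b3 := a5 .k (by decide)
    rw [z1] at b1; rw [z2] at b2; rw [z3] at b3
    refine ⟨by simp [a1, b3]; omega, ?_⟩
    have hc := cosZ_le k (k - 2) hk
    rw [← hK] at hc
    have hcc : cosZ K (k - 2) * cosZ K (k - 2) ≤ 2 ^ K * 2 ^ K := Nat.mul_le_mul hc hc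
    refine wp_seq (wp_set (x := 2 ^ K * 2 ^ K - cosZ K (k - 2) * cosZ K (k - 2)) (by
      simp only [Expr.eval_sub, Expr.eval_mul, Expr.eval_var, St.tick_var, a2, b2]
      rw [lit_mod hone, lit_mod (hcc.trans_lt hone)]
      exact sub_mod hcc hone) ?_)
    refine wp_seq (wp_isqrt (K := K) (by simp [b1]) ?_ (by omega) ?_)
    · simp only [St.set_var, if_true]
      rw [hK2]; have : 0 < 2 ^ K * 2 ^ K := by positivity
      omega
    intro s2 d1 d2 d3 d4
    have f1 : ∀ v ∉ [Var.sx, .sr, .sb, .cs, .j], s2.var v = s0.var v := by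
      intro v hv
      have e1 : v ∉ isqrtCmd.writes := fun hh => hv (by
        revert hh; simp [isqrtCmd, Cmd.writes]; tauto)
      rw [← a5 v hv, d4 v e1]
      simp only [List.mem_cons, not_or] at hv
      simp [hv]
    have f2 : s2.var .cs = cosZ K (k - 2) := by
      rw [d4 .cs (by decide)]; simp [a2]
    simp only [St.set_var, if_true, St.set_time, St.tick_time, St.set_mem, St.tick_mem] at d1 d2 d3
    refine wp_seq (wp_set (x := sinZ K (k - 2)) (by rw [Expr.eval_var, d1]; rfl) ?_)
    refine wp_seq (wp_set (x := s.var .top) (by simp [f1, z8]) ?_)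
    refine wp_seq (wp_fill (nv := 2 * 2 ^ k) (bv := s.var .top) (fun i => rep w (tableW k i))
      (by simp [f1, z6]) (by simp) (by decide) (by decide) (by omega) ?_ ?_)
    · intro i hi s3 g1 g2
      refine eval_tableE (tp := s.var .top) hk hw ?_ ?_ ?_ ?_ ?_ ?_ hi (by omega) ?_
      · constructor <;> simp [g1, Function.update_of_ne, f1, z1, z4, z5, z6, z7, hK]
      · simp [g1, Function.update_of_ne, f1, z2, hK]
      · simp [g1, Function.update_of_ne, f2, hK]
      · simp [g1, Function.update_of_ne, hK]
      · simp [g1, Function.update_of_ne]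
      · simp [g1]
      · intro i' hi'
        rw [g2, blk_add hi']
    · refine wp_set (x := s.var .top + 2 * 2 ^ k) ?_ ⟨⟨?_, ?_, ?_⟩, ?_, ?_, ?_, ?_⟩
      · simp [f1, z8, z6, lit_mod htop]
      · constructor <;> simp [f1, z1, z4, z5, z6, z7, hK]
      · intro i hi
        simp [blk_add hi]
      · simp
      · simp [f1, z2]
      · simp
      · intro a ha
        simp [blk_of_lt ha, d2, a3]
      · simp only [St.set_time, St.fill_time, d3, a4]
        have : (k - 2) * (2100 + (K + 2) * 900) ≤ k * (1800 * half k + 3900) :=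
          Nat.mul_le_mul (by omega) (by omega)
        omega

end WordRAM

/-! ### The fast Fourier transform as a program. -/

namespace WordRAM

variable {w : ℕ} {Q : St → Prop} {s : St}

section expressions

open Var

/-- The part of the position that is a multiple of the stride. -/
def baseE : Expr := i / 2 - i / 2 % hh

/-- The position of the first operand of a stage. -/
def posE : Expr := (i / 2 + baseE) % nn

/-- The entries of the array after a stage. -/
def stageE : Expr :=
  .ite (i % 2) 1
    (entryE src posE 0 + mulReE (entryE .w baseE 0) (entryE .w baseE 1)
      (entryE src (posE + hh) 0) (entryE src (posE + hh) 1))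
    (entryE src posE 1 + mulImE (entryE .w baseE 0) (entryE .w baseE 1)
      (entryE src (posE + hh) 0) (entryE src (posE + hh) 1))

/-- Transforms the array at `src` into a new array, whose address becomes `src`. -/
def fftCmd : Cmd :=
  .seq (.set hh (nn / 2)) <| .while 0 hh <| .seq (fill len top stageE) <|
    .seq (.set src top) <| .seq (.set top (top + len)) <| .set hh (hh / 2)

/-- The entries of the pointwise product of two arrays. -/
def prodE : Expr :=
  .ite (i % 2) 1
    (mulReE (entryE xa (i / 2) 0) (entryE xa (i / 2) 1) (entryE src (i / 2) 0) (entryE src (i / 2) 1))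
    (mulImE (entryE xa (i / 2) 0) (entryE xa (i / 2) 1) (entryE src (i / 2) 0) (entryE src (i / 2) 1))

/-- Computes the second transform of the arrays at `xa` and `ya`; its address becomes `src`. -/
def convCmd : Cmd :=
  .seq (.set src xa) <| .seq fftCmd <| .seq (.set xa src) <| .seq (.set src ya) <| .seq fftCmd <|
    .seq (fill len top prodE) <| .seq (.set src top) <| .seq (.set top (top + len)) fftCmd

end expressions

theorem HoldsZ.toC {n p : ℕ} {x : ℕ → ℤ} {s : St} (h : HoldsZ w n p x s) {s' : St}
    (hm : ∀ i < n, s'.mem (p + i) = s.mem (p + i)) : HoldsZ w n p x s' :=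
  fun i hi => (hm i hi).trans (h i hi)

theorem Table.congr {k : ℕ} {s s' : St} (h : Table w k s)
    (hv : ∀ v ∈ [Var.kk, .bk, .big, .nn, .len, .w], s'.var v = s.var v)
    (hm : ∀ a < s.var .top, s'.mem a = s.mem a) (ht : s.var .top ≤ s'.var .top) : Table w k s' := by
  have hw := hv .w (by decide)
  refine ⟨h.toConsts.congr fun v hv' => hv v (by revert hv'; simp; tauto), ?_, ?_⟩
  · rw [hw]
    exact h.tab.toC fun i hi => hm _ (by have := h.le; omega)
  · rw [hw]; exact h.le.trans ht

/-- The bound `hb` on the current array, together with `tableW_norm`, keeps the product within the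
range of the shift; the other address computations stay below `2 ^ w`. -/
theorem eval_stageE {k j sp H m : ℕ} {x : ℕ → ℤ} (hk : 2 ≤ k) (hw : 46 * k + 100 ≤ w)
    (hs : Table w k s) (hsrc : s.var .src = sp) (hH : s.var .hh = H) (hH0 : 0 < H)
    (hN : 2 ^ k = 2 * H * m) (hx : HoldsZ w (2 * 2 ^ k) sp x s) (hi : s.var .i = j)
    (hj : j < 2 * 2 ^ k) (hsp : sp + 2 * 2 ^ k ≤ 2 ^ w) (htop : s.var .top ≤ 2 ^ w)
    (hb : ∀ q < 2 ^ k, ‖toC x q‖ ≤ 2 ^ (2 * half k + 3 * k + 2)) :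
    stageE.eval w s = rep w (stageZ (2 * half k) (2 ^ k) H (tableW k) x j) := by
  obtain ⟨w1, -, -, -, w5⟩ := consts_lt hw
  have hh := half_eq k
  have n2 : 2 % 2 ^ w = 2 := lit_mod (by omega)
  have n1 : 1 % 2 ^ w = 1 := lit_mod (by omega)
  rw [pow_succ] at w5
  obtain ⟨h1, h2, h3, -⟩ := stage_index hH0 (q := j / 2) (m := m) (by omega)
  rw [← hN] at h1 h2 h3
  have hmod : j / 2 % H ≤ j / 2 := Nat.mod_le _ _
  have ebase : baseE.eval w s = j / 2 - j / 2 % H := by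
    simp only [baseE, Expr.eval_sub, Expr.eval_mod, Expr.eval_div, Expr.eval_var, Expr.eval_num, hi,
      hH, n2]
    exact sub_mod hmod (by omega)
  have epos : posE.eval w s = (j / 2 + (j / 2 - j / 2 % H)) % 2 ^ k := by
    simp only [posE, Expr.eval_mod, Expr.eval_add, Expr.eval_div, Expr.eval_var, Expr.eval_num, hi,
      n2, ebase, hs.hnn]
    rw [Nat.mod_eq_of_lt (show j / 2 + (j / 2 - j / 2 % H) < 2 ^ w by omega)]
  have epos2 : (posE + Expr.var .hh).eval w s = (j / 2 + (j / 2 - j / 2 % H)) % 2 ^ k + H := by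
    simp only [Expr.eval_add, Expr.eval_var, epos, hH]
    exact Nat.mod_eq_of_lt (by omega)
  have hwle := hs.le
  have he : j / 2 - j / 2 % H < 2 ^ k := by omega
  have hp : (j / 2 + (j / 2 - j / 2 % H)) % 2 ^ k < 2 ^ k := Nat.mod_lt _ (by positivity)
  have p1 := eval_entryE (r := 0) rfl ebase hs.tab (by omega) (by omega) (by omega)
  have p2 := eval_entryE (r := 1) rfl ebase hs.tab (by omega) (by omega) (by omega)
  have p3 := eval_entryE (r := 0) hsrc epos2 hx (by omega) (by omega) (by omega)
  have p4 := eval_entryE (r := 1) hsrc epos2 hx (by omega) (by omega) (by omega)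
  have p5 := eval_entryE (r := 0) hsrc epos hx (by omega) (by omega) (by omega)
  have p6 := eval_entryE (r := 1) hsrc epos hx (by omega) (by omega) (by omega)
  have na := tableW_norm hk he
  have nb := hb _ h2
  simp only [stageE, Expr.eval_ite, Expr.eval_mod, Expr.eval_var, Expr.eval_num, hi, n2, n1,
    Expr.eval_add, stageZ]
  by_cases hpar : j % 2 = 0
  · rw [if_pos (by omega), if_pos hpar, p5,
      eval_mulReE hs.toConsts p1 p2 p3 p4 na nb (by omega), rep_add]
    rfl
  · rw [if_neg (by omega), if_neg hpar, p6,
      eval_mulImE hs.toConsts p1 p2 p3 p4 na nb (by omega), rep_add]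
    rfl

/-- Each stage writes a new array at `top`, so the stage can be computed by a plain `fill` that
reads the previous array, at the price of `k` arrays of memory. -/
theorem wp_fft {k : ℕ} {x : ℕ → ℤ} (hk : 2 ≤ k) (hw : 46 * k + 100 ≤ w) (hs : Table w k s)
    (hx : HoldsZ w (2 * 2 ^ k) (s.var .src) x s) (hsrc : s.var .src + 2 * 2 ^ k ≤ s.var .top)
    (htop : s.var .top + k * (2 * 2 ^ k) < 2 ^ w)
    (hb : ∀ i ≤ k, ∀ q < 2 ^ k,
      ‖toC (fftZ (2 * half k) k (tableW k) x i) q‖ ≤ 2 ^ (2 * half k + 3 * k + 2))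
    (h : ∀ s' : St, Table w k s' →
      HoldsZ w (2 * 2 ^ k) (s'.var .src) (fftZ (2 * half k) k (tableW k) x k) s' →
      s'.var .src + 2 * 2 ^ k ≤ s'.var .top → s'.var .top = s.var .top + k * (2 * 2 ^ k) →
      (∀ a < s.var .top, s'.mem a = s.mem a) →
      s'.time = s.time + 600 + k * (1800 + 900 * (2 * 2 ^ k)) →
      (∀ v ∉ fftCmd.writes, s'.var v = s.var v) → Q s') :
    wp w fftCmd Q s := by
  suffices wp w fftCmd (fun s' => Table w k s' ∧
      HoldsZ w (2 * 2 ^ k) (s'.var .src) (fftZ (2 * half k) k (tableW k) x k) s' ∧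
      s'.var .src + 2 * 2 ^ k ≤ s'.var .top ∧ s'.var .top = s.var .top + k * (2 * 2 ^ k) ∧
      (∀ a < s.var .top, s'.mem a = s.mem a) ∧
      s'.time = s.time + 600 + k * (1800 + 900 * (2 * 2 ^ k))) s from
    this.frame.mono fun s' ⟨⟨a, b, c, d, e, f⟩, g⟩ => h s' a b c d e f g
  obtain ⟨w1, -, -, -, w5⟩ := consts_lt hw
  have n2 : 2 % 2 ^ w = 2 := lit_mod (by omega)
  refine wp_seq (wp_set (x := 2 ^ k / 2) (by simp [hs.hnn, n2]) ?_)
  -- The stride halves from `2 ^ (k - 1)` to `1` over the `k` stages; it then becomes zero, which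
  -- ends the loop.
  refine wp_while (fun i s' => s'.var .hh = 2 ^ k / 2 ^ (i + 1) ∧ s'.var .src + 2 * 2 ^ k ≤ s'.var .top ∧
    s'.var .top = s.var .top + i * (2 * 2 ^ k) ∧
    HoldsZ w (2 * 2 ^ k) (s'.var .src) (fftZ (2 * half k) k (tableW k) x i) s' ∧
    (∀ a < s.var .top, s'.mem a = s.mem a) ∧
    s'.time = s.time + 300 + i * (1800 + 900 * (2 * 2 ^ k)) ∧
    ∀ v ∉ [Var.i, .src, .top, .hh], s'.var v = s.var v) k ?_ ?_ ?_
  · refine ⟨by simp, by simpa using hsrc, by simp, ?_, by simp, by simp, ?_⟩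
    · simpa [HoldsZ, fftZ] using hx
    · intro v hv
      simp only [List.mem_cons, not_or] at hv
      simp [hv]
  · rintro i hi s1 ⟨a1, a2, a3, a4, a5, a6, a7⟩
    have e1 : 2 ^ k / 2 ^ (i + 1) = 2 ^ (k - 1 - i) := by
      rw [Nat.pow_div (by omega) (by norm_num)]; congr 1; omega
    have e2 : 2 ^ k = 2 * 2 ^ (k - 1 - i) * 2 ^ i := by
      rw [← pow_succ', ← pow_add]; congr 1; omega
    have hle : (i + 1) * (2 * 2 ^ k) ≤ k * (2 * 2 ^ k) := Nat.mul_le_mul_right _ hi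
    rw [add_mul, one_mul] at hle
    have ht1 : Table w k s1 := hs.congr (fun v hv => a7 v (by
      revert hv; revert v; decide)) a5 (by omega)
    rw [e1] at a1
    refine ⟨by simp [a1], wp_seq (wp_fill (nv := 2 * 2 ^ k) (bv := s1.var .top)
      (fun j => rep w (fftZ (2 * half k) k (tableW k) x (i + 1) j)) (by simp [ht1.hlen]) (by simp)
      (by decide) (by decide) (by omega) ?_ ?_)⟩
    · intro j hj s2 g1 g2
      have hmem : ∀ a < s1.var .top, s2.mem a = s1.mem a := fun a ha => by
        rw [g2, blk_of_lt ha]; rfl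
      have hvar : ∀ v ≠ Var.i, s2.var v = s1.var v := fun v hv => by
        rw [g1, Function.update_of_ne hv]; rfl
      refine eval_stageE (sp := s1.var .src) hk hw ?_ (hvar _ (by decide)) ((hvar _ (by decide)).trans a1)
        (by positivity) e2 (a4.toC fun i' hi' => hmem _ (by omega)) (by rw [g1, Function.update_self])
        hj (by omega) (by rw [hvar _ (by decide)]; omega) (hb i (by omega))
      exact ht1.congr (fun v hv => hvar v (by revert hv; revert v; decide)) hmem
        (hvar .top (by decide)).ge
    · have m1 : (s1.var .top + 2 * 2 ^ k) % 2 ^ w = s1.var .top + 2 * 2 ^ k := lit_mod (by omega)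
      refine wp_seq (wp_set (x := s1.var .top) (by simp) ?_)
      refine wp_seq (wp_set (x := s1.var .top + 2 * 2 ^ k) (by simp [ht1.hlen, m1]) ?_)
      refine wp_set (x := 2 ^ (k - 1 - i) / 2) (by simp [a1, n2]) ⟨?_, ?_, ?_, ?_, ?_, ?_, ?_⟩
      · simp only [St.set_var, if_true]
        rw [← e1, Nat.div_div_eq_div_mul, ← pow_succ]
      · simp
      · simp [a3]; ring
      · intro j hj
        simp [blk_add hj]
      · intro a ha
        simp only [St.set_mem, St.fill_mem, St.tick_mem]
        rw [blk_of_lt (by omega), a5 a ha]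
      · simp [a6]; ring
      · intro v hv
        rw [← a7 v hv]
        simp only [List.mem_cons, not_or] at hv
        simp [hv]
  · rintro s1 ⟨a1, a2, a3, a4, a5, a6, a7⟩
    have e1 : 2 ^ k / 2 ^ (k + 1) = 0 := Nat.div_eq_of_lt (Nat.pow_lt_pow_right (by norm_num) (by omega))
    refine ⟨by simp [a1, e1], ?_, a4, a2, a3, a5, by simp [a6]; ring⟩
    exact hs.congr (fun v hv => a7 v (by revert hv; revert v; decide)) a5 (by simp [a3])

end WordRAM

/-! ### The convolution: two transforms, a pointwise product and a third transform. -/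

namespace WordRAM

variable {w : ℕ} {Q : St → Prop} {s : St}

/-- Three transforms allocate `k` arrays each, and the pointwise product one more; this is the
factor `3 * k + 1`. -/
theorem wp_conv {k : ℕ} {x y : ℕ → ℕ} (hk : 2 ≤ k) (hw : 46 * k + 100 ≤ w) (hs : Table w k s)
    (hx1 : ∀ q, x q ≤ 1) (hy1 : ∀ q, y q ≤ 1)
    (hx : HoldsZ w (2 * 2 ^ k) (s.var .xa) (bitsZ (2 * half k) x) s)
    (hy : HoldsZ w (2 * 2 ^ k) (s.var .ya) (bitsZ (2 * half k) y) s)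
    (hxa : s.var .xa + 2 * 2 ^ k ≤ s.var .top) (hya : s.var .ya + 2 * 2 ^ k ≤ s.var .top)
    (htop : s.var .top + (3 * k + 1) * (2 * 2 ^ k) < 2 ^ w)
    (h : ∀ s' : St, Table w k s' → HoldsZ w (2 * 2 ^ k) (s'.var .src) (secondZ k x y k) s' →
      s'.var .src + 2 * 2 ^ k ≤ s'.var .top →
      s'.var .top = s.var .top + (3 * k + 1) * (2 * 2 ^ k) →
      (∀ a < s.var .top, s'.mem a = s.mem a) →
      s'.time = s.time + 3 * (600 + k * (1800 + 900 * (2 * 2 ^ k))) + 900 * (2 * 2 ^ k) + 2100 →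
      (∀ v ∉ convCmd.writes, s'.var v = s.var v) → Q s') :
    wp w convCmd Q s := by
  suffices wp w convCmd (fun s' => Table w k s' ∧
      HoldsZ w (2 * 2 ^ k) (s'.var .src) (secondZ k x y k) s' ∧
      s'.var .src + 2 * 2 ^ k ≤ s'.var .top ∧
      s'.var .top = s.var .top + (3 * k + 1) * (2 * 2 ^ k) ∧
      (∀ a < s.var .top, s'.mem a = s.mem a) ∧
      s'.time = s.time + 3 * (600 + k * (1800 + 900 * (2 * 2 ^ k))) + 900 * (2 * 2 ^ k) + 2100) s from
    this.frame.mono fun s' ⟨⟨a, b, c, d, e, f⟩, g⟩ => h s' a b c d e f g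
  obtain ⟨w1, -, -, -, w5⟩ := consts_lt hw
  have n2 : 2 % 2 ^ w = 2 := lit_mod (by omega)
  have n1 : 1 % 2 ^ w = 1 := lit_mod (by omega)
  rw [add_mul, mul_assoc, one_mul] at htop
  set N2 := 2 * 2 ^ k with hN2
  -- the transform of the first array
  refine wp_seq (wp_set (x := s.var .xa) (by simp) ?_)
  have tA : Table w k (s.set .src (s.var .xa)) := hs.congr (fun v hv => by
    revert hv; revert v; simp) (fun _ _ => rfl) (by simp)
  refine wp_seq (wp_fft (x := bitsZ (2 * half k) x) hk hw tA (fun i hi => by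
      simpa using hx i hi) (by simpa using hxa) (by simp [← hN2]; omega) (fun i hi q hq => forwardZ_norm hk hx1 hi hq) ?_)
  intro s1 t1 v1 l1 p1 m1 c1 f1
  simp only [St.set_var, St.set_mem, St.set_time, reduceCtorEq, if_false, ← hN2] at v1 l1 p1 m1 c1 f1
  have fy := f1 .ya (by decide)
  rw [if_neg (by decide)] at fy
  -- the transform of the second array
  refine wp_seq (wp_set (x := s1.var .src) (by simp) (wp_seq
    (wp_set (x := s.var .ya) (by simp [fy]) ?_)))
  have tB : Table w k ((s1.set .xa (s1.var .src)).set .src (s.var .ya)) :=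
    t1.congr (fun v hv => by revert hv; revert v; simp) (fun _ _ => rfl) (by simp)
  refine wp_seq (wp_fft (x := bitsZ (2 * half k) y) hk hw tB ?_ ?_ ?_
    (fun i hi q hq => forwardZ_norm hk hy1 hi hq) ?_)
  · intro i hi
    simp only [St.set_var, St.set_mem, if_true]
    rw [m1 _ (by omega)]
    exact hy i hi
  · simp [← hN2]; omega
  · simp [← hN2]; omega
  intro s2 t2 v2 l2 p2 m2 c2 f2
  simp only [St.set_var, St.set_mem, St.set_time, reduceCtorEq, if_false, ← hN2] at v2 l2 p2 m2 c2 f2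
  have fx := f2 .xa (by decide)
  rw [if_neg (by decide), if_pos rfl] at fx
  -- the pointwise product
  have hX : HoldsZ w N2 (s1.var .src) (forwardZ k x k) s2 := v1.toC fun i hi => m2 _ (by omega)
  refine wp_seq (wp_fill (nv := N2) (bv := s2.var .top)
    (fun j => rep w (prodZ (2 * half k) (forwardZ k x k) (forwardZ k y k) j)) (by simp [t2.hlen, hN2])
    (by simp) (by decide) (by decide) (by omega) ?_ ?_)
  · intro j hj s3 g1 g2
    have hmem : ∀ a < s2.var .top, s3.mem a = s2.mem a := fun a ha => by rw [g2, blk_of_lt ha]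
    have hvar : ∀ v ≠ Var.i, s3.var v = s2.var v := fun v hv => by
      rw [g1, Function.update_of_ne hv]
    have c3 : Consts k s3 := t2.toConsts.congr fun v hv => hvar v (by revert hv; revert v; decide)
    have hi : s3.var .i = j := by rw [g1, Function.update_self]
    have hX3 := hX.toC (s' := s3) fun i hi => hmem _ (by omega)
    have hY3 := HoldsZ.toC v2 (s' := s3) fun i hi => hmem _ (by omega)
    have eq : ((Expr.var .i) / 2).eval w s3 = j / 2 := by simp [hi, n2]
    have q1 := eval_entryE (r := 0) ((hvar .xa (by decide)).trans fx) eq hX3 (by omega) (by omega) (by omega)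
    have q2 := eval_entryE (r := 1) ((hvar .xa (by decide)).trans fx) eq hX3 (by omega) (by omega) (by omega)
    have q3 := eval_entryE (r := 0) (hvar .src (by decide)) eq hY3 (by omega) (by omega) (by omega)
    have q4 := eval_entryE (r := 1) (hvar .src (by decide)) eq hY3 (by omega) (by omega) (by omega)
    have na := forwardZ_norm hk hx1 le_rfl (q := j / 2) (by omega)
    have nb := forwardZ_norm hk hy1 le_rfl (q := j / 2) (by omega)
    have hh := half_eq k
    simp only [prodE, Expr.eval_ite, Expr.eval_mod, Expr.eval_var, Expr.eval_num, hi, n2, n1, prodZ]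
    by_cases hpar : j % 2 = 0
    · rw [if_pos (by omega), if_pos hpar, eval_mulReE c3 q1 q2 q3 q4 na nb (by omega)]
      rfl
    · rw [if_neg (by omega), if_neg hpar, eval_mulImE c3 q1 q2 q3 q4 na nb (by omega)]
      rfl
  have m3 : (s2.var .top + N2) % 2 ^ w = s2.var .top + N2 := lit_mod (by omega)
  refine wp_seq (wp_set (x := s2.var .top) (by simp) (wp_seq
    (wp_set (x := s2.var .top + N2) (by simp [t2.hlen, ← hN2, m3]) ?_)))
  have tC : Table w k (((s2.fill (s2.var .top) N2 (fun j => rep w (prodZ (2 * half k)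
      (forwardZ k x k) (forwardZ k y k) j))).set .src (s2.var .top)).set .top (s2.var .top + N2)) :=
    t2.congr (fun v hv => by revert hv; revert v; simp) (fun a ha => by
      simp only [St.set_mem, St.fill_mem]; exact blk_of_lt ha) (by simp)
  refine wp_fft (x := prodZ (2 * half k) (forwardZ k x k) (forwardZ k y k)) hk hw tC ?_ ?_ ?_
    (fun i hi q hq => secondZ_norm hk hx1 hy1 hi hq) ?_
  · intro i hi
    have hi' : i < N2 := hi
    simp [blk_add hi']
  · simp [← hN2]
  · simp [← hN2]; omega
  intro s4 t4 v4 l4 p4 m4 c4 f4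
  simp only [St.set_var, St.set_mem, St.set_time, St.fill_mem, St.fill_time, if_true, ← hN2]
    at v4 l4 p4 m4 c4 f4
  refine ⟨t4, v4, l4, ?_, ?_, ?_⟩
  · rw [p4, p2, p1]; ring
  · intro a ha
    rw [m4 a (by omega), blk_of_lt (by omega), m2 a (by omega), m1 a ha]
  · rw [c4, c2, c1]; ring

end WordRAM

/-! ### Nodes: subset sums of lists of values with multiplicities -/

namespace WordRAM

/-- `SubSum l j v`: some `j` elements of the multiset that the list `l` of values with multiplicities
describes have the sum `v`. -/
def SubSum : List (ℕ × ℕ) → ℕ → ℕ → Prop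
  | [], j, v => j = 0 ∧ v = 0
  | p :: l, j, v => ∃ i ≤ p.2, ∃ j' v', SubSum l j' v' ∧ j = i + j' ∧ v = i * p.1 + v'

theorem subSum_append {l₁ l₂ : List (ℕ × ℕ)} {j v : ℕ} : SubSum (l₁ ++ l₂) j v ↔
    ∃ j₁ v₁ j₂ v₂, SubSum l₁ j₁ v₁ ∧ SubSum l₂ j₂ v₂ ∧ j = j₁ + j₂ ∧ v = v₁ + v₂ := by
  induction l₁ generalizing j v with
  | nil =>
    constructor
    · exact fun h => ⟨0, 0, j, v, ⟨rfl, rfl⟩, h, by simp, by simp⟩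
    · rintro ⟨_, _, _, _, ⟨rfl, rfl⟩, h, rfl, rfl⟩
      simpa using h
  | cons p l ih =>
    simp only [List.cons_append, SubSum]
    constructor
    · rintro ⟨i, hi, j', v', h, rfl, rfl⟩
      obtain ⟨j₁, v₁, j₂, v₂, h₁, h₂, rfl, rfl⟩ := ih.mp h
      exact ⟨i + j₁, i * p.1 + v₁, j₂, v₂, ⟨i, hi, j₁, v₁, h₁, rfl, rfl⟩, h₂, by ring, by ring⟩
    · rintro ⟨_, _, j₂, v₂, ⟨i, hi, j₁, v₁, h₁, rfl, rfl⟩, h₂, rfl, rfl⟩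
      exact ⟨i, hi, j₁ + j₂, v₁ + v₂, ih.mpr ⟨j₁, v₁, j₂, v₂, h₁, h₂, rfl, rfl⟩, by ring, by ring⟩

theorem SubSum.mul_le {l : List (ℕ × ℕ)} {j v a : ℕ} (h : SubSum l j v) (ha : ∀ p ∈ l, a ≤ p.1) :
    j * a ≤ v := by
  induction l generalizing j v with
  | nil => obtain ⟨rfl, rfl⟩ := h; simp
  | cons p l ih =>
    obtain ⟨i, hi, j', v', h, rfl, rfl⟩ := h
    have h1 := ih h fun q hq => ha q (by simp [hq])
    have h2 := Nat.mul_le_mul_left i (ha p (by simp))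
    rw [add_mul]; omega

theorem SubSum.le_mul {l : List (ℕ × ℕ)} {j v b : ℕ} (h : SubSum l j v) (hb : ∀ p ∈ l, p.1 ≤ b) :
    v ≤ j * b := by
  induction l generalizing j v with
  | nil => obtain ⟨rfl, rfl⟩ := h; simp
  | cons p l ih =>
    obtain ⟨i, hi, j', v', h, rfl, rfl⟩ := h
    have h1 := ih h fun q hq => hb q (by simp [hq])
    have h2 := Nat.mul_le_mul_left i (hb p (by simp))
    rw [add_mul]; omega

/-- The table `bit`, with header `a`, `b`, `J`, `Z`, represents the sums up to `t` of `l`: the entry at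
`(j, z)` belongs to the sum `z + j * a`. For `g = 1` the row `j` is the number of summands; for `g = 0`
there is one row. -/
structure IsNode (t g : ℕ) (l : List (ℕ × ℕ)) (a b J Z : ℕ) (bit : ℕ → ℕ → ℕ) : Prop where
  g_le : g ≤ 1
  a_zero : g = 0 → a = 0
  a_pos : g = 1 → 1 ≤ a
  mem_le : g = 1 → ∀ p ∈ l, a ≤ p.1 ∧ p.1 ≤ b
  a_le_b : a ≤ b
  b_le : b ≤ t + 1
  J_le : J ≤ t / a
  Z_le : Z ≤ t
  J_le_card : J ≤ (l.map Prod.snd).sum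
  Z_le_sum : g = 0 → Z ≤ (l.map fun p => p.2 * p.1).sum
  Z_le_mul : g = 1 → Z ≤ J * (b - a)
  head : g = 1 → ∃ c, l.head? = some (a, c)
  last : g = 1 → ∃ c, l.getLast? = some (b, c)
  bit_le : ∀ j ≤ J, ∀ z ≤ Z, bit j z ≤ 1
  sound : ∀ j ≤ J, ∀ z ≤ Z, bit j z = 1 → ∃ j', SubSum l j' (z + j * a) ∧ j = g * j'
  complete : ∀ j' v, SubSum l j' v → v ≤ t →
    g * j' ≤ J ∧ ∃ z ≤ Z, z + g * j' * a = v ∧ bit (g * j') z = 1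

theorem IsNode.congr {t g : ℕ} {l : List (ℕ × ℕ)} {a b J Z : ℕ} {bit bit' : ℕ → ℕ → ℕ}
    (h : IsNode t g l a b J Z bit) (hb : ∀ j ≤ J, ∀ z ≤ Z, bit' j z = bit j z) :
    IsNode t g l a b J Z bit' :=
  { h with
    bit_le := fun j hj z hz => by rw [hb j hj z hz]; exact h.bit_le j hj z hz
    sound := fun j hj z hz => by rw [hb j hj z hz]; exact h.sound j hj z hz
    complete := fun j v h1 h2 => by
      obtain ⟨h3, z, hz, h4, h5⟩ := h.complete j v h1 h2
      exact ⟨h3, z, hz, h4, by rw [hb _ h3 z hz]; exact h5⟩ }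

/-- The number of rows of a combined node, less one. -/
def joinJ (t a₁ J₁ J₂ : ℕ) : ℕ := min (J₁ + J₂) (t / a₁)

/-- The number of columns of a combined node, less one. -/
def joinZ (t a₁ b₂ J Z₁ Z₂ : ℕ) : ℕ := min t (if 0 < a₁ then J * (b₂ - a₁) else Z₁ + Z₂)

theorem IsNode.a_le {t g : ℕ} {l₁ l₂ : List (ℕ × ℕ)} {a₁ b₁ J₁ Z₁ a₂ b₂ J₂ Z₂ : ℕ}
    {bit₁ bit₂ : ℕ → ℕ → ℕ} (h₁ : IsNode t g l₁ a₁ b₁ J₁ Z₁ bit₁)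
    (h₂ : IsNode t g l₂ a₂ b₂ J₂ Z₂ bit₂)
    (hs : g = 1 → ∀ p ∈ l₁, ∀ q ∈ l₂, p.1 ≤ q.1) : a₁ ≤ a₂ := by
  rcases (by have := h₁.g_le; omega : g = 0 ∨ g = 1) with hg | hg
  · rw [h₁.a_zero hg, h₂.a_zero hg]
  · obtain ⟨c₁, h3⟩ := h₁.head hg
    obtain ⟨c₂, h4⟩ := h₂.head hg
    exact hs hg _ (List.mem_of_head? h3) _ (List.mem_of_head? h4)

/-- For `g = 1` the columns of the second node are rebased from `a₂` to `a₁`, which shifts row `j₂`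
by `j₂ * (a₂ - a₁)`. All values lie between `a₁` and `b₂`, so sums up to `t` have at most `t / a₁`
summands and excess at most `J * (b₂ - a₁)`. For `g = 0` the base is `0`, and `t / 0 = 0` forces a
single row. Truncation at `t` is harmless because the two parts of a sum up to `t` are themselves at
most `t`. -/
theorem IsNode.join {t g : ℕ} {l₁ l₂ : List (ℕ × ℕ)} {a₁ b₁ J₁ Z₁ a₂ b₂ J₂ Z₂ : ℕ}
    {bit₁ bit₂ bit : ℕ → ℕ → ℕ} (h₁ : IsNode t g l₁ a₁ b₁ J₁ Z₁ bit₁)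
    (h₂ : IsNode t g l₂ a₂ b₂ J₂ Z₂ bit₂)
    (hs : g = 1 → ∀ p ∈ l₁, ∀ q ∈ l₂, p.1 ≤ q.1) {J Z : ℕ} (hJ : J = joinJ t a₁ J₁ J₂)
    (hZ : Z = joinZ t a₁ b₂ J Z₁ Z₂) (hb : ∀ j ≤ J, ∀ z ≤ Z, bit j z ≤ 1)
    (hbit : ∀ j ≤ J, ∀ z ≤ Z, bit j z = 1 ↔ ∃ j₁ ≤ J₁, ∃ z₁ ≤ Z₁, ∃ j₂ ≤ J₂, ∃ z₂ ≤ Z₂,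
      bit₁ j₁ z₁ = 1 ∧ bit₂ j₂ z₂ = 1 ∧ j = j₁ + j₂ ∧ z = z₁ + (z₂ + j₂ * (a₂ - a₁))) :
    IsNode t g (l₁ ++ l₂) a₁ b₂ J Z bit := by
  have ha := h₁.a_le h₂ hs
  have hab := h₂.a_le_b
  have hg01 : g = 0 ∨ g = 1 := by have := h₁.g_le; omega
  have hmem : g = 1 → ∀ p ∈ l₁ ++ l₂, a₁ ≤ p.1 ∧ p.1 ≤ b₂ := by
    intro hg p hp
    rcases List.mem_append.mp hp with hp | hp
    · obtain ⟨c, hc⟩ := h₂.head hg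
      have h3 := hs hg p hp _ (List.mem_of_head? hc)
      exact ⟨(h₁.mem_le hg p hp).1, h3.trans hab⟩
    · have := h₂.mem_le hg p hp
      exact ⟨ha.trans this.1, this.2⟩
  have hmul : ∀ j₂, j₂ * a₂ = j₂ * (a₂ - a₁) + j₂ * a₁ := fun j₂ => by
    rw [← mul_add, Nat.sub_add_cancel ha]
  refine ⟨h₁.g_le, h₁.a_zero, h₁.a_pos, hmem, ha.trans hab, h₂.b_le, ?_, ?_, ?_, ?_, ?_, ?_, ?_, hb,
    ?_, ?_⟩
  · rw [hJ]; exact min_le_right _ _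
  · rw [hZ]; exact min_le_left _ _
  · rw [List.map_append, List.sum_append, hJ]
    exact (min_le_left _ _).trans (add_le_add h₁.J_le_card h₂.J_le_card)
  · intro hg
    rw [List.map_append, List.sum_append, hZ, joinZ, h₁.a_zero hg, if_neg (by omega)]
    exact (min_le_right _ _).trans (add_le_add (h₁.Z_le_sum hg) (h₂.Z_le_sum hg))
  · intro hg
    have := h₁.a_pos hg
    rw [hZ, joinZ, if_pos (by omega)]
    exact min_le_right _ _
  · intro hg
    obtain ⟨c, hc⟩ := h₁.head hg
    exact ⟨c, by rw [List.head?_append, hc]; rfl⟩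
  · intro hg
    obtain ⟨c, hc⟩ := h₂.last hg
    exact ⟨c, by rw [List.getLast?_append, hc]; rfl⟩
  · intro j hj z hz h
    obtain ⟨j₁, hj₁, z₁, hz₁, j₂, hj₂, z₂, hz₂, k₁, k₂, rfl, rfl⟩ := (hbit j hj z hz).mp h
    obtain ⟨i₁, s₁, e₁⟩ := h₁.sound j₁ hj₁ z₁ hz₁ k₁
    obtain ⟨i₂, s₂, e₂⟩ := h₂.sound j₂ hj₂ z₂ hz₂ k₂
    refine ⟨i₁ + i₂, subSum_append.mpr ⟨_, _, _, _, s₁, s₂, rfl, ?_⟩, by rw [e₁, e₂]; ring⟩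
    rw [hmul j₂]; ring
  · intro j' v h hv
    obtain ⟨i₁, v₁, i₂, v₂, s₁, s₂, rfl, rfl⟩ := subSum_append.mp h
    obtain ⟨p₁, z₁, hz₁, e₁, k₁⟩ := h₁.complete i₁ v₁ s₁ (by omega)
    obtain ⟨p₂, z₂, hz₂, e₂, k₂⟩ := h₂.complete i₂ v₂ s₂ (by omega)
    have hJ' : g * (i₁ + i₂) ≤ J := by
      rw [hJ, joinJ, le_min_iff, mul_add]
      refine ⟨add_le_add p₁ p₂, ?_⟩
      rcases hg01 with hg | hg
      · simp [hg]
      · rw [Nat.le_div_iff_mul_le (h₁.a_pos hg), ← mul_add, hg, one_mul]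
        exact (h.mul_le fun p hp => (hmem hg p hp).1).trans hv
    have hsum : z₁ + (z₂ + g * i₂ * (a₂ - a₁)) + g * (i₁ + i₂) * a₁ = v₁ + v₂ := by
      rw [← e₁, ← e₂, hmul (g * i₂)]; ring
    -- For `g = 1`, a sum of `j` values up to `b₂` is at most `j * b₂ = j * (b₂ - a₁) + j * a₁`,
    -- which bounds the excess.
    have hZ' : z₁ + (z₂ + g * i₂ * (a₂ - a₁)) ≤ Z := by
      rw [hZ, joinZ, le_min_iff]
      refine ⟨by omega, ?_⟩
      rcases hg01 with hg | hg
      · rw [h₁.a_zero hg, if_neg (by omega), hg]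
        simp only [zero_mul]; omega
      · rw [if_pos (by have := h₁.a_pos hg; omega)]
        have h3 := h.le_mul fun p hp => (hmem hg p hp).2
        have h4 : (i₁ + i₂) * (b₂ - a₁) ≤ J * (b₂ - a₁) := Nat.mul_le_mul_right _ (by
          rwa [hg, one_mul] at hJ')
        have h5 : (i₁ + i₂) * b₂ = (i₁ + i₂) * (b₂ - a₁) + (i₁ + i₂) * a₁ := by
          rw [← mul_add, Nat.sub_add_cancel (ha.trans hab)]
        rw [hg, one_mul] at hsum
        rw [hg, one_mul] at *
        omega
    refine ⟨hJ', _, hZ', hsum, (hbit _ hJ' _ hZ').mpr ⟨_, p₁, z₁, hz₁, _, p₂, z₂, hz₂, k₁, k₂, ?_,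
      rfl⟩⟩
    ring

/-- The memory below `top` holds a node for `l` at the address `p`. -/
def NodeAt (t g : ℕ) (l : List (ℕ × ℕ)) (p top : ℕ) (mem : ℕ → ℕ) : Prop :=
  p + 4 + (mem (p + 2) + 1) * (mem (p + 3) + 1) ≤ top ∧
  IsNode t g l (mem p) (mem (p + 1)) (mem (p + 2)) (mem (p + 3))
    fun j z => mem (p + 4 + (j * (mem (p + 3) + 1) + z))

theorem cell_lt {j J z Z : ℕ} (hj : j ≤ J) (hz : z ≤ Z) : j * (Z + 1) + z < (J + 1) * (Z + 1) := by
  have : j * (Z + 1) ≤ J * (Z + 1) := Nat.mul_le_mul_right _ hj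
  rw [add_mul J 1]; omega

theorem NodeAt.congr {t g p top top' : ℕ} {l : List (ℕ × ℕ)} {mem mem' : ℕ → ℕ}
    (h : NodeAt t g l p top mem) (hm : ∀ a < top, p ≤ a → mem' a = mem a) (ht : top ≤ top') :
    NodeAt t g l p top' mem' := by
  obtain ⟨h1, h2⟩ := h
  have hpos : 0 < (mem (p + 2) + 1) * (mem (p + 3) + 1) := by positivity
  unfold NodeAt
  rw [hm p (by omega) (by omega), hm (p + 1) (by omega) (by omega), hm (p + 2) (by omega) (by omega),
    hm (p + 3) (by omega) (by omega)]
  refine ⟨by omega, h2.congr fun j hj z hz => hm _ ?_ (by omega)⟩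
  have := cell_lt hj hz
  omega

end WordRAM

/-! ### Packing a table into a sequence and reading the combined table back. -/

namespace WordRAM

variable {w : ℕ} {Q : St → Prop} {s : St}

/-- A table of bits as a sequence of rows of length `D`, the row `j` shifted by `j * δ`; the entries
beyond `Z` are dropped. -/
def packed (D Z δ J₁ Z₁ : ℕ) (bit : ℕ → ℕ → ℕ) (q : ℕ) : ℕ :=
  if J₁ < q / D then 0 else if q % D < q / D * δ then 0 else if Z₁ < q % D - q / D * δ then 0 else
    if Z < q % D then 0 else bit (q / D) (q % D - q / D * δ)

theorem packed_le {D Z δ J₁ Z₁ : ℕ} {bit : ℕ → ℕ → ℕ} (h : ∀ j ≤ J₁, ∀ z ≤ Z₁, bit j z ≤ 1) (q : ℕ) :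
    packed D Z δ J₁ Z₁ bit q ≤ 1 := by
  unfold packed
  split_ifs
  iterate 4 exact zero_le_one
  exact h _ (by omega) _ (by omega)

theorem packed_eq_one {D Z δ J₁ Z₁ : ℕ} {bit : ℕ → ℕ → ℕ} (hD : Z < D) {q : ℕ} :
    packed D Z δ J₁ Z₁ bit q = 1 ↔ ∃ j ≤ J₁, ∃ z ≤ Z₁, z + j * δ ≤ Z ∧ bit j z = 1 ∧
      q = j * D + (z + j * δ) := by
  constructor
  · intro h
    unfold packed at h
    split_ifs at h
    have := Nat.div_add_mod q D
    exact ⟨q / D, by omega, q % D - q / D * δ, by omega, by omega, h, by rw [mul_comm (q / D) D]; omega⟩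
  · rintro ⟨j, hj, z, hz, h1, h2, rfl⟩
    have e1 : (j * D + (z + j * δ)) / D = j := by
      rw [Nat.add_comm, Nat.add_mul_div_right _ _ (by omega), Nat.div_eq_of_lt (by omega), zero_add]
    have e2 : (j * D + (z + j * δ)) % D = z + j * δ := by
      rw [Nat.add_comm, Nat.add_mul_mod_self_right, Nat.mod_eq_of_lt (by omega)]
    unfold packed
    rw [e1, e2, if_neg (by omega), if_neg (by omega), if_neg (by omega), if_neg (by omega),
      Nat.add_sub_cancel]
    exact h2

/-- Kronecker substitution. Two column indices up to `Z` add up to less than the row length `D = 2 *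
Z + 2`, so rows do not run into each other; the length `N` holds all `J₁ + J₂ + 1` rows, so the
cyclic convolution does not wrap around. -/
theorem conv_packed {N D Z δ J₁ Z₁ J₂ Z₂ j z : ℕ} {bit₁ bit₂ : ℕ → ℕ → ℕ} (hD : D = 2 * Z + 2)
    (hN : (J₁ + J₂ + 1) * D ≤ N) (hz : z ≤ Z) :
    (∃ a < N, ∃ b < N, packed D Z 0 J₁ Z₁ bit₁ a = 1 ∧ packed D Z δ J₂ Z₂ bit₂ b = 1 ∧
      (a + b) % N = j * D + z) ↔
    ∃ j₁ ≤ J₁, ∃ z₁ ≤ Z₁, ∃ j₂ ≤ J₂, ∃ z₂ ≤ Z₂, bit₁ j₁ z₁ = 1 ∧ bit₂ j₂ z₂ = 1 ∧ j = j₁ + j₂ ∧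
      z = z₁ + (z₂ + j₂ * δ) := by
  have key : ∀ j₁ ≤ J₁, ∀ j₂ ≤ J₂, ∀ y ≤ 2 * Z, j₁ * D + j₂ * D + y < N := by
    intro j₁ h1 j₂ h2 y hy
    have : (j₁ + j₂) * D ≤ (J₁ + J₂) * D := Nat.mul_le_mul_right _ (by omega)
    rw [add_mul] at this
    rw [add_mul _ 1] at hN
    omega
  constructor
  · rintro ⟨_, -, _, -, ha, hb, hab⟩
    obtain ⟨j₁, hj₁, z₁, hz₁, h1, h2, rfl⟩ := (packed_eq_one (by omega)).mp ha
    obtain ⟨j₂, hj₂, z₂, hz₂, h3, h4, rfl⟩ := (packed_eq_one (by omega)).mp hb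
    have := key j₁ hj₁ j₂ hj₂ (z₁ + (z₂ + j₂ * δ)) (by omega)
    rw [mul_zero, add_zero, Nat.mod_eq_of_lt (by omega)] at hab
    have e : (j₁ + j₂) * D + (z₁ + (z₂ + j₂ * δ)) = j * D + z := by rw [add_mul]; omega
    have hm := congrArg (· % D) e
    have hd := congrArg (· / D) e
    simp only [Nat.mul_add_mod_self_right] at hm
    rw [Nat.mod_eq_of_lt (by omega), Nat.mod_eq_of_lt (by omega)] at hm
    simp only [Nat.add_comm (_ * D)] at hd
    rw [Nat.add_mul_div_right _ _ (by omega), Nat.add_mul_div_right _ _ (by omega),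
      Nat.div_eq_of_lt (by omega), Nat.div_eq_of_lt (by omega)] at hd
    exact ⟨j₁, hj₁, z₁, hz₁, j₂, hj₂, z₂, hz₂, h2, h4, by omega, by omega⟩
  · rintro ⟨j₁, hj₁, z₁, hz₁, j₂, hj₂, z₂, hz₂, h2, h4, rfl, rfl⟩
    have := key j₁ hj₁ j₂ hj₂ (z₁ + (z₂ + j₂ * δ)) (by omega)
    refine ⟨j₁ * D + (z₁ + j₁ * 0), by omega, j₂ * D + (z₂ + j₂ * δ), by omega,
      (packed_eq_one (by omega)).mpr ⟨j₁, hj₁, z₁, hz₁, by omega, h2, rfl⟩,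
      (packed_eq_one (by omega)).mpr ⟨j₂, hj₂, z₂, hz₂, by omega, h4, rfl⟩, ?_⟩
    rw [Nat.mod_eq_of_lt (by omega), add_mul]
    omega

section expressions

open Var

/-- The interleaved fixed-point entries of a packed table. -/
def packE (p jv zv : Var) (e : Expr) : Expr :=
  .ite 0 (i % 2) 0 <| .ite jv (i / 2 / dd) 0 <| .ite (i / 2 % dd) (i / 2 / dd * e) 0 <|
    .ite zv (i / 2 % dd - i / 2 / dd * e) 0 <| .ite zz (i / 2 % dd) 0 <|
      one * .load (p + (4 + (i / 2 / dd * (zv + 1) + (i / 2 % dd - i / 2 / dd * e))))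

/-- The bit of the combined table, from the second transform. -/
def unpackE : Expr :=
  .ite (entryE src ((nn - (i / (zz + 1) * dd + i % (zz + 1))) % nn) 0 + big) (big + .shl 1 (kk - 1)) 0 1

/-- Reads the headers of the nodes at `p1` and `p2` and computes the dimensions of their combination
and of the transform. -/
def dimsCmd : Cmd :=
  .seq (.set a1 (.load p1)) <| .seq (.set j1 (.load (p1 + 2))) <| .seq (.set z1 (.load (p1 + 3))) <|
  .seq (.set a2 (.load p2)) <| .seq (.set b2 (.load (p2 + 1))) <| .seq (.set j2 (.load (p2 + 2))) <|
  .seq (.set z2 (.load (p2 + 3))) <|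
  .seq (.set jj (.ite (t / a1) (j1 + j2) (t / a1) (j1 + j2))) <|
  .seq (.set zz (.ite 0 a1 (jj * (b2 - a1)) (z1 + z2))) <| .seq (.set zz (.ite zz t zz t)) <|
  .seq (.set dd (2 * zz + 2)) <| .seq (.set cap ((j1 + j2 + 1) * dd)) <| .seq (.set k 2) <|
  .seq (.set nn 4) <| .while nn cap <| .seq (.set nn (2 * nn)) (.set k (k + 1))

/-- Combines the nodes at `p1` and `p2` into a new node, whose address becomes `p3`. -/
def combineCmd : Cmd :=
  .seq dimsCmd <| .seq setupCmd <|
  .seq (.set xa top) <| .seq (fill len xa (packE p1 j1 z1 0)) <| .seq (.set top (top + len)) <|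
  .seq (.set ya top) <| .seq (fill len ya (packE p2 j2 z2 (a2 - a1))) <| .seq (.set top (top + len)) <|
  .seq convCmd <|
  .seq (.set p3 top) <| .seq (.store p3 a1) <| .seq (.store (p3 + 1) b2) <|
  .seq (.store (p3 + 2) jj) <| .seq (.store (p3 + 3) zz) <| .seq (.set de (p3 + 4)) <|
  .seq (.set cap ((jj + 1) * (zz + 1))) <| .seq (fill cap de unpackE) (.set top (de + cap))

end expressions

/-- The nested comparisons of `packE` follow the case distinction of `packed`, so each address or
difference is formed only where it is meaningful. -/
theorem eval_packE {p jv zv : Var} {e : Expr} {k N j pv J₁ Z₁ Z D δ t : ℕ} {bit : ℕ → ℕ → ℕ}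
    (hp : s.var p = pv) (hjv : s.var jv = J₁) (hzv : s.var zv = Z₁) (he : e.eval w s = δ)
    (hzz : s.var .zz = Z) (hdd : s.var .dd = D) (hone : s.var .one = 2 ^ (2 * half k))
    (hi : s.var .i = j) (hD : D = 2 * Z + 2)
    (hδ : J₁ * δ ≤ t) (ht : t < 2 ^ w) (hk : 2 ^ (2 * half k) < 2 ^ w) (h2 : 2 < 2 ^ w)
    (hN : pv + 4 + (J₁ + 1) * (Z₁ + 1) ≤ N) (hNw : N < 2 ^ w) (hDw : D < 2 ^ w)
    (hbit : ∀ j ≤ J₁, ∀ z ≤ Z₁, s.mem (pv + 4 + (j * (Z₁ + 1) + z)) = bit j z)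
    (hle : ∀ j ≤ J₁, ∀ z ≤ Z₁, bit j z ≤ 1) :
    (packE p jv zv e).eval w s = rep w (bitsZ (2 * half k) (packed D Z δ J₁ Z₁ bit) j) := by
  have hpos : 1 * 1 ≤ (J₁ + 1) * (Z₁ + 1) := Nat.mul_le_mul (by omega) (by omega)
  have hZle : 1 * (Z₁ + 1) ≤ (J₁ + 1) * (Z₁ + 1) := Nat.mul_le_mul (by omega) (by omega)
  have n2 : 2 % 2 ^ w = 2 := lit_mod (by omega)
  have n1 : 1 % 2 ^ w = 1 := lit_mod (by omega)
  have n4 : 4 % 2 ^ w = 4 := lit_mod (by omega)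
  simp only [packE, Expr.eval_ite, Expr.eval_mod, Expr.eval_var, Expr.eval_num, Expr.eval_zero, hi, n2,
    Expr.eval_div, hjv, hzv, he, hdd, hzz, Expr.eval_mul, Expr.eval_sub, Expr.eval_add, Expr.eval_load,
    n1, n4, hp, hone, Nat.zero_mod]
  unfold bitsZ
  by_cases hpar : j % 2 = 0
  swap
  · rw [if_pos (by omega), if_neg hpar]; simp [rep]
  rw [if_neg (by omega), if_pos hpar]
  unfold packed
  set q := j / 2
  by_cases c1 : J₁ < q / D
  · rw [if_pos c1, if_pos c1]; simp [rep]
  have c1' : q / D ≤ J₁ := by omega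
  rw [if_neg c1, if_neg c1]
  -- The row has already been tested, so its shift is at most `J₁ * δ ≤ t` and does not overflow.
  have hm : q / D * δ ≤ t := (Nat.mul_le_mul_right _ c1').trans hδ
  have hqD : q % D < D := Nat.mod_lt _ (by omega)
  rw [lit_mod (show q / D * δ < 2 ^ w by omega)]
  by_cases c2 : q % D < q / D * δ
  · rw [if_pos c2, if_pos c2]; simp [rep]
  rw [if_neg c2, if_neg c2, sub_mod (by omega) (by omega)]
  by_cases c3 : Z₁ < q % D - q / D * δ
  · rw [if_pos c3, if_pos c3]; simp [rep]
  rw [if_neg c3, if_neg c3]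
  by_cases c4 : Z < q % D
  · rw [if_pos c4, if_pos c4]; simp [rep]
  rw [if_neg c4, if_neg c4]
  have hc := cell_lt c1' (show q % D - q / D * δ ≤ Z₁ by omega)
  rw [lit_mod (show Z₁ + 1 < 2 ^ w by omega), lit_mod (show q / D * (Z₁ + 1) < 2 ^ w by omega),
    lit_mod (show q / D * (Z₁ + 1) + (q % D - q / D * δ) < 2 ^ w by omega),
    lit_mod (show 4 + (q / D * (Z₁ + 1) + (q % D - q / D * δ)) < 2 ^ w by omega),
    lit_mod (show pv + (4 + (q / D * (Z₁ + 1) + (q % D - q / D * δ))) < 2 ^ w by omega),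
    ← add_assoc pv, hbit _ c1' _ (by omega)]
  have hb := hle _ c1' (q % D - q / D * δ) (by omega)
  have hlt : 2 ^ (2 * half k) * bit (q / D) (q % D - q / D * δ) < 2 ^ w :=
    (Nat.mul_le_mul_left _ hb).trans_lt (by rwa [mul_one])
  rw [lit_mod hlt, ← rep_natCast hlt]
  push_cast
  rfl

/-- The bit that the second transform gives for the position `c`. -/
def convBit (k : ℕ) (x y : ℕ → ℕ) (c : ℕ) : ℕ :=
  if 2 ^ (2 * half k - 1) ≤ secondZ k x y k (2 * ((2 ^ k - c) % 2 ^ k)) then 1 else 0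

/-- The sign is handled by adding `big` to both sides of the comparison. The entry is read at `-c`
modulo the length because the last transform is again a forward one. -/
theorem eval_unpackE {k D Z j sp : ℕ} {x y : ℕ → ℕ} (hk : 2 ≤ k) (hw : 46 * k + 100 ≤ w)
    (hs : Consts k s) (hsrc : s.var .src = sp) (hzz : s.var .zz = Z) (hdd : s.var .dd = D)
    (hi : s.var .i = j) (hx : ∀ q, x q ≤ 1) (hy : ∀ q, y q ≤ 1)
    (hc : HoldsZ w (2 * 2 ^ k) sp (secondZ k x y k) s) (hsp : sp + 2 * 2 ^ k ≤ 2 ^ w)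
    (hD : D = 2 * Z + 2) (hDw : D < 2 ^ w) (hj : j / (Z + 1) * D + j % (Z + 1) < 2 ^ k) :
    unpackE.eval w s = convBit k x y (j / (Z + 1) * D + j % (Z + 1)) := by
  obtain ⟨w1, w2, w3, w4, w5⟩ := consts_lt hw
  have hh := half_eq k
  rw [pow_succ] at w5
  have n2 : 2 % 2 ^ w = 2 := lit_mod (by omega)
  have n1 : 1 % 2 ^ w = 1 := lit_mod (by omega)
  obtain ⟨c, hcd⟩ : ∃ c, c = j / (Z + 1) * D + j % (Z + 1) := ⟨_, rfl⟩
  rw [← hcd] at hj ⊢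
  have hq : (2 ^ k - c) % 2 ^ k < 2 ^ k := Nat.mod_lt _ (by positivity)
  have hd : j / (Z + 1) * D ≤ c := by omega
  have ec : ((Expr.var .nn - (Expr.var .i / (Expr.var .zz + 1) * Expr.var .dd +
      Expr.var .i % (Expr.var .zz + 1))) % Expr.var .nn).eval w s = (2 ^ k - c) % 2 ^ k := by
    simp only [Expr.eval_mod, Expr.eval_sub, Expr.eval_add, Expr.eval_mul, Expr.eval_div, Expr.eval_var,
      Expr.eval_num, hs.hnn, hi, hzz, hdd, n1]
    rw [lit_mod (show Z + 1 < 2 ^ w by omega), lit_mod (show j / (Z + 1) * D < 2 ^ w by omega), ← hcd,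
      lit_mod (show c < 2 ^ w by omega), sub_mod hj.le (by omega)]
  have e1 := eval_entryE (r := 0) hsrc ec hc (by omega) hsp (by omega)
  have hn := secondZ_norm hk hx hy le_rfl hq
  have hre : |secondZ k x y k (2 * ((2 ^ k - c) % 2 ^ k))| ≤ 2 ^ (2 * half k + 3 * k + 2) := by
    have h := (Complex.abs_re_le_norm _).trans hn
    simp only [toC, mkC] at h
    exact_mod_cast h
  have hlt : (2 : ℤ) ^ (2 * half k + 3 * k + 2) < 2 ^ (2 * half k + (2 * half k + 6 * k + 6)) :=
    pow_lt_pow_right₀ (by norm_num) (by omega)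
  rw [abs_le] at hre
  have hb2 : 2 * 2 ^ (2 * half k + (2 * half k + 6 * k + 6)) ≤ 2 ^ w := by
    rw [← pow_succ']; exact Nat.pow_le_pow_right (by norm_num) (by omega)
  have ho := rep_offset (w := w) (b := 2 ^ (2 * half k + (2 * half k + 6 * k + 6)))
    (v := secondZ k x y k (2 * ((2 ^ k - c) % 2 ^ k)))
    (by push_cast; linarith) (by push_cast; linarith) hb2
  have h1 : 1 * 2 ^ (2 * half k - 1) % 2 ^ w = 2 ^ (2 * half k - 1) := by
    rw [one_mul]; exact lit_mod (Nat.pow_lt_pow_right (by norm_num) (by omega))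
  have hle : 2 ^ (2 * half k - 1) ≤ 2 ^ (2 * half k + (2 * half k + 6 * k + 6)) :=
    Nat.pow_le_pow_right (by norm_num) (by omega)
  have hne : 2 ^ (2 * half k - 1) ≠ 2 ^ (2 * half k + (2 * half k + 6 * k + 6)) :=
    (Nat.pow_lt_pow_right (by norm_num) (by omega)).ne
  have h2 : (2 ^ (2 * half k + (2 * half k + 6 * k + 6)) + 2 ^ (2 * half k - 1)) % 2 ^ w =
      2 ^ (2 * half k + (2 * half k + 6 * k + 6)) + 2 ^ (2 * half k - 1) := lit_mod (by omega)
  have h3 : (2 * half k + (2 ^ w - 1)) % 2 ^ w = 2 * half k - 1 := sub_mod (by omega) (by omega)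
  unfold convBit
  simp only [unpackE, Expr.eval_ite, Expr.eval_add, Expr.eval_var, Expr.eval_shl, Expr.eval_sub,
    Expr.eval_num, Expr.eval_zero, e1, hs.hkk, hs.hbig, n1, h3, h1, h2, add_zero, Nat.zero_mod] at ho ⊢
  by_cases hcase : (2 : ℤ) ^ (2 * half k - 1) ≤ secondZ k x y k (2 * ((2 ^ k - c) % 2 ^ k))
  · rw [if_pos hcase, if_neg]
    zify
    push_cast at ho
    rw [ho]; linarith
  · rw [if_neg hcase, if_pos]
    zify
    push_cast at ho
    rw [ho]; linarith

end WordRAM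

/-! ### Dimensions of a combined node and of its transform. -/

namespace WordRAM

variable {w : ℕ} {Q : St → Prop} {s : St}

/-- The variables hold the dimensions for combining two nodes. -/
structure Dims (t a₁ J₁ Z₁ a₂ b₂ J₂ Z₂ J Z k : ℕ) (s : St) : Prop where
  ha1 : s.var .a1 = a₁
  hj1 : s.var .j1 = J₁
  hz1 : s.var .z1 = Z₁
  ha2 : s.var .a2 = a₂
  hb2 : s.var .b2 = b₂
  hj2 : s.var .j2 = J₂
  hz2 : s.var .z2 = Z₂
  hjj : s.var .jj = J
  hzz : s.var .zz = Z
  hdd : s.var .dd = 2 * Z + 2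
  hkv : s.var .k = k
  hnn : s.var .nn = 2 ^ k
  two_le : 2 ≤ k
  le : (J₁ + J₂ + 1) * (2 * Z + 2) ≤ 2 ^ k
  ge : 2 ^ k ≤ 2 * ((J₁ + J₂ + 1) * (2 * Z + 2))
  hJ : J = joinJ t a₁ J₁ J₂
  hZ : Z = joinZ t a₁ b₂ J Z₁ Z₂

theorem Dims.congr {t a₁ J₁ Z₁ a₂ b₂ J₂ Z₂ J Z k : ℕ} {s s' : St}
    (h : Dims t a₁ J₁ Z₁ a₂ b₂ J₂ Z₂ J Z k s)
    (hv : ∀ v ∈ [Var.a1, .j1, .z1, .a2, .b2, .j2, .z2, .jj, .zz, .dd, .k, .nn], s'.var v = s.var v) :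
    Dims t a₁ J₁ Z₁ a₂ b₂ J₂ Z₂ J Z k s' :=
  { h with
    ha1 := (hv _ (by decide)).trans h.ha1
    hj1 := (hv _ (by decide)).trans h.hj1
    hz1 := (hv _ (by decide)).trans h.hz1
    ha2 := (hv _ (by decide)).trans h.ha2
    hb2 := (hv _ (by decide)).trans h.hb2
    hj2 := (hv _ (by decide)).trans h.hj2
    hz2 := (hv _ (by decide)).trans h.hz2
    hjj := (hv _ (by decide)).trans h.hjj
    hzz := (hv _ (by decide)).trans h.hzz
    hdd := (hv _ (by decide)).trans h.hdd
    hkv := (hv _ (by decide)).trans h.hkv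
    hnn := (hv _ (by decide)).trans h.hnn }

/-- Division by zero gives zero on the machine as in `ℕ`, so the same code also yields the single
row of nodes with base `0`. The word length leaves room for products quadratic in `t`. -/
theorem wp_dims {t b a₁ J₁ Z₁ a₂ b₂ J₂ Z₂ : ℕ} (ht : s.var .t = t) (htb : t + 1 < 2 ^ b)
    (hw : 100 * b + 200 ≤ w) (hp1 : s.var .p1 + 3 < 2 ^ w) (hp2 : s.var .p2 + 3 < 2 ^ w)
    (ha1 : s.mem (s.var .p1) = a₁) (hj1 : s.mem (s.var .p1 + 2) = J₁)
    (hz1 : s.mem (s.var .p1 + 3) = Z₁) (ha2 : s.mem (s.var .p2) = a₂)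
    (hb2 : s.mem (s.var .p2 + 1) = b₂) (hj2 : s.mem (s.var .p2 + 2) = J₂)
    (hz2 : s.mem (s.var .p2 + 3) = Z₂) (hJ1 : J₁ ≤ t) (hJ2 : J₂ ≤ t) (hZ1 : Z₁ ≤ t) (hZ2 : Z₂ ≤ t)
    (hab : a₁ ≤ b₂) (hbt : b₂ ≤ t + 1)
    (h : ∀ s' : St, ∀ J Z k, Dims t a₁ J₁ Z₁ a₂ b₂ J₂ Z₂ J Z k s' → s'.mem = s.mem →
      s'.time ≤ s.time + (900 * k + 4800) → (∀ v ∉ dimsCmd.writes, s'.var v = s.var v) → Q s') :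
    wp w dimsCmd Q s := by
  suffices wp w dimsCmd (fun s' => ∃ J Z k, Dims t a₁ J₁ Z₁ a₂ b₂ J₂ Z₂ J Z k s' ∧ s'.mem = s.mem ∧
      s'.time ≤ s.time + (900 * k + 4800)) s from
    this.frame.mono fun s' ⟨⟨J, Z, k, a, b, c⟩, d⟩ => h s' J Z k a b c d
  have hbw : 2 ^ (2 * b + 200) ≤ 2 ^ w := Nat.pow_le_pow_right (by norm_num) (by omega)
  have hb2w : (t + 2) * (t + 2) ≤ 2 ^ (2 * b) := by
    rw [two_mul, pow_add]; exact Nat.mul_le_mul (by omega) (by omega)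
  have hlin : t + 2 ≤ (t + 2) * (t + 2) := Nat.le_mul_self _
  have hbig : 1024 * ((t + 2) * (t + 2)) < 2 ^ w := by
    have e : 2 ^ (2 * b + 200) = 2 ^ (2 * b) * 2 ^ 200 := pow_add _ _ _
    have : 0 < 2 ^ (2 * b) := by positivity
    omega
  obtain ⟨J, hJ⟩ : ∃ J, J = joinJ t a₁ J₁ J₂ := ⟨_, rfl⟩
  obtain ⟨Z, hZ⟩ : ∃ Z, Z = joinZ t a₁ b₂ J Z₁ Z₂ := ⟨_, rfl⟩
  have hJt : J ≤ t := by
    rw [hJ]; exact (min_le_right _ _).trans (Nat.div_le_self _ _)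
  have hZt : Z ≤ t := by rw [hZ]; exact min_le_left _ _
  have hmul : J * (b₂ - a₁) ≤ (t + 2) * (t + 2) := Nat.mul_le_mul (by omega) (by omega)
  have hcap : (J₁ + J₂ + 1) * (2 * Z + 2) ≤ 4 * ((t + 2) * (t + 2)) := by
    calc _ ≤ (2 * (t + 2)) * (2 * (t + 2)) := Nat.mul_le_mul (by omega) (by omega)
      _ = _ := by ring
  have n1 : 1 % 2 ^ w = 1 := lit_mod (by omega)
  have n2 : 2 % 2 ^ w = 2 := lit_mod (by omega)
  have n3 : 3 % 2 ^ w = 3 := lit_mod (by omega)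
  have n4 : 4 % 2 ^ w = 4 := lit_mod (by omega)
  have m1 : (s.var .p1 + 2) % 2 ^ w = s.var .p1 + 2 := lit_mod (by omega)
  have m2 : (s.var .p1 + 3) % 2 ^ w = s.var .p1 + 3 := lit_mod hp1
  have m3 : (s.var .p2 + 1) % 2 ^ w = s.var .p2 + 1 := lit_mod (by omega)
  have m4 : (s.var .p2 + 2) % 2 ^ w = s.var .p2 + 2 := lit_mod (by omega)
  have m5 : (s.var .p2 + 3) % 2 ^ w = s.var .p2 + 3 := lit_mod hp2
  have m6 : (J₁ + J₂) % 2 ^ w = J₁ + J₂ := lit_mod (by omega)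
  have m7 : (Z₁ + Z₂) % 2 ^ w = Z₁ + Z₂ := lit_mod (by omega)
  have m8 : (b₂ + (2 ^ w - a₁)) % 2 ^ w = b₂ - a₁ := sub_mod hab (by omega)
  have m9 : J * (b₂ - a₁) % 2 ^ w = J * (b₂ - a₁) := lit_mod (by omega)
  have m10 : 2 * Z % 2 ^ w = 2 * Z := lit_mod (by omega)
  have m11 : (2 * Z + 2) % 2 ^ w = 2 * Z + 2 := lit_mod (by omega)
  have m12 : (J₁ + J₂ + 1) % 2 ^ w = J₁ + J₂ + 1 := lit_mod (by omega)
  have m13 : (J₁ + J₂ + 1) * (2 * Z + 2) % 2 ^ w = (J₁ + J₂ + 1) * (2 * Z + 2) := lit_mod (by omega)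
  obtain ⟨cap, hcapd⟩ : ∃ cap, cap = (J₁ + J₂ + 1) * (2 * Z + 2) := ⟨_, rfl⟩
  -- This keeps `2 ^ k ≤ 2 * cap` true when `k` is raised to its minimum `2`.
  have hcap2 : 2 ≤ cap := by
    have : 1 * 2 ≤ (J₁ + J₂ + 1) * (2 * Z + 2) := Nat.mul_le_mul (by omega) (by omega)
    omega
  refine wp_seq (wp_set (x := a₁) (by simp [ha1]) ?_)
  refine wp_seq (wp_set (x := J₁) (by simp [n2, m1, hj1]) ?_)
  refine wp_seq (wp_set (x := Z₁) (by simp [n3, m2, hz1]) ?_)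
  refine wp_seq (wp_set (x := a₂) (by simp [ha2]) ?_)
  refine wp_seq (wp_set (x := b₂) (by simp [n1, m3, hb2]) ?_)
  refine wp_seq (wp_set (x := J₂) (by simp [n2, m4, hj2]) ?_)
  refine wp_seq (wp_set (x := Z₂) (by simp [n3, m5, hz2]) ?_)
  refine wp_seq (wp_set (x := J) (by
    simp [ht, m6, hJ, joinJ, min_def]; split_ifs <;> omega) ?_)
  obtain ⟨y, hy⟩ : ∃ y, y = if 0 < a₁ then J * (b₂ - a₁) else Z₁ + Z₂ := ⟨_, rfl⟩
  refine wp_seq (wp_set (x := y) (by simp [m7, m8, m9, hy]) ?_)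
  refine wp_seq (wp_set (x := Z) (by
    rw [hZ, joinZ, ← hy]; simp [ht, min_def]; split_ifs <;> omega) ?_)
  refine wp_seq (wp_set (x := 2 * Z + 2) (by simp [n2, m10, m11]) ?_)
  refine wp_seq (wp_set (x := cap) (by simp [n1, m6, m12, m13, hcapd]) ?_)
  refine wp_seq (wp_set (x := 2) (by simp [n2]) (wp_seq (wp_set (x := 4) (by simp [n4]) ?_)))
  -- The length is the least power of two that suffices, but at least `4`, the smallest length for
  -- which the root of unity is constructed.
  obtain ⟨k, hk⟩ : ∃ k, k = max 2 (Nat.clog 2 cap) := ⟨_, rfl⟩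
  have hk2 : 2 ≤ k := by omega
  have hkw : k + 1 ≤ w := by
    have : Nat.clog 2 cap ≤ 2 * b + 2 := Nat.clog_le_of_le_pow (by rw [pow_add]; omega)
    omega
  have hkp : 2 ^ (k + 1) ≤ 2 ^ w := Nat.pow_le_pow_right (by norm_num) hkw
  rw [pow_succ] at hkp
  have hkl : k < 2 ^ k := Nat.lt_two_pow_self
  refine wp_while (fun i s' => Dims t a₁ J₁ Z₁ a₂ b₂ J₂ Z₂ J Z k
      ((s'.set .k k).set .nn (2 ^ k)) ∧ s'.var .cap = cap ∧ s'.var .k = 2 + i ∧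
      s'.var .nn = 2 ^ (2 + i) ∧ s'.mem = s.mem ∧ s'.time = s.time + 4200 + i * 900) (k - 2) ?_ ?_ ?_
  · refine ⟨⟨?_, ?_, ?_, ?_, ?_, ?_, ?_, ?_, ?_, ?_, ?_, ?_, hk2, ?_, ?_, hJ, hZ⟩, ?_, ?_, ?_, ?_, ?_⟩
    iterate 12 simp
    · rw [← hcapd]
      exact (Nat.le_pow_clog (by norm_num) cap).trans (Nat.pow_le_pow_right (by norm_num) (by omega))
    · rw [← hcapd]
      by_cases hc : Nat.clog 2 cap ≤ 2
      · rw [hk, max_eq_left hc]; omega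
      · have h3 : 2 ^ (k - 1) < cap := Nat.pow_lt_of_lt_clog (by omega)
        have h4 : 2 ^ k = 2 * 2 ^ (k - 1) := by rw [← pow_succ', Nat.sub_add_cancel (by omega)]
        omega
    all_goals simp
  · rintro i hi s' ⟨c1, c2, c3, c4, c5, c6⟩
    have hlt : 2 ^ (2 + i) < cap := Nat.pow_lt_of_lt_clog (by omega)
    have hle : 2 ^ (2 + i + 1) ≤ 2 ^ k := Nat.pow_le_pow_right (by norm_num) (by omega)
    have e1 : 2 * 2 ^ (2 + i) = 2 ^ (2 + i + 1) := by rw [pow_succ']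
    refine ⟨by simpa [c4, c2] using hlt, ?_⟩
    refine wp_seq (wp_set (x := 2 ^ (2 + i + 1)) (by
      simp only [Expr.eval_mul, Expr.eval_num, Expr.eval_var, St.tick_var, c4, n2, e1]
      exact lit_mod (by omega)) ?_)
    refine wp_set (x := 2 + i + 1) (by simp [c3, n1]; exact lit_mod (by omega)) ⟨?_, ?_⟩
    · refine c1.congr fun v hv => ?_
      revert hv; revert v; simp
    · simp [c2, c5, c6]; constructor <;> ring
  · rintro s' ⟨c1, c2, c3, c4, c5, c6⟩
    have e1 : 2 + (k - 2) = k := by omega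
    rw [e1] at c3 c4
    refine ⟨?_, J, Z, k, c1.congr fun v hv => ?_, c5, ?_⟩
    · have := c1.le
      rw [← hcapd] at this
      simp [c4, c2, this]
    · revert hv; revert v; simp [c3, c4]
    · simp [c6]; omega

end WordRAM

/-! ### Combining two nodes. -/

namespace WordRAM

variable {w : ℕ} {Q : St → Prop} {s : St}

theorem IsNode.J_le_t {t g a b J Z : ℕ} {l : List (ℕ × ℕ)} {bit : ℕ → ℕ → ℕ}
    (h : IsNode t g l a b J Z bit) : J ≤ t := h.J_le.trans (Nat.div_le_self _ _)

/-- The quantity `2 ^ k * (6 * k + 10)` covers the memory of one combination: the root table and two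
packed arrays take `6 * 2 ^ k` cells, the convolution `(3 * k + 1) * (2 * 2 ^ k)`, and `2 * 2 ^ k`
remain for the result and its header. -/
theorem Dims.lt_pow {t b a₁ J₁ Z₁ a₂ b₂ J₂ Z₂ J Z k : ℕ} (h : Dims t a₁ J₁ Z₁ a₂ b₂ J₂ Z₂ J Z k s)
    (htb : t + 1 < 2 ^ b) (hJ1 : J₁ ≤ t) (hJ2 : J₂ ≤ t) :
    k ≤ 2 * b + 3 ∧ 2 ^ k * (6 * k + 10) ≤ 2 ^ (3 * b + 10) := by
  have hZt : Z ≤ t := by rw [h.hZ]; exact min_le_left _ _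
  have h1 : 2 ^ k ≤ 2 ^ (2 * b + 3) :=
    calc 2 ^ k ≤ 2 * ((J₁ + J₂ + 1) * (2 * Z + 2)) := h.ge
      _ ≤ 2 * ((2 * 2 ^ b) * (2 * 2 ^ b)) :=
        Nat.mul_le_mul_left _ (Nat.mul_le_mul (by omega) (by omega))
      _ = 2 ^ (2 * b + 3) := by ring
  have h2 : k ≤ 2 * b + 3 := (Nat.pow_le_pow_iff_right (by norm_num)).mp h1
  refine ⟨h2, ?_⟩
  have h3 : b < 2 ^ b := Nat.lt_two_pow_self
  calc 2 ^ k * (6 * k + 10) ≤ 2 ^ (2 * b + 3) * (2 ^ b * 64) := Nat.mul_le_mul h1 (by omega)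
    _ = 2 ^ (3 * b + 9) := by
      rw [show 2 ^ (3 * b + 9) = 2 ^ (2 * b + 3) * (2 ^ b * 2 ^ 6) by rw [← pow_add, ← pow_add]; congr 1; ring]
      norm_num
    _ ≤ _ := Nat.pow_le_pow_right (by norm_num) (by omega)

/-- Here `N` is the transform length and `n` the size of the result. As `k ≤ N`, every term is `O(k
* N)`, and `k ≤ 2 * b + 3` and `N ≤ 8 * n` turn this into `O(b * n)`. -/
theorem combine_time {k N n b : ℕ} (hk : 2 ≤ k) (hkN : k ≤ N) (hn : n ≤ N) (hN : N ≤ 8 * n)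
    (hb : k ≤ 2 * b + 3) :
    900 * k + 4800 + (k * (1800 * half k + 3900) + 1800 * half k + 1800 * N + 10000) +
      (3600 * N + 2400) + (3 * (600 + k * (1800 + 900 * (2 * N))) + 900 * (2 * N) + 2100) + 2100 +
      (600 + n * 900) + 300 ≤ 10000000 * ((b + 2) * n) := by
  rw [half_eq]
  have h1 : k * k ≤ k * N := Nat.mul_le_mul_left _ hkN
  have h2 : 2 * N ≤ k * N := Nat.mul_le_mul_right _ hk
  have h3 : k * N ≤ 16 * ((b + 2) * n) :=
    calc k * N ≤ (2 * (b + 2)) * (8 * n) := Nat.mul_le_mul (by omega) hN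
      _ = _ := by ring
  have e1 : k * (1800 * (10 * k + 20) + 3900) = 18000 * (k * k) + 39900 * k := by ring
  have e2 : k * (1800 + 900 * (2 * N)) = 1800 * k + 1800 * (k * N) := by ring
  rw [e1, e2]
  omega

/-- The time is charged to the size of the combined node alone, so that the cost of a level of the
tree is governed by the sizes of its nodes. -/
theorem wp_combine {t g b : ℕ} {l₁ l₂ : List (ℕ × ℕ)} (ht : s.var .t = t) (htb : t + 1 < 2 ^ b)
    (hw : 100 * b + 300 ≤ w) (h₁ : NodeAt t g l₁ (s.var .p1) (s.var .top) s.mem)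
    (h₂ : NodeAt t g l₂ (s.var .p2) (s.var .top) s.mem) (hs : g = 1 → ∀ p ∈ l₁, ∀ q ∈ l₂, p.1 ≤ q.1)
    (htop : s.var .top + 2 ^ (3 * b + 10) < 2 ^ w)
    (h : ∀ s' : St, NodeAt t g (l₁ ++ l₂) (s'.var .p3) (s'.var .top) s'.mem →
      s.var .top ≤ s'.var .p3 → s'.var .top ≤ s.var .top + 2 ^ (3 * b + 10) →
      (∀ a < s.var .top, s'.mem a = s.mem a) →
      s'.time ≤ s.time + 10000000 * ((b + 2) * ((s'.mem (s'.var .p3 + 2) + 1) *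
        (s'.mem (s'.var .p3 + 3) + 1))) →
      (∀ v ∉ combineCmd.writes, s'.var v = s.var v) → Q s') :
    wp w combineCmd Q s := by
  suffices wp w combineCmd (fun s' => NodeAt t g (l₁ ++ l₂) (s'.var .p3) (s'.var .top) s'.mem ∧
      s.var .top ≤ s'.var .p3 ∧ s'.var .top ≤ s.var .top + 2 ^ (3 * b + 10) ∧
      (∀ a < s.var .top, s'.mem a = s.mem a) ∧
      s'.time ≤ s.time + 10000000 * ((b + 2) * ((s'.mem (s'.var .p3 + 2) + 1) *
        (s'.mem (s'.var .p3 + 3) + 1)))) s from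
    this.frame.mono fun s' ⟨⟨a, b, c, d, e⟩, f⟩ => h s' a b c d e f
  have ha := IsNode.a_le h₁.2 h₂.2 hs
  obtain ⟨a₁, ha1⟩ : ∃ a, s.mem (s.var .p1) = a := ⟨_, rfl⟩
  obtain ⟨J₁, hj1⟩ : ∃ a, s.mem (s.var .p1 + 2) = a := ⟨_, rfl⟩
  obtain ⟨Z₁, hz1⟩ : ∃ a, s.mem (s.var .p1 + 3) = a := ⟨_, rfl⟩
  obtain ⟨a₂, ha2⟩ : ∃ a, s.mem (s.var .p2) = a := ⟨_, rfl⟩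
  obtain ⟨b₂, hb2⟩ : ∃ a, s.mem (s.var .p2 + 1) = a := ⟨_, rfl⟩
  obtain ⟨J₂, hj2⟩ : ∃ a, s.mem (s.var .p2 + 2) = a := ⟨_, rfl⟩
  obtain ⟨Z₂, hz2⟩ : ∃ a, s.mem (s.var .p2 + 3) = a := ⟨_, rfl⟩
  obtain ⟨r1, N1⟩ := h₁
  obtain ⟨r2, N2⟩ := h₂
  simp only [ha1, hj1, hz1] at r1 N1
  simp only [ha2, hj2, hz2, hb2] at r2 N2
  rw [ha1, ha2] at ha
  obtain ⟨bit₁, hbit1⟩ : ∃ f : ℕ → ℕ → ℕ, f = fun j z => s.mem (s.var .p1 + 4 + (j * (Z₁ + 1) + z)) :=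
    ⟨_, rfl⟩
  obtain ⟨bit₂, hbit2⟩ : ∃ f : ℕ → ℕ → ℕ, f = fun j z => s.mem (s.var .p2 + 4 + (j * (Z₂ + 1) + z)) :=
    ⟨_, rfl⟩
  rw [← hbit1] at N1
  rw [← hbit2] at N2
  have hbl : 2 ^ b * 2 ^ 2 ≤ 2 ^ w := by
    rw [← pow_add]; exact Nat.pow_le_pow_right (by norm_num) (by omega)
  have hGpos : 0 < 2 ^ (3 * b + 10) := by positivity
  have hpos1 : 0 < (J₁ + 1) * (Z₁ + 1) := by positivity
  have hpos2 : 0 < (J₂ + 1) * (Z₂ + 1) := by positivity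
  refine wp_seq (wp_dims ht htb (by omega) (by omega) (by omega) ha1 hj1 hz1 ha2 hb2 hj2 hz2
    N1.J_le_t N2.J_le_t N1.Z_le N2.Z_le (ha.trans N2.a_le_b) N2.b_le ?_)
  intro s1 J Z k D1 m1 c1 f1
  obtain ⟨hk, hG⟩ := D1.lt_pow htb N1.J_le_t N2.J_le_t
  have hk2 := D1.two_le
  have hwk : 46 * k + 100 ≤ w := by omega
  obtain ⟨w1, w2, -, -, w5⟩ := consts_lt hwk
  rw [pow_succ] at w5
  have hNpos : 4 ≤ 2 ^ k := by
    calc 4 = 2 ^ 2 := by norm_num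
      _ ≤ 2 ^ k := Nat.pow_le_pow_right (by norm_num) hk2
  have hGx : 2 ^ k * (6 * k + 10) = (3 * k + 1) * (2 * 2 ^ k) + 8 * 2 ^ k := by ring
  have t1 : s1.var .top = s.var .top := f1 _ (by decide)
  obtain ⟨N, hN⟩ : ∃ N, N = 2 ^ k := ⟨_, rfl⟩
  have hZt : Z ≤ t := by rw [D1.hZ]; exact min_le_left _ _
  have hcells : (J + 1) * (Z + 1) ≤ N := by
    rw [hN]
    refine le_trans (Nat.mul_le_mul ?_ ?_) D1.le
    · have : J ≤ J₁ + J₂ := by rw [D1.hJ]; exact min_le_left _ _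
      omega
    · omega
  refine wp_seq (wp_setup hk2 hwk D1.hkv D1.hnn (by omega) ?_)
  intro s2 T2 o2 p2 m2 c2 f2
  rw [t1] at p2 m2
  have D2 : Dims t a₁ J₁ Z₁ a₂ b₂ J₂ Z₂ J Z k s2 := D1.congr fun v hv => f2 v (by
    revert hv; revert v; decide)
  have q1 : s2.var .p1 = s.var .p1 := (f2 _ (by decide)).trans (f1 _ (by decide))
  have q2 : s2.var .p2 = s.var .p2 := (f2 _ (by decide)).trans (f1 _ (by decide))
  have hmem2 : ∀ a < s.var .top, s2.mem a = s.mem a := fun a ha => by rw [m2 a ha, m1]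
  have hlen := T2.hlen
  rw [← hN] at hlen p2 hNpos w5 hG hGx
  -- the first array
  obtain ⟨x, hx⟩ : ∃ x, x = packed (2 * Z + 2) Z 0 J₁ Z₁ bit₁ := ⟨_, rfl⟩
  obtain ⟨y, hy⟩ : ∃ y, y = packed (2 * Z + 2) Z (a₂ - a₁) J₂ Z₂ bit₂ := ⟨_, rfl⟩
  have hx1 : ∀ q, x q ≤ 1 := by rw [hx]; exact packed_le N1.bit_le
  have hy1 : ∀ q, y q ≤ 1 := by rw [hy]; exact packed_le N2.bit_le
  refine wp_seq (wp_set (x := s.var .top + 2 * N) (by simp [p2]) ?_)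
  refine wp_seq (wp_fill (nv := 2 * N) (bv := s.var .top + 2 * N)
    (fun i => rep w (bitsZ (2 * half k) x i)) (by simp [hlen]) (by simp) (by decide) (by decide)
    (by omega) ?_ ?_)
  · intro j hj s3 g1 g2
    have hvar : ∀ v, v ≠ .i → v ≠ .xa → s3.var v = s2.var v := fun v h1 h2 => by
      rw [g1, Function.update_of_ne h1]; simp [h2]
    rw [hx]
    refine eval_packE (t := t) (N := s.var .top)
      ((hvar .p1 (by decide) (by decide)).trans q1)
      ((hvar .j1 (by decide) (by decide)).trans D2.hj1)
      ((hvar .z1 (by decide) (by decide)).trans D2.hz1) (by simp)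
      ((hvar .zz (by decide) (by decide)).trans D2.hzz)
      ((hvar .dd (by decide) (by decide)).trans D2.hdd)
      ((hvar .one (by decide) (by decide)).trans o2) (by rw [g1, Function.update_self]) rfl (by omega)
      (by omega) w2 (by omega) r1 (by omega) (by omega) ?_ N1.bit_le
    intro j hj z hz
    have hc := cell_lt hj hz
    rw [g2, blk_of_lt (by omega)]
    simp only [St.set_mem]
    rw [hmem2 _ (by omega), hbit1]
  refine wp_seq (wp_set (x := s.var .top + 4 * N) (by
    simp [p2, hlen]
    rw [lit_mod (by omega)]
    omega) ?_)
  refine wp_seq (wp_set (x := s.var .top + 4 * N) (by simp) ?_)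
  refine wp_seq (wp_fill (nv := 2 * N) (bv := s.var .top + 4 * N)
    (fun i => rep w (bitsZ (2 * half k) y i)) (by simp [hlen]) (by simp) (by decide) (by decide)
    (by omega) ?_ ?_)
  · intro j hj s3 g1 g2
    have hvar : ∀ v, v ≠ .i → v ≠ .xa → v ≠ .ya → v ≠ .top → s3.var v = s2.var v :=
      fun v h1 h2 h3 h4 => by rw [g1, Function.update_of_ne h1]; simp [h1, h2, h3, h4]
    have e1 : ((Expr.var .a2) - (Expr.var .a1)).eval w s3 = a₂ - a₁ := by
      have hab := N2.a_le_b
      have hbt := N2.b_le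
      simp only [Expr.eval_sub, Expr.eval_var]
      rw [hvar .a2 (by decide) (by decide) (by decide) (by decide), D2.ha2,
        hvar .a1 (by decide) (by decide) (by decide) (by decide), D2.ha1]
      exact sub_mod ha (by omega)
    -- At most `t / a₂` rows, each shifted by at most `a₂` more than the previous one.
    have hδ : J₂ * (a₂ - a₁) ≤ t := (Nat.mul_le_mul N2.J_le (Nat.sub_le _ _)).trans
      (Nat.div_mul_le_self _ _)
    rw [hy]
    refine eval_packE (t := t) (N := s.var .top)
      ((hvar .p2 (by decide) (by decide) (by decide) (by decide)).trans q2)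
      ((hvar .j2 (by decide) (by decide) (by decide) (by decide)).trans D2.hj2)
      ((hvar .z2 (by decide) (by decide) (by decide) (by decide)).trans D2.hz2) e1
      ((hvar .zz (by decide) (by decide) (by decide) (by decide)).trans D2.hzz)
      ((hvar .dd (by decide) (by decide) (by decide) (by decide)).trans D2.hdd)
      ((hvar .one (by decide) (by decide) (by decide) (by decide)).trans o2)
      (by rw [g1, Function.update_self]) rfl hδ
      (by omega) w2 (by omega) r2 (by omega) (by omega) ?_ N2.bit_le
    intro j hj z hz
    have hc := cell_lt hj hz
    rw [g2, blk_of_lt (by omega)]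
    simp only [St.set_mem, St.fill_mem]
    rw [blk_of_lt (by omega), hmem2 _ (by omega), hbit2]
  refine wp_seq (wp_set (x := s.var .top + 6 * N) (by
    simp [hlen]
    rw [lit_mod (by omega)]
    omega) ?_)
  obtain ⟨s4, hs4⟩ : ∃ s4, s4 = ((((((s2.set .xa (s.var .top + 2 * N)).fill (s.var .top + 2 * N)
    (2 * N) (fun i => rep w (bitsZ (2 * half k) x i))).set .top (s.var .top + 4 * N)).set .ya
    (s.var .top + 4 * N)).fill (s.var .top + 4 * N) (2 * N) (fun i => rep w (bitsZ (2 * half k) y i))).set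
    .top (s.var .top + 6 * N)) := ⟨_, rfl⟩
  rw [← hs4]
  have xa4 : s4.var .xa = s.var .top + 2 * N := by simp [hs4]
  have ya4 : s4.var .ya = s.var .top + 4 * N := by simp [hs4]
  have top4 : s4.var .top = s.var .top + 6 * N := by simp [hs4]
  have time4 : s4.time = s2.time + (3600 * N + 2400) := by simp [hs4]; ring
  have mem4 : ∀ a < s.var .top + 2 * N, s4.mem a = s2.mem a := by
    intro a ha
    simp only [hs4, St.set_mem, St.fill_mem]
    rw [blk_of_lt (by omega), blk_of_lt (by omega)]
  have var4 : ∀ v, v ≠ .i → v ≠ .xa → v ≠ .ya → v ≠ .top → s4.var v = s2.var v :=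
    fun v h1 h2 h3 h4 => by rw [hs4]; simp [h1, h2, h3, h4]
  have X4 : HoldsZ w (2 * 2 ^ k) (s4.var .xa) (bitsZ (2 * half k) x) s4 := by
    intro i hi
    rw [← hN] at hi
    rw [xa4, hs4]
    simp only [St.set_mem, St.fill_mem]
    rw [blk_of_lt (by omega), blk_add hi]
  have Y4 : HoldsZ w (2 * 2 ^ k) (s4.var .ya) (bitsZ (2 * half k) y) s4 := by
    intro i hi
    rw [← hN] at hi
    rw [ya4, hs4]
    simp only [St.set_mem, St.fill_mem]
    rw [blk_add hi]
  have T4 : Table w k s4 := T2.congr (fun v hv => by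
    apply var4 <;> (rintro rfl; revert hv; decide)) (fun a ha => mem4 a (by omega)) (by omega)
  clear hs4
  refine wp_seq (wp_conv hk2 hwk T4 hx1 hy1 X4 Y4 (by rw [← hN]; omega) (by rw [← hN]; omega)
    (by rw [← hN]; omega) ?_)
  intro s5 T5 src5 src5' top5 m5 c5 f5
  rw [top4, ← hN] at top5
  rw [← hN] at src5'
  have D5 : Dims t a₁ J₁ Z₁ a₂ b₂ J₂ Z₂ J Z k s5 := D2.congr fun v hv => (f5 v (by
    revert hv; revert v; decide)).trans (by apply var4 <;> (rintro rfl; revert hv; decide))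
  have mem5 : ∀ a < s.var .top, s5.mem a = s.mem a := fun a ha => by
    rw [m5 a (by omega), mem4 a (by omega), hmem2 a ha]
  obtain ⟨P, hP⟩ : ∃ P, P = s5.var .top := ⟨_, rfl⟩
  rw [← hP] at top5 src5'
  have hPw : P + 4 + N < 2 ^ w := by omega
  clear hbit1 hbit2 mem4 var4
  obtain ⟨s6, hs6⟩ : ∃ s6, s6 = ((((((s5.set .p3 P).put P a₁).put (P + 1) b₂).put (P + 2) J).put
    (P + 3) Z).set .de (P + 4)).set .cap ((J + 1) * (Z + 1)) := ⟨_, rfl⟩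
  have n1 : 1 % 2 ^ w = 1 := lit_mod (by omega)
  have n2 : 2 % 2 ^ w = 2 := lit_mod (by omega)
  have n3 : 3 % 2 ^ w = 3 := lit_mod (by omega)
  have n4 : 4 % 2 ^ w = 4 := lit_mod (by omega)
  have hcpos : 0 < (J + 1) * (Z + 1) := by positivity
  have hJc : (J + 1) * 1 ≤ (J + 1) * (Z + 1) := Nat.mul_le_mul_left _ (by omega)
  have hZc : 1 * (Z + 1) ≤ (J + 1) * (Z + 1) := Nat.mul_le_mul_right _ (by omega)
  refine wp_seq (wp_set (x := P) (by simp [hP]) ?_)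
  refine wp_seq (wp_store (x := P) (y := a₁) (by simp) (by simp [D5.ha1]) ?_)
  refine wp_seq (wp_store (x := P + 1) (y := b₂) (by simp [n1]; exact lit_mod (by omega))
    (by simp [D5.hb2]) ?_)
  refine wp_seq (wp_store (x := P + 2) (y := J) (by simp [n2]; exact lit_mod (by omega))
    (by simp [D5.hjj]) ?_)
  refine wp_seq (wp_store (x := P + 3) (y := Z) (by simp [n3]; exact lit_mod (by omega))
    (by simp [D5.hzz]) ?_)
  refine wp_seq (wp_set (x := P + 4) (by simp [n4]; exact lit_mod (by omega)) ?_)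
  refine wp_seq (wp_set (x := (J + 1) * (Z + 1)) (by
    simp [D5.hjj, D5.hzz, n1]
    exact lit_mod (by omega)) ?_)
  rw [← hs6]
  have mem6 : ∀ a < P, s6.mem a = s5.mem a := fun a ha => by
    rw [hs6]; simp only [St.set_mem, St.put_mem]
    rw [Function.update_of_ne (by omega), Function.update_of_ne (by omega),
      Function.update_of_ne (by omega), Function.update_of_ne (by omega)]
  have h60 : s6.mem P = a₁ := by rw [hs6]; simp [Function.update_apply]
  have h61 : s6.mem (P + 1) = b₂ := by rw [hs6]; simp [Function.update_apply]
  have h62 : s6.mem (P + 2) = J := by rw [hs6]; simp [Function.update_apply]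
  have h63 : s6.mem (P + 3) = Z := by rw [hs6]; simp [Function.update_apply]
  have time6 : s6.time = s5.time + 2100 := by rw [hs6]; simp
  have var6 : ∀ v, v ≠ .p3 → v ≠ .de → v ≠ .cap → s6.var v = s5.var v := fun v h1 h2 h3 => by
    rw [hs6]; simp [h1, h2, h3]
  have p36 : s6.var .p3 = P := by simp [hs6]
  have de6 : s6.var .de = P + 4 := by simp [hs6]
  have cap6 : s6.var .cap = (J + 1) * (Z + 1) := by simp [hs6]
  clear hs6
  refine wp_seq (wp_fill (nv := (J + 1) * (Z + 1)) (bv := P + 4)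
    (fun i => convBit k x y (i / (Z + 1) * (2 * Z + 2) + i % (Z + 1))) cap6 de6
    (by decide) (by decide) (by omega) ?_ ?_)
  · intro j hj s7 g1 g2
    have hvar : ∀ v, v ≠ .i → v ≠ .p3 → v ≠ .de → v ≠ .cap → s7.var v = s5.var v :=
      fun v h1 h2 h3 h4 => by rw [g1, Function.update_of_ne h1, var6 v h2 h3 h4]
    refine eval_unpackE hk2 hwk (T5.toConsts.congr fun v hv => ?_)
      (hvar .src (by decide) (by decide) (by decide) (by decide))
      ((hvar .zz (by decide) (by decide) (by decide) (by decide)).trans D5.hzz)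
      ((hvar .dd (by decide) (by decide) (by decide) (by decide)).trans D5.hdd)
      (by rw [g1, Function.update_self]) hx1 hy1 (src5.toC fun i hi => ?_) (by omega) rfl (by omega) ?_
    · apply hvar <;> (rintro rfl; revert hv; decide)
    · rw [← hN] at hi
      rw [g2, blk_of_lt (by omega), mem6 _ (by omega)]
    · refine lt_of_lt_of_le ?_ D1.le
      have e1 : j / (Z + 1) ≤ J := by
        have : j / (Z + 1) < J + 1 := (Nat.div_lt_iff_lt_mul (by omega)).mpr hj
        omega
      have e2 : j % (Z + 1) < Z + 1 := Nat.mod_lt _ (by omega)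
      have e3 : J ≤ J₁ + J₂ := by rw [D1.hJ]; exact min_le_left _ _
      have e4 : j / (Z + 1) * (2 * Z + 2) ≤ (J₁ + J₂) * (2 * Z + 2) :=
        Nat.mul_le_mul_right _ (e1.trans e3)
      rw [add_mul (J₁ + J₂) 1]
      omega
  refine wp_set (x := P + 4 + (J + 1) * (Z + 1)) (by
    simp [de6, cap6]; exact lit_mod (by omega)) ?_
  have memf : ∀ a < P + 4, blk s6.mem (P + 4) ((J + 1) * (Z + 1)) (fun i => convBit k x y
      (i / (Z + 1) * (2 * Z + 2) + i % (Z + 1))) a = s6.mem a := fun a ha => blk_of_lt ha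
  refine ⟨?_, ?_, ?_, ?_, ?_⟩
  · simp only [St.set_var, St.fill_var, St.set_mem, St.fill_mem, reduceCtorEq, if_false, p36, if_true]
    unfold NodeAt
    rw [memf P (by omega), memf (P + 1) (by omega), memf (P + 2) (by omega), memf (P + 3) (by omega),
      h60, h61, h62, h63]
    refine ⟨le_rfl, N1.join N2 hs D1.hJ D1.hZ ?_ ?_⟩
    · intro j hj z hz
      rw [blk_add (cell_lt hj hz)]
      unfold convBit
      split_ifs <;> simp
    · intro j hj z hz
      have e0 := cell_lt hj hz
      have e1 : (j * (Z + 1) + z) / (Z + 1) = j := by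
        rw [Nat.add_comm, Nat.add_mul_div_right _ _ (by omega), Nat.div_eq_of_lt (by omega), zero_add]
      have e2 : (j * (Z + 1) + z) % (Z + 1) = z := by
        rw [Nat.add_comm, Nat.add_mul_mod_self_right, Nat.mod_eq_of_lt (by omega)]
      have e3 : J ≤ J₁ + J₂ := by rw [D1.hJ]; exact min_le_left _ _
      have e4 : j * (2 * Z + 2) ≤ (J₁ + J₂) * (2 * Z + 2) := Nat.mul_le_mul_right _ (hj.trans e3)
      have e5 := D1.le
      rw [add_mul (J₁ + J₂) 1] at e5
      rw [blk_add e0, e1, e2, ← conv_packed (N := 2 ^ k) rfl D1.le hz, ← hx, ← hy,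
        ← secondZ_correct hk2 hx1 hy1 (by omega)]
      unfold convBit
      split_ifs with hif <;> simp [hif]
  · simp [p36]; omega
  · simp; omega
  · intro a ha
    simp only [St.set_mem, St.fill_mem]
    rw [memf a (by omega), mem6 a (by omega), mem5 a ha]
  · simp only [St.set_var, St.fill_var, St.set_mem, St.fill_mem, reduceCtorEq, if_false, p36,
      St.set_time, St.fill_time]
    rw [memf (P + 2) (by omega), memf (P + 3) (by omega), h62, h63]
    -- Even when the number of rows is cut off at `t / a₁`, the padded arrays are only a constant
    -- factor larger than the result, since `J₁` and `J₂` are both at most `t / a₁`.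
    have hJJ : J₁ + J₂ + 1 ≤ 2 * (J + 1) := by
      have e1 : J₁ ≤ t / a₁ := N1.J_le
      have e2 : J₂ ≤ t / a₁ := by
        rcases Nat.eq_zero_or_pos a₁ with h0 | h0
        · have hg : g = 0 := by
            by_contra hg
            have := N1.a_pos (by have := N1.g_le; omega)
            omega
          have := N2.J_le
          rw [N2.a_zero hg] at this
          rwa [h0]
        · exact N2.J_le.trans (Nat.div_le_div_left ha h0)
      have e3 := D1.hJ
      unfold joinJ at e3
      omega
    have hNc : N ≤ 8 * ((J + 1) * (Z + 1)) :=
      calc N ≤ 2 * ((J₁ + J₂ + 1) * (2 * Z + 2)) := hN ▸ D1.ge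
        _ ≤ 2 * ((2 * (J + 1)) * (2 * Z + 2)) := Nat.mul_le_mul_left _ (Nat.mul_le_mul_right _ hJJ)
        _ = _ := by ring
    have hkN : k ≤ N := by rw [hN]; exact Nat.lt_two_pow_self.le
    rw [← hN] at c2 c5
    have := combine_time hk2 hkN hcells hNc hk
    omega

end WordRAM

/-! ### Leaves: nodes for a single value. -/

namespace WordRAM

variable {w : ℕ} {Q : St → Prop} {s : St}

section expressions

open Var

/-- Creates a node for the value `x` with multiplicity `c`, at the address `pt`. -/
def leafCmd : Cmd :=
  .seq (.set pt top) <| .seq (.store pt (.ite 0 g x 0)) <| .seq (.store (pt + 1) x) <|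
  .seq (.set jj (.ite 0 g (.ite c (t / x) c (t / x)) 0)) <|
  .seq (.set zz (.ite 0 g 0 (.ite (c * x) t (c * x) t))) <|
  .seq (.store (pt + 2) jj) <| .seq (.store (pt + 3) zz) <| .seq (.set q (.ite 0 g 1 x)) <|
  .seq (.set de (pt + 4)) <| .seq (.set cap ((jj + 1) * (zz + 1))) <|
  .seq (fill cap de (.ite (i % q) 1 1 0)) (.set top (de + cap))

end expressions

theorem subSum_singleton {x c j v : ℕ} : SubSum [(x, c)] j v ↔ j ≤ c ∧ v = j * x := by
  constructor
  · rintro ⟨i, hi, _, _, ⟨rfl, rfl⟩, rfl, rfl⟩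
    exact ⟨hi, by simp⟩
  · rintro ⟨h, rfl⟩
    exact ⟨j, h, 0, 0, ⟨rfl, rfl⟩, rfl, rfl⟩

/-- In the single row the positions that are set are the multiples of `x`. The value may be `t + 1`,
which is used with multiplicity zero as a sentinel. -/
theorem isNode_small {t x c : ℕ} (hx : 1 ≤ x) (hxt : x ≤ t + 1) {bit : ℕ → ℕ → ℕ}
    (hb : ∀ z ≤ min (c * x) t, bit 0 z = if z % x < 1 then 1 else 0) :
    IsNode t 0 [(x, c)] 0 x 0 (min (c * x) t) bit := by
  refine ⟨by simp, by simp, by simp, by simp, by simp, hxt, by simp, by simp, by simp, by simp, by simp,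
    by simp, by simp, ?_, ?_, ?_⟩
  · intro j hj z hz
    obtain rfl : j = 0 := by omega
    rw [hb z hz]; split_ifs <;> simp
  · intro j hj z hz h
    obtain rfl : j = 0 := by omega
    rw [hb z hz] at h
    split_ifs at h with h0
    have h1 := Nat.div_add_mod z x
    refine ⟨z / x, subSum_singleton.mpr ⟨?_, ?_⟩, by simp⟩
    · exact Nat.div_le_of_le_mul (by rw [mul_comm]; omega)
    · rw [mul_comm (z / x)]; omega
  · intro j v h hv
    obtain ⟨h1, rfl⟩ := subSum_singleton.mp h
    have h2 : j * x ≤ min (c * x) t := le_min (Nat.mul_le_mul_right _ h1) hv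
    refine ⟨by simp, j * x, h2, by simp, ?_⟩
    rw [zero_mul, hb _ h2, if_pos (by simp)]

/-- All summands equal the base, so the excess is zero: one column with all bits set. -/
theorem isNode_large {t x c : ℕ} (hx : 1 ≤ x) (hxt : x ≤ t + 1) {bit : ℕ → ℕ → ℕ}
    (hb : ∀ j ≤ min c (t / x), bit j 0 = 1) :
    IsNode t 1 [(x, c)] x x (min c (t / x)) 0 bit := by
  refine ⟨by simp, by simp, fun _ => hx, by simp, le_rfl, hxt, by simp, by simp, by simp, by simp,
    by simp, by simp, by simp, ?_, ?_, ?_⟩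
  · intro j hj z hz
    obtain rfl : z = 0 := by omega
    rw [hb j hj]
  · intro j hj z hz h
    obtain rfl : z = 0 := by omega
    exact ⟨j, subSum_singleton.mpr ⟨by omega, by simp⟩, by simp⟩
  · intro j v h hv
    obtain ⟨h1, rfl⟩ := subSum_singleton.mp h
    have h2 : j ≤ min c (t / x) := le_min h1 ((Nat.le_div_iff_mul_le hx).mpr hv)
    rw [one_mul]
    exact ⟨h2, 0, le_rfl, by simp, hb _ h2⟩

theorem wp_leaf {t g x c b : ℕ} (ht : s.var .t = t) (hg : s.var .g = g) (hg1 : g ≤ 1)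
    (hxv : s.var .x = x) (hcv : s.var .c = c) (hx : 1 ≤ x) (hxt : x ≤ t + 1) (hc : c ≤ 2)
    (htb : t + 1 < 2 ^ b) (hw : 100 * b + 300 ≤ w) (htop : s.var .top + t + 5 < 2 ^ w)
    (h : ∀ s' : St, NodeAt t g [(x, c)] (s.var .top) (s'.var .top) s'.mem →
      s'.var .pt = s.var .top → s.var .top ≤ s'.var .top → s'.var .top ≤ s.var .top + t + 5 →
      (∀ a < s.var .top, s'.mem a = s.mem a) →
      s'.time ≤ s.time + (6000 + 900 * if 0 < g then c else c * x) →
      (∀ v ∉ leafCmd.writes, s'.var v = s.var v) → Q s') :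
    wp w leafCmd Q s := by
  suffices wp w leafCmd (fun s' => NodeAt t g [(x, c)] (s.var .top) (s'.var .top) s'.mem ∧
      s'.var .pt = s.var .top ∧ s.var .top ≤ s'.var .top ∧ s'.var .top ≤ s.var .top + t + 5 ∧
      (∀ a < s.var .top, s'.mem a = s.mem a) ∧
      s'.time ≤ s.time + (6000 + 900 * if 0 < g then c else c * x)) s from
    this.frame.mono fun s' ⟨⟨a, b, c, d, e, f⟩, k⟩ => h s' a b c d e f k
  have hbl : 2 ^ b * 2 ^ 2 ≤ 2 ^ w := by
    rw [← pow_add]; exact Nat.pow_le_pow_right (by norm_num) (by omega)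
  have n1 : 1 % 2 ^ w = 1 := lit_mod (by omega)
  have n2 : 2 % 2 ^ w = 2 := lit_mod (by omega)
  have n3 : 3 % 2 ^ w = 3 := lit_mod (by omega)
  have n4 : 4 % 2 ^ w = 4 := lit_mod (by omega)
  have hcx : c * x ≤ 2 * x := Nat.mul_le_mul_right _ hc
  have m1 : c * x % 2 ^ w = c * x := lit_mod (by omega)
  obtain ⟨P, hP⟩ : ∃ P, P = s.var .top := ⟨_, rfl⟩
  rw [← hP] at htop ⊢
  obtain ⟨J, hJ⟩ : ∃ J, J = if 0 < g then min c (t / x) else 0 := ⟨_, rfl⟩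
  obtain ⟨Z, hZ⟩ : ∃ Z, Z = if 0 < g then 0 else min (c * x) t := ⟨_, rfl⟩
  obtain ⟨n, hn⟩ : ∃ n, n = (J + 1) * (Z + 1) := ⟨_, rfl⟩
  have htx : t / x ≤ t := Nat.div_le_self _ _
  have hnt : n ≤ t + 1 ∧ J ≤ t ∧ Z ≤ t ∧ n ≤ (if 0 < g then c else c * x) + 1 := by
    by_cases hg0 : 0 < g
    · rw [if_pos hg0] at *
      rw [hZ, Nat.zero_add, mul_one] at hn
      omega
    · rw [if_neg hg0] at *
      rw [hJ, Nat.zero_add, one_mul] at hn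
      omega
  obtain ⟨hn1, hJt, hZt, hn2⟩ := hnt
  refine wp_seq (wp_set (x := P) (by simp [hP]) ?_)
  refine wp_seq (wp_store (x := P) (y := if 0 < g then x else 0) (by simp) (by simp [hg, hxv]) ?_)
  refine wp_seq (wp_store (x := P + 1) (y := x) (by simp [n1]; exact lit_mod (by omega))
    (by simp [hxv]) ?_)
  refine wp_seq (wp_set (x := J) (by
    simp [hg, hxv, hcv, ht, hJ, min_def]; split_ifs <;> omega) ?_)
  refine wp_seq (wp_set (x := Z) (by
    simp [hg, hxv, hcv, ht, hZ, m1, min_def]; split_ifs <;> omega) ?_)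
  refine wp_seq (wp_store (x := P + 2) (y := J) (by simp [n2]; exact lit_mod (by omega))
    (by simp) ?_)
  refine wp_seq (wp_store (x := P + 3) (y := Z) (by simp [n3]; exact lit_mod (by omega))
    (by simp) ?_)
  refine wp_seq (wp_set (x := if 0 < g then 1 else x) (by simp [hg, hxv, n1]) ?_)
  refine wp_seq (wp_set (x := P + 4) (by simp [n4]; exact lit_mod (by omega)) ?_)
  refine wp_seq (wp_set (x := n) (by
    simp [n1, hn]
    exact lit_mod (by omega)) ?_)
  refine wp_seq (wp_fill (nv := n) (bv := P + 4)
    (fun i => if i % (if 0 < g then 1 else x) < 1 then 1 else 0) (by simp) (by simp)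
    (by decide) (by decide) (by omega) ?_ ?_)
  · intro j hj s7 g1 g2
    simp [g1, n1]
  refine wp_set (x := P + 4 + n) (by simp; exact lit_mod (by omega)) ⟨?_, ?_, ?_, ?_, ?_, ?_⟩
  · simp only [St.set_var, St.fill_var, St.set_mem, St.fill_mem, reduceCtorEq, if_false, if_true]
    unfold NodeAt
    rw [blk_of_lt (a := P) (by omega), blk_of_lt (a := P + 1) (by omega),
      blk_of_lt (a := P + 2) (by omega), blk_of_lt (a := P + 3) (by omega)]
    have h60 : (Function.update (Function.update (Function.update (Function.update s.mem P
      (if 0 < g then x else 0)) (P + 1) x) (P + 2) J) (P + 3) Z) P = if 0 < g then x else 0 := by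
      simp [Function.update_apply]
    have h61 : (Function.update (Function.update (Function.update (Function.update s.mem P
      (if 0 < g then x else 0)) (P + 1) x) (P + 2) J) (P + 3) Z) (P + 1) = x := by
      simp [Function.update_apply]
    have h62 : (Function.update (Function.update (Function.update (Function.update s.mem P
      (if 0 < g then x else 0)) (P + 1) x) (P + 2) J) (P + 3) Z) (P + 2) = J := by
      simp [Function.update_apply]
    have h63 : (Function.update (Function.update (Function.update (Function.update s.mem P
      (if 0 < g then x else 0)) (P + 1) x) (P + 2) J) (P + 3) Z) (P + 3) = Z := by
      simp [Function.update_apply]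
    simp only [St.put_mem, St.set_mem]
    rw [h60, h61, h62, h63]
    refine ⟨by omega, ?_⟩
    rcases (by omega : g = 0 ∨ g = 1) with rfl | rfl
    · simp only [lt_irrefl, if_false] at hJ hZ ⊢
      subst hJ hZ
      refine isNode_small hx hxt fun z hz => ?_
      rw [blk_add (by omega)]
      simp
    · simp only [zero_lt_one, if_true] at hJ hZ ⊢
      subst hJ hZ
      refine isNode_large hx hxt fun j hj => ?_
      rw [blk_add (by omega)]
      simp [Nat.mod_one]
  · simp
  · simp; omega
  · simp; omega
  · intro a ha
    simp only [St.set_mem, St.fill_mem, St.put_mem]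
    rw [blk_of_lt (by omega), Function.update_of_ne (by omega), Function.update_of_ne (by omega),
      Function.update_of_ne (by omega), Function.update_of_ne (by omega)]
  · simp only [St.set_time, St.fill_time, St.put_time]; omega

end WordRAM

/-! ### One level of the binary tree. -/

namespace WordRAM

variable {w : ℕ} {Q : St → Prop} {s : St}

section expressions

open Var

/-- Combines the nodes in the array at `d` in pairs into a new array at `d'`. -/
def pairsCmd : Cmd :=
  .while lo r <| .seq (.set p1 (.load (d + 2 * lo))) <| .seq (.set p2 (.load (d + (2 * lo + 1)))) <|
    .seq combineCmd <| .seq (.store (d' + lo) p3) <| .set lo (lo + 1)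

/-- Combines the `m` nodes in the array at `d` into one. -/
def treeCmd : Cmd :=
  .while 1 m <| .seq (.set d' top) <| .seq (.set top (top + (m / 2 + 1))) <| .seq (.set r (m / 2)) <|
    .seq (.set lo 0) <| .seq pairsCmd <| .seq (.store (d' + r) (.load (d + (m - 1)))) <|
    .seq (.set d d') <| .set m ((m + 1) / 2)

end expressions

/-- The piece of a list that belongs to the `i`-th node of a level. -/
def seg (l : List (ℕ × ℕ)) (e i : ℕ) : List (ℕ × ℕ) := (l.drop (i * 2 ^ e)).take (2 ^ e)

theorem seg_succ (l : List (ℕ × ℕ)) (e i : ℕ) :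
    seg l (e + 1) i = seg l e (2 * i) ++ seg l e (2 * i + 1) := by
  unfold seg
  rw [pow_succ, mul_two, List.take_add, List.drop_drop,
    show i * (2 ^ e + 2 ^ e) = 2 * i * 2 ^ e by ring,
    show 2 * i * 2 ^ e + 2 ^ e = (2 * i + 1) * 2 ^ e by ring]

theorem seg_nil {l : List (ℕ × ℕ)} {e i : ℕ} (h : l.length ≤ i * 2 ^ e) : seg l e i = [] := by
  unfold seg
  rw [List.drop_eq_nil_of_le h, List.take_nil]

theorem seg_sorted {l : List (ℕ × ℕ)} (hl : l.Pairwise fun p q => p.1 ≤ q.1) (e i : ℕ) :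
    ∀ p ∈ seg l e (2 * i), ∀ q ∈ seg l e (2 * i + 1), p.1 ≤ q.1 := by
  have h : (seg l (e + 1) i).Pairwise fun p q => p.1 ≤ q.1 :=
    hl.sublist ((List.take_sublist _ _).trans (List.drop_sublist _ _))
  rw [seg_succ] at h
  exact (List.pairwise_append.mp h).2.2

/-- The number of entries of the node at `p`. -/
def cells (mem : ℕ → ℕ) (p : ℕ) : ℕ := (mem (p + 2) + 1) * (mem (p + 3) + 1)

theorem NodeAt.cells_eq {t g p top : ℕ} {l : List (ℕ × ℕ)} {mem mem' : ℕ → ℕ}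
    (h : NodeAt t g l p top mem) (hm : ∀ a < top, p ≤ a → mem' a = mem a) :
    cells mem' p = cells mem p := by
  have h1 := h.1
  have hpos : 0 < (mem (p + 2) + 1) * (mem (p + 3) + 1) := by positivity
  unfold cells
  rw [hm (p + 2) (by omega) (by omega), hm (p + 3) (by omega) (by omega)]

/-- The new nodes lie above the previous `top`, so the old nodes and the new ones already built
remain valid. The time telescopes into the total size of the new nodes. -/
theorem wp_pairs {t g b e m dv dn : ℕ} {l : List (ℕ × ℕ)} (hl : l.Pairwise fun p q => p.1 ≤ q.1)
    (ht : s.var .t = t) (htb : t + 1 < 2 ^ b) (hw : 100 * b + 300 ≤ w) (hd : s.var .d = dv)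
    (hd' : s.var .d' = dn) (hr : s.var .r = m / 2) (hlo : s.var .lo = 0)
    (htop : s.var .top = dn + (m / 2 + 1)) (hdm : dv + m ≤ dn)
    (hnode : ∀ i < m, NodeAt t g (seg l e i) (s.mem (dv + i)) dn s.mem)
    (hspace : dn + (m / 2 + 1) + m / 2 * 2 ^ (3 * b + 10) < 2 ^ w)
    (h : ∀ s' : St, (∀ i < m / 2, dn + (m / 2 + 1) ≤ s'.mem (dn + i) ∧
        NodeAt t g (seg l (e + 1) i) (s'.mem (dn + i)) (s'.var .top) s'.mem) →
      (∀ a < dn, s'.mem a = s.mem a) → dn + (m / 2 + 1) ≤ s'.var .top →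
      s'.var .top ≤ dn + (m / 2 + 1) + m / 2 * 2 ^ (3 * b + 10) →
      s'.time ≤ s.time + 300 + m / 2 * 1500 +
        10000000 * ((b + 2) * ∑ i ∈ Finset.range (m / 2), cells s'.mem (s'.mem (dn + i))) →
      (∀ v ∉ pairsCmd.writes, s'.var v = s.var v) → Q s') :
    wp w pairsCmd Q s := by
  suffices wp w pairsCmd (fun s' => (∀ i < m / 2, dn + (m / 2 + 1) ≤ s'.mem (dn + i) ∧
        NodeAt t g (seg l (e + 1) i) (s'.mem (dn + i)) (s'.var .top) s'.mem) ∧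
      (∀ a < dn, s'.mem a = s.mem a) ∧ dn + (m / 2 + 1) ≤ s'.var .top ∧
      s'.var .top ≤ dn + (m / 2 + 1) + m / 2 * 2 ^ (3 * b + 10) ∧
      s'.time ≤ s.time + 300 + m / 2 * 1500 +
        10000000 * ((b + 2) * ∑ i ∈ Finset.range (m / 2), cells s'.mem (s'.mem (dn + i)))) s from
    this.frame.mono fun s' ⟨⟨a, b, c, d, e⟩, f⟩ => h s' a b c d e f
  obtain ⟨G, hG⟩ : ∃ G, G = 2 ^ (3 * b + 10) := ⟨_, rfl⟩
  obtain ⟨n, hn⟩ : ∃ n, n = m / 2 := ⟨_, rfl⟩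
  rw [← hG, ← hn] at hspace
  rw [← hn] at hr htop
  rw [← hG, ← hn]
  have hnG : n ≤ n * G := Nat.le_mul_of_pos_right _ (by rw [hG]; positivity)
  have n1 : 1 % 2 ^ w = 1 := Nat.mod_eq_of_lt (Nat.one_lt_two_pow (by omega))
  have n2 : 2 % 2 ^ w = 2 := by
    have : 2 ^ 2 ≤ 2 ^ w := Nat.pow_le_pow_right (by norm_num) (by omega)
    exact lit_mod (by omega)
  refine wp_while (fun k s' => s'.var .lo = k ∧ (∀ i < k, dn + (n + 1) ≤ s'.mem (dn + i) ∧
        NodeAt t g (seg l (e + 1) i) (s'.mem (dn + i)) (s'.var .top) s'.mem) ∧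
      (∀ a < dn, s'.mem a = s.mem a) ∧ dn + (n + 1) ≤ s'.var .top ∧
      s'.var .top ≤ dn + (n + 1) + k * G ∧
      s'.time ≤ s.time + k * 1500 +
        10000000 * ((b + 2) * ∑ i ∈ Finset.range k, cells s'.mem (s'.mem (dn + i))) ∧
      ∀ v ∉ pairsCmd.writes, s'.var v = s.var v) n ?_ ?_ ?_
  · exact ⟨hlo, by simp, fun _ _ => rfl, by omega, by omega, by simp, fun _ _ => rfl⟩
  · rintro k hk s1 ⟨c1, c2, c3, c4, c5, c6, c7⟩
    have hkG : (k + 1) * G ≤ n * G := Nat.mul_le_mul_right _ hk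
    rw [add_mul, one_mul] at hkG
    have v1 : s1.var .r = n := (c7 _ (by decide)).trans hr
    have v2 : s1.var .d = dv := (c7 _ (by decide)).trans hd
    have v3 : s1.var .d' = dn := (c7 _ (by decide)).trans hd'
    have v4 : s1.var .t = t := (c7 _ (by decide)).trans ht
    have e1 : 2 * k % 2 ^ w = 2 * k := lit_mod (by omega)
    have e2 : (2 * k + 1) % 2 ^ w = 2 * k + 1 := lit_mod (by omega)
    have e3 : (dv + 2 * k) % 2 ^ w = dv + 2 * k := lit_mod (by omega)
    have e4 : (dv + (2 * k + 1)) % 2 ^ w = dv + (2 * k + 1) := lit_mod (by omega)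
    refine ⟨by simp [c1, v1, hk], ?_⟩
    refine wp_seq (wp_set (x := s.mem (dv + 2 * k)) (by
      simp [v2, c1, n2, e1, e3]; exact c3 _ (by omega)) ?_)
    refine wp_seq (wp_set (x := s.mem (dv + (2 * k + 1))) (by
      simp [v2, c1, n1, n2, e1, e2, e4]; exact c3 _ (by omega)) ?_)
    refine wp_seq (wp_combine (t := t) (g := g) (b := b) (l₁ := seg l e (2 * k))
      (l₂ := seg l e (2 * k + 1)) (by simp [v4]) htb hw ?_ ?_ (fun _ => seg_sorted hl e k) ?_ ?_)
    · simp
      exact (hnode (2 * k) (by omega)).congr (fun a ha _ => c3 a ha) (by omega)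
    · simp
      exact (hnode (2 * k + 1) (by omega)).congr (fun a ha _ => c3 a ha) (by omega)
    · simp [← hG]; omega
    intro s2 d1 d2 d3 d4 d5 d6
    simp only [St.set_var, St.set_mem, St.set_time, St.tick_var, St.tick_mem, St.tick_time,
      reduceCtorEq, if_false, ← hG] at d2 d3 d4 d5 d6
    rw [← seg_succ] at d1
    have u1 : s2.var .d' = dn := by rw [d6 _ (by decide)]; simp [v3]
    have u2 : s2.var .lo = k := by rw [d6 _ (by decide)]; simp [c1]
    have e5 : (dn + k) % 2 ^ w = dn + k := lit_mod (by omega)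
    have e6 : (k + 1) % 2 ^ w = k + 1 := lit_mod (by omega)
    refine wp_seq (wp_store (x := dn + k) (y := s2.var .p3) (by simp [u1, u2, e5]) (by simp) ?_)
    refine wp_set (x := k + 1) (by simp [u2, n1, e6]) ?_
    have hold : ∀ i < k, s2.mem (dn + i) = s1.mem (dn + i) := fun i hi => d4 _ (by omega)
    have hput : ∀ a, a ≠ dn + k → Function.update s2.mem (dn + k) (s2.var .p3) a = s2.mem a :=
      fun a ha => Function.update_of_ne ha _ _
    refine ⟨by simp, ?_, ?_, by have := d1.1; simp; omega, by simp [add_mul]; omega, ?_, ?_⟩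
    · intro i hi
      simp only [St.set_mem, St.put_mem, St.set_var, St.put_var, reduceCtorEq, if_false]
      by_cases hik : i = k
      · subst hik
        rw [Function.update_self]
        exact ⟨by omega, d1.congr (fun a _ ha => hput a (by omega)) le_rfl⟩
      · rw [hput _ (by omega), hold i (by omega)]
        obtain ⟨f1, f2⟩ := c2 i (by omega)
        exact ⟨f1, f2.congr (fun a ha hp => by rw [hput a (by omega), d4 a ha]) (by
          have := d1.1
          omega)⟩
    · intro a ha
      simp only [St.set_mem, St.put_mem]
      rw [hput a (by omega), d4 a (by omega), c3 a ha]
    · simp only [St.set_mem, St.put_mem, St.set_time, St.put_time]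
      rw [Finset.sum_range_succ]
      have g1 : ∑ i ∈ Finset.range k, cells (Function.update s2.mem (dn + k) (s2.var .p3))
          (Function.update s2.mem (dn + k) (s2.var .p3) (dn + i)) =
          ∑ i ∈ Finset.range k, cells s1.mem (s1.mem (dn + i)) := by
        refine Finset.sum_congr rfl fun i hi => ?_
        rw [Finset.mem_range] at hi
        obtain ⟨f1, f2⟩ := c2 i hi
        rw [hput _ (by omega), hold i hi]
        exact f2.cells_eq fun a ha hp => by rw [hput a (by omega), d4 a ha]
      have g2 : cells (Function.update s2.mem (dn + k) (s2.var .p3))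
          (Function.update s2.mem (dn + k) (s2.var .p3) (dn + k)) = cells s2.mem (s2.var .p3) := by
        rw [Function.update_self]
        exact d1.cells_eq fun a ha hp => hput a (by omega)
      rw [g1, g2, mul_add (b + 2)]
      change s2.time ≤ s1.time + 300 + 300 + 300 + 10000000 * ((b + 2) * cells s2.mem (s2.var .p3)) at d5
      omega
    · intro v hv
      have hv' : v ∉ combineCmd.writes ∧ v ≠ .p1 ∧ v ≠ .p2 ∧ v ≠ .lo := by
        simp only [pairsCmd, Cmd.writes, List.mem_append, List.mem_singleton, not_or] at hv
        tauto
      simp only [St.set_var, St.put_var, if_neg hv'.2.2.2]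
      rw [d6 v hv'.1, if_neg hv'.2.2.1, if_neg hv'.2.1, c7 v hv]
  · rintro s1 ⟨c1, c2, c3, c4, c5, c6, c7⟩
    have v1 : s1.var .r = n := (c7 _ (by decide)).trans hr
    refine ⟨by simp [c1, v1], c2, c3, c4, c5, ?_⟩
    simp only [St.tick_time, St.tick_mem]
    omega

end WordRAM

/-! ### The whole binary tree. -/

namespace WordRAM

variable {w : ℕ} {Q : St → Prop} {s : St}

/-- The nodes of every level have at most `W` entries in total. -/
def LevelBound (t g : ℕ) (l : List (ℕ × ℕ)) (W : ℕ) : Prop :=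
  ∀ e n, ∀ J Z : ℕ → ℕ, (∀ i < n, i * 2 ^ e < l.length ∧
    ∃ a b bit, IsNode t g (seg l e i) a b (J i) (Z i) bit) →
    ∑ i ∈ Finset.range n, (J i + 1) * (Z i + 1) ≤ W

/-- There are `clog` of the number of leaves many levels, and each is paid for by the bound `W` on
the total size of a level. -/
theorem wp_tree {t g b dv W : ℕ} {l : List (ℕ × ℕ)} (hl : l.Pairwise fun p q => p.1 ≤ q.1)
    (ht : s.var .t = t) (htb : t + 1 < 2 ^ b) (hw : 100 * b + 300 ≤ w) (hd : s.var .d = dv)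
    (hm : s.var .m = l.length) (hl0 : l ≠ []) (hdm : dv + l.length ≤ s.var .top)
    (hnode : ∀ i (hi : i < l.length), NodeAt t g [l[i]] (s.mem (dv + i)) (s.var .top) s.mem)
    (hW : LevelBound t g l W)
    (hspace : s.var .top + l.length * (l.length * (2 ^ (3 * b + 10) + 1)) < 2 ^ w)
    (h : ∀ s' : St, NodeAt t g l (s'.mem (s'.var .d)) (s'.var .top) s'.mem →
      (∀ a < s.var .top, s'.mem a = s.mem a) → s.var .top ≤ s'.var .top →
      s'.var .d < s'.var .top →
      s'.var .top ≤ s.var .top + l.length * (l.length * (2 ^ (3 * b + 10) + 1)) →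
      s'.time ≤ s.time + 300 + Nat.clog 2 l.length * (20000000 * ((b + 2) * W)) →
      (∀ v ∉ treeCmd.writes, s'.var v = s.var v) → Q s') :
    wp w treeCmd Q s := by
  suffices wp w treeCmd (fun s' => NodeAt t g l (s'.mem (s'.var .d)) (s'.var .top) s'.mem ∧
      (∀ a < s.var .top, s'.mem a = s.mem a) ∧ s.var .top ≤ s'.var .top ∧
      s'.var .d < s'.var .top ∧
      s'.var .top ≤ s.var .top + l.length * (l.length * (2 ^ (3 * b + 10) + 1)) ∧
      s'.time ≤ s.time + 300 + Nat.clog 2 l.length * (20000000 * ((b + 2) * W))) s from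
    this.frame.mono fun s' ⟨⟨a, b, c, d, e, f⟩, k⟩ => h s' a b c d e f k
  obtain ⟨G, hG⟩ : ∃ G, G = 2 ^ (3 * b + 10) := ⟨_, rfl⟩
  obtain ⟨M, hM⟩ : ∃ M, M = l.length := ⟨_, rfl⟩
  rw [← hG, ← hM] at hspace
  rw [← hM] at hm hdm
  simp only [← hG, ← hM]
  have hM1 : 1 ≤ M := by rw [hM]; exact List.length_pos_of_ne_nil hl0
  have n1 : 1 % 2 ^ w = 1 := Nat.mod_eq_of_lt (Nat.one_lt_two_pow (by omega))
  have n2 : 2 % 2 ^ w = 2 := by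
    have : 2 ^ 2 ≤ 2 ^ w := Nat.pow_le_pow_right (by norm_num) (by omega)
    exact lit_mod (by omega)
  have hclog : Nat.clog 2 M ≤ M := Nat.clog_le_of_le_pow Nat.lt_two_pow_self.le
  -- At level `e` there are `m = ⌈M / 2 ^ e⌉` nodes, which the two inequalities express.
  refine wp_while (fun e s' => ∃ m dn, s'.var .m = m ∧ s'.var .d = dn ∧ 1 ≤ m ∧
    (m - 1) * 2 ^ e < M ∧ M ≤ m * 2 ^ e ∧ dn + m ≤ s'.var .top ∧
    (∀ i < m, NodeAt t g (seg l e i) (s'.mem (dn + i)) (s'.var .top) s'.mem) ∧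
    (∀ a < s.var .top, s'.mem a = s.mem a) ∧ s.var .top ≤ s'.var .top ∧
    s'.var .top ≤ s.var .top + e * (M * (G + 1)) ∧
    s'.time ≤ s.time + e * (20000000 * ((b + 2) * W)) ∧
    ∀ v ∉ treeCmd.writes, s'.var v = s.var v) (Nat.clog 2 M) ?_ ?_ ?_
  · refine ⟨M, dv, hm, hd, hM1, by simp; omega, by simp, hdm, ?_, fun _ _ => rfl, le_rfl, by omega,
      by omega, fun _ _ => rfl⟩
    intro i hi
    have e1 : seg l 0 i = [l[i]] := by
      unfold seg
      rw [pow_zero, mul_one, List.drop_eq_getElem_cons (by omega)]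
      rfl
    rw [e1]
    exact hnode i _
  · rintro e he s1 ⟨m, dn, c1, c2, c3, c4, c5, c6, c7, c8, c9, c10, c11, c12⟩
    have he2 : 2 ^ e < M := Nat.pow_lt_of_lt_clog he
    have hm2 : 1 < m := by
      by_contra hcon
      obtain rfl : m = 1 := by omega
      omega
    have hpe : 1 ≤ 2 ^ e := Nat.one_le_two_pow
    have hmM : m ≤ M := by
      have : (m - 1) * 1 ≤ (m - 1) * 2 ^ e := Nat.mul_le_mul_left _ hpe
      omega
    have hm3 : m / 2 + 1 ≤ M := by omega
    have hmG : m / 2 * G ≤ M * G := Nat.mul_le_mul_right _ (by omega)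
    have hle : (e + 1) * (M * (G + 1)) ≤ M * (M * (G + 1)) := Nat.mul_le_mul_right _ (by omega)
    rw [add_mul e, one_mul] at hle
    have hMG : M * (G + 1) = M * G + M := by ring
    obtain ⟨T, hT⟩ : ∃ T, T = s1.var .top := ⟨_, rfl⟩
    rw [← hT] at c6 c7 c9 c10
    refine ⟨by simp [c1, n1]; omega, ?_⟩
    refine wp_seq (wp_set (x := T) (by simp [hT]) ?_)
    refine wp_seq (wp_set (x := T + (m / 2 + 1)) (by
      simp only [Expr.eval_add, Expr.eval_div, Expr.eval_var, Expr.eval_num, St.set_var, St.tick_var,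
        reduceCtorEq, if_false, n1, n2, c1, ← hT]
      rw [lit_mod (show m / 2 + 1 < 2 ^ w by omega)]
      exact lit_mod (by omega)) ?_)
    refine wp_seq (wp_set (x := m / 2) (by simp [c1, n2]) ?_)
    refine wp_seq (wp_set (x := 0) (by simp) ?_)
    have v1 := c12 .t (by decide)
    refine wp_seq (wp_pairs (t := t) (g := g) (b := b) (e := e) (m := m) (dv := dn) (dn := T) hl
      (by simp [v1, ht]) htb hw (by simp [c2]) (by simp) (by simp) (by simp) (by simp) c6
      (by simpa using c7) (by rw [← hG]; omega) ?_)
    intro s2 d1 d2 d3 d4 d5 d6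
    simp only [St.set_mem, St.set_time, St.tick_mem, St.tick_time, ← hG] at d2 d4 d5
    have u1 : s2.var .d' = T := by rw [d6 _ (by decide)]; simp
    have u2 : s2.var .r = m / 2 := by rw [d6 _ (by decide)]; simp
    have u3 : s2.var .d = dn := by rw [d6 _ (by decide)]; simp [c2]
    have u4 : s2.var .m = m := by rw [d6 _ (by decide)]; simp [c1]
    have hodd : s2.mem (dn + (m - 1)) = s1.mem (dn + (m - 1)) := d2 _ (by omega)
    have e1 : (m + (2 ^ w - 1)) % 2 ^ w = m - 1 := sub_mod (by omega) (by omega)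
    have e2 : (T + m / 2) % 2 ^ w = T + m / 2 := lit_mod (by omega)
    have e3 : (dn + (m - 1)) % 2 ^ w = dn + (m - 1) := lit_mod (by omega)
    have e4 : (m + 1) % 2 ^ w = m + 1 := lit_mod (by omega)
    -- The last node is copied unconditionally. For odd `m` it has no partner and passes to the next
    -- level; for even `m` the cell lies just beyond the new array and is not used.
    refine wp_seq (wp_store (x := T + m / 2) (y := s1.mem (dn + (m - 1))) (by simp [u1, u2, e2])
      (by simp [u3, u4, n1, e1, e3, hodd]) ?_)
    refine wp_seq (wp_set (x := T) (by simp [u1]) ?_)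
    refine wp_set (x := (m + 1) / 2) (by simp [u4, n1, n2, e4]) ?_
    have hput : ∀ a, a ≠ T + m / 2 →
      Function.update s2.mem (T + m / 2) (s1.mem (dn + (m - 1))) a = s2.mem a :=
      fun a ha => Function.update_of_ne ha _ _
    have hlow : ∀ a < T, Function.update s2.mem (T + m / 2) (s1.mem (dn + (m - 1))) a = s1.mem a :=
      fun a ha => by rw [hput a (by omega), d2 a ha]
    refine ⟨(m + 1) / 2, T, by simp, by simp, by omega, ?_, ?_, by simp; omega, ?_, ?_, by simp; omega,
      ?_, ?_, ?_⟩
    · rw [pow_succ']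
      calc ((m + 1) / 2 - 1) * (2 * 2 ^ e) = (2 * ((m + 1) / 2 - 1)) * 2 ^ e := by ring
        _ ≤ (m - 1) * 2 ^ e := Nat.mul_le_mul_right _ (by omega)
        _ < M := c4
    · rw [pow_succ']
      calc M ≤ m * 2 ^ e := c5
        _ ≤ (2 * ((m + 1) / 2)) * 2 ^ e := Nat.mul_le_mul_right _ (by omega)
        _ = _ := by ring
    · intro i hi
      simp only [St.set_mem, St.put_mem, St.set_var, St.put_var, reduceCtorEq, if_false]
      by_cases him : i < m / 2
      · obtain ⟨f1, f2⟩ := d1 i him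
        rw [hput _ (by omega)]
        exact f2.congr (fun a _ ha => hput a (by omega)) le_rfl
      · obtain rfl : i = m / 2 := by omega
        -- The partner of an unpaired last block is empty, so the longer block of the next level is
        -- the same list.
        rw [Function.update_self, seg_succ, show 2 * (m / 2) = m - 1 by omega,
          seg_nil (i := m - 1 + 1) (by rw [Nat.sub_add_cancel c3, ← hM]; exact c5), List.append_nil]
        exact (c7 (m - 1) (by omega)).congr (fun a ha _ => hlow a ha) (by omega)
    · intro a ha
      simp only [St.set_mem, St.put_mem]
      rw [hlow a (by omega), c8 a ha]
    · simp only [St.set_var, St.put_var, reduceCtorEq, if_false]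
      rw [add_mul e, one_mul]
      omega
    · have hsum : ∑ i ∈ Finset.range (m / 2), cells s2.mem (s2.mem (T + i)) ≤ W := by
        refine hW (e + 1) (m / 2) (fun i => s2.mem (s2.mem (T + i) + 2))
          (fun i => s2.mem (s2.mem (T + i) + 3)) fun i hi => ⟨?_, _, _, _, (d1 i hi).2.2⟩
        rw [← hM, pow_succ']
        calc i * (2 * 2 ^ e) = (2 * i) * 2 ^ e := by ring
          _ ≤ (m - 1) * 2 ^ e := Nat.mul_le_mul_right _ (by omega)
          _ < M := c4
      -- A node has at least one cell, so the overhead per pair is absorbed by the total size.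
      have hr : m / 2 ≤ ∑ i ∈ Finset.range (m / 2), cells s2.mem (s2.mem (T + i)) := by
        calc m / 2 = ∑ i ∈ Finset.range (m / 2), 1 := by simp
          _ ≤ _ := Finset.sum_le_sum fun i _ => by unfold cells; exact Nat.mul_pos (by omega) (by omega)
      have h1 : 1 ≤ m / 2 := by omega
      have h2 : (b + 2) * ∑ i ∈ Finset.range (m / 2), cells s2.mem (s2.mem (T + i)) ≤ (b + 2) * W :=
        Nat.mul_le_mul_left _ hsum
      have h3 : W ≤ (b + 2) * W := Nat.le_mul_of_pos_left _ (by omega)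
      simp only [St.set_time, St.put_time]
      rw [add_mul e, one_mul]
      omega
    · intro v hv
      have hv' : v ∉ pairsCmd.writes ∧ v ≠ .d' ∧ v ≠ .top ∧ v ≠ .r ∧ v ≠ .lo ∧ v ≠ .d ∧ v ≠ .m := by
        simp only [treeCmd, Cmd.writes, List.mem_append, List.mem_singleton, not_or] at hv
        tauto
      simp only [St.set_var, St.put_var]
      rw [if_neg hv'.2.2.2.2.2.2, if_neg hv'.2.2.2.2.2.1, d6 v hv'.1]
      simp [hv'.2.1, hv'.2.2.1, hv'.2.2.2.1, hv'.2.2.2.2.1, c12 v hv]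
  · rintro s1 ⟨m, dn, c1, c2, c3, c4, c5, c6, c7, c8, c9, c10, c11, c12⟩
    have hle : Nat.clog 2 M * (M * (G + 1)) ≤ M * (M * (G + 1)) := Nat.mul_le_mul_right _ hclog
    have hM2 : M ≤ 2 ^ Nat.clog 2 M := Nat.le_pow_clog (by norm_num) M
    have hm1 : m = 1 := by
      by_contra hcon
      have : 1 * 2 ^ Nat.clog 2 M ≤ (m - 1) * 2 ^ Nat.clog 2 M := Nat.mul_le_mul_right _ (by omega)
      omega
    subst hm1
    have hseg : seg l (Nat.clog 2 M) 0 = l := by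
      unfold seg
      rw [zero_mul, List.drop_zero, List.take_of_length_le (by omega)]
    have := c7 0 (by omega)
    rw [hseg, add_zero] at this
    refine ⟨by simp [c1, n1], ?_, by simpa using c8, by simpa using c9, by simp; omega, by simp; omega,
      by simp; omega⟩
    simpa [c2] using this

end WordRAM

/-! ### The leaves for a range of values. -/

namespace WordRAM

variable {w : ℕ} {Q : St → Prop} {s : St}

section expressions

open Var

/-- Appends a node for the value `x` with multiplicity `c` to the array at `d` of length `m`. -/
def addLeafCmd : Cmd := .seq leafCmd <| .seq (.store (d + m) pt) (.set m (m + 1))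

/-- Creates nodes for the values from `x` to `r - 1` whose multiplicity in the array at `bb` is
positive, and a node for `t + 1` with multiplicity `0`; `ms` becomes the sum of the values. -/
def leavesCmd : Cmd :=
  .seq (.set d top) <| .seq (.set top (top + (t + 2))) <| .seq (.set m 0) <| .seq (.set ms 0) <|
  .seq (.while x r <| .seq (.set c (.load (bb + x))) <|
    .seq (.ite 0 c (.seq (.set ms (ms + c * x)) addLeafCmd) .skip) <| .set x (x + 1)) <|
  .seq (.set x (t + 1)) <| .seq (.set c 0) addLeafCmd

end expressions

/-- The array at `D` holds nodes for the entries of `l`. -/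
structure Leaves (t g D : ℕ) (l : List (ℕ × ℕ)) (mem₀ : ℕ → ℕ) (s : St) : Prop where
  hd : s.var .d = D
  hm : s.var .m = l.length
  node : ∀ i (hi : i < l.length), D + (t + 2) ≤ s.mem (D + i) ∧
    NodeAt t g [l[i]] (s.mem (D + i)) (s.var .top) s.mem
  mem_eq : ∀ a < D, s.mem a = mem₀ a
  le_top : D + (t + 2) ≤ s.var .top
  top_le : s.var .top ≤ D + (t + 2) + l.length * (t + 5)

theorem Leaves.congr {t g D : ℕ} {l : List (ℕ × ℕ)} {mem₀ : ℕ → ℕ} {s s' : St}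
    (h : Leaves t g D l mem₀ s) (hv : ∀ v ∈ [Var.d, .m, .top], s'.var v = s.var v)
    (hm : s'.mem = s.mem) : Leaves t g D l mem₀ s' := by
  obtain ⟨h1, h2, h3, h4, h5, h6⟩ := h
  have e1 := hv .d (by decide)
  have e2 := hv .m (by decide)
  have e3 := hv .top (by decide)
  constructor
  · rwa [e1]
  · rwa [e2]
  · rwa [e3, hm]
  · rwa [hm]
  · rwa [e3]
  · rwa [e3]

theorem wp_addLeaf {t g x c b D : ℕ} {l : List (ℕ × ℕ)} {mem₀ : ℕ → ℕ} (ht : s.var .t = t)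
    (hg : s.var .g = g) (hg1 : g ≤ 1)
    (hxv : s.var .x = x) (hcv : s.var .c = c) (hx : 1 ≤ x) (hxt : x ≤ t + 1) (hc : c ≤ 2)
    (htb : t + 1 < 2 ^ b) (hw : 100 * b + 300 ≤ w) (hL : Leaves t g D l mem₀ s)
    (hlen : l.length < t + 2) (hspace : D + (t + 2) + (t + 3) * (t + 5) < 2 ^ w)
    (h : ∀ s' : St, Leaves t g D (l ++ [(x, c)]) mem₀ s' →
      s'.time ≤ s.time + (6600 + 900 * if 0 < g then c else c * x) →
      (∀ v ∉ addLeafCmd.writes, s'.var v = s.var v) → Q s') :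
    wp w addLeafCmd Q s := by
  suffices wp w addLeafCmd (fun s' => Leaves t g D (l ++ [(x, c)]) mem₀ s' ∧
      s'.time ≤ s.time + (6600 + 900 * if 0 < g then c else c * x)) s from
    this.frame.mono fun s' ⟨⟨a, b⟩, k⟩ => h s' a b k
  obtain ⟨h1, h2, h3, h4, h5, h6⟩ := hL
  have hle : (l.length + 1) * (t + 5) ≤ (t + 3) * (t + 5) := Nat.mul_le_mul_right _ (by omega)
  rw [add_mul, one_mul] at hle
  refine wp_seq (wp_leaf ht hg hg1 hxv hcv hx hxt hc htb hw (by omega) ?_)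
  intro s1 d1 d2 d3 d4 d5 d6 d7
  have u1 : s1.var .d = D := (d7 _ (by decide)).trans h1
  have u2 : s1.var .m = l.length := (d7 _ (by decide)).trans h2
  have n1 : 1 % 2 ^ w = 1 := Nat.mod_eq_of_lt (Nat.one_lt_two_pow (by omega))
  have e1 : (D + l.length) % 2 ^ w = D + l.length := lit_mod (by omega)
  have e2 : (l.length + 1) % 2 ^ w = l.length + 1 := lit_mod (by omega)
  refine wp_seq (wp_store (x := D + l.length) (y := s.var .top) (by simp [u1, u2, e1])
    (by simp [d2]) ?_)
  have hput : ∀ a, a ≠ D + l.length →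
    Function.update s1.mem (D + l.length) (s.var .top) a = s1.mem a :=
    fun a ha => Function.update_of_ne ha _ _
  refine wp_set (x := l.length + 1) (by simp [u2, n1, e2]) ⟨⟨by simp [u1], by simp, ?_, ?_, ?_, ?_⟩, ?_⟩
  · intro i hi
    rw [List.length_append, List.length_singleton] at hi
    simp only [St.set_mem, St.put_mem, St.set_var, St.put_var, reduceCtorEq, if_false]
    by_cases hil : i = l.length
    · subst hil
      rw [Function.update_self, List.getElem_concat_length rfl]
      exact ⟨h5, d1.congr (fun a _ ha => hput a (by omega)) le_rfl⟩
    · have hi' : i < l.length := by omega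
      rw [List.getElem_append_left hi', hput _ (by omega), d5 _ (by omega)]
      obtain ⟨f1, f2⟩ := h3 i hi'
      exact ⟨f1, f2.congr (fun a ha hp => by rw [hput a (by omega), d5 a ha]) d3⟩
  · intro a ha
    simp only [St.set_mem, St.put_mem]
    rw [hput a (by omega), d5 a (by omega), h4 a ha]
  · simp; omega
  · simp [add_mul]; omega
  · simp only [St.set_time, St.put_time]; omega

/-- The values `a, …, a + n - 1` with positive multiplicities `f`. -/
def leafList (f : ℕ → ℕ) (a : ℕ) : ℕ → List (ℕ × ℕ)
  | 0 => []
  | n + 1 => leafList f a n ++ if 0 < f (a + n) then [(a + n, f (a + n))] else []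

theorem leafList_length (f : ℕ → ℕ) (a n : ℕ) : (leafList f a n).length ≤ n := by
  induction n with
  | zero => simp [leafList]
  | succ n ih =>
    simp only [leafList, List.length_append]
    split_ifs <;> simp <;> omega

/-- The time for creating a node. -/
def leafTime (g : ℕ) (p : ℕ × ℕ) : ℕ := 6900 + 900 * if 0 < g then p.2 else p.2 * p.1

/-- The sentinel `(t + 1, 0)` contributes nothing to the sums but makes the list nonempty, so a
range without values needs no separate treatment. It also stays in order, as the other values are at
most `t`. -/
theorem wp_leaves {t g b a n B : ℕ} {f : ℕ → ℕ} (ht : s.var .t = t) (hg : s.var .g = g) (hg1 : g ≤ 1)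
    (hx : s.var .x = a) (hr : s.var .r = a + n) (ha : 1 ≤ a) (han : a + n ≤ t + 1)
    (hB : s.var .bb = B) (hf : ∀ y, 1 ≤ y → y ≤ t → s.mem (B + y) = f y)
    (hf2 : ∀ y, 1 ≤ y → y ≤ t → f y ≤ 2) (hBt : B + t < s.var .top)
    (htb : t + 1 < 2 ^ b) (hw : 100 * b + 300 ≤ w)
    (hspace : s.var .top + (t + 2) + (t + 3) * (t + 5) < 2 ^ w)
    (h : ∀ s' : St, Leaves t g (s.var .top) (leafList f a n ++ [(t + 1, 0)]) s.mem s' →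
      s'.var .ms = ((leafList f a n).map fun p => p.2 * p.1).sum →
      s'.time ≤ s.time + (15000 + n * 1200 + ((leafList f a n).map (leafTime g)).sum) →
      (∀ v ∉ leavesCmd.writes, s'.var v = s.var v) → Q s') :
    wp w leavesCmd Q s := by
  suffices wp w leavesCmd (fun s' =>
      Leaves t g (s.var .top) (leafList f a n ++ [(t + 1, 0)]) s.mem s' ∧
      s'.var .ms = ((leafList f a n).map fun p => p.2 * p.1).sum ∧
      s'.time ≤ s.time + (15000 + n * 1200 + ((leafList f a n).map (leafTime g)).sum)) s from
    this.frame.mono fun s' ⟨⟨a, b, c⟩, k⟩ => h s' a b c k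
  obtain ⟨D, hD⟩ : ∃ D, D = s.var .top := ⟨_, rfl⟩
  rw [← hD] at hBt hspace ⊢
  have hbl : 2 ^ b * 2 ^ b * 2 ^ 2 ≤ 2 ^ w := by
    rw [← pow_add, ← pow_add]; exact Nat.pow_le_pow_right (by norm_num) (by omega)
  have htt : (t + 2) * (t + 2) ≤ 2 ^ b * 2 ^ b := Nat.mul_le_mul (by omega) (by omega)
  have htt2 : (t + 2) * (t + 2) = t * (t + 2) + 2 * (t + 2) := by ring
  have n1 : 1 % 2 ^ w = 1 := Nat.mod_eq_of_lt (Nat.one_lt_two_pow (by omega))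
  have n2 : 2 % 2 ^ w = 2 := lit_mod (by omega)
  have hL0 : ∀ k, (leafList f a k).length ≤ k := leafList_length f a
  have e1 : (t + 2) % 2 ^ w = t + 2 := lit_mod (by omega)
  have e2 : (D + (t + 2)) % 2 ^ w = D + (t + 2) := lit_mod (by omega)
  have e3 : (t + 1) % 2 ^ w = t + 1 := lit_mod (by omega)
  refine wp_seq (wp_set (x := D) (by simp [hD]) ?_)
  refine wp_seq (wp_set (x := D + (t + 2)) (by simp [ht, n2, e1, ← hD, e2]) ?_)
  refine wp_seq (wp_set (x := 0) (by simp) (wp_seq (wp_set (x := 0) (by simp) ?_)))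
  -- Multiplicities are at most two, so the running sum `ms` stays quadratic in `t` and cannot
  -- overflow.
  have hmass : ∀ k ≤ n, ((leafList f a k).map fun p => p.2 * p.1).sum ≤ k * (2 * (t + 1)) := by
    intro k
    induction k with
    | zero => simp [leafList]
    | succ k ih =>
      intro hk
      have h1 := ih (by omega)
      have h2 : f (a + k) * (a + k) ≤ 2 * (t + 1) :=
        Nat.mul_le_mul (hf2 _ (by omega) (by omega)) (by omega)
      simp only [leafList, List.map_append, List.sum_append, add_mul, one_mul]
      split_ifs <;> simp <;> omega
  refine wp_seq (wp_while (fun k s' => Leaves t g D (leafList f a k) s.mem s' ∧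
      s'.var .x = a + k ∧ s'.var .ms = ((leafList f a k).map fun p => p.2 * p.1).sum ∧
      s'.time ≤ s.time + (1200 + k * 1200 + ((leafList f a k).map (leafTime g)).sum) ∧
      ∀ v ∉ leavesCmd.writes, s'.var v = s.var v) n ?_ ?_ ?_)
  · refine ⟨⟨by simp, by simp [leafList], by simp [leafList], by simp, by simp, by simp [leafList]⟩,
      by simp [hx], by simp [leafList], by simp [leafList], fun v hv => ?_⟩
    simp only [leavesCmd, Cmd.writes, List.mem_append, List.mem_singleton, not_or] at hv
    simp [hv]
  · rintro k hk s1 ⟨c1, c2, c3, c4, c5⟩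
    have v1 : s1.var .t = t := (c5 _ (by decide)).trans ht
    have v2 : s1.var .g = g := (c5 _ (by decide)).trans hg
    have v3 : s1.var .r = a + n := (c5 _ (by decide)).trans hr
    have v4 : s1.var .bb = B := (c5 _ (by decide)).trans hB
    have e4 : (B + (a + k)) % 2 ^ w = B + (a + k) := lit_mod (by omega)
    have e5 : (a + k + 1) % 2 ^ w = a + k + 1 := lit_mod (by omega)
    have hfk := hf2 (a + k) (by omega) (by omega)
    have hfx : f (a + k) * (a + k) ≤ 2 * (t + 1) := Nat.mul_le_mul hfk (by omega)
    have e6 : f (a + k) * (a + k) % 2 ^ w = f (a + k) * (a + k) := lit_mod (by omega)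
    have hms := hmass k hk.le
    have hms2 : k * (2 * (t + 1)) ≤ t * (2 * (t + 1)) := Nat.mul_le_mul_right _ (by omega)
    have hms3 : t * (2 * (t + 1)) = 2 * (t * (t + 2)) - 2 * t := by
      have : t * (2 * (t + 1)) + 2 * t = 2 * (t * (t + 2)) := by ring
      omega
    refine ⟨by simp [c2, v3, hk], ?_⟩
    refine wp_seq (wp_set (x := f (a + k)) (by
      simp [v4, c2, e4]
      rw [c1.mem_eq _ (by omega)]
      exact hf _ (by omega) (by omega)) ?_)
    refine wp_seq (wp_ite (fun hlt => ?_) fun hlt => ?_)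
    · simp at hlt
      refine wp_seq (wp_set (x := s1.var .ms + f (a + k) * (a + k)) (by
        simp [c2, e6]
        exact lit_mod (by omega)) ?_)
      refine wp_addLeaf (t := t) (g := g) (x := a + k) (c := f (a + k)) (b := b) (D := D)
        (mem₀ := s.mem) (by simp [v1])
        (by simp [v2]) hg1 (by simp [c2]) (by simp) (by omega) (by omega) hfk htb hw
        (c1.congr (fun v hv => by revert hv; revert v; simp) (by simp)) (by have := hL0 k; omega)
        hspace ?_
      intro s2 d1 d2 d3
      refine wp_set (x := a + k + 1) (by rw [Expr.eval_add, Expr.eval_var, d3 _ (by decide)]; simp [c2, n1, e5]) ?_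
      refine ⟨?_, by simp; omega, ?_, ?_, ?_⟩
      · refine Leaves.congr (s := s2) ?_ (fun v hv => by revert hv; revert v; simp) (by simp)
        simpa [leafList, hlt] using d1
      · rw [St.set_var, if_neg (by decide), d3 _ (by decide)]
        simp [leafList, hlt, c3]
      · simp only [St.set_time, St.tick_time] at d2 ⊢
        simp only [leafList, hlt, if_true, List.map_append, List.sum_append, List.map_cons,
          List.map_nil, List.sum_cons, List.sum_nil, leafTime] at c4 ⊢
        omega
      · intro v hv
        have hv' := hv
        simp only [leavesCmd, Cmd.writes, List.mem_append, List.mem_singleton, not_or] at hv'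
        rw [St.set_var, if_neg hv'.2.2.2.2.2.1, d3 v hv'.2.2.2.2.2.2.2]
        simp [hv', c5 v hv]
    · simp at hlt
      refine wp_skip (wp_set (x := a + k + 1) (by simp [c2, n1, e5]) ?_)
      refine ⟨?_, by simp; omega, ?_, ?_, ?_⟩
      · refine Leaves.congr (s := s1) ?_ (fun v hv => by revert hv; revert v; simp) (by simp)
        simpa [leafList, hlt] using c1
      · simp [leafList, hlt, c3]
      · simp only [St.set_time, St.tick_time, leafList, hlt, lt_irrefl, if_false, List.append_nil] at c4 ⊢
        omega
      · intro v hv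
        have hv' := hv
        simp only [leavesCmd, Cmd.writes, List.mem_append, List.mem_singleton, not_or] at hv'
        simp [hv', c5 v hv]
  · rintro s1 ⟨c1, c2, c3, c4, c5⟩
    have v1 : s1.var .t = t := (c5 _ (by decide)).trans ht
    have v2 : s1.var .g = g := (c5 _ (by decide)).trans hg
    have v3 : s1.var .r = a + n := (c5 _ (by decide)).trans hr
    refine ⟨by simp [c2, v3], ?_⟩
    refine wp_seq (wp_set (x := t + 1) (by simp [v1, n1, e3]) ?_)
    refine wp_seq (wp_set (x := 0) (by simp) ?_)
    refine wp_addLeaf (t := t) (g := g) (x := t + 1) (c := 0) (b := b) (D := D)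
      (mem₀ := s.mem) (by simp [v1])
      (by simp [v2]) hg1 (by simp) (by simp) (by omega) le_rfl (by omega) htb hw
      (c1.congr (fun v hv => by revert hv; revert v; simp) (by simp)) (by have := hL0 n; omega)
      hspace ?_
    intro s2 d1 d2 d3
    refine ⟨d1, ?_, ?_⟩
    · rw [d3 _ (by decide)]; simp [c3]
    · simp only [St.set_time, St.tick_time, zero_mul, ite_self, mul_zero] at d2
      omega

end WordRAM

/-! ### Forgetting the number of summands, and the output. -/

namespace WordRAM

variable {w : ℕ} {Q : St → Prop} {s : St}

section expressions

open Var

/-- Replaces the node at `p2` by one with a single row. -/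
def flattenCmd : Cmd :=
  .seq (.set a1 (.load p2)) <| .seq (.set j1 (.load (p2 + 2))) <| .seq (.set z1 (.load (p2 + 3))) <|
  .seq (.set zz (.ite ms t ms t)) <| .seq (.set pt top) <| .seq (.store pt 0) <|
  .seq (.store (pt + 1) (t + 1)) <| .seq (.store (pt + 2) 0) <| .seq (.store (pt + 3) zz) <|
  .seq (.set de (pt + 4)) <| .seq (.set cap (zz + 1)) <| .seq (fill cap de 0) <|
  .seq (.set top (de + cap)) <| .seq (.set n ((j1 + 1) * (z1 + 1))) <| .seq (.set lo 0) <|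
  .seq (.while lo n <| .seq (.set x (lo / (z1 + 1) * a1 + lo % (z1 + 1))) <|
    .seq (.ite zz x .skip <| .ite 0 (.load (p2 + 4 + lo)) (.store (de + x) 1) .skip) <|
    .set lo (lo + 1)) <|
  .set p2 pt

/-- Lists the sums of the node at `p3`, which has a single row. -/
def outputCmd : Cmd :=
  .seq (.set n (.load (p3 + 3) + 1)) <| .seq (.set lo 0) <| .seq (.set m 0) <| .seq (.set de (p3 + 4)) <|
  .seq (.while lo n <| .seq (.ite 0 (.load (de + lo)) (.seq (.store (m + 1) lo) (.set m (m + 1))) .skip) <|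
    .set lo (lo + 1)) <|
  .store 0 m

end expressions

theorem SubSum.le_sum {l : List (ℕ × ℕ)} {j v : ℕ} (h : SubSum l j v) :
    v ≤ (l.map fun p => p.2 * p.1).sum := by
  induction l generalizing j v with
  | nil => obtain ⟨rfl, rfl⟩ := h; simp
  | cons p l ih =>
    obtain ⟨i, hi, j', v', h, rfl, rfl⟩ := h
    have h1 := ih h
    have h2 := Nat.mul_le_mul_right p.1 hi
    simp only [List.map_cons, List.sum_cons]
    omega

/-- The new row is the union over `j` of the old rows, each moved by `j * a`. Its length is cut at
the total sum of the list as well as at `t`, because nodes with one row must satisfy `Z_le_sum`. -/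
theorem IsNode.flatten {t a b J Z Y : ℕ} {l : List (ℕ × ℕ)} {bit bit' : ℕ → ℕ → ℕ}
    (h : IsNode t 1 l a b J Z bit) (hY : Y = min (l.map fun p => p.2 * p.1).sum t)
    (hle : ∀ v ≤ Y, bit' 0 v ≤ 1)
    (hb : ∀ v ≤ Y, bit' 0 v = 1 ↔ ∃ j ≤ J, ∃ z ≤ Z, bit j z = 1 ∧ j * a + z = v) :
    IsNode t 0 l 0 (t + 1) 0 Y bit' := by
  refine ⟨by simp, by simp, by simp, by simp, by simp, le_rfl, by simp, by omega, by simp,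
    fun _ => by omega, by simp, by simp, by simp, ?_, ?_, ?_⟩
  · intro j hj z hz
    obtain rfl : j = 0 := by omega
    exact hle z hz
  · intro j hj z hz h1
    obtain rfl : j = 0 := by omega
    obtain ⟨j, hj, z', hz', h2, rfl⟩ := (hb z hz).mp h1
    obtain ⟨j', h3, -⟩ := h.sound j hj z' hz' h2
    exact ⟨j', by rwa [mul_zero, add_zero, add_comm], by simp⟩
  · intro j v h1 hv
    have h2 := h1.le_sum
    obtain ⟨h3, z, hz, h4, h5⟩ := h.complete j v h1 hv
    rw [one_mul] at h3 h4 h5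
    refine ⟨by simp, v, by omega, by simp, ?_⟩
    rw [zero_mul]
    exact (hb v (by omega)).mpr ⟨j, h3, z, hz, h5, by omega⟩

theorem wp_flatten {t b : ℕ} {l : List (ℕ × ℕ)} (ht : s.var .t = t) (htb : t + 1 < 2 ^ b)
    (hw : 100 * b + 300 ≤ w) (hnode : NodeAt t 1 l (s.var .p2) (s.var .top) s.mem)
    (hms : s.var .ms = (l.map fun p => p.2 * p.1).sum) (hspace : s.var .top + t + 6 < 2 ^ w)
    (h : ∀ s' : St, NodeAt t 0 l (s'.var .p2) (s'.var .top) s'.mem →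
      (∀ a < s.var .top, s'.mem a = s.mem a) → s.var .top ≤ s'.var .p2 →
      s'.var .top ≤ s.var .top + t + 5 →
      s'.time ≤ s.time + (6000 + 900 * (t + 1) + 1800 * cells s.mem (s.var .p2)) →
      (∀ v ∉ flattenCmd.writes, s'.var v = s.var v) → Q s') :
    wp w flattenCmd Q s := by
  suffices wp w flattenCmd (fun s' => NodeAt t 0 l (s'.var .p2) (s'.var .top) s'.mem ∧
      (∀ a < s.var .top, s'.mem a = s.mem a) ∧ s.var .top ≤ s'.var .p2 ∧
      s'.var .top ≤ s.var .top + t + 5 ∧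
      s'.time ≤ s.time + (6000 + 900 * (t + 1) + 1800 * cells s.mem (s.var .p2))) s from
    this.frame.mono fun s' ⟨⟨a, b, c, d, e⟩, k⟩ => h s' a b c d e k
  unfold cells
  obtain ⟨R, hR⟩ : ∃ R, R = s.var .p2 := ⟨_, rfl⟩
  obtain ⟨P, hP⟩ : ∃ P, P = s.var .top := ⟨_, rfl⟩
  obtain ⟨r1, N⟩ := hnode
  rw [← hR, ← hP] at r1
  rw [← hR] at N ⊢
  rw [← hP] at hspace ⊢
  obtain ⟨a, ha⟩ : ∃ a, s.mem R = a := ⟨_, rfl⟩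
  obtain ⟨J, hJ⟩ : ∃ a, s.mem (R + 2) = a := ⟨_, rfl⟩
  obtain ⟨Z, hZ⟩ : ∃ a, s.mem (R + 3) = a := ⟨_, rfl⟩
  simp only [ha, hJ, hZ] at r1 N ⊢
  have hpos : 0 < (J + 1) * (Z + 1) := by positivity
  have hJc : (J + 1) * 1 ≤ (J + 1) * (Z + 1) := Nat.mul_le_mul_left _ (by omega)
  have hZc : 1 * (Z + 1) ≤ (J + 1) * (Z + 1) := Nat.mul_le_mul_right _ (by omega)
  have hJa : J * a ≤ t := (Nat.mul_le_mul_right _ N.J_le).trans (Nat.div_mul_le_self _ _)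
  have hZt := N.Z_le
  have hbl : 2 ^ b * 2 ^ 2 ≤ 2 ^ w := by
    rw [← pow_add]; exact Nat.pow_le_pow_right (by norm_num) (by omega)
  have n1 : 1 % 2 ^ w = 1 := lit_mod (by omega)
  have n2 : 2 % 2 ^ w = 2 := lit_mod (by omega)
  have n3 : 3 % 2 ^ w = 3 := lit_mod (by omega)
  have n4 : 4 % 2 ^ w = 4 := lit_mod (by omega)
  have m2 : (R + 2) % 2 ^ w = R + 2 := lit_mod (by omega)
  have m3 : (R + 3) % 2 ^ w = R + 3 := lit_mod (by omega)
  have m4 : (J + 1) % 2 ^ w = J + 1 := lit_mod (by omega)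
  have m5 : (Z + 1) % 2 ^ w = Z + 1 := lit_mod (by omega)
  have m6 : (J + 1) * (Z + 1) % 2 ^ w = (J + 1) * (Z + 1) := lit_mod (by omega)
  obtain ⟨Y, hY⟩ : ∃ Y, Y = min (l.map fun p => p.2 * p.1).sum t := ⟨_, rfl⟩
  obtain ⟨s6, hs6⟩ : ∃ s6, s6 = ((((((((((((((s.set .a1 a).set .j1 J).set .z1 Z).set .zz Y).set .pt
    P).put P 0).put (P + 1) (t + 1)).put (P + 2) 0).put (P + 3) Y).set .de (P + 4)).set .cap
    (Y + 1)).fill (P + 4) (Y + 1) (fun _ => 0)).set .top (P + 4 + (Y + 1))).set .n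
    ((J + 1) * (Z + 1))).set .lo 0 := ⟨_, rfl⟩
  refine wp_seq (wp_set (x := a) (by simp [← hR, ha]) ?_)
  refine wp_seq (wp_set (x := J) (by simp [← hR, n2, m2, hJ]) ?_)
  refine wp_seq (wp_set (x := Z) (by simp [← hR, n3, m3, hZ]) ?_)
  refine wp_seq (wp_set (x := Y) (by simp [hms, ht, hY, min_def]; split_ifs <;> omega) ?_)
  refine wp_seq (wp_set (x := P) (by simp [hP]) ?_)
  refine wp_seq (wp_store (x := P) (y := 0) (by simp) (by simp) ?_)
  refine wp_seq (wp_store (x := P + 1) (y := t + 1) (by simp [n1]; exact lit_mod (by omega))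
    (by simp [ht, n1]; exact lit_mod (by omega)) ?_)
  refine wp_seq (wp_store (x := P + 2) (y := 0) (by simp [n2]; exact lit_mod (by omega))
    (by simp) ?_)
  refine wp_seq (wp_store (x := P + 3) (y := Y) (by simp [n3]; exact lit_mod (by omega))
    (by simp) ?_)
  refine wp_seq (wp_set (x := P + 4) (by simp [n4]; exact lit_mod (by omega)) ?_)
  refine wp_seq (wp_set (x := Y + 1) (by simp [n1]; exact lit_mod (by omega)) ?_)
  refine wp_seq (wp_fill (nv := Y + 1) (bv := P + 4) (fun _ => 0) (by simp) (by simp)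
    (by decide) (by decide) (by omega) (by simp) ?_)
  refine wp_seq (wp_set (x := P + 4 + (Y + 1)) (by simp; exact lit_mod (by omega)) ?_)
  refine wp_seq (wp_set (x := (J + 1) * (Z + 1)) (by simp [n1, m6]) ?_)
  refine wp_seq (wp_set (x := 0) (by simp) ?_)
  rw [← hs6]
  have mem6 : ∀ a < P, s6.mem a = s.mem a := fun a ha => by
    rw [hs6]; simp only [St.set_mem, St.put_mem, St.fill_mem]
    rw [blk_of_lt (by omega), Function.update_of_ne (by omega), Function.update_of_ne (by omega),
      Function.update_of_ne (by omega), Function.update_of_ne (by omega)]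
  have h60 : s6.mem P = 0 := by rw [hs6]; simp [Function.update_apply, blk]
  have h61 : s6.mem (P + 1) = t + 1 := by rw [hs6]; simp [Function.update_apply, blk]
  have h62 : s6.mem (P + 2) = 0 := by rw [hs6]; simp [Function.update_apply, blk]
  have h63 : s6.mem (P + 3) = Y := by rw [hs6]; simp [Function.update_apply, blk]
  have h64 : ∀ v ≤ Y, s6.mem (P + 4 + v) = 0 := fun v hv => by
    rw [hs6]; simp only [St.set_mem, St.fill_mem]; rw [blk_add (by omega)]
  have time6 : s6.time = s.time + (4800 + (Y + 1) * 900) := by rw [hs6]; simp; ring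
  have v1 : s6.var .lo = 0 := by rw [hs6]; simp
  have v2 : s6.var .n = (J + 1) * (Z + 1) := by rw [hs6]; simp
  have v3 : s6.var .z1 = Z := by rw [hs6]; simp
  have v4 : s6.var .a1 = a := by rw [hs6]; simp
  have v5 : s6.var .zz = Y := by rw [hs6]; simp
  have v6 : s6.var .p2 = R := by rw [hs6]; simp [hR]
  have v7 : s6.var .de = P + 4 := by rw [hs6]; simp
  have v8 : s6.var .top = P + 4 + (Y + 1) := by rw [hs6]; simp
  have v9 : s6.var .pt = P := by rw [hs6]; simp
  clear hs6
  refine wp_seq (wp_while (fun k s' => s'.var .lo = k ∧ (∀ a < P + 4, s'.mem a = s6.mem a) ∧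
    (∀ v ≤ Y, s'.mem (P + 4 + v) ≤ 1 ∧ (s'.mem (P + 4 + v) = 1 ↔
      ∃ i < k, s.mem (R + 4 + i) = 1 ∧ i / (Z + 1) * a + i % (Z + 1) = v)) ∧
    s'.time ≤ s6.time + k * 1800 ∧ (∀ v, v ≠ .lo → v ≠ .x → s'.var v = s6.var v))
    ((J + 1) * (Z + 1)) ?_ ?_ ?_)
  · exact ⟨v1, fun _ _ => rfl, fun v hv => by simp [h64 v hv], by omega, fun _ _ _ => rfl⟩
  · rintro k hk s1 ⟨c1, c2, c3, c4, c5⟩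
    have u2 : s1.var .n = _ := (c5 _ (by decide) (by decide)).trans v2
    have u3 : s1.var .z1 = _ := (c5 _ (by decide) (by decide)).trans v3
    have u4 : s1.var .a1 = _ := (c5 _ (by decide) (by decide)).trans v4
    have u5 : s1.var .zz = _ := (c5 _ (by decide) (by decide)).trans v5
    have u6 : s1.var .p2 = _ := (c5 _ (by decide) (by decide)).trans v6
    have u7 : s1.var .de = _ := (c5 _ (by decide) (by decide)).trans v7
    have e1 : k / (Z + 1) ≤ J := by
      have : k / (Z + 1) < J + 1 := (Nat.div_lt_iff_lt_mul (by omega)).mpr hk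
      omega
    have e2 : k % (Z + 1) < Z + 1 := Nat.mod_lt _ (by omega)
    have e3 : k / (Z + 1) * a ≤ t := (Nat.mul_le_mul_right _ e1).trans hJa
    obtain ⟨y, hy⟩ : ∃ y, y = k / (Z + 1) * a + k % (Z + 1) := ⟨_, rfl⟩
    have e4 : k / (Z + 1) * a % 2 ^ w = k / (Z + 1) * a := lit_mod (by omega)
    have e5 : (R + 4) % 2 ^ w = R + 4 := lit_mod (by omega)
    have e6 : (R + 4 + k) % 2 ^ w = R + 4 + k := lit_mod (by omega)
    have e7 : (k + 1) % 2 ^ w = k + 1 := lit_mod (by omega)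
    have hbit : s.mem (R + 4 + k) ≤ 1 := by
      have := N.bit_le _ e1 _ (show k % (Z + 1) ≤ Z by omega)
      rwa [show k / (Z + 1) * (Z + 1) + k % (Z + 1) = k by rw [mul_comm]; exact Nat.div_add_mod _ _]
        at this
    have hmk : s1.mem (R + 4 + k) = s.mem (R + 4 + k) := by rw [c2 _ (by omega), mem6 _ (by omega)]
    have hsplit : ∀ v, (∃ i < k + 1, s.mem (R + 4 + i) = 1 ∧ i / (Z + 1) * a + i % (Z + 1) = v) ↔
        (∃ i < k, s.mem (R + 4 + i) = 1 ∧ i / (Z + 1) * a + i % (Z + 1) = v) ∨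
          s.mem (R + 4 + k) = 1 ∧ y = v := by
      intro v
      constructor
      · rintro ⟨i, hi, h1, h2⟩
        by_cases hik : i = k
        · subst hik; exact Or.inr ⟨h1, hy.trans h2⟩
        · exact Or.inl ⟨i, by omega, h1, h2⟩
      · rintro (⟨i, hi, h1, h2⟩ | ⟨h1, h2⟩)
        · exact ⟨i, by omega, h1, h2⟩
        · exact ⟨k, by omega, h1, hy ▸ h2⟩
    refine ⟨by simp [c1, u2, hk], ?_⟩
    refine wp_seq (wp_set (x := y) (by
      simp [c1, u3, u4, n1, m5, e4, hy]; exact lit_mod (by omega)) ?_)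
    -- The common tail of the three branches: in each of them cell `y` becomes one exactly if the
    -- scanned bit is one and `y` is in range, and nothing else changes.
    have finish : ∀ s2 : St, s2.var = (s1.set .x y).var → (∀ a < P + 4, s2.mem a = s1.mem a) →
        (∀ v ≤ Y, s2.mem (P + 4 + v) = if s.mem (R + 4 + k) = 1 ∧ y = v then 1
          else s1.mem (P + 4 + v)) → s2.time ≤ s1.time + 1500 →
        wp w (.set .lo (.var .lo + 1)) (fun s' => s'.var .lo = k + 1 ∧
          (∀ a < P + 4, s'.mem a = s6.mem a) ∧
          (∀ v ≤ Y, s'.mem (P + 4 + v) ≤ 1 ∧ (s'.mem (P + 4 + v) = 1 ↔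
            ∃ i < k + 1, s.mem (R + 4 + i) = 1 ∧ i / (Z + 1) * a + i % (Z + 1) = v)) ∧
          s'.time ≤ s6.time + (k + 1) * 1800 ∧ (∀ v, v ≠ .lo → v ≠ .x → s'.var v = s6.var v)) s2 := by
      intro s2 f1 f2 f3 f4
      refine wp_set (x := k + 1) (by simp [f1, c1, n1, e7]) ⟨by simp, ?_, ?_, ?_, ?_⟩
      · intro a ha
        rw [St.set_mem, f2 a ha, c2 a ha]
      · intro v hv
        obtain ⟨g1, g2⟩ := c3 v hv
        rw [St.set_mem, f3 v hv, hsplit v, ← g2]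
        split_ifs with hif
        · simp [hif]
        · exact ⟨g1, by simp [hif]⟩
      · rw [St.set_time]; omega
      · intro v hv1 hv2
        rw [St.set_var, if_neg hv1, f1, St.set_var, if_neg hv2, c5 v hv1 hv2]
    refine wp_seq (wp_ite (fun hlt => ?_) fun hlt => wp_ite (fun hlt2 => ?_) fun hlt2 => ?_)
    · simp [u5] at hlt
      exact wp_skip (finish _ rfl (by simp) (fun v hv => by
        rw [if_neg (by omega)]; simp) (by simp))
    · simp [u5] at hlt
      simp [u6, c1, n4, e5, e6, hmk] at hlt2
      refine wp_store (x := P + 4 + y) (y := 1) (by simp [u7]; exact lit_mod (by omega)) (by simp [n1])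
        (finish _ rfl ?_ ?_ (by simp))
      · intro a ha
        simp only [St.put_mem, St.tick_mem, St.set_mem]
        exact Function.update_of_ne (by omega) _ _
      · intro v hv
        simp only [St.put_mem, St.tick_mem, St.set_mem, Function.update_apply]
        exact if_congr (by omega) rfl rfl
    · simp [u6, c1, n4, e5, e6, hmk] at hlt2
      exact wp_skip (finish _ rfl (by simp) (fun v hv => by
        rw [if_neg (by omega)]; simp) (by simp))
  · rintro s1 ⟨c1, c2, c3, c4, c5⟩
    have u2 : s1.var .n = _ := (c5 _ (by decide) (by decide)).trans v2
    have u8 : s1.var .top = _ := (c5 _ (by decide) (by decide)).trans v8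
    have u9 : s1.var .pt = _ := (c5 _ (by decide) (by decide)).trans v9
    refine ⟨by simp [c1, u2], wp_set (x := P) (by simp [u9]) ⟨?_, ?_, by simp, by simp [u8]; omega, ?_⟩⟩
    · unfold NodeAt
      simp only [St.set_var, St.set_mem, St.tick_var, St.tick_mem, if_true, reduceCtorEq, if_false]
      rw [c2 P (by omega), c2 (P + 1) (by omega), c2 (P + 2) (by omega), c2 (P + 3) (by omega),
        h60, h61, h62, h63, u8]
      refine ⟨by omega, N.flatten hY (fun v hv => ?_) fun v hv => ?_⟩
      · simpa using (c3 v hv).1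
      · rw [zero_mul, zero_add, (c3 v hv).2]
        constructor
        · rintro ⟨i, hi, h1, h2⟩
          have e1 : i / (Z + 1) < J + 1 := (Nat.div_lt_iff_lt_mul (by omega)).mpr hi
          have e2 : i % (Z + 1) < Z + 1 := Nat.mod_lt _ (by omega)
          refine ⟨i / (Z + 1), by omega, i % (Z + 1), by omega, ?_, h2⟩
          rwa [show i / (Z + 1) * (Z + 1) + i % (Z + 1) = i by rw [mul_comm]; exact Nat.div_add_mod _ _]
        · rintro ⟨j, hj, z, hz, h1, h2⟩
          have e1 : (j * (Z + 1) + z) / (Z + 1) = j := by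
            rw [Nat.add_comm, Nat.add_mul_div_right _ _ (by omega), Nat.div_eq_of_lt (by omega), zero_add]
          have e2 : (j * (Z + 1) + z) % (Z + 1) = z := by
            rw [Nat.add_comm, Nat.add_mul_mod_self_right, Nat.mod_eq_of_lt (by omega)]
          exact ⟨j * (Z + 1) + z, cell_lt hj hz, h1, by rw [e1, e2]; exact h2⟩
    · intro a ha
      simp only [St.set_mem, St.tick_mem]
      rw [c2 a (by omega), mem6 a ha]
    · simp only [St.set_time, St.tick_time]
      omega

/-- The list is written to the bottom of the memory, over cells that are not needed any more. At
most `t + 1` entries and their number fit below the table because it starts at `t + 2` or later. -/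
theorem wp_output {t b : ℕ} {l : List (ℕ × ℕ)} (htb : t + 1 < 2 ^ b)
    (hw : 100 * b + 300 ≤ w) (hnode : NodeAt t 0 l (s.var .p3) (s.var .top) s.mem)
    (hp : t + 2 ≤ s.var .p3) (hspace : s.var .top < 2 ^ w)
    (h : ∀ s' : St, ∀ out : List ℕ, out.Nodup → (∀ x, x ∈ out ↔ x ≤ t ∧ ∃ j, SubSum l j x) →
      Holds s'.mem out → s'.time ≤ s.time + (3000 + 1500 * (t + 1)) → Q s') :
    wp w outputCmd Q s := by
  obtain ⟨R, hR⟩ : ∃ R, R = s.var .p3 := ⟨_, rfl⟩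
  obtain ⟨r1, N⟩ := hnode
  rw [← hR] at r1 N hp
  obtain ⟨Z, hZ⟩ : ∃ a, s.mem (R + 3) = a := ⟨_, rfl⟩
  simp only [hZ] at r1 N
  have hJ := N.J_le
  -- The base is zero, so `J ≤ t / 0 = 0` and the node has one row.
  rw [N.a_zero rfl, Nat.div_zero] at hJ
  have hJ0 : s.mem (R + 2) = 0 := by omega
  rw [hJ0] at r1 N
  have hZt := N.Z_le
  have hbl : 2 ^ b * 2 ^ 2 ≤ 2 ^ w := by
    rw [← pow_add]; exact Nat.pow_le_pow_right (by norm_num) (by omega)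
  have n1 : 1 % 2 ^ w = 1 := lit_mod (by omega)
  have n3 : 3 % 2 ^ w = 3 := lit_mod (by omega)
  have n4 : 4 % 2 ^ w = 4 := lit_mod (by omega)
  have m3 : (R + 3) % 2 ^ w = R + 3 := lit_mod (by omega)
  have m4 : (R + 4) % 2 ^ w = R + 4 := lit_mod (by omega)
  have m5 : (Z + 1) % 2 ^ w = Z + 1 := lit_mod (by omega)
  refine wp_seq (wp_set (x := Z + 1) (by simp [← hR, n3, m3, hZ, n1, m5]) ?_)
  refine wp_seq (wp_set (x := 0) (by simp) (wp_seq (wp_set (x := 0) (by simp) ?_)))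
  refine wp_seq (wp_set (x := R + 4) (by simp [← hR, n4, m4]) ?_)
  have hbit : ∀ z ≤ Z, s.mem (R + 4 + z) ≤ 1 := fun z hz => by
    simpa using N.bit_le 0 le_rfl z hz
  refine wp_seq (wp_while (fun k s' => s'.var .lo = k ∧ s'.var .n = Z + 1 ∧ s'.var .de = R + 4 ∧
    s'.var .m = ((List.range k).filter fun z => s.mem (R + 4 + z) = 1).length ∧
    (∀ i (hi : i < ((List.range k).filter fun z => s.mem (R + 4 + z) = 1).length),
      s'.mem (i + 1) = ((List.range k).filter fun z => s.mem (R + 4 + z) = 1)[i]) ∧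
    (∀ a, R ≤ a → s'.mem a = s.mem a) ∧ s'.time ≤ s.time + (1200 + k * 1500)) (Z + 1) ?_ ?_ ?_)
  · exact ⟨by simp, by simp, by simp, by simp, by simp, fun _ _ => rfl, by simp⟩
  · rintro k hk s1 ⟨c1, c2, c3, c4, c5, c6, c7⟩
    have hlen : ((List.range k).filter fun z => s.mem (R + 4 + z) = 1).length ≤ k :=
      (List.length_filter_le _ _).trans (by simp)
    have e6 : (R + 4 + k) % 2 ^ w = R + 4 + k := lit_mod (by omega)
    have e7 : (k + 1) % 2 ^ w = k + 1 := lit_mod (by omega)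
    have hmk : s1.mem (R + 4 + k) = s.mem (R + 4 + k) := c6 _ (by omega)
    have hb := hbit k (by omega)
    refine ⟨by simp [c1, c2, hk], wp_seq (wp_ite (fun hlt => ?_) fun hlt => ?_)⟩
    · simp [c1, c3, e6, hmk] at hlt
      have h1 : s.mem (R + 4 + k) = 1 := by omega
      have hf : ((List.range (k + 1)).filter fun z => s.mem (R + 4 + z) = 1) =
          ((List.range k).filter fun z => s.mem (R + 4 + z) = 1) ++ [k] := by
        rw [List.range_succ, List.filter_append]; simp [h1]
      rw [hf]
      obtain ⟨out, ho⟩ : ∃ o, o = (List.range k).filter fun z => s.mem (R + 4 + z) = 1 := ⟨_, rfl⟩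
      rw [← ho] at hlen c4
      simp only [← ho] at c5 ⊢
      have e8 : (out.length + 1) % 2 ^ w = out.length + 1 := lit_mod (by omega)
      refine wp_seq (wp_store (x := out.length + 1) (y := k) (by simp [c4, n1, e8]) (by simp [c1])
        (wp_set (x := out.length + 1) (by simp [c4, n1, e8]) ?_))
      refine wp_set (x := k + 1) (by simp [c1, n1, e7]) ⟨by simp, by simp [c2], by simp [c3], by simp, ?_, ?_,
        by simp; omega⟩
      · intro i hi
        simp only [St.set_mem, St.put_mem, St.tick_mem]
        rw [List.length_append, List.length_singleton] at hi
        by_cases hil : i = out.length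
        · subst hil
          rw [Function.update_self, List.getElem_concat_length rfl]
        · rw [Function.update_of_ne (by omega), List.getElem_append_left (by omega), c5 i (by omega)]
      · intro a ha
        simp only [St.set_mem, St.put_mem, St.tick_mem]
        rw [Function.update_of_ne (by omega), c6 a ha]
    · simp [c1, c3, e6, hmk] at hlt
      have hf : ((List.range (k + 1)).filter fun z => s.mem (R + 4 + z) = 1) =
          ((List.range k).filter fun z => s.mem (R + 4 + z) = 1) := by
        rw [List.range_succ, List.filter_append]; simp [hlt]
      rw [hf]
      exact wp_skip (wp_set (x := k + 1) (by simp [c1, n1, e7]) ⟨by simp, by simp [c2], by simp [c3],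
        by simp [c4], by simpa using c5, by simpa using c6, by simp; omega⟩)
  · rintro s1 ⟨c1, c2, c3, c4, c5, c6, c7⟩
    refine ⟨by simp [c1, c2], wp_store (x := 0) (y := s1.var .m) (by simp) (by simp) (h _
      ((List.range (Z + 1)).filter fun z => s.mem (R + 4 + z) = 1) ?_ ?_ ⟨?_, ?_⟩ ?_)⟩
    · exact List.nodup_range.filter _
    · intro x
      rw [List.mem_filter, List.mem_range]
      constructor
      · rintro ⟨h1, h2⟩
        obtain ⟨j, hj, -⟩ := N.sound 0 le_rfl x (by omega) (by simpa using h2)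
        exact ⟨by omega, j, by simpa using hj⟩
      · rintro ⟨hx, j, hj⟩
        obtain ⟨-, z, hz, h3, h4⟩ := N.complete j x hj hx
        simp at h3 h4
        subst h3
        exact ⟨by omega, by simpa using h4⟩
    · simp [c4]
    · intro i hi
      simp only [St.put_mem, St.tick_mem]
      rw [Function.update_of_ne (by omega), c5]
    · simp only [St.put_time, St.tick_time]; omega

end WordRAM

/-! ### Reduction of multiplicities -/

namespace WordRAM

open Finset

/-- The sum of the values `1, …, t` with the multiplicities `f`. -/
def mass (t : ℕ) (f : ℕ → ℕ) : ℕ := ∑ y ∈ Ico 1 (t + 1), f y * y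

/-- The sums of the values `1, …, t` with multiplicities at most `f`. -/
def HasSubsetSum (t : ℕ) (f : ℕ → ℕ) (v : ℕ) : Prop := ∃ e : ℕ → ℕ, (∀ y ∈ Ico 1 (t + 1), e y ≤ f y) ∧ mass t e = v

/-- Replaces `2 * i` copies of `x` by `i` copies of `2 * x`. -/
def shift (x i : ℕ) (f : ℕ → ℕ) (y : ℕ) : ℕ :=
  if y = x then f x - 2 * i else if y = 2 * x then f (2 * x) + i else f y

/-- Trading copies preserves the total, except that copies of `2 * x` beyond `t` are no longer
counted. -/
theorem mass_shift {t x i : ℕ} {f : ℕ → ℕ} (hx : 1 ≤ x) (hxt : x ≤ t) (hi : 2 * i ≤ f x) :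
    mass t (shift x i f) + 2 * i * x = mass t f + if 2 * x ≤ t then 2 * i * x else 0 := by
  have h1 : ∑ y ∈ Ico 1 (t + 1), (shift x i f y * y + if y = x then 2 * i * x else 0) =
      ∑ y ∈ Ico 1 (t + 1), (f y * y + if y = 2 * x then 2 * i * x else 0) := by
    refine sum_congr rfl fun y _ => ?_
    unfold shift
    by_cases h1 : y = x
    · subst h1
      rw [if_pos rfl, if_pos rfl, if_neg (by omega), add_zero, ← add_mul, Nat.sub_add_cancel hi]
    · rw [if_neg h1, if_neg h1]
      by_cases h2 : y = 2 * x
      · subst h2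
        rw [if_pos rfl, if_pos rfl]; ring
      · rw [if_neg h2, if_neg h2]
  rw [sum_add_distrib, sum_add_distrib, sum_ite_eq', sum_ite_eq', if_pos (by simp; omega)] at h1
  refine h1.trans ?_
  unfold mass
  congr 1
  exact if_congr (by simp; omega) rfl rfl

theorem mass_shift_le {t x i : ℕ} {f : ℕ → ℕ} (hx : 1 ≤ x) (hxt : x ≤ t) (hi : 2 * i ≤ f x) :
    mass t (shift x i f) ≤ mass t f := by
  have := mass_shift hx hxt hi
  split_ifs at this <;> omega

theorem term_le_mass {t y : ℕ} {f : ℕ → ℕ} (hy : 1 ≤ y) (hyt : y ≤ t) : f y * y ≤ mass t f :=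
  single_le_sum (f := fun y => f y * y) (fun _ _ => Nat.zero_le _) (by simp; omega)

/-- The trade leaves one or two copies of a value that occurs at all. A new copy of `2 * x` that is
used can be expanded into two copies of `x`. Conversely, superfluous copies of `x` are paired up,
and one remaining copy suffices to fix the parity. -/
theorem hasSubsetSum_shift {t x v : ℕ} {f : ℕ → ℕ} (hx : 1 ≤ x) (hxt : x ≤ t) (hv : v ≤ t) :
    HasSubsetSum t (shift x ((f x - 1) / 2) f) v ↔ HasSubsetSum t f v := by
  obtain ⟨k, hk⟩ : ∃ k, k = (f x - 1) / 2 := ⟨_, rfl⟩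
  rw [← hk]
  have hmx : x ∈ Ico 1 (t + 1) := by simp; omega
  constructor
  · rintro ⟨e, he, rfl⟩
    -- The number of copies of `2 * x` in use that the original multiplicity does not provide.
    obtain ⟨i, hi⟩ : ∃ i, i = if 2 * x ≤ t then e (2 * x) - f (2 * x) else 0 := ⟨_, rfl⟩
    have hex := he x hmx
    simp only [shift, if_true] at hex
    have hik : i ≤ k := by
      rw [hi]
      split_ifs with h2
      · have := he (2 * x) (by simp; omega)
        simp only [shift, if_true] at this
        rw [if_neg (by omega)] at this
        omega
      · omega
    have hie : 2 * x ≤ t → i ≤ e (2 * x) := fun h => by rw [hi, if_pos h]; omega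
    refine ⟨fun y => if y = x then e x + 2 * i else if y = 2 * x then e (2 * x) - i else e y, ?_, ?_⟩
    · intro y hy
      have h1 := he y hy
      have hy' := hy
      simp only [mem_Ico] at hy'
      simp only [shift] at h1 ⊢
      by_cases hyx : y = x
      · rw [if_pos hyx] at h1 ⊢
        subst hyx; omega
      · rw [if_neg hyx] at h1 ⊢
        by_cases hy2 : y = 2 * x
        · rw [if_pos hy2] at h1 ⊢
          subst hy2
          rw [hi, if_pos (by omega)]; omega
        · rw [if_neg hy2] at h1 ⊢
          exact h1
    · have h2 := mass_shift (t := t) (i := i)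
        (f := fun y => if y = x then e x + 2 * i else if y = 2 * x then e (2 * x) - i else e y) hx hxt
        (by simp)
      have h3 : mass t (shift x i fun y => if y = x then e x + 2 * i else
          if y = 2 * x then e (2 * x) - i else e y) = mass t e := by
        refine sum_congr rfl fun y hy => ?_
        have hy' := hy
        simp only [mem_Ico] at hy'
        congr 1
        simp only [shift]
        by_cases hyx : y = x
        · subst hyx; simp
        · rw [if_neg hyx]
          by_cases hy2 : y = 2 * x
          · subst hy2
            have := hie (by omega)
            simp only [if_true]
            rw [if_neg (by omega)]
            omega
          · rw [if_neg hy2, if_neg hyx, if_neg hy2]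
      rw [h3] at h2
      split_ifs at h2 with h4
      · omega
      · rw [if_neg h4] at hi
        subst hi
        omega
  · rintro ⟨e, he, rfl⟩
    have hex := he x hmx
    -- Pair up just enough copies that no more than the remaining `f x - 2 * k` copies of `x` are
    -- used singly; rounding up is possible because at least one copy remains whenever `x` occurs.
    obtain ⟨i, h1, h2, h3⟩ : ∃ i, 2 * i ≤ e x ∧ e x - 2 * i ≤ f x - 2 * k ∧ i ≤ k := by
      by_cases hc : e x ≤ f x - 2 * k
      · exact ⟨0, by omega, by omega, by omega⟩
      · exact ⟨(e x - (f x - 2 * k) + 1) / 2, by omega, by omega, by omega⟩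
    have hsm := mass_shift hx hxt h1
    have h4 := term_le_mass (f := e) hx hxt
    refine ⟨shift x i e, ?_, ?_⟩
    · intro y hy
      have h5 := he y hy
      simp only [shift]
      split_ifs with c1 c2
      · exact h2
      · subst c2; omega
      · exact h5
    · have h6 : 2 * i * x ≤ e x * x := Nat.mul_le_mul_right _ h1
      split_ifs at hsm with h5
      · omega
      -- If `2 * x > t`, then two copies of `x` already exceed `v ≤ t`, so nothing is paired.
      · have : i = 0 := by
          by_contra h0
          have : 2 * 1 * x ≤ 2 * i * x := Nat.mul_le_mul_right _ (by omega)
          omega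
        subst this
        omega

/-- The multiplicities after the reduction of the values up to `n`. -/
def reduced (f : ℕ → ℕ) : ℕ → ℕ → ℕ
  | 0 => f
  | n + 1 => shift (n + 1) ((reduced f n (n + 1) - 1) / 2) (reduced f n)

theorem mass_reduced_le (f : ℕ → ℕ) {t n : ℕ} (hn : n ≤ t) : mass t (reduced f n) ≤ mass t f := by
  induction n with
  | zero => exact le_rfl
  | succ n ih => exact (mass_shift_le (by omega) hn (by omega)).trans (ih (by omega))

theorem hasSubsetSum_reduced {f : ℕ → ℕ} {t n v : ℕ} (hn : n ≤ t) (hv : v ≤ t) :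
    HasSubsetSum t (reduced f n) v ↔ HasSubsetSum t f v := by
  induction n with
  | zero => exact Iff.rfl
  | succ n ih => exact (hasSubsetSum_shift (by omega) hn hv).trans (ih (by omega))

/-- Values are treated in increasing order and a step only adds copies to a larger value, so a
multiplicity that has been reduced does not grow again. -/
theorem reduced_le {f : ℕ → ℕ} {n y : ℕ} (hy : 1 ≤ y) (hyn : y ≤ n) : reduced f n y ≤ 2 := by
  induction n with
  | zero => omega
  | succ n ih =>
    simp only [reduced, shift]
    split_ifs with h1 h2
    · omega
    · omega
    · exact ih (by omega)

/-- New values arise only by doubling. -/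
theorem reduced_support {f : ℕ → ℕ} {n y : ℕ} (h : 0 < reduced f n y) :
    ∃ x i, 0 < f x ∧ y = x * 2 ^ i := by
  induction n generalizing y with
  | zero => exact ⟨y, 0, h, by simp⟩
  | succ n ih =>
    simp only [reduced, shift] at h
    split_ifs at h with h1 h2
    · subst h1; exact ih (by omega)
    · by_cases h3 : 0 < reduced f n (2 * (n + 1))
      · subst h2; exact ih h3
      · obtain ⟨x, i, h4, h5⟩ := ih (y := n + 1) (by omega)
        exact ⟨x, i + 1, h4, by rw [h2, pow_succ]; linarith⟩
    · exact ih h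

/-- An original value `x ≥ 1` has at most `log t + 1` multiples `x * 2 ^ i` up to `t`. -/
theorem card_support_le {f : ℕ → ℕ} {t n : ℕ} {A : Finset ℕ} (hA : ∀ x, 0 < f x → x ∈ A)
    (hA1 : ∀ x ∈ A, 1 ≤ x) :
    ((Ico 1 (t + 1)).filter fun y => 0 < reduced f n y).card ≤ A.card * (Nat.log 2 t + 1) := by
  have hsub : ((Ico 1 (t + 1)).filter fun y => 0 < reduced f n y) ⊆
      (A ×ˢ range (Nat.log 2 t + 1)).image fun p => p.1 * 2 ^ p.2 := by
    intro y hy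
    simp only [mem_filter, mem_Ico] at hy
    obtain ⟨x, i, h1, h2⟩ := reduced_support hy.2
    refine mem_image.mpr ⟨(x, i), mem_product.mpr ⟨hA x h1, mem_range.mpr ?_⟩, h2.symm⟩
    have hx := hA1 x (hA x h1)
    have h3 : 1 * 2 ^ i ≤ x * 2 ^ i := Nat.mul_le_mul_right _ hx
    exact Nat.lt_succ_of_le (Nat.le_log_of_pow_le (by norm_num) (by
      rw [one_mul, ← h2] at h3
      exact h3.trans (Nat.lt_succ_iff.mp hy.1.2)))
  refine (card_le_card hsub).trans (card_image_le.trans ?_)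
  rw [card_product, card_range]

theorem mem_subsetSums {S : Multiset ℕ} {t v : ℕ} (hS : ∀ x ∈ S, 1 ≤ x ∧ x ≤ t) :
    v ∈ subsetSums S ↔ HasSubsetSum t (fun x => S.count x) v := by
  constructor
  · rintro ⟨T, hT, rfl⟩
    refine ⟨fun x => T.count x, fun y _ => Multiset.le_iff_count.mp hT y, ?_⟩
    rw [Finset.sum_multiset_count_of_subset T (Ico 1 (t + 1))]
    · rfl
    · intro x hx
      have := hS x (Multiset.mem_of_le hT (Multiset.mem_toFinset.mp hx))
      simp; omega
  · rintro ⟨e, he, rfl⟩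
    refine ⟨∑ x ∈ Ico 1 (t + 1), Multiset.replicate (e x) x, ?_, ?_⟩
    · rw [Multiset.le_iff_count]
      intro y
      rw [Multiset.count_sum']
      by_cases hy : y ∈ Ico 1 (t + 1)
      · rw [Finset.sum_eq_single y]
        · simpa using he y hy
        · intro b _ hb
          simp [Multiset.count_replicate, hb]
        · exact fun h => absurd hy h
      · rw [Finset.sum_eq_zero]
        · exact Nat.zero_le _
        · intro b hb
          have : b ≠ y := fun h => hy (h ▸ hb)
          simp [Multiset.count_replicate, this]
    · rw [← Multiset.coe_sumAddMonoidHom, map_sum]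
      refine sum_congr rfl fun x _ => ?_
      simp

theorem mass_count {S : Multiset ℕ} {t : ℕ} (hS : ∀ x ∈ S, 1 ≤ x ∧ x ≤ t) :
    mass t (fun x => S.count x) = S.sum := by
  rw [Finset.sum_multiset_count_of_subset S (Ico 1 (t + 1))]
  · rfl
  · intro x hx
    have := hS x (Multiset.mem_toFinset.mp hx)
    simp; omega

theorem subSum_leafList {f : ℕ → ℕ} {a n v : ℕ} : (∃ j, SubSum (leafList f a n) j v) ↔
    ∃ e : ℕ → ℕ, (∀ k < n, e (a + k) ≤ f (a + k)) ∧ ∑ k ∈ range n, e (a + k) * (a + k) = v := by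
  induction n generalizing v with
  | zero =>
    simp only [leafList, SubSum, range_zero, sum_empty]
    constructor
    · rintro ⟨j, -, rfl⟩; exact ⟨fun _ => 0, by simp, rfl⟩
    · rintro ⟨e, -, rfl⟩; exact ⟨0, rfl, rfl⟩
  | succ n ih =>
    have hlast : ∀ v, (∃ j, SubSum (if 0 < f (a + n) then [(a + n, f (a + n))] else []) j v) ↔
        ∃ i ≤ f (a + n), v = i * (a + n) := by
      intro v
      split_ifs with h
      · simp only [subSum_singleton]
      · simp only [SubSum]
        constructor
        · rintro ⟨j, -, rfl⟩; exact ⟨0, by omega, by simp⟩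
        · rintro ⟨i, hi, rfl⟩; exact ⟨0, rfl, by rw [show i = 0 by omega, zero_mul]⟩
    constructor
    · rintro ⟨j, h⟩
      obtain ⟨j₁, v₁, j₂, v₂, h1, h2, rfl, rfl⟩ := subSum_append.mp h
      obtain ⟨e, he, rfl⟩ := ih.mp ⟨j₁, h1⟩
      obtain ⟨i, hi, rfl⟩ := (hlast v₂).mp ⟨j₂, h2⟩
      refine ⟨Function.update e (a + n) i, fun k hk => ?_, ?_⟩
      · by_cases hkn : k = n
        · subst hkn; simpa using hi
        · rw [Function.update_of_ne (by omega)]; exact he k (by omega)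
      · rw [sum_range_succ, Function.update_self]
        congr 1
        refine sum_congr rfl fun k hk => ?_
        rw [mem_range] at hk
        rw [Function.update_of_ne (by omega)]
    · rintro ⟨e, he, rfl⟩
      obtain ⟨j₁, h1⟩ := ih.mpr ⟨e, fun k hk => he k (by omega), rfl⟩
      obtain ⟨j₂, h2⟩ := (hlast _).mpr ⟨e (a + n), he n (by omega), rfl⟩
      exact ⟨j₁ + j₂, subSum_append.mpr ⟨_, _, _, _, h1, h2, rfl, by rw [sum_range_succ]⟩⟩

theorem leafList_append (f : ℕ → ℕ) (a n m : ℕ) :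
    leafList f a n ++ leafList f (a + n) m = leafList f a (n + m) := by
  induction m with
  | zero => simp [leafList]
  | succ m ih =>
    rw [← add_assoc, leafList, leafList, ← List.append_assoc, ih, add_assoc a]

/-- The sentinel is neutral: multiplicity zero allows only the empty choice. -/
theorem subSum_append_zero {l : List (ℕ × ℕ)} {x j v : ℕ} :
    SubSum (l ++ [(x, 0)]) j v ↔ SubSum l j v := by
  rw [subSum_append]
  constructor
  · rintro ⟨j₁, v₁, j₂, v₂, h1, h2, rfl, rfl⟩
    obtain ⟨h3, rfl⟩ := subSum_singleton.mp h2
    obtain rfl : j₂ = 0 := by omega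
    simpa using h1
  · intro h
    exact ⟨j, v, 0, 0, h, subSum_singleton.mpr (by simp), by simp, by simp⟩

/-- Without their sentinels the two lists concatenate to the list of all values `1, …, t`, so the
threshold does not affect the result. -/
theorem subSum_split {f : ℕ → ℕ} {a t v y : ℕ} (ha : 1 ≤ a) (hat : a ≤ t + 1) :
    (∃ j, SubSum ((leafList f 1 (a - 1) ++ [(y, 0)]) ++ (leafList f a (t + 1 - a) ++ [(y, 0)])) j v) ↔
      HasSubsetSum t f v := by
  have h1 : ∀ j, SubSum ((leafList f 1 (a - 1) ++ [(y, 0)]) ++ (leafList f a (t + 1 - a) ++ [(y, 0)])) j v ↔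
      SubSum (leafList f 1 t) j v := by
    intro j
    have h2 := leafList_append f 1 (a - 1) (t + 1 - a)
    rw [show 1 + (a - 1) = a by omega, show a - 1 + (t + 1 - a) = t by omega] at h2
    rw [← h2, subSum_append, subSum_append]
    simp only [subSum_append_zero]
  simp only [h1, subSum_leafList, HasSubsetSum, mass]
  constructor
  · rintro ⟨e, he, rfl⟩
    refine ⟨e, fun y hy => ?_, by rw [sum_Ico_eq_sum_range]; rfl⟩
    simp only [mem_Ico] at hy
    have := he (y - 1) (by omega)
    rwa [show 1 + (y - 1) = y by omega] at this
  · rintro ⟨e, he, rfl⟩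
    exact ⟨e, fun k hk => he _ (by simp; omega), by rw [sum_Ico_eq_sum_range]; rfl⟩

end WordRAM

/-! ### Reading the input, reducing the multiplicities, choosing the threshold -/

namespace WordRAM

variable {w : ℕ} {Q : St → Prop} {s : St}

section expressions

open Var

/-- Reads the input; `t` becomes the minimum of the bound and the sum of the multiset, and the array
at `bb` holds the multiplicities of the values. -/
def prepCmd : Cmd :=
  .seq (.set u (.load 0)) <| .seq (.set n (.load 1)) <| .seq (.set bb (2 * n + 2)) <|
  .seq (.set Var.s 0) <| .seq (.set lo 0) <|
  .seq (.while lo n <| .seq (.set Var.s (Var.s + .load (3 + 2 * lo) * .load (2 + 2 * lo))) <|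
    .set lo (lo + 1)) <|
  .seq (.set t (.ite u Var.s u Var.s)) <| .seq (.set top (bb + t + 1)) <| .seq (.set lo 0) <|
  .while lo n <| .seq (.store (bb + .load (2 + 2 * lo)) (.load (3 + 2 * lo))) <| .set lo (lo + 1)

/-- Reduces the multiplicities in the array at `bb` to at most two. -/
def reduceCmd : Cmd :=
  .seq (.set x 1) <| .while x (t + 1) <| .seq (.set c (.load (bb + x))) <|
  .seq (.ite 2 c (.seq (.set q ((c - 1) / 2)) <| .seq (.store (bb + x) (c - 2 * q)) <|
    .ite t (2 * x) .skip (.store (bb + 2 * x) (.load (bb + 2 * x) + q))) .skip) <|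
  .set x (x + 1)

/-- Finds the first value `x0` for which `x0` times the sum of the values up to `x0` exceeds `t * t`. -/
def thresholdCmd : Cmd :=
  .seq (.set x0 1) <| .seq (.set Var.s 0) <|
  .while 0 (.ite t x0 0 (.ite (t * t) ((Var.s + .load (bb + x0) * x0) * x0) 0 1)) <|
  .seq (.set Var.s (Var.s + .load (bb + x0) * x0)) <| .set x0 (x0 + 1)

end expressions

/-- The array of multiplicities lies directly behind the input, in memory that is still zero, so
only the listed values have to be stored. All of them are at most `t`: they are bounded by `u` and
by the total sum. -/
theorem wp_prep {u N B t : ℕ} {v c f : ℕ → ℕ} (hu : s.mem 0 = u) (hN : s.mem 1 = N) (hB : B = 2 * N + 2)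
    (hv : ∀ i < N, s.mem (2 + 2 * i) = v i) (hc : ∀ i < N, s.mem (3 + 2 * i) = c i)
    (h0 : ∀ a, B ≤ a → s.mem a = 0) (hvt : ∀ i < N, v i ≤ t) (hf : ∀ i < N, f (v i) = c i)
    (hf0 : ∀ y, (∀ i < N, v i ≠ y) → f y = 0)
    (ht : t = min u (∑ i ∈ Finset.range N, c i * v i))
    (hsum : (∑ i ∈ Finset.range N, c i * v i) < 2 ^ w) (hw : 3 ≤ w) (hspace : B + t + 1 < 2 ^ w)
    (h : ∀ s' : St, s'.var .t = t → s'.var .bb = B → s'.var .top = B + t + 1 →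
      (∀ y ≤ t, s'.mem (B + y) = f y) → s'.time ≤ s.time + (3000 + 2000 * N) → Q s') :
    wp w prepCmd Q s := by
  have h8 : 2 ^ 3 ≤ 2 ^ w := Nat.pow_le_pow_right (by norm_num) hw
  have n1 : 1 % 2 ^ w = 1 := lit_mod (by omega)
  have n2 : 2 % 2 ^ w = 2 := lit_mod (by omega)
  have n3 : 3 % 2 ^ w = 3 := lit_mod (by omega)
  have e1 : 2 * N % 2 ^ w = 2 * N := lit_mod (by omega)
  have e2 : (2 * N + 2) % 2 ^ w = B := by rw [← hB]; exact lit_mod (by omega)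
  have hpart : ∀ k ≤ N, ∑ i ∈ Finset.range k, c i * v i ≤ ∑ i ∈ Finset.range N, c i * v i :=
    fun k hk => Finset.sum_le_sum_of_subset (Finset.range_mono hk)
  refine wp_seq (wp_set (x := u) (by simp [hu]) ?_)
  refine wp_seq (wp_set (x := N) (by simp [n1, hN]) ?_)
  refine wp_seq (wp_set (x := B) (by simp [n2, e1, e2]) ?_)
  refine wp_seq (wp_set (x := 0) (by simp) (wp_seq (wp_set (x := 0) (by simp) ?_)))
  refine wp_seq (wp_while (fun k s' => s'.var .lo = k ∧ s'.var .n = N ∧ s'.var .u = u ∧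
    s'.var .bb = B ∧ s'.var .s = ∑ i ∈ Finset.range k, c i * v i ∧ s'.mem = s.mem ∧
    s'.time ≤ s.time + (1500 + k * 900)) N ?_ ?_ ?_)
  · exact ⟨by simp, by simp, by simp, by simp, by simp, by simp, by simp⟩
  · rintro k hk s1 ⟨c1, c2, c3, c4, c5, c6, c7⟩
    have e3 : 2 * k % 2 ^ w = 2 * k := lit_mod (by omega)
    have e4 : (2 + 2 * k) % 2 ^ w = 2 + 2 * k := lit_mod (by omega)
    have e5 : (3 + 2 * k) % 2 ^ w = 3 + 2 * k := lit_mod (by omega)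
    have e6 : (k + 1) % 2 ^ w = k + 1 := lit_mod (by omega)
    have h1 := hpart (k + 1) hk
    rw [Finset.sum_range_succ] at h1
    have e7 : c k * v k % 2 ^ w = c k * v k := lit_mod (by omega)
    refine ⟨by simp [c1, c2, hk], wp_seq (wp_set (x := ∑ i ∈ Finset.range (k + 1), c i * v i) (by
      simp [c1, c5, c6, n2, n3, e3, e4, e5, hv k hk, hc k hk, e7, Finset.sum_range_succ]
      exact lit_mod (by omega)) ?_)⟩
    refine wp_set (x := k + 1) (by simp [c1, n1, e6]) ⟨by simp, by simp [c2], by simp [c3], by simp [c4],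
      by simp, by simp [c6], by simp; omega⟩
  · rintro s1 ⟨c1, c2, c3, c4, c5, c6, c7⟩
    refine ⟨by simp [c1, c2], ?_⟩
    refine wp_seq (wp_set (x := t) (by simp [c3, c5, ht, min_def]; split_ifs <;> omega) ?_)
    have e3 : (B + t) % 2 ^ w = B + t := lit_mod (by omega)
    refine wp_seq (wp_set (x := B + t + 1) (by simp [c4, e3, n1]; exact lit_mod hspace) ?_)
    refine wp_seq (wp_set (x := 0) (by simp) ?_)
    refine wp_while (fun k s' => s'.var .lo = k ∧ s'.var .n = N ∧ s'.var .t = t ∧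
      s'.var .bb = B ∧ s'.var .top = B + t + 1 ∧ (∀ a < B, s'.mem a = s.mem a) ∧
      (∀ y ≤ t, s'.mem (B + y) = if ∃ i < k, v i = y then f y else 0) ∧
      s'.time ≤ s.time + (2700 + N * 900 + k * 900)) N ?_ ?_ ?_
    · exact ⟨by simp, by simp [c2], by simp, by simp [c4], by simp, by simp [c6],
        fun y _ => by simp [c6, h0 (B + y) (by omega)], by simp; omega⟩
    · rintro k hk s2 ⟨d1, d2, d3, d4, d5, d6, d7, d8⟩
      have e3 : 2 * k % 2 ^ w = 2 * k := lit_mod (by omega)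
      have e4 : (2 + 2 * k) % 2 ^ w = 2 + 2 * k := lit_mod (by omega)
      have e5 : (3 + 2 * k) % 2 ^ w = 3 + 2 * k := lit_mod (by omega)
      have e6 : (k + 1) % 2 ^ w = k + 1 := lit_mod (by omega)
      have h1 := hvt k hk
      have e7 : (B + v k) % 2 ^ w = B + v k := lit_mod (by omega)
      refine ⟨by simp [d1, d2, hk], wp_seq (wp_store (x := B + v k) (y := c k) (by
        simp [d1, d4, n2, e3, e4]; rw [d6 _ (by omega), hv k hk, e7]) (by
        simp [d1, n2, n3, e3, e5]; rw [d6 _ (by omega), hc k hk]) ?_)⟩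
      refine wp_set (x := k + 1) (by simp [d1, n1, e6]) ⟨by simp, by simp [d2], by simp [d3], by simp [d4],
        by simp [d5], fun a ha => ?_, fun y hy => ?_, by simp; omega⟩
      · simp only [St.set_mem, St.put_mem, St.tick_mem]
        rw [Function.update_of_ne (by omega), d6 a ha]
      · simp only [St.set_mem, St.put_mem, St.tick_mem]
        by_cases hy2 : v k = y
        · subst hy2
          rw [Function.update_self, if_pos ⟨k, by omega, rfl⟩, hf k hk]
        · rw [Function.update_of_ne (by omega), d7 y hy]
          refine if_congr ?_ rfl rfl
          constructor
          · rintro ⟨i, hi, h2⟩; exact ⟨i, by omega, h2⟩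
          · rintro ⟨i, hi, h2⟩
            refine ⟨i, ?_, h2⟩
            by_contra h3
            obtain rfl : i = k := by omega
            exact hy2 h2
    · rintro s2 ⟨d1, d2, d3, d4, d5, d6, d7, d8⟩
      refine ⟨by simp [d1, d2], h _ d3 d4 d5 (fun y hy => ?_) (by simp; omega)⟩
      rw [St.tick_mem, d7 y hy]
      split_ifs with h1
      · rfl
      · exact (hf0 y fun i hi h2 => h1 ⟨i, hi, h2⟩).symm

/-- Every multiplicity is at most the mass of the current function, which never grows, so no word
overflows while copies are collected at larger values. -/
theorem wp_reduce {B t : ℕ} {f : ℕ → ℕ} (ht : s.var .t = t) (hB : s.var .bb = B)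
    (hf : ∀ y, 1 ≤ y → y ≤ t → s.mem (B + y) = f y) (hmass : mass t f < 2 ^ w)
    (hspace : B + 2 * t + 3 < 2 ^ w)
    (h : ∀ s' : St, (∀ y, 1 ≤ y → y ≤ t → s'.mem (B + y) = reduced f t y) →
      s'.time ≤ s.time + (600 + 2400 * t) →
      (∀ v ∉ reduceCmd.writes, s'.var v = s.var v) → Q s') :
    wp w reduceCmd Q s := by
  suffices wp w reduceCmd (fun s' => (∀ y, 1 ≤ y → y ≤ t → s'.mem (B + y) = reduced f t y) ∧
      s'.time ≤ s.time + (600 + 2400 * t)) s from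
    this.frame.mono fun s' ⟨⟨a, b⟩, k⟩ => h s' a b k
  have n1 : 1 % 2 ^ w = 1 := lit_mod (by omega)
  have n2 : 2 % 2 ^ w = 2 := lit_mod (by omega)
  have e1 : (t + 1) % 2 ^ w = t + 1 := lit_mod (by omega)
  refine wp_seq (wp_set (x := 1) (by simp [n1]) ?_)
  refine wp_while (fun k s' => s'.var .x = k + 1 ∧ s'.var .t = t ∧ s'.var .bb = B ∧
    (∀ y, 1 ≤ y → y ≤ t → s'.mem (B + y) = reduced f k y) ∧
    s'.time ≤ s.time + (300 + k * 2400)) t ?_ ?_ ?_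
  · exact ⟨by simp, by simp [ht], by simp [hB], fun y h1 h2 => by simp [hf y h1 h2, reduced], by simp⟩
  · rintro k hk s1 ⟨c1, c2, c3, c4, c5⟩
    obtain ⟨g, hg⟩ : ∃ g, g = reduced f k := ⟨_, rfl⟩
    have hm : mass t g ≤ mass t f := by rw [hg]; exact mass_reduced_le f (by omega)
    have hgy : ∀ y, 1 ≤ y → y ≤ t → g y < 2 ^ w := fun y h1 h2 => by
      have h3 := term_le_mass (f := g) h1 h2
      have h4 : g y * 1 ≤ g y * y := Nat.mul_le_mul_left _ h1
      omega
    have hnext : reduced f (k + 1) = shift (k + 1) ((g (k + 1) - 1) / 2) g := by rw [hg]; rfl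
    rw [← hg] at c4
    have e2 : (B + (k + 1)) % 2 ^ w = B + (k + 1) := lit_mod (by omega)
    have e3 : (k + 1 + 1) % 2 ^ w = k + 1 + 1 := lit_mod (by omega)
    have e4 : 2 * (k + 1) % 2 ^ w = 2 * (k + 1) := lit_mod (by omega)
    have e5 : (B + 2 * (k + 1)) % 2 ^ w = B + 2 * (k + 1) := lit_mod (by omega)
    have hgk := hgy (k + 1) (by omega) (by omega)
    have hck := c4 (k + 1) (by omega) (by omega)
    obtain ⟨C, hC⟩ : ∃ C, C = g (k + 1) := ⟨_, rfl⟩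
    rw [← hC] at hgk hck hnext
    have finish : ∀ s2 : St, s2.var .x = k + 1 → s2.var .t = t → s2.var .bb = B →
        (∀ y, 1 ≤ y → y ≤ t → s2.mem (B + y) = shift (k + 1) ((C - 1) / 2) g y) →
        s2.time ≤ s1.time + 2100 →
        wp w (.set .x (.var .x + 1)) (fun s' => s'.var .x = k + 1 + 1 ∧ s'.var .t = t ∧
          s'.var .bb = B ∧ (∀ y, 1 ≤ y → y ≤ t → s'.mem (B + y) = reduced f (k + 1) y) ∧
          s'.time ≤ s.time + (300 + (k + 1) * 2400)) s2 := by
      intro s2 f1 f2 f3 f4 f5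
      exact wp_set (x := k + 1 + 1) (by simp [f1, n1, e3]) ⟨by simp, by simp [f2], by simp [f3],
        fun y h1 h2 => by rw [hnext, St.set_mem, f4 y h1 h2], by rw [St.set_time]; omega⟩
    refine ⟨by simp [c1, c2, n1, e1, hk], wp_seq (wp_set (x := C) (by simp [c1, c3, e2, hck]) ?_)⟩
    refine wp_seq (wp_ite (fun hlt => ?_) fun hlt => ?_)
    · simp [n2] at hlt
      have m1 : (C + (2 ^ w - 1)) % 2 ^ w = C - 1 := sub_mod (by omega) hgk
      obtain ⟨q, hq⟩ : ∃ q, q = (C - 1) / 2 := ⟨_, rfl⟩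
      rw [← hq] at finish
      have m2 : 2 * q % 2 ^ w = 2 * q := lit_mod (by omega)
      have m3 : (C + (2 ^ w - 2 * q)) % 2 ^ w = C - 2 * q := sub_mod (by omega) hgk
      refine wp_seq (wp_set (x := q) (by simp [n1, n2, m1, hq]) ?_)
      refine wp_seq (wp_store (x := B + (k + 1)) (y := C - 2 * q) (by simp [c1, c3, e2])
        (by simp [n2, m2, m3]) ?_)
      refine wp_ite (fun hlt2 => wp_skip (finish _ (by simp [c1]) (by simp [c2]) (by simp [c3]) ?_
        (by simp))) fun hlt2 => ?_
      · simp [c1, c2, n2, e4] at hlt2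
        intro y h1 h2
        simp only [St.tick_mem, St.put_mem, St.set_mem, shift]
        by_cases hy : y = k + 1
        · rw [if_pos hy, hy, Function.update_self, ← hC]
        · rw [if_neg hy, if_neg (by omega), Function.update_of_ne (by omega), c4 y h1 h2]
      · simp [c1, c2, n2, e4] at hlt2
        have h3 := c4 (2 * (k + 1)) (by omega) hlt2
        have h4 := term_le_mass (t := t) (f := shift (k + 1) q g) (y := 2 * (k + 1)) (by omega) hlt2
        have h5 := mass_shift_le (t := t) (x := k + 1) (i := q) (f := g) (by omega) (by omega) (by omega)
        have h6 : shift (k + 1) q g (2 * (k + 1)) = g (2 * (k + 1)) + q := by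
          simp only [shift]; rw [if_neg (by omega)]; simp
        rw [h6] at h4
        have h7 : (g (2 * (k + 1)) + q) * 1 ≤ (g (2 * (k + 1)) + q) * (2 * (k + 1)) :=
          Nat.mul_le_mul_left _ (by omega)
        refine wp_store (x := B + 2 * (k + 1)) (y := g (2 * (k + 1)) + q) (by simp [c1, c3, n2, e4, e5])
          (by
            simp [c1, c3, n2, e4, e5]
            rw [h3]
            exact lit_mod (by omega)) (finish _ (by simp [c1]) (by simp [c2]) (by simp [c3]) ?_ (by simp))
        intro y h1 h2
        simp only [St.tick_mem, St.put_mem, St.set_mem, shift]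
        by_cases hy2 : y = 2 * (k + 1)
        · rw [hy2, Function.update_self, if_neg (by omega), if_pos rfl]
        · rw [Function.update_of_ne (by omega), if_neg hy2]
          by_cases hy : y = k + 1
          · rw [if_pos hy, hy, Function.update_self, ← hC]
          · rw [if_neg hy, Function.update_of_ne (by omega), c4 y h1 h2]
    · simp [n2] at hlt
      -- With at most two copies the trade is empty, which justifies skipping it.
      have h0 : (C - 1) / 2 = 0 := by omega
      rw [h0] at finish
      refine wp_skip (finish _ (by simp [c1]) (by simp [c2]) (by simp [c3]) ?_ (by simp))
      intro y h1 h2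
      simp only [St.tick_mem, St.set_mem, shift]
      rw [c4 y h1 h2]
      split_ifs with h3 h4
      · rw [h3]; simp
      · rw [h4]; simp
      · rfl
  · rintro s1 ⟨c1, c2, c3, c4, c5⟩
    exact ⟨by simp [c1, c2, n1, e1], c4, by simp; omega⟩

/-- The number `a` is the first value whose product with the sum of the values up to it exceeds
`t * t`. -/
structure Threshold (t : ℕ) (f : ℕ → ℕ) (a : ℕ) : Prop where
  one_le : 1 ≤ a
  le : a ≤ t + 1
  below : ∀ k, 1 ≤ k → k < a → mass k f * k ≤ t * t
  above : a ≤ t → t * t < mass a f * a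

/-- The least candidate exists because `t + 1` qualifies unconditionally. -/
theorem exists_threshold (t : ℕ) (f : ℕ → ℕ) : ∃ a, Threshold t f a := by
  have hex : ∃ a, 1 ≤ a ∧ (t < a ∨ t * t < mass a f * a) := ⟨t + 1, by omega, Or.inl (by omega)⟩
  classical
  refine ⟨Nat.find hex, (Nat.find_spec hex).1, Nat.find_min' hex ⟨by omega, Or.inl (by omega)⟩,
    fun k h1 h2 => ?_, fun h => ?_⟩
  · have := Nat.find_min hex h2
    by_contra h3
    exact this ⟨h1, Or.inr (by omega)⟩
  · rcases (Nat.find_spec hex).2 with h1 | h1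
    · omega
    · exact h1

theorem mass_succ (k : ℕ) (f : ℕ → ℕ) : mass (k + 1) f = mass k f + f (k + 1) * (k + 1) := by
  unfold mass
  rw [Finset.sum_Ico_succ_top (by omega)]

theorem mass_le_of_le_two {k t : ℕ} {f : ℕ → ℕ} (hf : ∀ y, 1 ≤ y → y ≤ t → f y ≤ 2) (hk : k ≤ t) :
    mass k f ≤ 2 * (k * k) := by
  induction k with
  | zero => simp [mass]
  | succ k ih =>
    have h1 := ih (by omega)
    have h2 := Nat.mul_le_mul_right (k + 1) (hf (k + 1) (by omega) hk)
    rw [mass_succ]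
    nlinarith

/-- Multiplicities at most two make the mass quadratic in its range, so the tested products are
cubic in `t` and fit in a word. -/
theorem wp_threshold {B t a : ℕ} {f : ℕ → ℕ} (ht : s.var .t = t) (hB : s.var .bb = B)
    (hf : ∀ y, 1 ≤ y → y ≤ t → s.mem (B + y) = f y) (hf2 : ∀ y, 1 ≤ y → y ≤ t → f y ≤ 2)
    (ha : Threshold t f a)
    (hspace : B + 2 * ((t + 1) * (t + 1) * (t + 1)) + 1 < 2 ^ w)
    (h : ∀ s' : St, s'.var .x0 = a → s'.mem = s.mem → s'.time ≤ s.time + (900 + 900 * t) →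
      (∀ v ∉ thresholdCmd.writes, s'.var v = s.var v) → Q s') :
    wp w thresholdCmd Q s := by
  suffices wp w thresholdCmd (fun s' => s'.var .x0 = a ∧ s'.mem = s.mem ∧
      s'.time ≤ s.time + (900 + 900 * t)) s from
    this.frame.mono fun s' ⟨⟨a, b, c⟩, k⟩ => h s' a b c k
  obtain ⟨a, rfl⟩ : ∃ k, a = k + 1 := ⟨a - 1, by have := ha.one_le; omega⟩
  have hat := ha.le
  have h2t : (t + 1) * (t + 1) * 1 ≤ (t + 1) * (t + 1) * (t + 1) := Nat.mul_le_mul_left _ (by omega)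
  have h3t : 1 * (t + 1) ≤ (t + 1) * (t + 1) := Nat.mul_le_mul_right _ (by omega)
  have h4t : t * t ≤ (t + 1) * (t + 1) := Nat.mul_le_mul (by omega) (by omega)
  have n1 : 1 % 2 ^ w = 1 := lit_mod (by omega)
  have e0 : t * t % 2 ^ w = t * t := lit_mod (by omega)
  have hmass : ∀ k < t, mass (k + 1) f * (k + 1) ≤ 2 * ((t + 1) * (t + 1) * (t + 1)) := fun k hk => by
    have h1 := mass_le_of_le_two hf2 (k := k + 1) (by omega)
    refine (Nat.mul_le_mul_right _ h1).trans ?_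
    rw [mul_assoc]
    exact Nat.mul_le_mul_left _ (Nat.mul_le_mul (Nat.mul_le_mul (by omega) (by omega)) (by omega))
  -- A guard is a single comparison, so the conjunction of the two conditions is encoded as a nested
  -- conditional with values `0` and `1`.
  have hguard : ∀ k ≤ t, ∀ s1 : St, s1.var .x0 = k + 1 → s1.var .t = t → s1.var .bb = B →
      s1.var .s = mass k f → s1.mem = s.mem →
      ((Expr.eval w s1 0 < Expr.eval w s1 (.ite Var.t Var.x0 0 (.ite (.var .t * .var .t)
        ((Var.s + .load (.var .bb + .var .x0) * .var .x0) * .var .x0) 0 1))) ↔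
        k + 1 ≤ t ∧ mass (k + 1) f * (k + 1) ≤ t * t) := by
    intro k hk s1 c1 c2 c3 c4 c5
    by_cases hkt : t < k + 1
    · simp [c1, c2, hkt]
      omega
    · have e1 : (B + (k + 1)) % 2 ^ w = B + (k + 1) := lit_mod (by omega)
      have h1 := hmass k (by omega)
      have h2 : mass (k + 1) f * 1 ≤ mass (k + 1) f * (k + 1) := Nat.mul_le_mul_left _ (by omega)
      have h3 := mass_succ k f
      have e2 : f (k + 1) * (k + 1) % 2 ^ w = f (k + 1) * (k + 1) := lit_mod (by omega)
      have e3 : (mass k f + f (k + 1) * (k + 1)) % 2 ^ w = mass (k + 1) f := by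
        rw [← h3]; exact lit_mod (by omega)
      have e4 : mass (k + 1) f * (k + 1) % 2 ^ w = mass (k + 1) f * (k + 1) := lit_mod (by omega)
      simp [c1, c2, c3, c4, c5, hkt, e1, hf (k + 1) (by omega) (by omega), e2, e3, e4, e0, n1]
      split_ifs <;> simp <;> omega
  refine wp_seq (wp_set (x := 1) (by simp [n1]) ?_)
  refine wp_seq (wp_set (x := 0) (by simp) ?_)
  refine wp_while (fun k s' => s'.var .x0 = k + 1 ∧ s'.var .t = t ∧ s'.var .bb = B ∧
    s'.var .s = mass k f ∧ s'.mem = s.mem ∧ s'.time ≤ s.time + (600 + k * 900)) a ?_ ?_ ?_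
  · exact ⟨by simp, by simp [ht], by simp [hB], by simp [mass], by simp, by simp⟩
  · rintro k hk s1 ⟨c1, c2, c3, c4, c5, c6⟩
    refine ⟨(hguard k (by omega) s1 c1 c2 c3 c4 c5).mpr ⟨by omega, ha.below _ (by omega) (by omega)⟩, ?_⟩
    have e1 : (B + (k + 1)) % 2 ^ w = B + (k + 1) := lit_mod (by omega)
    have h1 := hmass k (by omega)
    have h2 : mass (k + 1) f * 1 ≤ mass (k + 1) f * (k + 1) := Nat.mul_le_mul_left _ (by omega)
    have h3 := mass_succ k f
    have e2 : f (k + 1) * (k + 1) % 2 ^ w = f (k + 1) * (k + 1) := lit_mod (by omega)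
    have e3 : (mass k f + f (k + 1) * (k + 1)) % 2 ^ w = mass (k + 1) f := by
      rw [← h3]; exact lit_mod (by omega)
    have e5 : (k + 1 + 1) % 2 ^ w = k + 1 + 1 := lit_mod (by omega)
    refine wp_seq (wp_set (x := mass (k + 1) f) (by
      simp [c1, c3, c4, c5, e1, hf (k + 1) (by omega) (by omega), e2, e3]) ?_)
    exact wp_set (x := k + 1 + 1) (by simp [c1, n1, e5]) ⟨by simp, by simp [c2], by simp [c3], by simp,
      by simp [c5], by simp; omega⟩
  · rintro s1 ⟨c1, c2, c3, c4, c5, c6⟩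
    refine ⟨fun hlt => ?_, c1, c5, by
      have : a * 900 ≤ t * 900 := Nat.mul_le_mul_right _ (by omega)
      simp; omega⟩
    obtain ⟨h1, h2⟩ := (hguard a (by omega) s1 c1 c2 c3 c4 c5).mp hlt
    have := ha.above h1
    omega

end WordRAM

/-! ### The total size of the nodes of a level -/

namespace WordRAM

open Finset

theorem sum_seg (h : ℕ × ℕ → ℕ) (l : List (ℕ × ℕ)) (e n : ℕ) :
    ∑ i ∈ range n, ((seg l e i).map h).sum = ((l.take (n * 2 ^ e)).map h).sum := by
  induction n with
  | zero => simp
  | succ n ih =>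
    rw [sum_range_succ, ih, add_mul, one_mul, List.take_add, List.map_append, List.sum_append]
    rfl

theorem sum_take_le (h : ℕ × ℕ → ℕ) (l : List (ℕ × ℕ)) (n : ℕ) :
    ((l.take n).map h).sum ≤ (l.map h).sum := by
  conv_rhs => rw [← List.take_append_drop n l, List.map_append, List.sum_append]
  omega

theorem le_length_of_seg {l : List (ℕ × ℕ)} {e n : ℕ} (h : ∀ i < n, i * 2 ^ e < l.length) :
    n ≤ l.length := by
  rcases n with _ | n
  · omega
  · have h1 := h n (by omega)
    have h2 : n * 1 ≤ n * 2 ^ e := Nat.mul_le_mul_left _ Nat.one_le_two_pow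
    omega

/-- A node has one row, whose length is at most the sum of its block plus one, and the blocks of a
level are disjoint. -/
theorem levelBound_zero (t : ℕ) (l : List (ℕ × ℕ)) :
    LevelBound t 0 l ((l.map fun p => p.2 * p.1).sum + l.length) := by
  intro e n J Z h
  have h1 : ∀ i ∈ range n, (J i + 1) * (Z i + 1) ≤ ((seg l e i).map fun p => p.2 * p.1).sum + 1 := by
    intro i hi
    obtain ⟨-, a, b, bit, N⟩ := h i (mem_range.mp hi)
    have h2 := N.J_le
    rw [N.a_zero rfl, Nat.div_zero] at h2
    have h3 := N.Z_le_sum rfl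
    rw [show J i = 0 by omega]
    omega
  refine (sum_le_sum h1).trans ?_
  rw [sum_add_distrib, sum_seg, sum_const, card_range, smul_eq_mul, mul_one]
  exact Nat.add_le_add (sum_take_le _ _ _) (le_length_of_seg fun i hi => (h i hi).1)

/-- The product `J * Z` has two bounds. If `b ≤ 2 * a`, then `Z ≤ J * (b - a)` and `J ≤ t / a` give
`t² (b - a) / a²`, at most `2 t² (1/a - 1/b)`. Otherwise `1/a - 1/b` is at least `1 / (2 a)`, and `J
* Z ≤ (t / a) * t` suffices. -/
theorem node_cells_le {t a b J Z : ℕ} (ha : 1 ≤ a) (hJ : J ≤ t / a) (hZ : Z ≤ t)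
    (hZJ : Z ≤ J * (b - a)) (hab : a ≤ b) :
    (((J + 1) * (Z + 1) : ℕ) : ℚ) ≤ 4 * t ^ 2 * (1 / a - 1 / b) + (J + 1) := by
  have hJa : J * a ≤ t := (Nat.mul_le_mul_right _ hJ).trans (Nat.div_mul_le_self _ _)
  have haq : (1 : ℚ) ≤ a := by exact_mod_cast ha
  have habq : (a : ℚ) ≤ b := by exact_mod_cast hab
  have hJaq : (J : ℚ) * a ≤ t := by exact_mod_cast hJa
  have hZq : (Z : ℚ) ≤ t := by exact_mod_cast hZ
  have hZJq : (Z : ℚ) ≤ J * (b - a) := by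
    rw [← Nat.cast_sub hab]; exact_mod_cast hZJ
  have hJ0 : (0 : ℚ) ≤ J := Nat.cast_nonneg _
  have hZ0 : (0 : ℚ) ≤ Z := Nat.cast_nonneg _
  have ht0 : (0 : ℚ) ≤ t := Nat.cast_nonneg _
  -- If `J = 0` then `Z = 0`; otherwise `J + 1 ≤ 2 * J`.
  have h1 : ((J + 1) * (Z + 1) : ℕ) ≤ 2 * (J * Z) + (J + 1) := by
    rcases J with _ | J
    · simp at hZJ; subst hZJ; simp
    · nlinarith [Nat.zero_le (J * Z)]
  have h2 : (J : ℚ) * Z ≤ 2 * t ^ 2 * (1 / a - 1 / b) := by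
    have hb0 : (0 : ℚ) < b := by linarith
    have ha0 : (0 : ℚ) < a := by linarith
    rw [div_sub_div _ _ ha0.ne' hb0.ne', mul_div_assoc', le_div_iff₀ (by positivity)]
    by_cases hc : (b : ℚ) ≤ 2 * a
    · have h3 : (J : ℚ) * Z * (a * a) ≤ t ^ 2 * (b - a) := by
        have h4 : (J : ℚ) * Z * (a * a) ≤ J * (J * (b - a)) * (a * a) := by gcongr
        have h5 : (J : ℚ) * a * (J * a) ≤ t * t := by gcongr
        have h6 : (J : ℚ) * a * (J * a) * (b - a) ≤ t * t * (b - a) :=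
          mul_le_mul_of_nonneg_right h5 (by linarith)
        nlinarith
      have h4 : (J : ℚ) * Z * (a * b) ≤ J * Z * (a * (2 * a)) := by gcongr
      nlinarith
    · have h3 : (J : ℚ) * a * Z ≤ t * t := by gcongr
      have h4 : (J : ℚ) * a * Z * b ≤ t * t * b := by gcongr
      have h5 : (t : ℚ) * t * (2 * a) ≤ t * t * b := by
        apply mul_le_mul_of_nonneg_left (by linarith) (by positivity)
      nlinarith
  calc (((J + 1) * (Z + 1) : ℕ) : ℚ) ≤ ((2 * (J * Z) + (J + 1) : ℕ) : ℚ) := by exact_mod_cast h1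
    _ = 2 * (J * Z) + (J + 1) := by push_cast; ring
    _ ≤ _ := by linarith

/-- The blocks are sorted, so the intervals from first to last value are disjoint up to endpoints
and the differences `1/a - 1/b` telescope to at most `1/X`. The terms `J + 1` add up to at most the
number of elements plus the number of blocks. -/
theorem levelBound_one {t X : ℕ} {l : List (ℕ × ℕ)} (hl : l.Pairwise fun p q => p.1 ≤ q.1)
    (hX : 1 ≤ X) (hlX : ∀ p ∈ l, X ≤ p.1) :
    LevelBound t 1 l (4 * (t * t) / X + (l.map Prod.snd).sum + l.length) := by
  intro e n J Z h
  -- The bound is strengthened to any `y` above the values seen so far; in the induction step the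
  -- first value of the next block takes the role of `y`.
  have key : ∀ m ≤ n, ∀ y : ℕ, X ≤ y → (∀ p ∈ l.take (m * 2 ^ e), p.1 ≤ y) →
      ((∑ i ∈ range m, (J i + 1) * (Z i + 1) : ℕ) : ℚ) ≤
        4 * t ^ 2 * (1 / X - 1 / y) + (∑ i ∈ range m, (J i + 1) : ℕ) := by
    intro m
    induction m with
    | zero =>
      intro _ y hy _
      have hXq : (0 : ℚ) < X := by exact_mod_cast hX
      have hyq : (X : ℚ) ≤ y := by exact_mod_cast hy
      have : (1 : ℚ) / y ≤ 1 / X := one_div_le_one_div_of_le hXq hyq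
      simp only [range_zero, sum_empty, Nat.cast_zero, add_zero]
      exact mul_nonneg (by positivity) (by linarith)
    | succ m ih =>
      intro hm y hy hp
      obtain ⟨h1, a, b, bit, N⟩ := h m (by omega)
      obtain ⟨c, hc⟩ := N.head rfl
      obtain ⟨c', hc'⟩ := N.last rfl
      have hca : (a, c) ∈ seg l e m := List.mem_of_mem_head? (by rw [hc]; rfl)
      have hcb : (b, c') ∈ seg l e m := List.mem_of_mem_getLast? (by rw [hc']; rfl)
      have htk : l.take ((m + 1) * 2 ^ e) = l.take (m * 2 ^ e) ++ seg l e m := by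
        rw [add_mul, one_mul, List.take_add]; rfl
      have hby : b ≤ y := hp (b, c') (by rw [htk]; exact List.mem_append_right _ hcb)
      have hXa : X ≤ a := hlX (a, c) (List.mem_of_mem_drop (List.mem_of_mem_take hca))
      have hprev : ∀ p ∈ l.take (m * 2 ^ e), p.1 ≤ a := by
        intro p hp
        have h2 := hl
        rw [← List.take_append_drop (m * 2 ^ e) l, List.pairwise_append] at h2
        exact h2.2.2 p hp (a, c) (List.mem_of_mem_take hca)
      have h3 := ih (by omega) a hXa hprev
      have ha1 : 1 ≤ a := by omega
      have h4 := node_cells_le ha1 N.J_le N.Z_le (N.Z_le_mul rfl) N.a_le_b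
      have h5 : (1 : ℚ) / y ≤ 1 / b :=
        one_div_le_one_div_of_le (by have := N.a_le_b; exact_mod_cast (by omega : 0 < b))
          (by exact_mod_cast hby)
      have h6 : (4 : ℚ) * t ^ 2 * (1 / a - 1 / b) ≤ 4 * t ^ 2 * (1 / a - 1 / y) :=
        mul_le_mul_of_nonneg_left (by linarith) (by positivity)
      rw [sum_range_succ, sum_range_succ]
      push_cast at h3 h4 ⊢
      linarith
  have h1 : ∑ i ∈ range n, (J i + 1) ≤ (l.map Prod.snd).sum + l.length := by
    have h2 : ∀ i ∈ range n, J i + 1 ≤ ((seg l e i).map Prod.snd).sum + 1 := by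
      intro i hi
      obtain ⟨-, a, b, bit, N⟩ := h i (mem_range.mp hi)
      have := N.J_le_card
      omega
    refine (sum_le_sum h2).trans ?_
    rw [sum_add_distrib, sum_seg, sum_const, card_range, smul_eq_mul, mul_one]
    exact Nat.add_le_add (sum_take_le _ _ _) (le_length_of_seg fun i hi => (h i hi).1)
  obtain ⟨y, hy1, hy2⟩ : ∃ y, X ≤ y ∧ ∀ p ∈ l, p.1 ≤ y :=
    ⟨X + (l.map Prod.fst).sum, by omega, fun p hp => by
      have := List.single_le_sum (l := l.map Prod.fst) (by simp) p.1 (List.mem_map_of_mem hp)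
      omega⟩
  have h2 := key n le_rfl y hy1 fun p hp => hy2 p (List.mem_of_mem_take hp)
  have hXq : (0 : ℚ) < X := by exact_mod_cast hX
  have h3 : ((∑ i ∈ range n, (J i + 1) * (Z i + 1) : ℕ) : ℚ) ≤
      4 * t ^ 2 / X + (∑ i ∈ range n, (J i + 1) : ℕ) := by
    have h4 : (0 : ℚ) ≤ 1 / y := by positivity
    have h5 : (4 : ℚ) * t ^ 2 * (1 / X - 1 / y) ≤ 4 * t ^ 2 * (1 / X) :=
      mul_le_mul_of_nonneg_left (by linarith) (by positivity)
    rw [mul_one_div] at h5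
    linarith
  have h6 : ∑ i ∈ range n, (J i + 1) * (Z i + 1) - ∑ i ∈ range n, (J i + 1) ≤ 4 * (t * t) / X := by
    rw [Nat.le_div_iff_mul_le (by omega)]
    by_cases hc : ∑ i ∈ range n, (J i + 1) ≤ ∑ i ∈ range n, (J i + 1) * (Z i + 1)
    · rw [← sub_le_iff_le_add, le_div_iff₀ hXq, ← Nat.cast_sub hc] at h3
      have : (((∑ i ∈ range n, (J i + 1) * (Z i + 1) - ∑ i ∈ range n, (J i + 1)) * X : ℕ) : ℚ) ≤
          ((4 * (t * t) : ℕ) : ℚ) := by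
        push_cast at h3 ⊢
        linarith
      exact_mod_cast this
    · rw [Nat.sub_eq_zero_of_le (by omega)]; simp
  omega

theorem mem_leafList {f : ℕ → ℕ} {a n : ℕ} {p : ℕ × ℕ} :
    p ∈ leafList f a n ↔ (a ≤ p.1 ∧ p.1 < a + n) ∧ 0 < f p.1 ∧ p.2 = f p.1 := by
  induction n with
  | zero => simp [leafList]
  | succ n ih =>
    rw [leafList, List.mem_append, ih]
    constructor
    · rintro (h | h)
      · exact ⟨by omega, h.2⟩
      · split_ifs at h with h0
        · rw [List.mem_singleton] at h
          subst h
          exact ⟨by simp, h0, rfl⟩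
        · simp at h
    · rintro ⟨h1, h2, h3⟩
      by_cases h4 : p.1 = a + n
      · right
        rw [← h4, if_pos h2, List.mem_singleton, ← h3]
      · exact Or.inl ⟨by omega, h2, h3⟩

theorem leafList_sorted (f : ℕ → ℕ) (a n : ℕ) : (leafList f a n).Pairwise fun p q => p.1 ≤ q.1 := by
  induction n with
  | zero => simp [leafList]
  | succ n ih =>
    rw [leafList, List.pairwise_append]
    refine ⟨ih, ?_, fun p hp q hq => ?_⟩
    · split_ifs <;> simp
    · have h1 := (mem_leafList.mp hp).1
      split_ifs at hq
      · rw [List.mem_singleton] at hq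
        subst hq
        simp; omega
      · simp at hq

theorem leafList_sum (h : ℕ × ℕ → ℕ) (f : ℕ → ℕ) (a n : ℕ) : ((leafList f a n).map h).sum =
    ∑ y ∈ (Ico a (a + n)).filter fun y => 0 < f y, h (y, f y) := by
  induction n with
  | zero => simp [leafList]
  | succ n ih =>
    rw [leafList, List.map_append, List.sum_append, ih, ← add_assoc, sum_filter, sum_filter,
      sum_Ico_succ_top (by omega)]
    congr 1
    split_ifs <;> simp

theorem leafList_mass (f : ℕ → ℕ) (n : ℕ) :
    ((leafList f 1 n).map fun p => p.2 * p.1).sum = mass n f := by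
  rw [leafList_sum, sum_filter, mass, add_comm 1]
  refine sum_congr rfl fun y _ => ?_
  split_ifs with h
  · rfl
  · rw [show f y = 0 by omega, zero_mul]

theorem leafList_length_le {f : ℕ → ℕ} {a n t : ℕ} (ha : 1 ≤ a) (hn : a + n ≤ t + 1) :
    (leafList f a n).length ≤ ((Ico 1 (t + 1)).filter fun y => 0 < f y).card := by
  have h1 := leafList_sum (fun _ => 1) f a n
  rw [List.map_const', List.sum_replicate, sum_const] at h1
  simp only [smul_eq_mul, mul_one] at h1
  rw [h1]
  exact card_le_card (filter_subset_filter _ (Ico_subset_Ico ha hn))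

theorem sum_map_le_length {l : List (ℕ × ℕ)} {h : ℕ × ℕ → ℕ} {c : ℕ} (hc : ∀ p ∈ l, h p ≤ c) :
    (l.map h).sum ≤ l.length * c := by
  have := List.sum_le_card_nsmul (l.map h) c (fun x hx => by
    obtain ⟨p, hp, rfl⟩ := List.mem_map.mp hx
    exact hc p hp)
  simpa using this

end WordRAM

/-! ### The program -/

namespace WordRAM

variable {w : ℕ} {Q : St → Prop} {s : St}

section expressions

open Var

/-- Computes the subset sums of the values from `x` to `r - 1`. -/
def rangeCmd : Cmd := .seq leavesCmd treeCmd

/-- The program: the values below the threshold and the others are treated separately. -/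
def mainCmd : Cmd :=
  .seq prepCmd <| .seq reduceCmd <| .seq thresholdCmd <|
  .seq (.set g 0) <| .seq (.set x 1) <| .seq (.set r x0) <| .seq rangeCmd <|
  .seq (.set root (.load d)) <|
  .seq (.set g 1) <| .seq (.set x x0) <| .seq (.set r (t + 1)) <| .seq rangeCmd <|
  .seq (.set p2 (.load d)) <| .seq flattenCmd <| .seq (.set p1 root) <| .seq combineCmd outputCmd

end expressions

/-- The list of the leaves for the values `a, …, a + n - 1`. -/
def leaves (t : ℕ) (f : ℕ → ℕ) (a n : ℕ) : List (ℕ × ℕ) := leafList f a n ++ [(t + 1, 0)]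

theorem leaves_sorted {t : ℕ} (f : ℕ → ℕ) {a n : ℕ} (han : a + n ≤ t + 1) :
    (leaves t f a n).Pairwise fun p q => p.1 ≤ q.1 := by
  rw [leaves, List.pairwise_append]
  refine ⟨leafList_sorted f a n, by simp, fun p hp q hq => ?_⟩
  rw [List.mem_singleton] at hq
  subst hq
  have := (mem_leafList.mp hp).1
  simp; omega

theorem leaves_length_pos (t : ℕ) (f : ℕ → ℕ) (a n : ℕ) : 1 ≤ (leaves t f a n).length := by
  simp [leaves]

theorem leaves_length (t : ℕ) (f : ℕ → ℕ) (a n : ℕ) : (leaves t f a n).length ≤ n + 1 := by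
  have := leafList_length f a n
  simp [leaves]; omega

/-- At a sufficiently high level the whole list is one block. -/
theorem LevelBound.cells_le {t g W p top : ℕ} {l : List (ℕ × ℕ)} {mem : ℕ → ℕ} (h : LevelBound t g l W)
    (hl : 1 ≤ l.length) (hn : NodeAt t g l p top mem) : cells mem p ≤ W := by
  have h1 : seg l l.length 0 = l := by
    rw [seg, zero_mul, List.drop_zero, List.take_of_length_le Nat.lt_two_pow_self.le]
  have h2 := h l.length 1 (fun _ => mem (p + 2)) (fun _ => mem (p + 3)) fun i hi => by
    obtain rfl : i = 0 := by omega
    refine ⟨by omega, ?_⟩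
    rw [h1]
    exact ⟨_, _, _, hn.2⟩
  simpa [cells] using h2

/-- The memory estimate is generous: the number of levels and the number of nodes are both bounded
by `2 ^ b`, and each combination uses at most `2 ^ (3 * b + 10)` cells. -/
theorem wp_range {t g b a n B W : ℕ} {f : ℕ → ℕ} (ht : s.var .t = t) (hg : s.var .g = g) (hg1 : g ≤ 1)
    (hx : s.var .x = a) (hr : s.var .r = a + n) (ha : 1 ≤ a) (han : a + n ≤ t + 1)
    (hB : s.var .bb = B) (hf : ∀ y, 1 ≤ y → y ≤ t → s.mem (B + y) = f y)
    (hf2 : ∀ y, 1 ≤ y → y ≤ t → f y ≤ 2) (hBt : B + t < s.var .top)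
    (htb : t + 1 < 2 ^ b) (hw : 100 * b + 300 ≤ w)
    (hspace : s.var .top + 2 ^ (5 * b + 20) ≤ 2 ^ w) (hW : LevelBound t g (leaves t f a n) W)
    (h : ∀ s' : St, NodeAt t g (leaves t f a n) (s'.mem (s'.var .d)) (s'.var .top) s'.mem →
      (∀ i < s.var .top, s'.mem i = s.mem i) → s.var .top ≤ s'.var .top →
      s'.var .top ≤ s.var .top + 2 ^ (5 * b + 20) →
      s'.var .ms = ((leaves t f a n).map fun p => p.2 * p.1).sum →
      cells s'.mem (s'.mem (s'.var .d)) ≤ W →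
      s'.time ≤ s.time + (15300 + n * 1200 + ((leafList f a n).map (leafTime g)).sum +
        Nat.clog 2 (leaves t f a n).length * (20000000 * ((b + 2) * W))) →
      (∀ v ∉ rangeCmd.writes, s'.var v = s.var v) → Q s') :
    wp w rangeCmd Q s := by
  suffices wp w rangeCmd (fun s' =>
      NodeAt t g (leaves t f a n) (s'.mem (s'.var .d)) (s'.var .top) s'.mem ∧
      (∀ i < s.var .top, s'.mem i = s.mem i) ∧ s.var .top ≤ s'.var .top ∧
      s'.var .top ≤ s.var .top + 2 ^ (5 * b + 20) ∧
      s'.var .ms = ((leaves t f a n).map fun p => p.2 * p.1).sum ∧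
      cells s'.mem (s'.mem (s'.var .d)) ≤ W ∧
      s'.time ≤ s.time + (15300 + n * 1200 + ((leafList f a n).map (leafTime g)).sum +
        Nat.clog 2 (leaves t f a n).length * (20000000 * ((b + 2) * W)))) s from
    this.frame.mono fun s' ⟨⟨a, b, c, d, e, e', f⟩, k⟩ => h s' a b c d e e' f k
  have hlen := leaves_length t f a n
  have hpos := leaves_length_pos t f a n
  obtain ⟨l, hl⟩ : ∃ l, l = leaves t f a n := ⟨_, rfl⟩
  rw [← hl] at hlen hpos
  have hsp1 : (t + 3) * (t + 5) ≤ 2 ^ (5 * b + 18) := by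
    calc (t + 3) * (t + 5) ≤ 2 ^ (b + 2) * 2 ^ (b + 2) :=
          Nat.mul_le_mul (by rw [pow_add]; omega) (by rw [pow_add]; omega)
      _ = 2 ^ (2 * b + 4) := by rw [← pow_add]; congr 1; ring
      _ ≤ _ := Nat.pow_le_pow_right (by norm_num) (by omega)
  have hsp2 : l.length * (l.length * (2 ^ (3 * b + 10) + 1)) ≤ 2 ^ (5 * b + 18) := by
    have h1 : l.length ≤ 2 ^ b := by omega
    have h2 : 2 ^ (3 * b + 10) + 1 ≤ 2 ^ (3 * b + 11) := by
      have : 1 ≤ 2 ^ (3 * b + 10) := Nat.one_le_two_pow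
      have : 2 ^ (3 * b + 11) = 2 * 2 ^ (3 * b + 10) := by ring
      omega
    calc l.length * (l.length * (2 ^ (3 * b + 10) + 1)) ≤ 2 ^ b * (2 ^ b * 2 ^ (3 * b + 11)) :=
          Nat.mul_le_mul h1 (Nat.mul_le_mul h1 h2)
      _ = 2 ^ (5 * b + 11) := by rw [← pow_add, ← pow_add]; congr 1; ring
      _ ≤ _ := Nat.pow_le_pow_right (by norm_num) (by omega)
  have hlt : l.length * (t + 5) ≤ (t + 3) * (t + 5) := Nat.mul_le_mul_right _ (by omega)
  have htt : t + 2 ≤ 2 ^ (5 * b + 18) :=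
    (show t + 2 ≤ 2 ^ b by omega).trans (Nat.pow_le_pow_right (by norm_num) (by omega))
  have h20 : 2 ^ (5 * b + 20) = 4 * 2 ^ (5 * b + 18) := by rw [pow_add, pow_add]; ring
  rw [h20] at hspace ⊢
  refine wp_seq (wp_leaves ht hg hg1 hx hr ha han hB hf hf2 hBt htb hw (by omega) ?_)
  intro s1 L hms htime hfr
  change Leaves t g (s.var .top) (leaves t f a n) s.mem s1 at L
  rw [← hl] at L hW ⊢
  obtain ⟨L1, L2, L3, L4, L5, L6⟩ := L
  refine wp_tree (hl ▸ leaves_sorted f han) ((hfr _ (by decide)).trans ht) htb hw L1 L2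
    (List.ne_nil_of_length_pos hpos) (by omega) (fun i hi => (L3 i hi).2) hW (by omega) ?_
  intro s2 d1 d2 d3 d4 d5 d6 d7
  refine ⟨d1, fun i hi => by rw [d2 i (by omega), L4 i hi], by omega, by omega, ?_,
    hW.cells_le hpos d1, by omega⟩
  rw [d7 _ (by decide), hms, hl, leaves]
  simp

set_option maxHeartbeats 2000000 in
-- One quantity `K` dominates the level sizes of both trees, up to a constant, and also the linear
-- passes over the values up to `t`. Each of the at most `clog M` levels costs `O(b * K)`; the
-- sentinel explains the `+ 1` in the bound for `M`.
theorem wp_main {u N B t b : ℕ} {v c f : ℕ → ℕ} (hu : s.mem 0 = u) (hN : s.mem 1 = N)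
    (hB : B = 2 * N + 2) (hv : ∀ i < N, s.mem (2 + 2 * i) = v i)
    (hc : ∀ i < N, s.mem (3 + 2 * i) = c i) (h0 : ∀ a, B ≤ a → s.mem a = 0) (hvt : ∀ i < N, v i ≤ t)
    (hfv : ∀ i < N, f (v i) = c i) (hf0 : ∀ y, (∀ i < N, v i ≠ y) → f y = 0)
    (ht : t = min u (∑ i ∈ Finset.range N, c i * v i))
    (hsum : (∑ i ∈ Finset.range N, c i * v i) < 2 ^ w) (hmass : mass t f < 2 ^ w) (hNt : N ≤ t)
    (htb : t + 1 < 2 ^ b) (hw : 100 * b + 300 ≤ w) {a M K : ℕ}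
    (ha : Threshold t (reduced f t) a)
    (hM : ((Finset.Ico 1 (t + 1)).filter fun y => 0 < reduced f t y).card + 1 ≤ M)
    (hK : mass (a - 1) (reduced f t) + t * t / a + t + 1 ≤ K)
    (h : ∀ s' : St, ∀ out : List ℕ, out.Nodup → (∀ x, x ∈ out ↔ x ≤ t ∧ HasSubsetSum t f x) →
      Holds s'.mem out →
      s'.time ≤ s.time + 1000000000 * ((b + 2) * ((Nat.clog 2 M + 1) * K)) → Q s') :
    wp w mainCmd Q s := by
  have hb2 : 2 ^ b * 2 ^ b * 2 ^ b * 2 ^ 20 ≤ 2 ^ (5 * b + 20) := by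
    rw [← pow_add, ← pow_add, ← pow_add]; exact Nat.pow_le_pow_right (by norm_num) (by omega)
  have hb3 : 2 ^ b * 1 * 1 ≤ 2 ^ b * 2 ^ b * 2 ^ b :=
    Nat.mul_le_mul (Nat.mul_le_mul_left _ Nat.one_le_two_pow) Nat.one_le_two_pow
  have hbw : 2 ^ (5 * b + 20) * 2 ^ 10 ≤ 2 ^ w := by
    rw [← pow_add]; exact Nat.pow_le_pow_right (by norm_num) (by omega)
  have hbc : 2 ^ (3 * b + 10) ≤ 2 ^ (5 * b + 20) := Nat.pow_le_pow_right (by norm_num) (by omega)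
  have ht3 : (t + 1) * (t + 1) * (t + 1) ≤ 2 ^ b * 2 ^ b * 2 ^ b :=
    Nat.mul_le_mul (Nat.mul_le_mul htb.le htb.le) htb.le
  obtain ⟨E, hE⟩ : ∃ E, E = 2 ^ (5 * b + 20) := ⟨_, rfl⟩
  have n1 : 1 % 2 ^ w = 1 := lit_mod (by omega)
  have e1 : (t + 1) % 2 ^ w = t + 1 := lit_mod (by omega)
  obtain ⟨G, hG⟩ : ∃ G, G = reduced f t := ⟨_, rfl⟩
  have hG2 : ∀ y, 1 ≤ y → y ≤ t → G y ≤ 2 := fun y h1 h2 => hG ▸ reduced_le h1 h2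
  rw [← hG] at ha hM hK
  obtain ⟨D, hD⟩ : ∃ D, D = t * t / a := ⟨_, rfl⟩
  rw [← hD] at hK
  have ha1 := ha.one_le
  have hat := ha.le
  obtain ⟨l₀, hl0⟩ : ∃ l, l = leaves t G 1 (a - 1) := ⟨_, rfl⟩
  obtain ⟨l₁, hl1⟩ : ∃ l, l = leaves t G a (t + 1 - a) := ⟨_, rfl⟩
  have hlen0 : l₀.length ≤ M ∧ l₀.length ≤ t + 1 := by
    have h1 := leafList_length_le (f := G) (a := 1) (n := a - 1) (t := t) le_rfl (by omega)
    have h2 := leaves_length t G 1 (a - 1)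
    subst hl0
    refine ⟨?_, by omega⟩
    simp only [leaves, List.length_append, List.length_singleton]; omega
  have hlen1 : l₁.length ≤ M ∧ l₁.length ≤ t + 1 := by
    have h1 := leafList_length_le (f := G) (a := a) (n := t + 1 - a) (t := t) ha1 (by omega)
    have h2 := leaves_length t G a (t + 1 - a)
    subst hl1
    refine ⟨?_, by omega⟩
    simp only [leaves, List.length_append, List.length_singleton]; omega
  have hW0 : LevelBound t 0 l₀ K := by
    intro e n J Z hJZ
    refine (levelBound_zero t l₀ e n J Z hJZ).trans ?_
    have h1 : (l₀.map fun p => p.2 * p.1).sum = mass (a - 1) G := by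
      rw [← leafList_mass, hl0, leaves]; simp
    omega
  have hsnd : (l₁.map Prod.snd).sum ≤ l₁.length * 2 := sum_map_le_length fun p hp => by
    rw [hl1, leaves, List.mem_append] at hp
    rcases hp with hp | hp
    · obtain ⟨h1, -, h2⟩ := mem_leafList.mp hp
      rw [h2]; exact hG2 _ (by omega) (by omega)
    · rw [List.mem_singleton] at hp; subst hp; simp
  -- There are at most `t + 1` leaves with multiplicities at most two, so the level size is at most
  -- `4 * D + 4 + 3 * (t + 1)`.
  have hW1 : LevelBound t 1 l₁ (7 * K) := by
    intro e n J Z hJZ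
    refine (levelBound_one (X := a) (hl1 ▸ leaves_sorted G (by omega)) ha1 (fun p hp => ?_)
      e n J Z hJZ).trans ?_
    · rw [hl1, leaves, List.mem_append] at hp
      rcases hp with hp | hp
      · exact (mem_leafList.mp hp).1.1
      · rw [List.mem_singleton] at hp; subst hp; exact hat
    · have h1 : 4 * (t * t) / a < 4 * D + 4 := by
        rw [hD, Nat.div_lt_iff_lt_mul (by omega)]
        have h2 := Nat.lt_mul_div_succ (t * t) (show 0 < a by omega)
        nlinarith
      omega
  have hlf0 : ((leafList G 1 (a - 1)).map (leafTime 0)).sum ≤ 7800 * K := by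
    have h1 : ((leafList G 1 (a - 1)).map (leafTime 0)).sum =
        (leafList G 1 (a - 1)).length * 6900 + 900 * mass (a - 1) G := by
      rw [← leafList_mass]
      induction leafList G 1 (a - 1) with
      | nil => simp
      | cons p l ih =>
        rw [List.map_cons, List.sum_cons, ih, List.map_cons, List.sum_cons, List.length_cons, leafTime]
        simp only [lt_irrefl, if_false]; ring
    have h2 := leafList_length G 1 (a - 1)
    omega
  have hlf1 : ((leafList G a (t + 1 - a)).map (leafTime 1)).sum ≤ 8700 * K := by
    have h1 : ((leafList G a (t + 1 - a)).map (leafTime 1)).sum ≤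
        (leafList G a (t + 1 - a)).length * 8700 := sum_map_le_length fun p hp => by
      obtain ⟨h1, -, h2⟩ := mem_leafList.mp hp
      have := hG2 p.1 (by omega) (by omega)
      simp only [leafTime, zero_lt_one, if_true]
      omega
    have h2 := leafList_length G a (t + 1 - a)
    omega
  refine wp_seq (wp_prep hu hN hB hv hc h0 hvt hfv hf0 ht hsum (by omega) (by omega) ?_)
  intro s1 a1 a2 a3 a4 a5
  refine wp_seq (wp_reduce a1 a2 (fun y _ h2 => a4 y h2) hmass (by omega) ?_)
  rw [← hG]
  intro s2 b1 b2 b3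
  have b4 : s2.var .t = t := (b3 _ (by decide)).trans a1
  have b5 : s2.var .bb = B := (b3 _ (by decide)).trans a2
  refine wp_seq (wp_threshold b4 b5 b1 hG2 ha (by omega) ?_)
  intro s3 c1 c2 c3 c4
  have c5 : s3.var .t = t := (c4 _ (by decide)).trans b4
  have c6 : s3.var .bb = B := (c4 _ (by decide)).trans b5
  have c7 : s3.var .top = B + t + 1 :=
    (c4 _ (by decide)).trans ((b3 _ (by decide)).trans a3)
  refine wp_seq (wp_set (x := 0) (by simp) ?_)
  refine wp_seq (wp_set (x := 1) (by simp [n1]) ?_)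
  refine wp_seq (wp_set (x := a) (by simp [c1]) ?_)
  refine wp_seq (wp_range (t := t) (g := 0) (b := b) (a := 1) (n := a - 1) (B := B) (W := K) (f := G)
    (by simp [c5]) (by simp) (by simp) (by simp) (by simp; omega) le_rfl (by omega) (by simp [c6])
    (by simpa [c2] using b1) hG2 (by simp [c7]) htb hw (by simp [c7]; omega) (hl0 ▸ hW0) ?_)
  rw [← hl0]
  intro s4 d1 d2 d3 d4 _ _ d5 d6
  simp only [St.set_var, St.set_mem, reduceCtorEq, if_false, c7, c2] at d2 d3 d4
  have d7 : s4.var .t = t := (d6 _ (by decide)).trans (by simp [c5])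
  have d8 : s4.var .bb = B := (d6 _ (by decide)).trans (by simp [c6])
  have d9 : s4.var .x0 = a := (d6 _ (by decide)).trans (by simp [c1])
  obtain ⟨R, hR⟩ : ∃ R, R = s4.mem (s4.var .d) := ⟨_, rfl⟩
  rw [← hR] at d1
  refine wp_seq (wp_set (x := R) (by simp [hR]) ?_)
  refine wp_seq (wp_set (x := 1) (by simp [n1]) ?_)
  refine wp_seq (wp_set (x := a) (by simp [d9]) ?_)
  refine wp_seq (wp_set (x := t + 1) (by simp [d7, n1, e1]) ?_)
  refine wp_seq (wp_range (t := t) (g := 1) (b := b) (a := a) (n := t + 1 - a) (B := B) (W := 7 * K)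
    (f := G) (by simp [d7]) (by simp) (by simp) (by simp) (by simp; omega) ha1 (by omega)
    (by simp [d8]) (fun y h1 h2 => ?_) hG2 (by simp; omega) htb hw (by simp; omega)
    (hl1 ▸ hW1) ?_)
  · simp only [St.set_mem]
    rw [d2 _ (by omega), b1 y h1 h2]
  rw [← hl1]
  intro s5 f1 f2 f3 f4 f5 f6 f7 f8
  simp only [St.set_var, St.set_mem, reduceCtorEq, if_false] at f2 f3 f4
  have f9 : s5.var .t = t := (f8 _ (by decide)).trans (by simp [d7])
  have f10 : s5.var .root = R := (f8 _ (by decide)).trans (by simp)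
  obtain ⟨R', hR'⟩ : ∃ R, R = s5.mem (s5.var .d) := ⟨_, rfl⟩
  rw [← hR'] at f1 f6
  refine wp_seq (wp_set (x := R') (by simp [hR']) ?_)
  refine wp_seq (wp_flatten (t := t) (b := b) (l := l₁) (by simp [f9]) htb hw (by simpa using f1)
    (by simpa using f5) (by simp; omega) ?_)
  intro s6 g1 g2 g3 g4 g5 g6
  simp only [St.set_var, St.set_mem, reduceCtorEq, if_false, if_true] at g2 g3 g4 g5
  have g7 : s6.var .t = t := (g6 _ (by decide)).trans (by simp [f9])
  have g8 : s6.var .root = R := (g6 _ (by decide)).trans (by simp [f10])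
  refine wp_seq (wp_set (x := R) (by simp [g8]) ?_)
  have htop6 : s5.var .top ≤ s6.var .top := by have := g1.1; omega
  have hnode0 : NodeAt t 0 l₀ R (s6.var .top) s6.mem := by
    refine d1.congr (fun i hi _ => ?_) (by omega)
    rw [g2 i (by omega), f2 i hi]
  refine wp_seq (wp_combine (t := t) (g := 0) (b := b) (l₁ := l₀) (l₂ := l₁) (by simp [g7]) htb hw
    (by simpa using hnode0) (by simpa using g1) (by simp) (by simp; omega) ?_)
  intro s7 k1 k2 k3 k4 k5 k6
  simp only [St.set_var, reduceCtorEq, if_false] at k2 k3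
  refine wp_output htb hw k1 (by omega) (by omega) ?_
  intro s8 out o1 o2 o3 o4
  refine h s8 out o1 (fun x => ?_) o3 ?_
  · rw [o2, hl0, hl1, leaves, leaves, subSum_split ha1 hat, hG]
    exact and_congr_right fun hx => hasSubsetSum_reduced le_rfl hx
  -- The final node has base zero and hence a single row of at most `t + 1` cells, so the last
  -- combination is cheap.
  · have hJ := k1.2.J_le
    rw [k1.2.a_zero rfl, Nat.div_zero] at hJ
    have hZ := k1.2.Z_le
    rw [show s7.mem (s7.var .p3 + 2) = 0 by omega] at k5
    obtain ⟨Z, hZ'⟩ : ∃ Z, Z = s7.mem (s7.var .p3 + 3) := ⟨_, rfl⟩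
    rw [← hZ'] at k5 hZ
    obtain ⟨L, hL⟩ : ∃ L, L = Nat.clog 2 M := ⟨_, rfl⟩
    have hc0 : Nat.clog 2 l₀.length ≤ L := hL ▸ Nat.clog_mono_right 2 hlen0.1
    have hc1 : Nat.clog 2 l₁.length ≤ L := hL ▸ Nat.clog_mono_right 2 hlen1.1
    rw [← hL]
    have q1 : Nat.clog 2 l₀.length * (20000000 * ((b + 2) * K)) ≤
        20000000 * ((b + 2) * ((L + 1) * K)) := by
      calc _ ≤ (L + 1) * (20000000 * ((b + 2) * K)) := Nat.mul_le_mul_right _ (by omega)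
        _ = _ := by ring
    have q2 : Nat.clog 2 l₁.length * (20000000 * ((b + 2) * (7 * K))) ≤
        140000000 * ((b + 2) * ((L + 1) * K)) := by
      calc _ ≤ (L + 1) * (20000000 * ((b + 2) * (7 * K))) := Nat.mul_le_mul_right _ (by omega)
        _ = _ := by ring
    have q3 : 10000000 * ((b + 2) * ((0 + 1) * (Z + 1))) ≤ 10000000 * ((b + 2) * ((L + 1) * K)) :=
      Nat.mul_le_mul_left _ (Nat.mul_le_mul_left _ (Nat.mul_le_mul (by omega) (by omega)))
    have q4 : 1 * (1 * K) ≤ (b + 2) * ((L + 1) * K) :=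
      Nat.mul_le_mul (by omega) (Nat.mul_le_mul (by omega) le_rfl)
    simp only [St.set_time] at d5 f7 g5 k5
    omega

end WordRAM

/-! ### The running time -/

namespace WordRAM

open Finset

theorem mass_mono {k n : ℕ} (f : ℕ → ℕ) (h : k ≤ n) : mass k f ≤ mass n f :=
  sum_le_sum_of_subset (Ico_subset_Ico le_rfl (by omega))

theorem mass_le_card {k t : ℕ} {f : ℕ → ℕ} (hf : ∀ y, 1 ≤ y → y ≤ t → f y ≤ 2) (hk : k ≤ t) :
    mass k f ≤ 2 * k * ((Ico 1 (t + 1)).filter fun y => 0 < f y).card := by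
  have h1 : mass k f = ∑ y ∈ (Ico 1 (k + 1)).filter fun y => 0 < f y, f y * y := by
    rw [sum_filter, mass]
    refine sum_congr rfl fun y _ => ?_
    split_ifs with h
    · rfl
    · rw [show f y = 0 by omega, zero_mul]
  have h2 : ∑ y ∈ (Ico 1 (k + 1)).filter (fun y => 0 < f y), f y * y ≤
      ((Ico 1 (k + 1)).filter fun y => 0 < f y).card • (2 * k) :=
    sum_le_card_nsmul _ _ _ fun y hy => by
      simp only [mem_filter, mem_Ico] at hy
      exact Nat.mul_le_mul (hf y (by omega) (by omega)) (by omega)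
  rw [h1]
  refine h2.trans ?_
  rw [smul_eq_mul, mul_comm]
  exact Nat.mul_le_mul_left _
    (card_le_card (filter_subset_filter _ (Ico_subset_Ico le_rfl (by omega))))

/-- Optimality up to a factor of two. If `a ≤ θ`, then `t² / a` is below the mass up to `a`, hence
up to `θ`. If `a > θ`, then by minimality the mass up to `a - 1` is at most `t² / (a - 1)`, hence at
most `t² / θ`. -/
theorem Threshold.le_of_nat {t a θ : ℕ} {f : ℕ → ℕ} (h : Threshold t f a) (hθ : 1 ≤ θ) (hθt : θ ≤ t) :
    ((mass (a - 1) f + t * t / a : ℕ) : ℝ) ≤ 2 * (mass θ f + (t : ℝ) ^ 2 / θ) := by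
  have ha := h.one_le
  have haq : (0 : ℝ) < a := by exact_mod_cast ha
  have hθq : (0 : ℝ) < θ := by exact_mod_cast hθ
  have hdiv : ((t * t / a : ℕ) : ℝ) ≤ (t : ℝ) ^ 2 / a := by
    refine Nat.cast_div_le.trans ?_
    push_cast; rw [sq]
  have hm0 : (0 : ℝ) ≤ mass θ f := Nat.cast_nonneg _
  have hd0 : (0 : ℝ) ≤ (t : ℝ) ^ 2 / θ := by positivity
  push_cast
  by_cases hc : a ≤ θ
  · have h1 : (mass (a - 1) f : ℝ) ≤ mass θ f := by exact_mod_cast mass_mono f (by omega)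
    have h2 : (t : ℝ) ^ 2 / a ≤ mass θ f := by
      rw [div_le_iff₀ haq]
      have h3 := h.above (by omega)
      have h4 : mass a f * a ≤ mass θ f * a := Nat.mul_le_mul_right _ (mass_mono f hc)
      have : t * t ≤ mass θ f * a := by omega
      rw [sq]; exact_mod_cast this
    linarith
  · have h1 : (t : ℝ) ^ 2 / a ≤ t ^ 2 / θ := by
      apply div_le_div_of_nonneg_left (by positivity) hθq
      exact_mod_cast (by omega : θ ≤ a)
    have h2 : (mass (a - 1) f : ℝ) ≤ t ^ 2 / θ := by
      rw [le_div_iff₀ hθq]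
      have h3 := h.below (a - 1) (by omega) (by omega)
      have h4 : mass (a - 1) f * θ ≤ mass (a - 1) f * (a - 1) := Nat.mul_le_mul_left _ (by omega)
      have : mass (a - 1) f * θ ≤ t * t := by omega
      rw [sq]; exact_mod_cast this
    linarith

/-- Rounding `r ≥ 1` down loses at most a factor of two in `t² / r`. -/
theorem Threshold.le_of_real {t a : ℕ} {f : ℕ → ℕ} {r R : ℝ} (h : Threshold t f a) (hr : 1 ≤ r)
    (hrt : r ≤ t) (hR : ∀ θ : ℕ, θ ≤ t → (θ : ℝ) ≤ r → (mass θ f : ℝ) ≤ R) :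
    ((mass (a - 1) f + t * t / a : ℕ) : ℝ) ≤ 2 * (R + 2 * ((t : ℝ) ^ 2 / r)) := by
  have h1 : 1 ≤ ⌊r⌋₊ := (Nat.one_le_floor_iff r).mpr hr
  have h2 : (⌊r⌋₊ : ℝ) ≤ r := Nat.floor_le (by linarith)
  have h3 : r < ⌊r⌋₊ + 1 := Nat.lt_floor_add_one r
  have h4 : ⌊r⌋₊ ≤ t := by exact_mod_cast h2.trans hrt
  have h5 : (1 : ℝ) ≤ ⌊r⌋₊ := by exact_mod_cast h1
  have h6 := h.le_of_nat h1 h4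
  have h7 := hR _ h4 h2
  have h8 : (t : ℝ) ^ 2 / ⌊r⌋₊ ≤ 2 * (t ^ 2 / r) := by
    rw [mul_div_assoc', div_le_div_iff₀ (by linarith) (by linarith)]
    have : (0 : ℝ) ≤ t ^ 2 := by positivity
    nlinarith
  linarith

/-- The inner logarithm could only be negative for an argument strictly between `0` and `1`. This
does not occur: the argument is `0`, where the logarithm has the value `0`, or `n' ≥ 1` and `u ≥ 2`.
-/
theorem subsetSumTime_nonneg {n' u : ℕ} (σ : ℕ) (hu : 1 ≤ u) : 0 ≤ subsetSumTime n' u σ := by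
  have hu' : (1 : ℝ) ≤ u := by exact_mod_cast hu
  have hlog : 0 ≤ Real.logb 2 u := Real.logb_nonneg (by norm_num) hu'
  have hσ : 0 ≤ Real.logb 2 σ := by
    rcases Nat.eq_zero_or_pos σ with h | h
    · simp [h]
    · exact Real.logb_nonneg (by norm_num) (by exact_mod_cast h)
  have hl : 0 ≤ Real.logb 2 (n' * Real.logb 2 u) := by
    rcases Nat.eq_zero_or_pos n' with h | h
    · simp [h]
    · rcases Nat.eq_or_lt_of_le hu with h1 | h1
      · simp [← h1]
      · have h2 : 1 ≤ Real.logb 2 u := by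
          rw [Real.le_logb_iff_rpow_le (by norm_num) (by linarith)]
          simp only [Real.rpow_one]; exact_mod_cast h1
        have h3 : (1 : ℝ) ≤ n' := by exact_mod_cast h
        exact Real.logb_nonneg (by norm_num) (by nlinarith)
  unfold subsetSumTime
  positivity

theorem three_halves_le_logb {x : ℝ} (hx : 3 ≤ x) : 3 / 2 ≤ Real.logb 2 x := by
  rw [Real.le_logb_iff_rpow_le (by norm_num) (by linarith)]
  have h1 : ((2 : ℝ) ^ (3 / 2 : ℝ)) ^ 2 = 8 := by
    rw [← Real.rpow_natCast, ← Real.rpow_mul (by norm_num)]; norm_num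
  have h2 : (0 : ℝ) ≤ 2 ^ (3 / 2 : ℝ) := by positivity
  nlinarith

theorem half_le_logb {x : ℝ} (hx : 3 / 2 ≤ x) : 1 / 2 ≤ Real.logb 2 x := by
  rw [Real.le_logb_iff_rpow_le (by norm_num) (by linarith)]
  have h1 : ((2 : ℝ) ^ (1 / 2 : ℝ)) ^ 2 = 2 := by
    rw [← Real.rpow_natCast, ← Real.rpow_mul (by norm_num)]; norm_num
  have h2 : (0 : ℝ) ≤ 2 ^ (1 / 2 : ℝ) := by positivity
  nlinarith

theorem natLog_le_logb (x : ℕ) : (Nat.log 2 x : ℝ) ≤ Real.logb 2 x := Real.natLog_le_logb x 2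

/-- The additive constants are absorbed because `log y ≥ 1 / 2`. -/
theorem clog_add_one_le {x : ℕ} {y : ℝ} (hx : 1 ≤ x) (hxy : (x : ℝ) ≤ 3 * y) (hy : 3 / 2 ≤ y) :
    ((Nat.clog 2 x + 1 : ℕ) : ℝ) ≤ 9 * Real.logb 2 y := by
  have h1 := half_le_logb hy
  have h2 : (Nat.clog 2 x : ℝ) ≤ Real.logb 2 x + 1 := by
    have h3 : Nat.clog 2 x ≤ Nat.log 2 x + 1 := by
      rw [Nat.clog_le_iff_le_pow (by norm_num)]
      exact (Nat.lt_pow_succ_log_self (by norm_num) x).le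
    have h4 := natLog_le_logb x
    have h5 : (Nat.clog 2 x : ℝ) ≤ Nat.log 2 x + 1 := by exact_mod_cast h3
    linarith
  have hx0 : (0 : ℝ) < x := by exact_mod_cast hx
  have h3 : Real.logb 2 x ≤ Real.logb 2 (4 * y) :=
    Real.logb_le_logb_of_le (by norm_num) hx0 (by linarith)
  rw [Real.logb_mul (by norm_num) (by linarith), show (4 : ℝ) = 2 ^ (2 : ℝ) by norm_num,
    Real.logb_rpow (by norm_num) (by norm_num)] at h3
  push_cast
  linarith

section

variable {t n' u σ a m : ℕ} {f : ℕ → ℕ}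

/-- Compare with the threshold `t / √m`, where `m` is the number of reduced values: the mass up to
`θ` is at most `2 * θ * m`, so both terms are of order `t * √m`. The factor `√(log t)` comes from `m
≤ n' * (log t + 1)`. -/
theorem Threshold.cost_sqrt_le (h : Threshold t f a) (hf : ∀ y, 1 ≤ y → y ≤ t → f y ≤ 2) (ht : 3 ≤ t)
    (hm : m = ((Ico 1 (t + 1)).filter fun y => 0 < f y).card) (hn : 1 ≤ n')
    (hmn : m ≤ n' * (Nat.log 2 t + 1)) :
    ((mass (a - 1) f + t * t / a + t + 1 : ℕ) : ℝ) ≤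
      20 * (Real.sqrt n' * t * Real.sqrt (Real.logb 2 t)) := by
  have ht3 : (3 : ℝ) ≤ t := by exact_mod_cast ht
  have hlog := three_halves_le_logb ht3
  have hmt : m ≤ t := by
    rw [hm]
    refine (card_filter_le _ _).trans ?_
    simp
  -- The maximum avoids a division by zero.
  obtain ⟨M, hM⟩ : ∃ M : ℝ, M = max (m : ℝ) 1 := ⟨_, rfl⟩
  have hM1 : 1 ≤ M := by rw [hM]; exact le_max_right _ _
  have hmM : (m : ℝ) ≤ M := by rw [hM]; exact le_max_left _ _
  have hMt : M ≤ t := by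
    rw [hM]; exact max_le (by exact_mod_cast hmt) (by linarith)
  have hnq : (1 : ℝ) ≤ n' := by exact_mod_cast hn
  have hMn : M ≤ 4 * (n' * Real.logb 2 t) := by
    have h1 := natLog_le_logb t
    have h2 : (m : ℝ) ≤ n' * (Nat.log 2 t + 1) := by exact_mod_cast hmn
    rw [hM]
    refine max_le (h2.trans ?_) (by nlinarith)
    nlinarith
  obtain ⟨q, hq⟩ : ∃ q, q = Real.sqrt M := ⟨_, rfl⟩
  have hqq : q * q = M := by rw [hq]; exact Real.mul_self_sqrt (by linarith)
  have hq1 : 1 ≤ q := by rw [hq]; exact Real.one_le_sqrt.mpr hM1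
  have hqM : q ≤ M := by nlinarith
  have hq0 : 0 < q := by linarith
  have h1 := h.le_of_real (r := t / q) (R := 2 * (t * q)) (by rw [le_div_iff₀ hq0]; linarith)
    (div_le_self (by linarith) hq1) fun θ h1 h2 => by
      have h3 : (mass θ f : ℝ) ≤ 2 * θ * m := by
        rw [hm]; exact_mod_cast mass_le_card hf h1
      refine h3.trans ?_
      calc 2 * (θ : ℝ) * m ≤ 2 * (t / q) * (q * q) := by
            rw [hqq]; gcongr
        _ = 2 * (t * q) := by field_simp
  have h2 : (t : ℝ) ^ 2 / (t / q) = t * q := by field_simp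
  rw [h2] at h1
  have h3 : q ≤ 2 * (Real.sqrt n' * Real.sqrt (Real.logb 2 t)) := by
    rw [hq, ← Real.sqrt_mul (by linarith)]
    refine (Real.sqrt_le_sqrt hMn).trans ?_
    rw [Real.sqrt_mul (by norm_num), show (4 : ℝ) = 2 ^ 2 by norm_num, Real.sqrt_sq (by norm_num)]
  have h4 : (t : ℝ) * q ≤ t * (2 * (Real.sqrt n' * Real.sqrt (Real.logb 2 t))) := by gcongr
  push_cast at h1 ⊢
  nlinarith

/-- Compare with the threshold `t ^ (2 / 3)`, which balances the mass bound `2 * θ ^ 2` with `t ^ 2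
/ θ`. -/
theorem Threshold.cost_rpow_le (h : Threshold t f a) (hf : ∀ y, 1 ≤ y → y ≤ t → f y ≤ 2)
    (ht : 3 ≤ t) :
    ((mass (a - 1) f + t * t / a + t + 1 : ℕ) : ℝ) ≤ 10 * (t : ℝ) ^ (4 / 3 : ℝ) := by
  have ht1 : (1 : ℝ) ≤ t := by exact_mod_cast (by omega : 1 ≤ t)
  have ht0 : (0 : ℝ) < t := by linarith
  have hr1 : (1 : ℝ) ≤ (t : ℝ) ^ (2 / 3 : ℝ) := Real.one_le_rpow ht1 (by norm_num)
  have e1 : ((t : ℝ) ^ (2 / 3 : ℝ)) * (t : ℝ) ^ (2 / 3 : ℝ) = (t : ℝ) ^ (4 / 3 : ℝ) := by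
    rw [← Real.rpow_add ht0]; norm_num
  have e2 : (t : ℝ) ^ 2 / (t : ℝ) ^ (2 / 3 : ℝ) = (t : ℝ) ^ (4 / 3 : ℝ) := by
    rw [← Real.rpow_natCast, ← Real.rpow_sub ht0]; norm_num
  have e3 : (t : ℝ) ≤ (t : ℝ) ^ (4 / 3 : ℝ) := by
    conv_lhs => rw [← Real.rpow_one (t : ℝ)]
    exact Real.rpow_le_rpow_of_exponent_le ht1 (by norm_num)
  have hrt : (t : ℝ) ^ (2 / 3 : ℝ) ≤ t := by
    conv_rhs => rw [← Real.rpow_one (t : ℝ)]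
    exact Real.rpow_le_rpow_of_exponent_le ht1 (by norm_num)
  have h1 := h.le_of_real (R := 2 * (t : ℝ) ^ (4 / 3 : ℝ)) hr1 hrt fun θ h1 h2 => by
    have h3 : (mass θ f : ℝ) ≤ 2 * (θ * θ) := by exact_mod_cast mass_le_of_le_two hf h1
    rw [← e1]
    refine h3.trans ?_
    gcongr
  rw [e2] at h1
  push_cast at h1 ⊢
  linarith

/-- Compare with the threshold `t`, where all values count as small. -/
theorem Threshold.cost_sum_le (h : Threshold t f a) (ht : 3 ≤ t) (hσ : mass t f ≤ σ) (htσ : t ≤ σ) :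
    ((mass (a - 1) f + t * t / a + t + 1 : ℕ) : ℝ) ≤ 6 * σ := by
  have h1 := h.le_of_nat (θ := t) (by omega) le_rfl
  have ht0 : (3 : ℝ) ≤ t := by exact_mod_cast ht
  have h2 : (t : ℝ) ^ 2 / t = t := by field_simp
  have h3 : (mass t f : ℝ) ≤ σ := by exact_mod_cast hσ
  have h4 : (t : ℝ) ≤ σ := by exact_mod_cast htσ
  rw [h2] at h1
  push_cast at h1 ⊢
  linarith

/-- For tiny `t` the logarithms in the bound may vanish, so this case is charged to the additive
constant. -/
theorem Threshold.time_le_of_le_two (h : Threshold t f a) (hf : ∀ y, 1 ≤ y → y ≤ t → f y ≤ 2)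
    (ht : t ≤ 2) (hm : m ≤ t) :
    (Nat.log 2 (t + 1) + 1 + 2) * ((Nat.clog 2 (m + 1) + 1) *
      (mass (a - 1) f + t * t / a + t + 1)) ≤ 1000 := by
  have h1 : mass (a - 1) f ≤ 2 * (2 * 2) :=
    (mass_le_of_le_two hf (by have := h.le; omega)).trans
      (Nat.mul_le_mul_left _ (by have := h.le; exact Nat.mul_le_mul (by omega) (by omega)))
  have h2 : t * t / a ≤ 2 * 2 := (Nat.div_le_self _ _).trans (Nat.mul_le_mul ht ht)
  have h3 : Nat.log 2 (t + 1) ≤ 1 := by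
    have : Nat.log 2 (t + 1) < 2 := Nat.log_lt_of_lt_pow (by omega) (by norm_num; omega)
    omega
  have h4 : Nat.clog 2 (m + 1) ≤ 2 := by
    rw [Nat.clog_le_iff_le_pow (by norm_num)]; omega
  calc _ ≤ (1 + 1 + 2) * ((2 + 1) * (2 * (2 * 2) + 2 * 2 + 2 + 1)) := by gcongr
    _ ≤ 1000 := by norm_num

/-- In the first two terms both logarithmic factors are bounded by multiples of `log u`. In the
third one the depth of the tree is measured by the number of values instead, which gives `log (n' *
log u)`. -/
theorem Threshold.time_le (h : Threshold t f a) (hf : ∀ y, 1 ≤ y → y ≤ t → f y ≤ 2) (hu : 1 ≤ u)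
    (ht : t = min u σ) (hσ : mass t f ≤ σ)
    (hm : m = ((Ico 1 (t + 1)).filter fun y => 0 < f y).card) (hn : n' = 0 → σ = 0)
    (hmn : m ≤ n' * (Nat.log 2 t + 1)) :
    (((Nat.log 2 (t + 1) + 1 + 2) * ((Nat.clog 2 (m + 1) + 1) *
      (mass (a - 1) f + t * t / a + t + 1)) : ℕ) : ℝ) ≤ 1000 * (1 + subsetSumTime n' u σ) := by
  have hmt : m ≤ t := by
    rw [hm]
    refine (card_filter_le _ _).trans ?_
    simp
  have hnn := subsetSumTime_nonneg (n' := n') σ hu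
  by_cases ht3 : t ≤ 2
  · have h1 : (((Nat.log 2 (t + 1) + 1 + 2) * ((Nat.clog 2 (m + 1) + 1) *
        (mass (a - 1) f + t * t / a + t + 1)) : ℕ) : ℝ) ≤ 1000 := by
      exact_mod_cast h.time_le_of_le_two hf ht3 hmt
    linarith
  replace ht3 : 3 ≤ t := by omega
  have htu : t ≤ u := by omega
  have htσ : t ≤ σ := by omega
  have hn1 : 1 ≤ n' := by
    by_contra h0
    have := hn (by omega)
    omega
  have hA := h.cost_sqrt_le hf ht3 hm hn1 hmn
  have hB := h.cost_rpow_le hf ht3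
  have hC := h.cost_sum_le ht3 hσ htσ
  obtain ⟨K, hK⟩ : ∃ K, K = mass (a - 1) f + t * t / a + t + 1 := ⟨_, rfl⟩
  rw [← hK] at hA hB hC ⊢
  have ht3q : (3 : ℝ) ≤ t := by exact_mod_cast ht3
  have htuq : (t : ℝ) ≤ u := by exact_mod_cast htu
  have htσq : (t : ℝ) ≤ σ := by exact_mod_cast htσ
  have hnq : (1 : ℝ) ≤ n' := by exact_mod_cast hn1
  obtain ⟨l, hl⟩ : ∃ l, l = Real.logb 2 t := ⟨_, rfl⟩
  have hl1 : 3 / 2 ≤ l := hl ▸ three_halves_le_logb ht3q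
  have hlu : l ≤ Real.logb 2 u := hl ▸ Real.logb_le_logb_of_le (by norm_num) (by linarith) htuq
  have hlσ : l ≤ Real.logb 2 σ := hl ▸ Real.logb_le_logb_of_le (by norm_num) (by linarith) htσq
  have hb : ((Nat.log 2 (t + 1) + 1 + 2 : ℕ) : ℝ) ≤ 4 * l := by
    have h1 : Nat.log 2 (t + 1) ≤ Nat.log 2 t + 1 := by
      rw [← Nat.log_mul_base (by norm_num) (by omega)]
      exact Nat.log_mono_right (by omega)
    have h2 := natLog_le_logb t
    have h3 : (Nat.log 2 (t + 1) : ℝ) ≤ Nat.log 2 t + 1 := by exact_mod_cast h1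
    push_cast
    linarith
  have hc : ((Nat.clog 2 (m + 1) + 1 : ℕ) : ℝ) ≤ 4 * l := by
    refine le_trans ?_ hb
    have h1 : Nat.clog 2 (m + 1) ≤ Nat.log 2 (t + 1) + 1 := by
      rw [Nat.clog_le_iff_le_pow (by norm_num)]
      have := (Nat.lt_pow_succ_log_self (b := 2) (by norm_num) (t + 1)).le
      omega
    exact_mod_cast (by omega)
  have hcn : ((Nat.clog 2 (m + 1) + 1 : ℕ) : ℝ) ≤ 9 * Real.logb 2 (n' * Real.logb 2 u) := by
    refine clog_add_one_le (by omega) ?_ (by nlinarith)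
    have h1 := natLog_le_logb t
    have h2 : (m : ℝ) ≤ n' * (Nat.log 2 t + 1) := by exact_mod_cast hmn
    rw [← hl] at h1
    push_cast
    nlinarith
  have h1 : ((Nat.log 2 (t + 1) + 1 + 2) * ((Nat.clog 2 (m + 1) + 1) * K) : ℕ) ≤
      16 * l ^ 2 * (K : ℝ) := by
    push_cast at hb hc ⊢
    calc ((Nat.log 2 (t + 1) : ℝ) + 1 + 2) * ((Nat.clog 2 (m + 1) + 1) * K)
        ≤ (4 * l) * ((4 * l) * K) := by gcongr
      _ = _ := by ring
  have hKle : (((Nat.log 2 (t + 1) + 1 + 2) * ((Nat.clog 2 (m + 1) + 1) * K) : ℕ) : ℝ) ≤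
      1000 * subsetSumTime n' u σ := by
    have hlu0 : 0 ≤ Real.logb 2 u := by linarith
    unfold subsetSumTime
    rw [mul_min_of_nonneg _ _ (by norm_num), mul_min_of_nonneg _ _ (by norm_num)]
    refine le_min ?_ (le_min ?_ ?_)
    · have e1 : Real.logb 2 u ^ (5 / 2 : ℝ) = Real.logb 2 u ^ 2 * Real.sqrt (Real.logb 2 u) := by
        rw [Real.sqrt_eq_rpow, ← Real.rpow_natCast, ← Real.rpow_add (by linarith)]; norm_num
      rw [e1]
      calc _ ≤ 16 * l ^ 2 * (K : ℝ) := h1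
        _ ≤ 16 * (Real.logb 2 u) ^ 2 * (20 * (Real.sqrt n' * u * Real.sqrt (Real.logb 2 u))) := by
          rw [← hl] at hA
          have : (K : ℝ) ≤ 20 * (Real.sqrt n' * u * Real.sqrt (Real.logb 2 u)) :=
            hA.trans (by gcongr)
          gcongr
        _ = 320 * (Real.sqrt n' * u * (Real.logb 2 u ^ 2 * Real.sqrt (Real.logb 2 u))) := by ring
        _ ≤ _ := by gcongr; norm_num
    · calc _ ≤ 16 * l ^ 2 * (K : ℝ) := h1
        _ ≤ 16 * (Real.logb 2 u) ^ 2 * (10 * (u : ℝ) ^ (4 / 3 : ℝ)) := by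
          have : (K : ℝ) ≤ 10 * (u : ℝ) ^ (4 / 3 : ℝ) := hB.trans (by gcongr)
          gcongr
        _ = 160 * ((u : ℝ) ^ (4 / 3 : ℝ) * Real.logb 2 u ^ 2) := by ring
        _ ≤ _ := by gcongr; norm_num
    · have hσ0 : 0 ≤ Real.logb 2 σ := by linarith
      have hl0 : 0 ≤ Real.logb 2 (n' * Real.logb 2 u) :=
        Real.logb_nonneg (by norm_num) (by nlinarith)
      have hb' := hb.trans (mul_le_mul_of_nonneg_left hlσ (by norm_num : (0 : ℝ) ≤ 4))
      calc (((Nat.log 2 (t + 1) + 1 + 2) * ((Nat.clog 2 (m + 1) + 1) * K) : ℕ) : ℝ)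
          = ((Nat.log 2 (t + 1) + 1 + 2 : ℕ) : ℝ) * (((Nat.clog 2 (m + 1) + 1 : ℕ) : ℝ) * K) := by
            push_cast; ring
        _ ≤ (4 * Real.logb 2 σ) * ((9 * Real.logb 2 (n' * Real.logb 2 u)) * (6 * σ)) := by gcongr
        _ = 216 * (σ * Real.logb 2 σ * Real.logb 2 (n' * Real.logb 2 u)) := by ring
        _ ≤ _ := by gcongr; norm_num
  linarith

end

end WordRAM

/-! ### The theorem -/

namespace WordRAM

theorem getD_flatMap (g : ℕ → ℕ) (L : List ℕ) (i : ℕ) :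
    (i < L.length → (L.flatMap fun x => [x, g x]).getD (2 * i) 0 = L.getD i 0 ∧
      (L.flatMap fun x => [x, g x]).getD (2 * i + 1) 0 = g (L.getD i 0)) ∧
    (2 * L.length ≤ i → (L.flatMap fun x => [x, g x]).getD i 0 = 0) := by
  induction L generalizing i with
  | nil => simp
  | cons x L ih =>
    rw [List.flatMap_cons]
    constructor
    · intro hi
      rcases i with _ | i
      · simp
      · have := (ih i).1 (by simpa using hi)
        rw [show 2 * (i + 1) = 2 * i + 1 + 1 by ring]
        simpa using this
    · intro hi
      rw [List.length_cons] at hi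
      obtain ⟨i, rfl⟩ : ∃ j, i = j + 1 + 1 := ⟨i - 2, by omega⟩
      have := (ih i).2 (by omega)
      simpa using this

theorem sum_range_getD (h : ℕ → ℕ) (L : List ℕ) :
    ∑ i ∈ Finset.range L.length, h (L.getD i 0) = (L.map h).sum := by
  induction L with
  | nil => simp
  | cons x L ih =>
    rw [List.length_cons, Finset.sum_range_succ']
    simp only [List.getD_cons_succ, List.getD_cons_zero, ih, List.map_cons, List.sum_cons]
    ring

theorem sum_map_count {S : Multiset ℕ} {L : List ℕ} (hL : L.Nodup) (hLS : ∀ x, x ∈ L ↔ x ∈ S) :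
    (L.map fun x => S.count x * x).sum = S.sum := by
  have h1 : L.toFinset = S.toFinset := by ext x; simp [hLS]
  rw [← List.sum_toFinset _ hL, h1, Finset.sum_multiset_count]
  rfl

theorem wp.listsWithin {c : Cmd} {input : List ℕ} {A : Set ℕ} {T : ℝ}
    (h : wp w c (fun s' => ∃ out : List ℕ, out.Nodup ∧ (∀ x, x ∈ out ↔ x ∈ A) ∧ Holds s'.mem out ∧
      (s'.time : ℝ) ≤ T) ⟨fun _ => 0, fun i => input.getD i 0, 0⟩) :
    ListsWithin w (c.code 0) input A T := by
  obtain ⟨s', hr, out, h1, h2, h3, h4⟩ := h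
  obtain ⟨n, hn, h5, h6⟩ := hr.halts
  exact ⟨n, le_trans (by exact_mod_cast hn) h4, h5, out, h1, h2, by rwa [h6]⟩

/-- The total is at most the cardinality times `u`, so it has at most twice as many bits as `u` plus
the cardinality. -/
theorem sum_lt_two_pow {u w : ℕ} {S : Multiset ℕ} (hS : ∀ x ∈ S, 1 ≤ x ∧ x ≤ u)
    (hw : 1000 * (Nat.log 2 (u + S.card) + 1) ≤ w) : S.sum < 2 ^ w := by
  have h1 := Multiset.sum_le_card_nsmul S u fun x hx => (hS x hx).2
  rw [smul_eq_mul] at h1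
  have h2 : u + S.card < 2 ^ (Nat.log 2 (u + S.card) + 1) :=
    Nat.lt_pow_succ_log_self (by norm_num) _
  obtain ⟨q, hq⟩ : ∃ q, q = Nat.log 2 (u + S.card) + 1 := ⟨_, rfl⟩
  rw [← hq] at h2 hw
  calc S.sum ≤ S.card * u := h1
    _ ≤ (u + S.card) * (u + S.card) := Nat.mul_le_mul (by omega) (by omega)
    _ < 2 ^ q * 2 ^ q := Nat.mul_lt_mul'' h2 h2
    _ = 2 ^ (q + q) := by rw [pow_add]
    _ ≤ 2 ^ w := Nat.pow_le_pow_right (by norm_num) (by omega)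

end WordRAM

open WordRAM in
/-- A single word RAM program computes all subset sums up to `u` of a multiset `S ⊆ [u]`, on words
of any length that is at least a constant times the number of bits of `u + |S|`. -/
theorem mainTheorem1 :
    ∃ (P : WordRAM.Program) (c : ℕ) (C : ℝ), 1 ≤ c ∧
      ∀ (u : ℕ) (S : Multiset ℕ) (L : List ℕ) (w : ℕ),
        1 ≤ u → (∀ x ∈ S, 1 ≤ x ∧ x ≤ u) →
        L.Nodup → (∀ x, x ∈ L ↔ x ∈ S) →
        c * (Nat.log 2 (u + S.card) + 1) ≤ w →
        WordRAM.ListsWithin w P (encodeInput u S L) (subsetSumsUpTo S u)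
          (C * (1 + subsetSumTime S.toFinset.card u S.sum)) := by
  -- The time constant is `10 ^ 9` from `wp_main` times `1000` from `Threshold.time_le`. The factor
  -- `1000` per bit covers the requirement `100 * b + 300 ≤ w`.
  refine ⟨mainCmd.code 0, 1000, 1000000000000, by norm_num, ?_⟩
  intro u S L w hu hS hLn hLS hw
  have hSsum := sum_lt_two_pow hS hw
  obtain ⟨t, ht⟩ : ∃ t, t = min u S.sum := ⟨_, rfl⟩
  have hSt : ∀ x ∈ S, 1 ≤ x ∧ x ≤ t := fun x hx =>
    ⟨(hS x hx).1, by have := (hS x hx).2; have := Multiset.single_le_sum (fun _ _ => Nat.zero_le _) x hx; omega⟩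
  obtain ⟨a, ha⟩ := exists_threshold t (reduced (fun x => S.count x) t)
  have hmass := mass_count hSt
  have hcard : S.toFinset.card = L.length := by
    rw [← List.toFinset_card_of_nodup hLn]
    congr 1
    ext x; simp [hLS]
  have hNt : L.length ≤ t := by
    rw [← hcard]
    have : S.toFinset ⊆ Finset.Ico 1 (t + 1) := fun x hx => by
      have := hSt x (Multiset.mem_toFinset.mp hx)
      simp; omega
    simpa using Finset.card_le_card this
  have hgetL : ∀ i < L.length, L.getD i 0 ∈ L := fun i hi => by
    rw [List.getD_eq_getElem _ _ hi]; exact List.getElem_mem hi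
  have hsum : ∑ i ∈ Finset.range L.length, S.count (L.getD i 0) * L.getD i 0 = S.sum :=
    (sum_range_getD (fun x => S.count x * x) L).trans (sum_map_count hLn hLS)
  -- Since `t ≤ u` and `u ≥ 1`, passing from `u` plus the cardinality to `t + 1` costs at most one
  -- bit.
  have hlog : Nat.log 2 (t + 1) ≤ Nat.log 2 (u + S.card) + 1 := by
    rw [← Nat.log_mul_base (by norm_num) (by omega)]
    exact Nat.log_mono_right (by omega)
  refine wp.listsWithin (wp_main (u := u) (N := L.length) (B := 2 * L.length + 2) (t := t)
    (b := Nat.log 2 (t + 1) + 1) (v := fun i => L.getD i 0) (c := fun i => S.count (L.getD i 0))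
    (f := fun x => S.count x) rfl rfl rfl ?_ ?_ ?_ ?_ ?_ ?_ ?_ ?_ ?_ hNt ?_ ?_ ha le_rfl le_rfl ?_)
  · intro i hi
    have := ((getD_flatMap (fun x => S.count x) L i).1 hi).1
    rw [add_comm]
    simpa [encodeInput] using this
  · intro i hi
    have := ((getD_flatMap (fun x => S.count x) L i).1 hi).2
    rw [show 3 + 2 * i = 2 * i + 1 + 1 + 1 by ring]
    simpa [encodeInput] using this
  · intro i hi
    obtain ⟨i, rfl⟩ : ∃ j, i = j + 1 + 1 := ⟨i - 2, by omega⟩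
    have := (getD_flatMap (fun x => S.count x) L i).2 (by omega)
    simpa [encodeInput] using this
  · exact fun i hi => (hSt _ ((hLS _).mp (hgetL i hi))).2
  · exact fun i hi => rfl
  · intro y hy
    refine Multiset.count_eq_zero.mpr fun hyS => ?_
    obtain ⟨i, hi, h⟩ := List.getElem_of_mem ((hLS y).mpr hyS)
    exact hy i hi (by rw [← h]; exact List.getD_eq_getElem _ _ hi)
  · rw [hsum]; exact ht
  · rw [hsum]; exact hSsum
  · rw [hmass]; exact hSsum
  · exact Nat.lt_pow_succ_log_self (by norm_num) _
  · omega
  · intro s' out h1 h2 h3 h4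
    refine ⟨out, h1, fun x => ?_, h3, ?_⟩
    · rw [h2, ← mem_subsetSums hSt, subsetSumsUpTo, Set.mem_inter_iff, Set.mem_Icc]
      constructor
      · rintro ⟨h5, h6⟩
        exact ⟨h6, Nat.zero_le _, by omega⟩
      · rintro ⟨h5, -, h6⟩
        refine ⟨?_, h5⟩
        obtain ⟨T, hT, rfl⟩ := h5
        have : T.sum ≤ S.sum := by
          obtain ⟨U, rfl⟩ := Multiset.le_iff_exists_add.mp hT
          simp
        omega
    · have h5 := ha.time_le (n' := S.toFinset.card) (u := u) (σ := S.sum)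
        (fun y hy hyt => reduced_le hy hyt) hu ht
        ((mass_reduced_le _ le_rfl).trans hmass.le) rfl (fun h0 => ?_)
        (card_support_le (fun x hx => Multiset.mem_toFinset.mpr (Multiset.count_pos.mp hx))
          fun x hx => (hSt x (Multiset.mem_toFinset.mp hx)).1)
      · have h6 := (Nat.cast_le (α := ℝ)).mpr (h4.trans_eq (zero_add _))
        rw [Nat.cast_mul] at h6
        refine h6.trans ((mul_le_mul_of_nonneg_left h5 (Nat.cast_nonneg _)).trans_eq ?_)
        push_cast
        ring
      · rw [Finset.card_eq_zero, Multiset.toFinset_eq_empty] at h0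
        simp [h0]
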